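/- Let $k$ be an algebraically closed field of characteristic zero, complete with respect to a non-trivial norm (e.g. $k=\mathbb{C}$), and let $n\ge 3$. Let $\mathcal{O}_n$ be one of the rings $k[x_1,\dots,x_n]_{(\mathfrak m)}$ (rational functions regular at the origin), $k\{x_1,\dots,x_n\}$ (locally converging power series), $k[[x_1,\dots,x_n]]$ (formal power series). Let $f_1,f_2\in\mathcal{O}_n$ be non-units without common factors (each may be reducible or non-reduced), let $(X_i,0)=\{f_i=0\}$, and let $(X,0)=(X_1,0)\cup(X_2,0)=\{f_1f_2=0\}\subset(k^n,0)$. Let $\mathcal{M}$ be a determinantal representation of $(X,0)$: a $d\times d$ matrix over $\mathcal{O}_n$ with $\mathcal{M}|_0=0$ and $\det\mathcal{M}=f_1f_2$ up to an invertible factor. $\mathcal{M}$ is called *maximally generated at a point* $p$ if $\operatorname{corank}(\mathcal{M}|_p)=\operatorname{mult}(X,p)$, the order of vanishing of $\det\mathcal{M}$ at $p$; it is maximally generated *near the origin* if this holds at every point $p\in X$ in some neighbourhood of $0\in k^n$, and *at the smooth points of* $(X_1,0)\cap(X_2,0)$ if it holds at every smooth point of the scheme $X_1\cap X_2=\{f_1=f_2=0\}$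 in some neighbourhood of $0$. (For formal power series, the points are those of $\operatorname{Spec}\mathcal{O}_n$, with the corank taken over the residue field at $p$ and the order of vanishing taken in the local ring at $p$, and the smooth points of $X_1\cap X_2$ are the points of $\operatorname{Spec}\mathcal{O}_n/(f_1,f_2)$ with regular local ring.) $\mathcal{M}$ is called *decomposable* if there are $A,B\in GL(d,\mathcal{O}_n)$ with $A\mathcal{M}B=\mathcal{M}_1\oplus\mathcal{M}_2$, where $\mathcal{M}_i$ is a determinantal representation of $(X_i,0)$, i.e. $\det\mathcal{M}_i=f_i$ up to an invertible factor. 1. If the intersection $(X_1,0)\cap(X_2,0)$ is reduced, i.e. the ideal $(f_1,f_2)\subset\mathcal{O}_n$ is radical, and $\mathcal{M}$ is maximally generated at the smooth points of $(X_1,0)\cap(X_2,0)$, then $\mathcal{M}$ is decomposable. 2. Let $\mathbb{P}T_{(X_i,0)}\subset\mathbb{P}(k^n)$ be the projectivized tangent cone of $X_i$, i.e. the projective hypersurface (with its multiplicities) defined by the lowest order homogeneous form of $f_i$. Suppose that $\mathbb{P}T_{(X_1,0)}$ and $\mathbb{P}T_{(X_2,0)}$ intersect transversally: at each common point both hypersurfaces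 are smooth and their tangent hyperplanes are distinct; it is enough that this holds at a Zariski dense set of common points. If $\mathcal{M}$ is maximally generated near the origin, then $\mathcal{M}$ is decomposable, and all the entries of its adjugate matrix $\mathcal{M}^\vee$ belong to the ideal $(f_1,f_2)\subset\mathcal{O}_n$. -/

import Mathlib

open Filter Topology

noncomputable section

namespace DetRep

/-! ### The local rings of regular functions at the origin -/

section Rings

variable (k : Type*) [NontriviallyNormedField k] (n : ℕ)

/-- `f` converges absolutely on some polydisc of positive radius. -/
def Converges {k : Type*} [NontriviallyNormedField k] {n : ℕ}
    (f : MvPowerSeries (Fin n) k) : Prop :=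
  ∃ r : ℝ, 0 < r ∧
    Summable fun m : Fin n →₀ ℕ => ‖MvPowerSeries.coeff m f‖ * r ^ m.degree

theorem summable_of_le {k : Type*} [NontriviallyNormedField k] {n : ℕ}
    {f : MvPowerSeries (Fin n) k} {r s : ℝ} (hs : 0 ≤ s) (hsr : s ≤ r)
    (hf : Summable fun m : Fin n →₀ ℕ => ‖MvPowerSeries.coeff m f‖ * r ^ m.degree) :
    Summable fun m : Fin n →₀ ℕ => ‖MvPowerSeries.coeff m f‖ * s ^ m.degree :=
  Summable.of_nonneg_of_le (fun m => by positivity) (fun m => by gcongr) hf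

theorem Converges.add {k : Type*} [NontriviallyNormedField k] {n : ℕ}
    {f g : MvPowerSeries (Fin n) k} (hf : Converges f) (hg : Converges g) :
    Converges (f + g) := by
  obtain ⟨r, hr, hf⟩ := hf
  obtain ⟨s, hs, hg⟩ := hg
  have ht : 0 < min r s := lt_min hr hs
  refine ⟨min r s, ht, ?_⟩
  refine Summable.of_nonneg_of_le (fun m => by positivity) (fun m => ?_)
    ((summable_of_le ht.le (min_le_left r s) hf).add
      (summable_of_le ht.le (min_le_right r s) hg))
  rw [map_add, ← add_mul]
  gcongr
  exact norm_add_le _ _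

theorem summable_antidiagonal {n : ℕ} {F G : (Fin n →₀ ℕ) → ℝ} (hF : Summable F)
    (hG : Summable G) (hF0 : ∀ m, 0 ≤ F m) (hG0 : ∀ m, 0 ≤ G m) :
    Summable fun m => ∑ p ∈ Finset.HasAntidiagonal.antidiagonal m, F p.1 * G p.2 :=
  summable_sum_mul_antidiagonal_of_summable_mul (hF.mul_of_nonneg hG hF0 hG0)

theorem norm_coeff_mul_le {k : Type*} [NontriviallyNormedField k] {n : ℕ}
    (f g : MvPowerSeries (Fin n) k) {t : ℝ} (ht : 0 ≤ t) (m : Fin n →₀ ℕ) :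
    ‖MvPowerSeries.coeff m (f * g)‖ * t ^ m.degree ≤ ∑ p ∈ Finset.HasAntidiagonal.antidiagonal m,
      (‖MvPowerSeries.coeff p.1 f‖ * t ^ p.1.degree) *
        (‖MvPowerSeries.coeff p.2 g‖ * t ^ p.2.degree) := by
  have h₁ : ‖MvPowerSeries.coeff m (f * g)‖ ≤ ∑ p ∈ Finset.HasAntidiagonal.antidiagonal m,
      ‖MvPowerSeries.coeff p.1 f‖ * ‖MvPowerSeries.coeff p.2 g‖ := by
    rw [MvPowerSeries.coeff_mul]
    exact (norm_sum_le _ _).trans (Finset.sum_le_sum fun p _ => norm_mul_le _ _)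
  refine (mul_le_mul_of_nonneg_right h₁ (pow_nonneg ht _)).trans (le_of_eq ?_)
  rw [Finset.sum_mul]
  refine Finset.sum_congr rfl fun p hp => ?_
  have hd : m.degree = p.1.degree + p.2.degree := by
    rw [← Finset.HasAntidiagonal.mem_antidiagonal.mp hp, map_add]
  rw [hd, pow_add]
  ring

theorem summable_coeff_mul {k : Type*} [NontriviallyNormedField k] {n : ℕ}
    {f g : MvPowerSeries (Fin n) k} {t : ℝ} (ht : 0 ≤ t)
    (hf : Summable fun m : Fin n →₀ ℕ => ‖MvPowerSeries.coeff m f‖ * t ^ m.degree)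
    (hg : Summable fun m : Fin n →₀ ℕ => ‖MvPowerSeries.coeff m g‖ * t ^ m.degree) :
    Summable fun m : Fin n →₀ ℕ => ‖MvPowerSeries.coeff m (f * g)‖ * t ^ m.degree := by
  have h := summable_antidiagonal hf hg
    (fun m => mul_nonneg (norm_nonneg _) (pow_nonneg ht _))
    (fun m => mul_nonneg (norm_nonneg _) (pow_nonneg ht _))
  refine Summable.of_nonneg_of_le ?_ ?_ h
  · intro m
    exact mul_nonneg (norm_nonneg _) (pow_nonneg ht _)
  · intro m
    exact norm_coeff_mul_le f g ht m

theorem Converges.mul {k : Type*} [NontriviallyNormedField k] {n : ℕ}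
    {f g : MvPowerSeries (Fin n) k} (hf : Converges f) (hg : Converges g) :
    Converges (f * g) := by
  obtain ⟨r, hr, hf⟩ := hf
  obtain ⟨s, hs, hg⟩ := hg
  have ht : 0 < min r s := lt_min hr hs
  have h := summable_coeff_mul ht.le (summable_of_le ht.le (min_le_left r s) hf)
    (summable_of_le ht.le (min_le_right r s) hg)
  exact ⟨min r s, ht, h⟩

theorem converges_C {k : Type*} [NontriviallyNormedField k] {n : ℕ} (c : k) :
    Converges (MvPowerSeries.C c : MvPowerSeries (Fin n) k) := by
  classical
  refine ⟨1, one_pos, summable_of_ne_finset_zero (s := {0}) fun m hm => ?_⟩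
  rw [MvPowerSeries.coeff_C, if_neg (by simpa using hm)]
  simp

/-- The ring `k{x₁, …, xₙ}` of locally converging power series. -/
def convergentSeries : Subalgebra k (MvPowerSeries (Fin n) k) where
  carrier := {f | Converges f}
  mul_mem' := Converges.mul
  add_mem' := Converges.add
  algebraMap_mem' := converges_C

/-- The ring `k[x₁, …, xₙ]_(𝔪)` of rational functions that are regular at the origin, each one
identified with its Taylor expansion: the series `f` with `q * f = p` for some polynomials `p`, `q`
such that `q` does not vanish at the origin. -/
def rationalSeries : Subalgebra k (MvPowerSeries (Fin n) k) where
  carrier := {f | ∃ p q : MvPolynomial (Fin n) k, MvPolynomial.constantCoeff q ≠ 0 ∧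
    (q : MvPowerSeries (Fin n) k) * f = p}
  mul_mem' := by
    rintro f g ⟨p, q, hq, h⟩ ⟨p', q', hq', h'⟩
    refine ⟨p * p', q * q', by simp [hq, hq'], ?_⟩
    rw [MvPolynomial.coe_mul, MvPolynomial.coe_mul, ← h, ← h']
    ring
  add_mem' := by
    rintro f g ⟨p, q, hq, h⟩ ⟨p', q', hq', h'⟩
    refine ⟨q' * p + q * p', q * q', by simp [hq, hq'], ?_⟩
    rw [MvPolynomial.coe_mul, MvPolynomial.coe_add, MvPolynomial.coe_mul, MvPolynomial.coe_mul,
      ← h, ← h']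
    ring
  algebraMap_mem' := fun c => ⟨MvPolynomial.C c, 1, by simp, by simp; rfl⟩

/-- The three settings: algebraic, analytic, formal. -/
inductive Setting
  | rational
  | convergent
  | formal

/-- The local ring `𝒪ₙ` of regular functions on the germ `(kⁿ, 0)`. -/
def regularFunctions : Setting → Subalgebra k (MvPowerSeries (Fin n) k)
  | .rational => rationalSeries k n
  | .convergent => convergentSeries k n
  | .formal => ⊤

end Rings

/-! ### Closed points near the origin (algebraic and analytic germs) -/

section ClosedPoints

variable {k : Type*} [NontriviallyNormedField k] {n : ℕ}

/-- The Taylor expansion `f (a + y)`, as a power series in `y`, of a convergent series `f` at a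
point `a` near the origin. Its constant coefficient is the value of `f` at `a`, and its linear
coefficients are the partial derivatives of `f` at `a`. -/
def expandAt (f : MvPowerSeries (Fin n) k) (a : Fin n → k) : MvPowerSeries (Fin n) k :=
  fun m => ∑' l : Fin n →₀ ℕ,
    MvPowerSeries.coeff (m + l) f * ∏ i, (((m i + l i).choose (m i) : ℕ) : k) * a i ^ l i

/-- The value of `f` at `a`. -/
def valueAt (f : MvPowerSeries (Fin n) k) (a : Fin n → k) : k :=
  MvPowerSeries.constantCoeff (expandAt f a)

/-- The gradient of `f` at `a`. -/
def gradientAt (f : MvPowerSeries (Fin n) k) (a : Fin n → k) : Fin n → k :=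
  fun i => MvPowerSeries.coeff (Finsupp.single i 1) (expandAt f a)

/-- The order of vanishing of `f` at `a`, i.e. the multiplicity at `a` of `{f = 0}`. -/
def multAt (f : MvPowerSeries (Fin n) k) (a : Fin n → k) : ℕ∞ :=
  (expandAt f a).order

variable {O : Subalgebra k (MvPowerSeries (Fin n) k)} {d : ℕ}

/-- The corank at `a` of a matrix of functions. -/
def corankAt (M : Matrix (Fin d) (Fin d) O) (a : Fin n → k) : ℕ :=
  d - (M.map fun g => valueAt (g : MvPowerSeries (Fin n) k) a).rank

/-- `M` is maximally generated at the point `a`. -/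
def MaxGenAt (M : Matrix (Fin d) (Fin d) O) (a : Fin n → k) : Prop :=
  (corankAt M a : ℕ∞) = multAt (M.det : MvPowerSeries (Fin n) k) a

/-- `a` is a smooth point of `{f₁ = 0} ∩ {f₂ = 0}`, by the Jacobian criterion
(the intersection has codimension two when `f₁`, `f₂` are relatively prime). -/
def IsSmoothPoint (f₁ f₂ : MvPowerSeries (Fin n) k) (a : Fin n → k) : Prop :=
  valueAt f₁ a = 0 ∧ valueAt f₂ a = 0 ∧ LinearIndependent k ![gradientAt f₁ a, gradientAt f₂ a]

end ClosedPoints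

/-! ### Scheme-theoretic points (formal germs) -/

section SchemePoints

variable {S : Type*} [CommRing S]

/-- The order of vanishing of `f` at a point `p` of `Spec S`: the largest `e` such that `f` lies
in the `e`-th power of the maximal ideal of the local ring at `p`. -/
def multAtPrime (f : S) (p : PrimeSpectrum S) : ℕ∞ :=
  ⨆ (e : ℕ) (_ : algebraMap S (Localization.AtPrime p.asIdeal) f ∈
    IsLocalRing.maximalIdeal (Localization.AtPrime p.asIdeal) ^ e), (e : ℕ∞)

/-- The corank of a matrix at a point `p` of `Spec S`, i.e. over the residue field at `p`. -/
def corankAtPrime {d : ℕ} (M : Matrix (Fin d) (Fin d) S) (p : PrimeSpectrum S) : ℕ :=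
  d - (M.map (algebraMap S p.asIdeal.ResidueField)).rank

/-- `M` is maximally generated at the point `p` of `Spec S`. -/
def MaxGenAtPrime {d : ℕ} (M : Matrix (Fin d) (Fin d) S) (p : PrimeSpectrum S) : Prop :=
  (corankAtPrime M p : ℕ∞) = multAtPrime M.det p

/-- `M` is maximally generated at every regular point of the closed subscheme `Spec (S / I)`. -/
def MaxGenAtRegularPrimes {d : ℕ} (M : Matrix (Fin d) (Fin d) S) (I : Ideal S) : Prop :=
  ∀ q : PrimeSpectrum (S ⧸ I), IsRegularLocalRing (Localization.AtPrime q.asIdeal) →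
    MaxGenAtPrime M (PrimeSpectrum.comap (Ideal.Quotient.mk I) q)

end SchemePoints

/-! ### Maximally generated representations of germs -/

section Germs

variable {k : Type*} [NontriviallyNormedField k] {n d : ℕ}

/-- `M` is maximally generated near the origin: at all points, in some neighbourhood of the origin,
of the hypersurface `{det M = 0}`. A formal germ has no points of `kⁿ` but the origin; its points
are those of `Spec k[[x₁, …, xₙ]]`. -/
def MaxGenNear : (s : Setting) → Matrix (Fin d) (Fin d) (regularFunctions k n s) → Prop
  | .rational, M => ∀ᶠ a in 𝓝 (0 : Fin n → k),
      valueAt (M.det : MvPowerSeries (Fin n) k) a = 0 → MaxGenAt M a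
  | .convergent, M => ∀ᶠ a in 𝓝 (0 : Fin n → k),
      valueAt (M.det : MvPowerSeries (Fin n) k) a = 0 → MaxGenAt M a
  | .formal, M => ∀ p : PrimeSpectrum (regularFunctions k n .formal),
      M.det ∈ p.asIdeal → MaxGenAtPrime M p

/-- `M` is maximally generated at the smooth points of the germ `{f₁ = 0} ∩ {f₂ = 0}`. For a formal
germ these are the points of `Spec (𝒪ₙ / (f₁, f₂))` whose local ring is regular. -/
def MaxGenAtSmooth : (s : Setting) → (f₁ f₂ : regularFunctions k n s) →
    Matrix (Fin d) (Fin d) (regularFunctions k n s) → Prop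
  | .rational, f₁, f₂, M => ∀ᶠ a in 𝓝 (0 : Fin n → k),
      IsSmoothPoint (f₁ : MvPowerSeries (Fin n) k) f₂ a → MaxGenAt M a
  | .convergent, f₁, f₂, M => ∀ᶠ a in 𝓝 (0 : Fin n → k),
      IsSmoothPoint (f₁ : MvPowerSeries (Fin n) k) f₂ a → MaxGenAt M a
  | .formal, f₁, f₂, M => MaxGenAtRegularPrimes M (Ideal.span {f₁, f₂})

end Germs

/-! ### Tangent cones -/

section TangentCones

variable {k : Type*} [Field k] {n : ℕ}

/-- The lowest order homogeneous form of a power series: the equation of the tangent cone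
of `{f = 0}` at the origin. -/
def leadingForm (f : MvPowerSeries (Fin n) k) : MvPolynomial (Fin n) k :=
  MvPowerSeries.truncTotal (f.order.toNat + 1)
    (MvPowerSeries.homogeneousComponent f.order.toNat f)

/-- The projective hypersurfaces `{F = 0}` and `{G = 0}` have the common point `[v]`. -/
def CommonPoint (F G : MvPolynomial (Fin n) k) (v : Fin n → k) : Prop :=
  v ≠ 0 ∧ MvPolynomial.eval v F = 0 ∧ MvPolynomial.eval v G = 0

/-- The projective hypersurfaces `{F = 0}` and `{G = 0}` intersect transversally at `[v]`: both
are smooth there, and their tangent hyperplanes are distinct. -/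
def TransverseAt (F G : MvPolynomial (Fin n) k) (v : Fin n → k) : Prop :=
  CommonPoint F G v ∧
    LinearIndependent k ![fun i => MvPolynomial.eval v (MvPolynomial.pderiv i F),
      fun i => MvPolynomial.eval v (MvPolynomial.pderiv i G)]

/-- The projective hypersurfaces `{F = 0}` and `{G = 0}` intersect transversally, at least
generically: the points at which they are transverse are Zariski dense in the intersection. This
holds in particular if they are transverse at every common point. -/
def MeetTransversally (F G : MvPolynomial (Fin n) k) : Prop :=
  ∀ P : MvPolynomial (Fin n) k, (∀ v, TransverseAt F G v → MvPolynomial.eval v P = 0) →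
    ∀ v, CommonPoint F G v → MvPolynomial.eval v P = 0

theorem meetTransversally_of_forall {F G : MvPolynomial (Fin n) k}
    (h : ∀ v, CommonPoint F G v → TransverseAt F G v) : MeetTransversally F G :=
  fun _ hP v hv => hP v (h v hv)

end TangentCones

/-! ### Decomposability -/

/-- `M` is equivalent to `M₁ ⊕ M₂`, where `M₁`, `M₂` are determinantal representations of the
hypersurfaces `{f₁ = 0}`, `{f₂ = 0}`. -/
def Decomposable {S : Type*} [CommRing S] {d : ℕ} (M : Matrix (Fin d) (Fin d) S)
    (f₁ f₂ : S) : Prop :=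
  ∃ (d₁ d₂ : ℕ) (e : Fin d₁ ⊕ Fin d₂ ≃ Fin d) (A B : GL (Fin d) S)
    (M₁ : Matrix (Fin d₁) (Fin d₁) S) (M₂ : Matrix (Fin d₂) (Fin d₂) S),
    0 < d₁ ∧ 0 < d₂ ∧ Associated M₁.det f₁ ∧ Associated M₂.det f₂ ∧
      (A : Matrix (Fin d) (Fin d) S) * M * (B : Matrix (Fin d) (Fin d) S) =
        Matrix.reindex e e (Matrix.fromBlocks M₁ 0 0 M₂)

end DetRep

end

/-!
Both parts reduce to one fact: the entries of `M.adjugate` lie in the ideal `(f₁, f₂)`.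

*From the adjugate to the decomposition* (`decomposable_of_adjugate_mem`). Up to a unit, the
adjugate is `f₂ N₁ + f₁ N₂`. Multiplication by `M` gives `f₂ M N₁ + f₁ M N₂ = f₁ f₂`, and as `f₁` and
`f₂` are coprime, `M N₁ = f₁ P₁` and `M N₂ = f₂ P₂` with `P₁ + P₂ = 1`. The product `P₁ P₂` is a
multiple of `M`, hence zero modulo the maximal ideal, where `P₁` and `P₂` are complementary
idempotents. They can be corrected to an idempotent `E` over the local ring with `E M = M F`,
`F` idempotent. In bases that diagonalize `E` and `F` the matrix `M` is block diagonal; the ranks of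
`E` and `F` agree because their traces do, which needs characteristic zero. The blocks have
determinants dividing a power of `f₁` and a power of `f₂`, hence `f₁` and `f₂` themselves.

*From maximal generation to the adjugate* (`adjugate_mem_of_maxGenAtSmooth`). At a point of the
intersection `det M` vanishes to order at least two, so maximal generation there forces corank at
least two, and the adjugate vanishes. As `(f₁, f₂)` is radical, it is enough to show that the adjugate
lies in every minimal prime `P` of it. In the formal setting, `P` itself is a regular point. In the
other two settings one needs smooth points of the intersection, close to the origin, at which a given
germ outside `P` does not vanish. Smoothness comes from a Jacobian minor outside `P`
(`IsWeierstrass.exists_minor_notMem`, `exists_minor_notMem_rational`; here the characteristic enters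
again). The points come from `exists_point_of_minimalPrime`: Weierstrass preparation presents the
intersection as a finite cover of a polydisc with torsion-free ring of functions (`AdaptedPair`);
homomorphisms of the coefficient ring into `k` given by points of the polydisc extend to the cover
outside a proper analytic subset (`exists_specialization`), and bounds for the roots of monic
polynomials keep the extended points near the origin. This uses that convergent and formal power
series form Noetherian factorial local rings, which follows from Weierstrass division alone
(`IsWeierstrass`); the properties shared with the rational functions are collected in `IsGermRing`.

*Transverse tangent cones.* Maximal generation near the origin includes maximal generation at the
smooth points of the intersection, so only the radicality of `(f₁, f₂)` is missing. The lowest order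
forms `F`, `G` are coprime (`isRelPrime_of_meetTransversally`) and generate a radical ideal
(`isRadical_span_pair_of_meetTransversally`): the quotient by `(F, G)` has no torsion over the
polynomials in `n - 2` suitable coordinates, so that every associated prime `Q` has height at most two
and is minimal; the density of the transverse points and the Nullstellensatz give a Jacobian minor
outside `Q`, whence `F` and `G` generate the maximal ideal of the regular local ring at `Q`. Since `F`
and `G` are coprime, they generate the initial forms of the ideal `(f₁, f₂)`, and its radicality
follows from that of `(F, G)` (`IsGermRing.isRadical_of_initialForms`).
-/

noncomputable section

namespace DetRep

/-! ### Decomposition of matrices whose adjugate lies in the ideal of two equations -/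

section MatrixLemmas
open Matrix

theorem adjugate_eq_zero_of_rank_add_two_le {K : Type*} [Field K] {d : ℕ}
    (M : Matrix (Fin d) (Fin d) K) (h : M.rank + 2 ≤ d) : M.adjugate = 0 := by
  ext i j
  rw [adjugate_apply]
  by_contra hne
  have h1 : (M.updateRow j (Pi.single i 1)).rank = d := by
    simpa using rank_of_isUnit _ ((isUnit_iff_isUnit_det _).2 (isUnit_iff_ne_zero.2 hne))
  have h2 : M.updateRow j (Pi.single i 1) =
      M + vecMulVec (Pi.single j 1) (Pi.single i 1 - M j) := by
    ext a b
    by_cases ha : a = j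
    · subst ha; simp [vecMulVec_apply]
    · simp [vecMulVec_apply, ha]
  have h3 : (M + vecMulVec (Pi.single j 1) (Pi.single i 1 - M j)).rank ≤
      M.rank + (vecMulVec (Pi.single j 1) (Pi.single i 1 - M j)).rank := by
    rw [rank, rank, rank, mulVecLin_add]
    exact (Submodule.finrank_mono (LinearMap.range_add_le _ _)).trans
      (Submodule.finrank_add_le_finrank_add_finrank _ _)
  have h4 := rank_vecMulVec_le (Pi.single j (1 : K)) (Pi.single i 1 - M j)
  rw [← h2] at h3
  omega

/-- The diagonal idempotent matrix with ones at the places in `s`. -/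
def diagProj (R : Type*) [CommRing R] {d : ℕ} (s : Finset (Fin d)) : Matrix (Fin d) (Fin d) R :=
  diagonal fun i => if i ∈ s then 1 else 0

theorem diagProj_mul_self {R : Type*} [CommRing R] {d : ℕ} (s : Finset (Fin d)) :
    diagProj R s * diagProj R s = diagProj R s := by
  rw [diagProj, diagonal_mul_diagonal]
  congr 1
  ext i
  split_ifs <;> simp

theorem diagProj_map {R S : Type*} [CommRing R] [CommRing S] (φ : R →+* S) {d : ℕ}
    (s : Finset (Fin d)) : (diagProj R s).map φ = diagProj S s := by
  ext i j
  simp only [diagProj, diagonal_apply, map_apply]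
  split_ifs <;> simp

/-- Over a field, an idempotent matrix is diagonalizable: the space is the direct sum of its range
and its kernel. -/
theorem exists_mul_eq_mul_diagProj {K : Type*} [Field K] {d : ℕ}
    (P : Matrix (Fin d) (Fin d) K) (hP : P * P = P) :
    ∃ (V : Matrix (Fin d) (Fin d) K) (s : Finset (Fin d)), IsUnit V.det ∧
      P * V = V * diagProj K s := by
  classical
  let p := toLin' P
  have hp : IsIdempotentElem p := by
    change p * p = p
    rw [Module.End.mul_eq_comp, ← toLin'_mul, hP]
  have hc : IsCompl (LinearMap.range p) (LinearMap.ker p) := LinearMap.IsIdempotentElem.isCompl hp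
  let b₁ := Module.finBasis K (LinearMap.range p)
  let b₂ := Module.finBasis K (LinearMap.ker p)
  let b₀ := (b₁.prod b₂).map (Submodule.prodEquivOfIsCompl _ _ hc)
  have hcard : Fintype.card (Fin (Module.finrank K (LinearMap.range p)) ⊕
      Fin (Module.finrank K (LinearMap.ker p))) = Fintype.card (Fin d) := by
    rw [← Module.finrank_eq_card_basis b₀]; simp
  let e := Fintype.equivOfCardEq hcard
  let b := b₀.reindex e
  have hb : ∀ j, p (b j) = b j ∨ p (b j) = 0 := by
    intro j
    obtain ⟨c, rfl⟩ := e.surjective j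
    rcases c with c | c
    · left
      obtain ⟨w, hw⟩ := (b₁ c).2
      have : b (e (Sum.inl c)) = p w := by simp [b, b₀, hw]
      rw [this]
      exact LinearMap.congr_fun hp w
    · right
      have : b (e (Sum.inr c)) = b₂ c := by simp [b, b₀]
      rw [this]
      exact (b₂ c).2
  refine ⟨(Pi.basisFun K (Fin d)).toMatrix b, Finset.univ.filter fun j => p (b j) = b j, ?_, ?_⟩
  · rw [← Module.Basis.det_apply]
    exact Module.Basis.isUnit_det _ _
  · ext i j
    have h1 : (P * (Pi.basisFun K (Fin d)).toMatrix b) i j = p (b j) i := by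
      simp [Matrix.mul_apply, p, toLin'_apply, mulVec, dotProduct, Module.Basis.toMatrix_apply]
    rw [h1, diagProj, mul_diagonal]
    by_cases h : p (b j) = b j
    · simp [h, Module.Basis.toMatrix_apply]
    · have h0 := (hb j).resolve_left h
      rw [if_neg (by simpa using h), h0]
      simp

/-- Over a local ring, complementary matrices whose product vanishes in the residue field are,
up to right multiples of that product, complementary coordinate projections in a suitable basis. -/
theorem exists_conj_diagProj {R : Type*} [CommRing R] [IsLocalRing R] {d : ℕ}
    (P Q : Matrix (Fin d) (Fin d) R) (hPQ : P + Q = 1)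
    (h0 : (P * Q).map (IsLocalRing.residue R) = 0) :
    ∃ (A : GL (Fin d) R) (s : Finset (Fin d)) (W : Matrix (Fin d) (Fin d) R),
      (A : Matrix (Fin d) (Fin d) R) * diagProj R s *
        ((A⁻¹ : GL (Fin d) R) : Matrix (Fin d) (Fin d) R) = P + P * Q * W := by
  set π := IsLocalRing.residue R
  have hmul : ∀ X Y : Matrix (Fin d) (Fin d) R, (X * Y).map π = X.map π * Y.map π :=
    fun X Y => Matrix.map_mul
  have hQ : Q = 1 - P := eq_sub_of_add_eq' hPQ
  have hid : P.map π * P.map π = P.map π := by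
    have : P * Q = P - P * P := by rw [hQ, mul_sub, mul_one]
    rw [this, Matrix.map_sub _ (fun a b => map_sub π a b), hmul, sub_eq_zero] at h0
    exact h0.symm
  obtain ⟨V', s, hV', hPV⟩ := exists_mul_eq_mul_diagProj _ hid
  have hlift : ∃ V : Matrix (Fin d) (Fin d) R, V.map π = V' := by
    choose g hg using IsLocalRing.residue_surjective (R := R)
    exact ⟨V'.map g, by ext i j; exact hg _⟩
  obtain ⟨V, hV⟩ := hlift
  set D := diagProj R s
  have hDD : D * D = D := diagProj_mul_self s
  set A₀ := P * V * D + Q * V * (1 - D)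
  have hA₀ : A₀.map π = V' := by
    have hDπ : D.map π = diagProj _ s := diagProj_map π s
    have h1π : (1 : Matrix (Fin d) (Fin d) R).map π = 1 := Matrix.map_one _ (map_zero π) (map_one π)
    simp only [A₀, hQ]
    rw [Matrix.map_add _ (fun a b => map_add π a b), hmul, hmul, hmul, hmul,
      Matrix.map_sub _ (fun a b => map_sub π a b), Matrix.map_sub _ (fun a b => map_sub π a b),
      hV, hDπ, h1π, sub_mul, one_mul, hPV]
    have h2 : diagProj (IsLocalRing.ResidueField R) s * diagProj _ s = diagProj _ s :=
      diagProj_mul_self s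
    have h3 : V' * diagProj (IsLocalRing.ResidueField R) s * diagProj _ s = V' * diagProj _ s := by
      rw [mul_assoc, h2]
    rw [mul_sub, sub_mul, mul_one, sub_mul, h3, mul_one]
    abel
  have hdet : IsUnit A₀.det := by
    apply isUnit_of_map_unit π
    rw [RingHom.map_det]
    change IsUnit (A₀.map π).det
    rwa [hA₀]
  let A : GL (Fin d) R := GeneralLinearGroup.mk'' A₀ hdet
  have hA : (A : Matrix (Fin d) (Fin d) R) = A₀ := rfl
  have hAA : A₀ * ((A⁻¹ : GL (Fin d) R) : Matrix (Fin d) (Fin d) R) = 1 := by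
    rw [← hA, ← Units.val_mul, mul_inv_cancel, Units.val_one]
  refine ⟨A, s, V * (2 * D - 1) * ((A⁻¹ : GL (Fin d) R) : Matrix (Fin d) (Fin d) R), ?_⟩
  have key : A₀ * D = P * A₀ + P * Q * (V * (2 * D - 1)) := by
    simp only [A₀, hQ]
    have e1 : D * D = D := hDD
    have e2 : (1 - D) * D = 0 := by rw [sub_mul, one_mul, hDD, sub_self]
    rw [add_mul, mul_assoc _ D D, e1, mul_assoc _ (1 - D) D, e2, mul_zero, add_zero]
    noncomm_ring
  rw [hA, key, add_mul, mul_assoc P, hAA, mul_one]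
  simp only [mul_assoc]

theorem eq_of_smul_eq_smul {R : Type*} [CommRing R] [IsDomain R] {d : ℕ} {c : R} (hc : c ≠ 0)
    {X Y : Matrix (Fin d) (Fin d) R} (h : c • X = c • Y) : X = Y := by
  ext i j
  have := congrFun (congrFun h i) j
  simpa [hc] using this

theorem exists_smul_eq_of_dvd {R : Type*} [CommRing R] {d : ℕ} {c : R}
    {X : Matrix (Fin d) (Fin d) R} (h : ∀ i j, c ∣ X i j) : ∃ Y, X = c • Y := by
  choose Y hY using h
  exact ⟨Y, by ext i j; exact hY i j⟩

/-- If the adjugate of `M` has its entries in `(f₁, f₂)`, then the cokernel of `M` is the direct sum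
of its parts killed by `f₁` and by `f₂`; in suitable bases, `M` intertwines coordinate projections
that realize this splitting. -/
theorem exists_intertwining {R : Type*} [CommRing R] [IsDomain R] [IsLocalRing R] [CharZero R]
    [DecompositionMonoid R] {d : ℕ} {M : Matrix (Fin d) (Fin d) R} {f₁ f₂ : R}
    (h₁ : f₁ ≠ 0) (h₂ : f₂ ≠ 0) (hf : IsRelPrime f₁ f₂)
    (hM : Associated M.det (f₁ * f₂)) (hM0 : ∀ i j, M i j ∈ IsLocalRing.maximalIdeal R)
    (hadj : ∀ i j, M.adjugate i j ∈ Ideal.span {f₁, f₂}) :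
    ∃ (A B : GL (Fin d) R) (s t : Finset (Fin d)) (X Y : Matrix (Fin d) (Fin d) R),
      s.card = t.card ∧
      diagProj R s * ((A : Matrix (Fin d) (Fin d) R) * M * (B : Matrix (Fin d) (Fin d) R)) =
        ((A : Matrix (Fin d) (Fin d) R) * M * (B : Matrix (Fin d) (Fin d) R)) * diagProj R t ∧
      f₁ • diagProj R s = (A : Matrix (Fin d) (Fin d) R) * M * (B : Matrix (Fin d) (Fin d) R) * X ∧
      f₂ • (1 - diagProj R s) =
        (A : Matrix (Fin d) (Fin d) R) * M * (B : Matrix (Fin d) (Fin d) R) * Y := by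
  have h12 : f₁ * f₂ ≠ 0 := mul_ne_zero h₁ h₂
  obtain ⟨u, hu⟩ := hM
  have hdet : M.det ≠ 0 := fun h => h12 (by rw [← hu, h, zero_mul])
  have hcancel : ∀ X Y : Matrix (Fin d) (Fin d) R, M * X = M * Y → X = Y := by
    intro X Y h
    apply eq_of_smul_eq_smul hdet
    have := congrArg (M.adjugate * ·) h
    simpa [← mul_assoc, adjugate_mul] using this
  simp only [Ideal.mem_span_pair] at hadj
  choose a b hab using hadj
  obtain ⟨N₁, hN₁⟩ : ∃ N : Matrix (Fin d) (Fin d) R, N = (u : R) • Matrix.of b := ⟨_, rfl⟩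
  obtain ⟨N₂, hN₂⟩ : ∃ N : Matrix (Fin d) (Fin d) R, N = (u : R) • Matrix.of a := ⟨_, rfl⟩
  have hN : f₂ • N₁ + f₁ • N₂ = (u : R) • M.adjugate := by
    ext i j
    simp [hN₁, hN₂, ← hab i j]
    ring
  have hMN : f₂ • (M * N₁) + f₁ • (M * N₂) = (f₁ * f₂) • 1 := by
    rw [← Matrix.mul_smul, ← Matrix.mul_smul, ← mul_add, hN, Matrix.mul_smul, mul_adjugate, smul_smul, mul_comm, hu]
  have hNM : f₂ • (N₁ * M) + f₁ • (N₂ * M) = (f₁ * f₂) • 1 := by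
    rw [← Matrix.smul_mul, ← Matrix.smul_mul, ← add_mul, hN, Matrix.smul_mul, adjugate_mul, smul_smul, mul_comm, hu]
  -- compare the coefficients: `f₁` divides those of `U`, and `f₂` those of `V`
  have hsplit : ∀ U V : Matrix (Fin d) (Fin d) R, f₂ • U + f₁ • V = (f₁ * f₂) • 1 →
      ∃ P Q, U = f₁ • P ∧ V = f₂ • Q ∧ P + Q = 1 := by
    intro U V h
    have hij : ∀ i j, f₂ * U i j + f₁ * V i j = f₁ * f₂ * (1 : Matrix (Fin d) (Fin d) R) i j :=
      fun i j => by simpa using congrFun (congrFun h i) j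
    obtain ⟨P, hP⟩ := exists_smul_eq_of_dvd (c := f₁) (X := U) fun i j =>
      hf.dvd_of_dvd_mul_left
        ⟨f₂ * (1 : Matrix (Fin d) (Fin d) R) i j - V i j, by linear_combination hij i j⟩
    obtain ⟨Q, hQ⟩ := exists_smul_eq_of_dvd (c := f₂) (X := V) fun i j =>
      hf.symm.dvd_of_dvd_mul_left
        ⟨f₁ * (1 : Matrix (Fin d) (Fin d) R) i j - U i j, by linear_combination hij i j⟩
    refine ⟨P, Q, hP, hQ, eq_of_smul_eq_smul h12 ?_⟩
    rw [← h, hP, hQ, smul_add, smul_smul, smul_smul, mul_comm f₂ f₁]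
  obtain ⟨P₁, P₂, hP₁, hP₂, hP⟩ := hsplit _ _ hMN
  obtain ⟨Q₁, Q₂, hQ₁, hQ₂, hQ⟩ := hsplit _ _ hNM
  -- `P₁ P₂` is a multiple of `M`, hence vanishes over the residue field; so `P₁`, `P₂` are
  -- complementary idempotents there
  have hNMN : f₂ • (N₁ * P₂) = f₁ • (Q₁ * N₂) := by
    rw [← Matrix.mul_smul, ← hP₂, ← Matrix.smul_mul, ← hQ₁, mul_assoc]
  obtain ⟨Z, hZ⟩ := exists_smul_eq_of_dvd (c := f₁) (X := N₁ * P₂) fun i j =>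
    hf.dvd_of_dvd_mul_left ⟨(Q₁ * N₂) i j, by simpa using congrFun (congrFun hNMN i) j⟩
  have hPP : P₁ * P₂ = M * Z := by
    apply eq_of_smul_eq_smul h₁
    rw [← Matrix.smul_mul, ← hP₁, mul_assoc, hZ, Matrix.mul_smul]
  have hPM : P₁ * M = M * Q₁ := by
    apply eq_of_smul_eq_smul h₁
    rw [← Matrix.smul_mul, ← hP₁, mul_assoc, hQ₁, Matrix.mul_smul]
  have hres : ∀ X : Matrix (Fin d) (Fin d) R, (M * X).map (IsLocalRing.residue R) = 0 := by
    intro X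
    rw [Matrix.map_mul]
    have : M.map (IsLocalRing.residue R) = 0 := by
      ext i j
      simpa using hM0 i j
    rw [this, zero_mul]
  -- correct `P₁` by a multiple of `M` to an idempotent `E`, and move `E` to the other side of `M`
  obtain ⟨A, s, W, hA⟩ := exists_conj_diagProj P₁ P₂ hP (by rw [hPP]; exact hres Z)
  set D := diagProj R s
  have hDD : D * D = D := diagProj_mul_self s
  set A' : Matrix (Fin d) (Fin d) R := ((A⁻¹ : GL (Fin d) R) : Matrix (Fin d) (Fin d) R)
  have hA'A : A' * (A : Matrix (Fin d) (Fin d) R) = 1 := by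
    simp only [A', ← Units.val_mul, inv_mul_cancel, Units.val_one]
  obtain ⟨E, hE⟩ : ∃ E, E = (A : Matrix (Fin d) (Fin d) R) * D * A' := ⟨_, rfl⟩
  have hE' : E = P₁ + M * (Z * W) := by rw [hE, hA, hPP, mul_assoc]
  have hEE : E * E = E := by
    calc E * E = (A : Matrix (Fin d) (Fin d) R) * (D * (A' * (A : Matrix (Fin d) (Fin d) R)) * D)
            * A' := by
          rw [hE]; simp only [mul_assoc]
      _ = E := by rw [hA'A, mul_one, hDD, hE]
  have hA'E : A' * E = D * A' := by
    rw [hE, ← mul_assoc, ← mul_assoc, hA'A, one_mul]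
  obtain ⟨F, hF⟩ : ∃ F, F = Q₁ + Z * W * M := ⟨_, rfl⟩
  have hEM : E * M = M * F := by
    rw [hE', hF, add_mul, mul_add, hPM, mul_assoc]
  have hFF : F * F = F := by
    apply hcancel
    rw [← mul_assoc, ← hEM, mul_assoc, ← hEM, ← mul_assoc, hEE]
  -- `F` is idempotent already, and is only to be diagonalized
  obtain ⟨B, t, W', hB⟩ := exists_conj_diagProj F (1 - F) (by abel) (by
    rw [mul_sub, mul_one, hFF, sub_self]; ext; simp)
  rw [mul_sub, mul_one, hFF, sub_self, zero_mul, add_zero] at hB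
  set B' : Matrix (Fin d) (Fin d) R := ((B⁻¹ : GL (Fin d) R) : Matrix (Fin d) (Fin d) R)
  have hBB' : (B : Matrix (Fin d) (Fin d) R) * B' = 1 := by
    simp only [B', ← Units.val_mul, mul_inv_cancel, Units.val_one]
  have hB'B : B' * (B : Matrix (Fin d) (Fin d) R) = 1 := by
    simp only [B', ← Units.val_mul, inv_mul_cancel, Units.val_one]
  have hFB : F * (B : Matrix (Fin d) (Fin d) R) = (B : Matrix (Fin d) (Fin d) R) * diagProj R t := by
    rw [← hB, mul_assoc, hB'B, mul_one]
  have hA'' : ((A⁻¹ : GL (Fin d) R) : Matrix (Fin d) (Fin d) R) = A' := rfl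
  have hfE : f₁ • E = M * (N₁ + f₁ • (Z * W)) := by
    rw [hE', smul_add, ← hP₁, mul_add, Matrix.mul_smul]
  have hfE' : f₂ • (1 - E) = M * (N₂ - f₂ • (Z * W)) := by
    rw [hE', ← hP, add_sub_add_left_eq_sub, smul_sub, ← hP₂, mul_sub, Matrix.mul_smul]
  have hDA : A' * E * (A : Matrix (Fin d) (Fin d) R) = D := by
    rw [hA'E, mul_assoc, hA'A, mul_one]
  refine ⟨A⁻¹, B, s, t, B' * (N₁ + f₁ • (Z * W)) * A, B' * (N₂ - f₂ • (Z * W)) * A,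
    ?_, ?_, ?_, ?_⟩
  · -- the two projections have the same rank because they are conjugate over the fraction field
    have htr : M.det * trace E = M.det * trace F := by
      have e1 : trace (E * (M * M.adjugate)) = M.det * trace E := by
        rw [mul_adjugate, Matrix.mul_smul, mul_one, trace_smul, smul_eq_mul]
      have e2 : trace (M.adjugate * M * F) = M.det * trace F := by
        rw [adjugate_mul, Matrix.smul_mul, one_mul, trace_smul, smul_eq_mul]
      rw [← e1, ← e2, ← mul_assoc, hEM, trace_mul_comm, mul_assoc]
    have htE : trace E = s.card := by
      rw [hE, trace_mul_comm, ← mul_assoc, hA'A, one_mul]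
      simp [D, diagProj]
    have htF : trace F = t.card := by
      rw [← hB, trace_mul_comm, ← mul_assoc, hB'B, one_mul]
      simp [diagProj]
    have := mul_left_cancel₀ hdet htr
    rw [htE, htF] at this
    exact_mod_cast this
  · rw [hA'', mul_assoc _ _ (diagProj R t), ← hFB, ← mul_assoc, ← mul_assoc, ← hA'E, mul_assoc A' E,
      hEM]
    simp only [mul_assoc]
  · calc f₁ • D = A' * (f₁ • E) * A := by rw [Matrix.mul_smul, Matrix.smul_mul, hDA]
      _ = A' * M * (B * B') * (N₁ + f₁ • (Z * W)) * A := by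
          rw [hfE, hBB', mul_one]; simp only [mul_assoc]
      _ = _ := by rw [hA'']; simp only [mul_assoc]
  · calc f₂ • (1 - D) = A' * (f₂ • (1 - E)) * A := by
          rw [Matrix.mul_smul, Matrix.smul_mul, mul_sub, sub_mul, mul_one, hA'A, hDA]
      _ = A' * M * (B * B') * (N₂ - f₂ • (Z * W)) * A := by
          rw [hfE', hBB', mul_one]; simp only [mul_assoc]
      _ = _ := by rw [hA'']; simp only [mul_assoc]

theorem exists_equiv_sum_of_finset {d : ℕ} (s : Finset (Fin d)) {a b : ℕ} (ha : s.card = a)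
    (hb : d - s.card = b) : ∃ e : Fin a ⊕ Fin b ≃ Fin d, ∀ c, e c ∈ s ↔ c.isLeft := by
  have h1 : Fintype.card (Fin a) = Fintype.card {x // x ∈ s} := by simp [ha]
  have h2 : Fintype.card (Fin b) = Fintype.card {x // ¬ x ∈ s} := by
    rw [Fintype.card_subtype_compl]; simp [hb]
  refine ⟨((Fintype.equivOfCardEq h1).sumCongr (Fintype.equivOfCardEq h2)).trans
    (Equiv.sumCompl _), ?_⟩
  rintro (c | c)
  · simp
  · simpa using ((Fintype.equivOfCardEq h2) c).2

/-- The decomposition criterion. In the bases of `exists_intertwining` the matrix is block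
diagonal; the determinants of the blocks divide powers of `f₁` and of `f₂`, and their product is
`f₁ f₂` up to a unit. -/
theorem decomposable_of_adjugate_mem {R : Type*} [CommRing R] [IsDomain R] [IsLocalRing R]
    [CharZero R] [DecompositionMonoid R] {d : ℕ} {M : Matrix (Fin d) (Fin d) R} {f₁ f₂ : R}
    (hu₁ : ¬ IsUnit f₁) (hu₂ : ¬ IsUnit f₂) (hf : IsRelPrime f₁ f₂)
    (hM : Associated M.det (f₁ * f₂)) (hM0 : ∀ i j, M i j ∈ IsLocalRing.maximalIdeal R)
    (hadj : ∀ i j, M.adjugate i j ∈ Ideal.span {f₁, f₂}) : Decomposable M f₁ f₂ := by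
  have h₁ : f₁ ≠ 0 := by
    rintro rfl
    exact hu₂ (hf (dvd_zero _) dvd_rfl)
  have h₂ : f₂ ≠ 0 := by
    rintro rfl
    exact hu₁ (hf dvd_rfl (dvd_zero _))
  obtain ⟨A, B, s, t, X, Y, hst, hD, hX, hY⟩ := exists_intertwining h₁ h₂ hf hM hM0 hadj
  obtain ⟨e, he⟩ := exists_equiv_sum_of_finset s rfl rfl
  obtain ⟨e', he'⟩ := exists_equiv_sum_of_finset t hst.symm (by rw [← hst])
  obtain ⟨N, hN⟩ : ∃ N, N = (A : Matrix (Fin d) (Fin d) R) * M * (B : Matrix (Fin d) (Fin d) R) :=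
    ⟨_, rfl⟩
  rw [← hN] at hD hX hY
  have hNij : ∀ i j, (i ∈ s ↔ j ∉ t) → N i j = 0 := by
    intro i j hij
    have := congrFun (congrFun hD i) j
    rw [diagProj, diagProj, diagonal_mul, mul_diagonal] at this
    by_cases hi : i ∈ s
    · simpa [hi, hij.1 hi] using this
    · have hj : j ∈ t := by by_contra h; exact hi (hij.2 h)
      simpa [hi, hj] using this.symm
  let M₁ := (N.submatrix e e').toBlocks₁₁
  let M₂ := (N.submatrix e e').toBlocks₂₂
  have hblocks : N.submatrix e e' = fromBlocks M₁ 0 0 M₂ := by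
    rw [← fromBlocks_toBlocks (N.submatrix e e')]
    congr 1
    · ext i j; exact hNij _ _ (by simp [he, he'])
    · ext i j; exact hNij _ _ (by simp [he, he'])
  have hσ : IsUnit ((B : Matrix (Fin d) (Fin d) R).submatrix id (e.symm.trans e')).det := by
    rw [det_permute']
    exact ((Units.isUnit (Equiv.Perm.sign _)).map (Int.castRingHom R)).mul
      ((isUnit_iff_isUnit_det _).1 B.isUnit)
  have hprod : (A : Matrix (Fin d) (Fin d) R) * M *
      (B : Matrix (Fin d) (Fin d) R).submatrix id (e.symm.trans e') =
      reindex e e (fromBlocks M₁ 0 0 M₂) := by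
    rw [← hblocks, hN]
    ext i j
    simp [Matrix.mul_apply]
  have hdetN : Associated (M₁.det * M₂.det) (f₁ * f₂) := by
    have h := congrArg det hprod
    rw [det_reindex_self, det_fromBlocks_zero₂₁, det_mul, det_mul] at h
    rw [← h]
    refine Associated.trans ?_ hM
    exact (associated_mul_unit_left _ _ hσ).trans
      (associated_unit_mul_left _ _ ((isUnit_iff_isUnit_det _).1 A.isUnit))
  have hDe : (diagProj R s).submatrix e e = fromBlocks 1 0 0 0 := by
    ext (i | i) (j | j) <;> simp [diagProj, diagonal_apply, he, Matrix.one_apply]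
  have hDe' : (1 - diagProj R s).submatrix e e = fromBlocks 0 0 0 1 := by
    ext (i | i) (j | j) <;> simp [diagProj, diagonal_apply, he, Matrix.one_apply]
  have hd₁ : M₁.det ∣ f₁ ^ s.card := by
    have h := congrArg (fun Q : Matrix (Fin d) (Fin d) R => Q.submatrix e e) hX
    simp only [submatrix_smul, Pi.smul_apply, hDe] at h
    rw [← submatrix_mul_equiv N X e e' e, hblocks, ← fromBlocks_toBlocks (X.submatrix e' e),
      fromBlocks_multiply, fromBlocks_smul, fromBlocks_inj] at h
    have h11 := congrArg det h.1
    rw [Matrix.zero_mul, add_zero, det_mul, det_smul, det_one, mul_one, Fintype.card_fin] at h11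
    exact ⟨_, h11⟩
  have hd₂ : M₂.det ∣ f₂ ^ (d - s.card) := by
    have h := congrArg (fun Q : Matrix (Fin d) (Fin d) R => Q.submatrix e e) hY
    simp only [submatrix_smul, Pi.smul_apply, hDe'] at h
    rw [← submatrix_mul_equiv N Y e e' e, hblocks, ← fromBlocks_toBlocks (Y.submatrix e' e),
      fromBlocks_multiply, fromBlocks_smul, fromBlocks_inj] at h
    have h22 := congrArg det h.2.2.2
    rw [Matrix.zero_mul, zero_add, det_mul, det_smul, det_one, mul_one, Fintype.card_fin] at h22
    exact ⟨_, h22⟩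
  have hdvd₁ : M₁.det ∣ f₁ :=
    (IsRelPrime.of_dvd_left hf.pow_left hd₁).dvd_of_dvd_mul_right
      ((dvd_mul_right _ _).trans hdetN.dvd)
  have hdvd₂ : M₂.det ∣ f₂ :=
    (IsRelPrime.of_dvd_left hf.symm.pow_left hd₂).dvd_of_dvd_mul_left
      ((dvd_mul_left _ _).trans hdetN.dvd)
  have has₁ : Associated M₁.det f₁ := by
    obtain ⟨a, ha⟩ := hdvd₁
    obtain ⟨b, hb⟩ := hdvd₂
    have h3 := hdetN.symm.dvd
    obtain ⟨c, hc⟩ := h3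
    have hne : f₁ * f₂ ≠ 0 := mul_ne_zero h₁ h₂
    have : IsUnit a := by
      apply IsUnit.of_mul_eq_one (b * c)
      have hne' : M₁.det * M₂.det ≠ 0 := by
        intro h0; exact hne (by rw [ha, hb]; linear_combination a * b * h0)
      apply mul_left_cancel₀ hne'
      rw [ha, hb] at hc
      linear_combination -hc
    rw [ha]
    exact (associated_mul_unit_right _ _ this)
  have has₂ : Associated M₂.det f₂ := by
    refine Associated.of_mul_left hdetN has₁ ?_
    intro h
    exact h₁ (has₁.eq_zero_iff.1 h)
  have hpos : ∀ {m : ℕ} (Q : Matrix (Fin m) (Fin m) R) (f : R), ¬ IsUnit f → Associated Q.det f →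
      0 < m := by
    intro m Q f hfu hQ
    rcases Nat.eq_zero_or_pos m with rfl | h
    · rw [det_isEmpty] at hQ
      exact absurd (hQ.isUnit isUnit_one) hfu
    · exact h
  exact ⟨s.card, d - s.card, e, A, GeneralLinearGroup.mk'' _ hσ, M₁, M₂, hpos M₁ f₁ hu₁ has₁,
    hpos M₂ f₂ hu₂ has₂, has₁, has₂, hprod⟩

end MatrixLemmas

/-! ### Weierstrass division of formal power series -/

section FormalDivision
open MvPowerSeries Finsupp

variable {k : Type*} [Field k] {n : ℕ}

/-- The series in the variables `xᵢ`, `i ∈ T`. -/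
def seriesIn (k : Type*) [Field k] {n : ℕ} (T : Finset (Fin n)) :
    Subalgebra k (MvPowerSeries (Fin n) k) where
  carrier := {f | ∀ m, (∃ i ∉ T, m i ≠ 0) → coeff m f = 0}
  mul_mem' := by
    classical
    intro f g hf hg m ⟨i, hi, hm⟩
    rw [coeff_mul]
    refine Finset.sum_eq_zero fun p hp => ?_
    rw [Finset.HasAntidiagonal.mem_antidiagonal] at hp
    rw [← hp, Finsupp.add_apply] at hm
    by_cases h : p.1 i = 0
    · rw [hg p.2 ⟨i, hi, by omega⟩, mul_zero]
    · rw [hf p.1 ⟨i, hi, h⟩, zero_mul]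
  add_mem' := by
    intro f g hf hg m hm
    rw [map_add, hf m hm, hg m hm, add_zero]
  algebraMap_mem' := by
    classical
    rintro c m ⟨i, -, hm⟩
    rw [← c_eq_algebraMap, coeff_C, if_neg]
    rintro rfl
    exact hm rfl

theorem seriesIn_mono {S T : Finset (Fin n)} (h : S ⊆ T) : seriesIn k S ≤ seriesIn k T :=
  fun _ hf m ⟨i, hi, hm⟩ => hf m ⟨i, fun hS => hi (h hS), hm⟩

theorem mem_seriesIn_univ (f : MvPowerSeries (Fin n) k) : f ∈ seriesIn k Finset.univ :=
  fun _ ⟨i, hi, _⟩ => absurd (Finset.mem_univ i) hi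

theorem X_mem_seriesIn {T : Finset (Fin n)} {i : Fin n} (hi : i ∈ T) :
    (X i : MvPowerSeries (Fin n) k) ∈ seriesIn k T := by
  classical
  rintro m ⟨j, hj, hm⟩
  rw [coeff_X, if_neg]
  rintro rfl
  apply hm
  rw [Finsupp.single_apply, if_neg]
  rintro rfl
  exact hj hi

/-- The quotient of the division of `f` by `x_z ^ D`. -/
def divXPow (z : Fin n) (D : ℕ) (f : MvPowerSeries (Fin n) k) : MvPowerSeries (Fin n) k :=
  fun m => coeff (m + single z D) f

/-- The coefficient of `x_z ^ j` in `f`, a series in the other variables. -/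
def sliceCoeff (z : Fin n) (j : ℕ) (f : MvPowerSeries (Fin n) k) : MvPowerSeries (Fin n) k :=
  fun m => if m z = 0 then coeff (m + single z j) f else 0

theorem coeff_divXPow (z : Fin n) (D : ℕ) (f : MvPowerSeries (Fin n) k) (m : Fin n →₀ ℕ) :
    coeff m (divXPow z D f) = coeff (m + single z D) f := rfl

theorem coeff_sliceCoeff (z : Fin n) (j : ℕ) (f : MvPowerSeries (Fin n) k) (m : Fin n →₀ ℕ) :
    coeff m (sliceCoeff z j f) = if m z = 0 then coeff (m + single z j) f else 0 := rfl

theorem coeff_mul_X_pow (z : Fin n) (j : ℕ) (f : MvPowerSeries (Fin n) k) (m : Fin n →₀ ℕ) :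
    coeff m (f * X z ^ j) = if j ≤ m z then coeff (m - single z j) f else 0 := by
  classical
  rw [X_pow_eq, coeff_mul_monomial]
  simp

theorem coeff_sliceCoeff_mul_X_pow (z : Fin n) (j : ℕ) (f : MvPowerSeries (Fin n) k)
    (m : Fin n →₀ ℕ) :
    coeff m (sliceCoeff z j f * X z ^ j) = if m z = j then coeff m f else 0 := by
  rw [coeff_mul_X_pow, coeff_sliceCoeff]
  by_cases h : j ≤ m z
  · have e : m - single z j + single z j = m := tsub_add_cancel_of_le (by simpa using h)
    have e' : (m - single z j) z = m z - j := by simp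
    rw [if_pos h, e, e']
    by_cases h' : m z = j
    · rw [if_pos (by omega), if_pos h']
    · rw [if_neg (by omega), if_neg h']
  · rw [if_neg h, if_neg (by omega)]

theorem coeff_sum_sliceCoeff (z : Fin n) (D : ℕ) (f : MvPowerSeries (Fin n) k) (m : Fin n →₀ ℕ) :
    coeff m (∑ j ∈ Finset.range D, sliceCoeff z j f * X z ^ j) =
      if m z < D then coeff m f else 0 := by
  simp [map_sum, coeff_sliceCoeff_mul_X_pow]

theorem eq_sum_sliceCoeff_add (z : Fin n) (D : ℕ) (f : MvPowerSeries (Fin n) k) :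
    f = ∑ j ∈ Finset.range D, sliceCoeff z j f * X z ^ j + divXPow z D f * X z ^ D := by
  ext m
  rw [map_add, coeff_sum_sliceCoeff, coeff_mul_X_pow, coeff_divXPow]
  by_cases h : m z < D
  · rw [if_pos h, if_neg (by omega), add_zero]
  · rw [if_neg h, if_pos (by omega), zero_add, tsub_add_cancel_of_le]
    simpa using h

theorem divXPow_add (z : Fin n) (D : ℕ) (f g : MvPowerSeries (Fin n) k) :
    divXPow z D (f + g) = divXPow z D f + divXPow z D g := by
  ext m; simp [coeff_divXPow]

theorem divXPow_mul_X_pow (z : Fin n) (D : ℕ) (f : MvPowerSeries (Fin n) k) :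
    divXPow z D (f * X z ^ D) = f := by
  ext m
  rw [coeff_divXPow, coeff_mul_X_pow, if_pos (by simp), add_tsub_cancel_right]

theorem divXPow_mem_seriesIn {T : Finset (Fin n)} (z : Fin n) (D : ℕ)
    {f : MvPowerSeries (Fin n) k} (hf : f ∈ seriesIn k T) : divXPow z D f ∈ seriesIn k T := by
  rintro m ⟨i, hi, hm⟩
  exact hf _ ⟨i, hi, by rw [Finsupp.add_apply]; omega⟩

theorem sliceCoeff_mem_seriesIn {T : Finset (Fin n)} {z : Fin n} (j : ℕ)
    {f : MvPowerSeries (Fin n) k} (hf : f ∈ seriesIn k (insert z T)) :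
    sliceCoeff z j f ∈ seriesIn k T := by
  rintro m ⟨i, hi, hm⟩
  rw [coeff_sliceCoeff]
  split_ifs with h
  · refine hf _ ⟨i, ?_, by rw [Finsupp.add_apply]; omega⟩
    rw [Finset.mem_insert, not_or]
    exact ⟨fun e => hm (e ▸ h), hi⟩
  · rfl

theorem divXPow_eq_zero_of_sum {T : Finset (Fin n)} {z : Fin n} (hz : z ∉ T) {D : ℕ}
    {c : ℕ → MvPowerSeries (Fin n) k} (hc : ∀ j, c j ∈ seriesIn k T) :
    divXPow z D (∑ j ∈ Finset.range D, c j * X z ^ j) = 0 := by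
  ext m
  rw [coeff_divXPow, map_sum, map_zero]
  refine Finset.sum_eq_zero fun j hj => ?_
  rw [Finset.mem_range] at hj
  rw [coeff_mul_X_pow]
  split_ifs with h
  · refine hc j _ ⟨z, hz, ?_⟩
    simp
    omega
  · rfl

/-- The degree of a monomial in the variables `xᵢ`, `i ∈ U`. -/
def partialDegree (U : Finset (Fin n)) (m : Fin n →₀ ℕ) : ℕ := ∑ i ∈ U, m i

theorem partialDegree_add (U : Finset (Fin n)) (m l : Fin n →₀ ℕ) :
    partialDegree U (m + l) = partialDegree U m + partialDegree U l := by
  simp [partialDegree, Finset.sum_add_distrib]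

/-- All monomials of `p` involve a variable `xᵢ` with `i ∈ U`. -/
def VanishesOn (U : Finset (Fin n)) (p : MvPowerSeries (Fin n) k) : Prop :=
  ∀ m, partialDegree U m = 0 → coeff m p = 0

theorem VanishesOn.mul_left {U : Finset (Fin n)} {p : MvPowerSeries (Fin n) k}
    (hp : VanishesOn U p) (e : MvPowerSeries (Fin n) k) : VanishesOn U (e * p) := by
  classical
  intro m hm
  rw [coeff_mul]
  refine Finset.sum_eq_zero fun a ha => ?_
  rw [Finset.HasAntidiagonal.mem_antidiagonal] at ha
  rw [← ha, partialDegree_add] at hm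
  rw [hp _ (by omega), mul_zero]

/-- The operator `q ↦ p q / x_z ^ D` whose fixed point equation expresses Weierstrass division. -/
def divOp (z : Fin n) (D : ℕ) (p q : MvPowerSeries (Fin n) k) : MvPowerSeries (Fin n) k :=
  divXPow z D (p * q)

/-- The sum `∑ᵢ Kⁱ g` for the operator `K = divOp z D p`; the grading by the degree in the
variables from `U` makes the sum finite in each coefficient. -/
def divSol (U : Finset (Fin n)) (z : Fin n) (D : ℕ) (p g : MvPowerSeries (Fin n) k) :
    MvPowerSeries (Fin n) k :=
  fun m => ∑ i ∈ Finset.range (partialDegree U m + 1), coeff m ((divOp z D p)^[i] g)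

theorem coeff_divSol (U : Finset (Fin n)) (z : Fin n) (D : ℕ) (p g : MvPowerSeries (Fin n) k)
    (m : Fin n →₀ ℕ) : coeff m (divSol U z D p g) =
      ∑ i ∈ Finset.range (partialDegree U m + 1), coeff m ((divOp z D p)^[i] g) := rfl

/-- Each application of `divOp` raises the degree in the variables from `U`, so the iterates tend
to zero. -/
theorem coeff_divOp_iterate {U : Finset (Fin n)} {z : Fin n} {D : ℕ} {p : MvPowerSeries (Fin n) k}
    (hp : VanishesOn U p) (hz : partialDegree U (single z D) = 0) (g : MvPowerSeries (Fin n) k)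
    (i : ℕ) : ∀ m, partialDegree U m < i → coeff m ((divOp z D p)^[i] g) = 0 := by
  classical
  induction i with
  | zero => intro m hm; omega
  | succ i ih =>
    intro m hm
    rw [Function.iterate_succ_apply', divOp, coeff_divXPow, coeff_mul]
    refine Finset.sum_eq_zero fun a ha => ?_
    rw [Finset.HasAntidiagonal.mem_antidiagonal] at ha
    have h := congrArg (partialDegree U) ha
    rw [partialDegree_add, partialDegree_add, hz] at h
    by_cases h0 : partialDegree U a.1 = 0
    · rw [hp _ h0, zero_mul]
    · rw [ih _ (by omega), mul_zero]

/-- The series `divSol` solves the fixed point equation `q = g + p q / x_z ^ D`. -/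
theorem divSol_eq {U : Finset (Fin n)} {z : Fin n} {D : ℕ} {p : MvPowerSeries (Fin n) k}
    (hp : VanishesOn U p) (hz : partialDegree U (single z D) = 0) (g : MvPowerSeries (Fin n) k) :
    divSol U z D p g = g + divXPow z D (p * divSol U z D p g) := by
  classical
  ext m
  rw [map_add, coeff_divXPow, coeff_divSol, Finset.sum_range_succ', add_comm]
  congr 1
  have h1 : ∀ i, coeff m ((divOp z D p)^[i + 1] g) =
      ∑ a ∈ Finset.HasAntidiagonal.antidiagonal (m + single z D), coeff a.1 p * coeff a.2 ((divOp z D p)^[i] g) := by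
    intro i
    rw [Function.iterate_succ_apply', divOp, coeff_divXPow, coeff_mul]
  simp_rw [h1]
  rw [Finset.sum_comm, coeff_mul]
  refine Finset.sum_congr rfl fun a ha => ?_
  rw [Finset.HasAntidiagonal.mem_antidiagonal] at ha
  have h := congrArg (partialDegree U) ha
  rw [partialDegree_add, partialDegree_add, hz] at h
  by_cases h0 : partialDegree U a.1 = 0
  · simp [hp _ h0]
  · rw [← Finset.mul_sum, coeff_divSol]
    congr 1
    symm
    apply Finset.sum_subset
    · intro i hi
      rw [Finset.mem_range] at hi ⊢
      omega
    · intro i _ hi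
      rw [Finset.mem_range] at hi
      exact coeff_divOp_iterate hp hz g i _ (by omega)

/-- Uniqueness for the fixed point equation of `divSol_eq`. -/
theorem eq_zero_of_eq_divOp {U : Finset (Fin n)} {z : Fin n} {D : ℕ} {p q : MvPowerSeries (Fin n) k}
    (hp : VanishesOn U p) (hz : partialDegree U (single z D) = 0)
    (hq : q = divXPow z D (p * q)) : q = 0 := by
  have h : ∀ i, (divOp z D p)^[i] q = q := by
    intro i
    induction i with
    | zero => rfl
    | succ i ih => rw [Function.iterate_succ_apply', ih, divOp, ← hq]
  ext m
  rw [← h (partialDegree U m + 1), coeff_divOp_iterate hp hz q _ m (Nat.lt_succ_self _), map_zero]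

theorem divSol_mem_seriesIn {T U : Finset (Fin n)} {z : Fin n} {D : ℕ}
    {p g : MvPowerSeries (Fin n) k} (hp : p ∈ seriesIn k T) (hg : g ∈ seriesIn k T) :
    divSol U z D p g ∈ seriesIn k T := by
  have h : ∀ i, (divOp z D p)^[i] g ∈ seriesIn k T := by
    intro i
    induction i with
    | zero => exact hg
    | succ i ih =>
      rw [Function.iterate_succ_apply']
      exact divXPow_mem_seriesIn _ _ (mul_mem hp ih)
  intro m hm
  rw [coeff_divSol]
  exact Finset.sum_eq_zero fun i _ => h i m hm

theorem partialDegree_compl_single (z : Fin n) (D : ℕ) :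
    partialDegree (Finset.univ.erase z) (single z D) = 0 := by
  refine Finset.sum_eq_zero fun i hi => ?_
  rw [single_apply, if_neg]
  rintro rfl
  simp at hi

theorem eq_single_of_partialDegree_eq_zero {z : Fin n} {m : Fin n →₀ ℕ}
    (h : partialDegree (Finset.univ.erase z) m = 0) : m = single z (m z) := by
  rw [partialDegree, Finset.sum_eq_zero_iff] at h
  ext i
  by_cases hi : i = z
  · subst hi; simp
  · rw [h i (by simp [hi]), single_apply, if_neg (Ne.symm hi)]

/-- `f` is regular of order `D` in `x_z`: its restriction to the `x_z`-axis has order `D`. -/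
def IsRegularIn (z : Fin n) (D : ℕ) (f : MvPowerSeries (Fin n) k) : Prop :=
  (∀ j < D, coeff (single z j) f = 0) ∧ coeff (single z D) f ≠ 0

theorem IsRegularIn.constantCoeff_divXPow {z : Fin n} {D : ℕ} {f : MvPowerSeries (Fin n) k}
    (hf : IsRegularIn z D f) : constantCoeff (divXPow z D f) ≠ 0 := by
  rw [← coeff_zero_eq_constantCoeff_apply, coeff_divXPow, zero_add]
  exact hf.2

theorem IsRegularIn.vanishesOn {z : Fin n} {D : ℕ} {f : MvPowerSeries (Fin n) k}
    (hf : IsRegularIn z D f) : VanishesOn (Finset.univ.erase z)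
      (∑ j ∈ Finset.range D, sliceCoeff z j f * X z ^ j) := by
  intro m hm
  rw [coeff_sum_sliceCoeff]
  split_ifs with h
  · rw [eq_single_of_partialDegree_eq_zero hm]
    exact hf.1 _ h
  · rfl

/-- Uniqueness in the Weierstrass division theorem. -/
theorem IsRegularIn.eq_zero_of_mul_eq {T : Finset (Fin n)} {z : Fin n} (hz : z ∉ T) {D : ℕ}
    {f q : MvPowerSeries (Fin n) k} (hf : IsRegularIn z D f) {c : ℕ → MvPowerSeries (Fin n) k}
    (hc : ∀ j, c j ∈ seriesIn k T) (h : q * f = ∑ j ∈ Finset.range D, c j * X z ^ j) : q = 0 := by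
  set u := divXPow z D f
  have hu : u * u⁻¹ = 1 := MvPowerSeries.mul_inv_cancel u hf.constantCoeff_divXPow
  set p := -u⁻¹ * ∑ j ∈ Finset.range D, sliceCoeff z j f * X z ^ j
  have hfp : u⁻¹ * f = X z ^ D - p := by
    have h1 := eq_sum_sliceCoeff_add z D f
    simp only [p]
    calc u⁻¹ * f = u⁻¹ * (∑ j ∈ Finset.range D, sliceCoeff z j f * X z ^ j + u * X z ^ D) := by
          rw [← h1]
      _ = _ := by linear_combination X z ^ D * hu
  have h2 : (q * u) * X z ^ D = q * f + p * (q * u) := by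
    have : q * f = (q * u) * (u⁻¹ * f) := by linear_combination -q * f * hu
    rw [this, hfp]
    ring
  have h3 := congrArg (divXPow z D) h2
  rw [divXPow_mul_X_pow, divXPow_add, h, divXPow_eq_zero_of_sum hz hc, zero_add] at h3
  have h4 := eq_zero_of_eq_divOp (hf.vanishesOn.mul_left (-u⁻¹)) (partialDegree_compl_single z D) h3
  have : q = q * u * u⁻¹ := by rw [mul_assoc, hu, mul_one]
  rw [this, h4, zero_mul]

end FormalDivision

/-! ### Lowest order forms -/

section LeadingForm
open MvPowerSeries

variable {k : Type*} [Field k] {n : ℕ}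

theorem coeff_leadingForm (f : MvPowerSeries (Fin n) k) (m : Fin n →₀ ℕ) :
    (leadingForm f).coeff m = if m.degree = f.order.toNat then coeff m f else 0 := by
  rw [leadingForm, coeff_truncTotal_eq_ite, coeff_homogeneousComponent]
  split_ifs <;> first | rfl | omega

theorem isHomogeneous_leadingForm (f : MvPowerSeries (Fin n) k) :
    (leadingForm f).IsHomogeneous f.order.toNat := by
  intro m hm
  rw [coeff_leadingForm] at hm
  change Finsupp.weight (fun _ => 1) m = _
  rw [← Finsupp.degree_eq_weight_one]
  by_contra h
  rw [if_neg h] at hm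
  exact hm rfl

theorem leadingForm_ne_zero {f : MvPowerSeries (Fin n) k} (hf : f ≠ 0) : leadingForm f ≠ 0 := by
  obtain ⟨m, hm, hm'⟩ := exists_coeff_ne_zero_and_order (ne_zero_iff_order_finite.1 hf)
  rw [MvPolynomial.ne_zero_iff]
  refine ⟨m, ?_⟩
  rw [coeff_leadingForm, if_pos]
  · exact hm
  · rw [← hm']; simp

theorem eval_smul_of_isHomogeneous {F : MvPolynomial (Fin n) k} {a : ℕ} (hF : F.IsHomogeneous a)
    (r : k) (v : Fin n → k) :
    MvPolynomial.eval (r • v) F = r ^ a * MvPolynomial.eval v F := by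
  rw [MvPolynomial.eval_eq', MvPolynomial.eval_eq', Finset.mul_sum]
  refine Finset.sum_congr rfl fun m hm => ?_
  have h1 : Finsupp.weight (fun _ => 1) m = a := hF (MvPolynomial.mem_support_iff.1 hm)
  rw [← Finsupp.degree_eq_weight_one, Finsupp.degree_eq_sum] at h1
  simp only [Pi.smul_apply, smul_eq_mul, mul_pow, Finset.prod_mul_distrib, Finset.prod_pow_eq_pow_sum]
  rw [h1]
  ring

/-- A nonzero form over an infinite field does not vanish at some point of a given affine chart. -/
theorem exists_eval_ne_zero_of_isHomogeneous [Infinite k] {F : MvPolynomial (Fin n) k} {a : ℕ}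
    (hF : F.IsHomogeneous a) (h0 : F ≠ 0) (z : Fin n) :
    ∃ v : Fin n → k, v z = 1 ∧ MvPolynomial.eval v F ≠ 0 := by
  have h1 : MvPolynomial.X z * F ≠ 0 := mul_ne_zero (MvPolynomial.X_ne_zero z) h0
  obtain ⟨v, hv⟩ : ∃ v, MvPolynomial.eval v (MvPolynomial.X z * F) ≠ 0 := by
    by_contra! h
    exact h1 (MvPolynomial.funext fun v => by rw [h v, map_zero])
  rw [map_mul, MvPolynomial.eval_X] at hv
  refine ⟨(v z)⁻¹ • v, by simp [left_ne_zero_of_mul hv], ?_⟩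
  rw [eval_smul_of_isHomogeneous hF]
  exact mul_ne_zero (pow_ne_zero _ (inv_ne_zero (left_ne_zero_of_mul hv))) (right_ne_zero_of_mul hv)

end LeadingForm

/-! ### Linear changes of coordinates -/

section Shear
open MvPowerSeries Finsupp

variable {k : Type*} [Field k] {n : ℕ}

theorem hasSubst_shear (z : Fin n) (c : Fin n → k) :
    HasSubst (fun i => (X i + C (c i) * X z : MvPowerSeries (Fin n) k)) :=
  hasSubst_of_constantCoeff_zero fun i => by simp

/-- The substitution `xᵢ ↦ xᵢ + cᵢ x_z`. -/
def shear (z : Fin n) (c : Fin n → k) :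
    MvPowerSeries (Fin n) k →ₐ[k] MvPowerSeries (Fin n) k :=
  substAlgHom (hasSubst_shear z c)

theorem shear_X (z : Fin n) (c : Fin n → k) (i : Fin n) :
    shear z c (X i) = X i + C (c i) * X z :=
  substAlgHom_X (hasSubst_shear z c) i

theorem shear_neg_shear (z : Fin n) {c : Fin n → k} (hc : c z = 0) (f : MvPowerSeries (Fin n) k) :
    shear z (-c) (shear z c f) = f := by
  rw [shear, shear, substAlgHom_apply, substAlgHom_apply,
    subst_comp_subst_apply (hasSubst_shear z c) (hasSubst_shear z (-c))]
  have : (fun s => subst (fun i => (X i + C ((-c) i) * X z : MvPowerSeries (Fin n) k))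
      (X s + C (c s) * X z)) = X := by
    funext s
    rw [← substAlgHom_apply (hasSubst_shear z (-c))]
    change shear z (-c) _ = _
    rw [map_add, map_mul, shear_X, shear_X, c_eq_algebraMap, AlgHom.commutes, ← c_eq_algebraMap]
    simp [hc]
  rw [this, subst_self]
  rfl

/-- The restriction of a series to the `x_z`-axis. -/
def axis (z : Fin n) : MvPowerSeries (Fin n) k →+* PowerSeries k where
  toFun f := PowerSeries.mk fun j => coeff (single z j) f
  map_one' := by
    classical
    ext j
    rw [PowerSeries.coeff_mk, coeff_one, PowerSeries.coeff_one]
    simp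
  map_zero' := by ext; simp
  map_add' f g := by ext; simp
  map_mul' f g := by
    classical
    ext j
    rw [PowerSeries.coeff_mk, coeff_mul, PowerSeries.coeff_mul, Finsupp.antidiagonal_single,
      Finset.sum_map]
    simp

theorem coeff_axis (z : Fin n) (f : MvPowerSeries (Fin n) k) (j : ℕ) :
    PowerSeries.coeff j (axis z f) = coeff (single z j) f := by
  simp [axis]

/-- On the axis of `x_z`, the shear with parameter `c` sends `x_i` to `v i` times the parameter,
where `v` is `c` with the entry at `z` increased by one. Hence the values of forms at `v` decide
whether a sheared series is regular in `x_z`. -/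
theorem axis_shear_X (z : Fin n) {c v : Fin n → k} (hv : ∀ i, v i = c i + if i = z then 1 else 0)
    (i : Fin n) : axis z (X i + C (c i) * X z : MvPowerSeries (Fin n) k) =
      PowerSeries.C (v i) * PowerSeries.X := by
  classical
  ext j
  rw [coeff_axis, map_add, coeff_C_mul, PowerSeries.coeff_C_mul, coeff_X, coeff_X,
    PowerSeries.coeff_X, hv]
  simp only [Finsupp.single_eq_single_iff]
  by_cases hj : j = 1
  · subst hj
    by_cases hi : i = z
    · subst hi; simp [add_comm]
    · simp [hi, Ne.symm hi]
  · simp [hj]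

theorem coeff_single_prod (z : Fin n) {c v : Fin n → k}
    (hv : ∀ i, v i = c i + if i = z then 1 else 0) (m : Fin n →₀ ℕ) (j : ℕ) :
    coeff (single z j) (m.prod fun s e => (X s + C (c s) * X z : MvPowerSeries (Fin n) k) ^ e) =
      if m.degree = j then ∏ i, v i ^ m i else 0 := by
  rw [← coeff_axis, Finsupp.prod_fintype _ _ (by simp), map_prod]
  simp_rw [map_pow, axis_shear_X z hv, mul_pow, Finset.prod_mul_distrib, ← map_pow]
  rw [← map_prod, Finset.prod_pow_eq_pow_sum, PowerSeries.coeff_C_mul, PowerSeries.coeff_X_pow,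
    Finsupp.degree_eq_sum]
  simp [eq_comm]

theorem coeff_single_shear (z : Fin n) {c v : Fin n → k}
    (hv : ∀ i, v i = c i + if i = z then 1 else 0) (f : MvPowerSeries (Fin n) k) (j : ℕ) :
    coeff (single z j) (shear z c f) =
      ∑ᶠ m : Fin n →₀ ℕ, coeff m f * if m.degree = j then ∏ i, v i ^ m i else 0 := by
  rw [shear, substAlgHom_apply, coeff_subst (hasSubst_shear z c)]
  simp_rw [coeff_single_prod z hv, smul_eq_mul]

/-- After a suitable shear, a nonzero series is regular in a given variable. -/
theorem exists_isRegularIn_shear [Infinite k] (z : Fin n) {f : MvPowerSeries (Fin n) k}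
    (hf : f ≠ 0) : ∃ c : Fin n → k, c z = 0 ∧ ∃ D, IsRegularIn z D (shear z c f) := by
  obtain ⟨v, hvz, hv⟩ := exists_eval_ne_zero_of_isHomogeneous (isHomogeneous_leadingForm f)
    (leadingForm_ne_zero hf) z
  have hc : ∀ i, v i = (v i - if i = z then 1 else 0) + if i = z then 1 else 0 := by
    intro i; ring
  refine ⟨fun i => v i - if i = z then 1 else 0, by simp [hvz], f.order.toNat, ?_, ?_⟩
  · intro j hj
    rw [coeff_single_shear z hc]
    refine finsum_eq_zero_of_forall_eq_zero fun m => ?_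
    split_ifs with h
    · rw [coeff_of_lt_order, zero_mul]
      rw [← ne_zero_iff_order_finite.1 hf, h]
      exact_mod_cast hj
    · rw [mul_zero]
  · rw [coeff_single_shear z hc]
    convert hv using 1
    rw [MvPolynomial.eval_eq', finsum_eq_sum_of_support_subset]
    · refine Finset.sum_congr rfl fun m hm => ?_
      rw [coeff_leadingForm]
      split_ifs <;> simp
    · intro m hm
      rw [Finset.mem_coe, MvPolynomial.mem_support_iff, coeff_leadingForm]
      intro h
      apply hm
      split_ifs at h ⊢ with h'
      · simp [h]
      · simp [h']

theorem shear_mem_seriesIn {T : Finset (Fin n)} {z : Fin n} (hz : z ∈ T) (c : Fin n → k)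
    {f : MvPowerSeries (Fin n) k} (hf : f ∈ seriesIn k T) : shear z c f ∈ seriesIn k T := by
  intro m hm
  rw [shear, substAlgHom_apply, coeff_subst (hasSubst_shear z c)]
  refine finsum_eq_zero_of_forall_eq_zero fun l => ?_
  by_cases h : ∃ i ∉ T, l i ≠ 0
  · rw [hf l h, zero_smul]
  · push Not at h
    have : (l.prod fun s e => (X s + C (c s) * X z : MvPowerSeries (Fin n) k) ^ e) ∈
        seriesIn k T := by
      refine prod_mem fun i hi => pow_mem (add_mem ?_ (mul_mem ?_ (X_mem_seriesIn hz))) _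
      · refine X_mem_seriesIn ?_
        by_contra hiT
        exact (Finsupp.mem_support_iff.1 hi) (h i hiT)
      · exact (seriesIn k T).algebraMap_mem (c i)
    rw [this m hm, smul_zero]

end Shear

/-! ### Rings of power series closed under Weierstrass division -/

section WeierstrassSystem
open MvPowerSeries Finsupp

variable {k : Type*} [Field k] {n : ℕ}

/-- A ring of power series that is closed under the operations needed for Weierstrass division:
for example, the ring of all formal power series, or that of the convergent ones. -/
structure IsWeierstrass (O : Subalgebra k (MvPowerSeries (Fin n) k)) : Prop where
  X_mem : ∀ i, X i ∈ O
  divXPow_mem : ∀ {f} z D, f ∈ O → divXPow z D f ∈ O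
  sliceCoeff_mem : ∀ {f} z j, f ∈ O → sliceCoeff z j f ∈ O
  divSol_mem : ∀ {U z D p g}, VanishesOn U p → partialDegree U (single z D) = 0 → p ∈ O → g ∈ O →
    divSol U z D p g ∈ O
  shear_mem : ∀ {f} z c, f ∈ O → shear z c f ∈ O

theorem isWeierstrass_top : IsWeierstrass (⊤ : Subalgebra k (MvPowerSeries (Fin n) k)) where
  X_mem _ := trivial
  divXPow_mem _ _ _ := trivial
  sliceCoeff_mem _ _ _ := trivial
  divSol_mem _ _ _ _ := trivial
  shear_mem _ _ _ := trivial

variable {O : Subalgebra k (MvPowerSeries (Fin n) k)}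

/-- A geometric series gives the inverse; it is the case `D = 0` of `divSol`. -/
theorem IsWeierstrass.inv_mem (hO : IsWeierstrass O) (z : Fin n) {T : Finset (Fin n)}
    {f : MvPowerSeries (Fin n) k} (hf : f ∈ O ⊓ seriesIn k T) (h0 : constantCoeff f ≠ 0) :
    f⁻¹ ∈ O ⊓ seriesIn k T := by
  classical
  set a := constantCoeff f
  set p : MvPowerSeries (Fin n) k := 1 - algebraMap k _ a⁻¹ * f
  have hpm : p ∈ O ⊓ seriesIn k T :=
    sub_mem (one_mem _) (mul_mem (Subalgebra.algebraMap_mem _ _) hf)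
  have hp : VanishesOn Finset.univ p := by
    intro m hm
    have hm0 : m = 0 := by
      rw [partialDegree, Finset.sum_eq_zero_iff] at hm
      ext i
      exact hm i (Finset.mem_univ i)
    subst hm0
    rw [coeff_zero_eq_constantCoeff_apply]
    simp only [p, ← c_eq_algebraMap, map_sub, map_mul, map_one, constantCoeff_C]
    rw [inv_mul_cancel₀ h0, sub_self]
  have hz : partialDegree Finset.univ (single z 0) = 0 := by simp [partialDegree]
  have h1 := divSol_eq hp hz 1
  have hq : divSol Finset.univ z 0 p 1 ∈ O ⊓ seriesIn k T :=
    ⟨hO.divSol_mem hp hz hpm.1 (one_mem O), divSol_mem_seriesIn hpm.2 (one_mem _)⟩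
  set q := divSol Finset.univ z 0 p 1
  have h2 : divXPow z 0 (p * q) = p * q := by
    ext m; rw [coeff_divXPow]; simp
  rw [h2] at h1
  have h3 : algebraMap k _ a⁻¹ * q * f = 1 := by
    simp only [p] at h1
    linear_combination h1
  have : f⁻¹ = algebraMap k _ a⁻¹ * q := ((MvPowerSeries.eq_inv_iff_mul_eq_one h0).2 h3).symm
  rw [this]
  exact mul_mem (Subalgebra.algebraMap_mem _ _) hq

/-- The Weierstrass division theorem. -/
theorem IsWeierstrass.exists_division (hO : IsWeierstrass O) {T : Finset (Fin n)} {z : Fin n}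
    {D : ℕ} {f g : MvPowerSeries (Fin n) k} (hfD : IsRegularIn z D f)
    (hf : f ∈ O ⊓ seriesIn k (insert z T)) (hg : g ∈ O ⊓ seriesIn k (insert z T)) :
    ∃ (q : MvPowerSeries (Fin n) k) (c : ℕ → MvPowerSeries (Fin n) k),
      q ∈ O ⊓ seriesIn k (insert z T) ∧ (∀ j, c j ∈ O ⊓ seriesIn k T) ∧
      g = q * f + ∑ j ∈ Finset.range D, c j * X z ^ j := by
  have hX : X z ∈ O ⊓ seriesIn k (insert z T) :=
    ⟨hO.X_mem z, X_mem_seriesIn (Finset.mem_insert_self z T)⟩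
  have hslice : ∀ {h} j, h ∈ O ⊓ seriesIn k (insert z T) → sliceCoeff z j h ∈ O ⊓ seriesIn k T :=
    fun j hh => ⟨hO.sliceCoeff_mem z j hh.1, sliceCoeff_mem_seriesIn j hh.2⟩
  have hTm : O ⊓ seriesIn k T ≤ O ⊓ seriesIn k (insert z T) :=
    inf_le_inf_left O (seriesIn_mono (Finset.subset_insert z T))
  have hlow : ∀ {h}, h ∈ O ⊓ seriesIn k (insert z T) →
      ∑ j ∈ Finset.range D, sliceCoeff z j h * X z ^ j ∈ O ⊓ seriesIn k (insert z T) :=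
    fun hh => sum_mem fun j _ => mul_mem (hTm (hslice j hh)) (pow_mem hX j)
  have hdiv : ∀ {h}, h ∈ O ⊓ seriesIn k (insert z T) →
      divXPow z D h ∈ O ⊓ seriesIn k (insert z T) :=
    fun hh => ⟨hO.divXPow_mem z D hh.1, divXPow_mem_seriesIn z D hh.2⟩
  set u := divXPow z D f
  have hu : u * u⁻¹ = 1 := MvPowerSeries.mul_inv_cancel u hfD.constantCoeff_divXPow
  have hum : u⁻¹ ∈ O ⊓ seriesIn k (insert z T) := hO.inv_mem z (hdiv hf) hfD.constantCoeff_divXPow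
  set p := -u⁻¹ * ∑ j ∈ Finset.range D, sliceCoeff z j f * X z ^ j
  have hpm : p ∈ O ⊓ seriesIn k (insert z T) := mul_mem (neg_mem hum) (hlow hf)
  have hp : VanishesOn (Finset.univ.erase z) p := hfD.vanishesOn.mul_left _
  have hz := partialDegree_compl_single z D
  set q := divSol (Finset.univ.erase z) z D p (divXPow z D g)
  have hq : q ∈ O ⊓ seriesIn k (insert z T) :=
    ⟨hO.divSol_mem hp hz hpm.1 (hdiv hg).1, divSol_mem_seriesIn hpm.2 (hdiv hg).2⟩
  have hq1 : q = divXPow z D (g + p * q) := by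
    rw [divXPow_add]
    exact divSol_eq hp hz _
  refine ⟨q * u⁻¹, fun j => sliceCoeff z j (g + p * q), mul_mem hq hum,
    fun j => hslice j (add_mem hg (mul_mem hpm hq)), ?_⟩
  have h1 := eq_sum_sliceCoeff_add z D (g + p * q)
  rw [← hq1] at h1
  have h2 : u⁻¹ * f = X z ^ D - p := by
    have h3 := eq_sum_sliceCoeff_add z D f
    simp only [p]
    calc u⁻¹ * f = u⁻¹ * (∑ j ∈ Finset.range D, sliceCoeff z j f * X z ^ j + u * X z ^ D) := by
          rw [← h3]
      _ = _ := by linear_combination X z ^ D * hu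
  linear_combination h1 - q * h2

end WeierstrassSystem

/-! ### Primality and division by monic polynomials -/

section PrimeOfDivision
open Polynomial

/-- If every element of `R` has a unique remainder of degree less than `deg W` modulo a monic
polynomial `W(z)` over a factorial ring `A`, then an irreducible element associated to `W(z)` is
prime, provided that no proper monic factor of `W` becomes a unit. -/
theorem prime_of_irreducible_of_division {A R : Type*} [CommRing A] [IsDomain A]
    [UniqueFactorizationMonoid A] [CommRing R] [IsDomain R] (ι : A →+* R) (z f : R) (W : A[X])
    (hW : W.Monic) (hfW : Associated (eval₂ ι z W) f)
    (hdiv : ∀ g, ∃ (q : R) (p : A[X]), p.degree < W.degree ∧ g = q * f + eval₂ ι z p)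
    (huniq : ∀ p : A[X], p.degree < W.degree → f ∣ eval₂ ι z p → p = 0)
    (hunit : ∀ U V : A[X], U.Monic → V.Monic → U * V = W → IsUnit (eval₂ ι z U) →
      U.natDegree = 0)
    (hf : Irreducible f) : Prime f := by
  have hWirr : Irreducible W := by
    rw [hW.irreducible_iff_natDegree]
    constructor
    · rintro rfl
      rw [eval₂_one] at hfW
      exact hf.not_isUnit (hfW.isUnit isUnit_one)
    · intro U V hU hV hUV
      have h1 : Irreducible (eval₂ ι z U * eval₂ ι z V) := by
        rw [← eval₂_mul, hUV]
        exact (hfW.irreducible_iff).2 hf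
      rcases h1.isUnit_or_isUnit rfl with h | h
      · exact Or.inl (hunit U V hU hV hUV h)
      · exact Or.inr (hunit V U hV hU (by rw [mul_comm, hUV]) h)
  have hWp : Prime W := hWirr.prime
  refine ⟨hf.ne_zero, hf.not_isUnit, fun a b hab => ?_⟩
  obtain ⟨q₁, p₁, -, h₁⟩ := hdiv a
  obtain ⟨q₂, p₂, -, h₂⟩ := hdiv b
  have h3 : f ∣ eval₂ ι z (p₁ * p₂) := by
    rw [eval₂_mul]
    obtain ⟨e, he⟩ := hab
    rw [h₁, h₂] at he
    exact ⟨e - q₁ * q₂ * f - q₁ * eval₂ ι z p₂ - q₂ * eval₂ ι z p₁, by linear_combination he⟩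
  have h4 : W ∣ p₁ * p₂ := by
    rw [← modByMonic_eq_zero_iff_dvd hW]
    refine huniq _ (degree_modByMonic_lt _ hW) ?_
    have h5 := modByMonic_add_div (p₁ * p₂) W
    have h6 : eval₂ ι z (p₁ * p₂ %ₘ W) =
        eval₂ ι z (p₁ * p₂) - eval₂ ι z W * eval₂ ι z (p₁ * p₂ /ₘ W) := by
      have h5' := congrArg (eval₂ ι z) h5
      rw [eval₂_add, eval₂_mul] at h5'
      linear_combination h5'
    rw [h6]
    exact dvd_sub h3 (hfW.symm.dvd.mul_right _)
  have h7 : ∀ p : A[X], W ∣ p → f ∣ eval₂ ι z p := by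
    rintro p ⟨e, rfl⟩
    rw [eval₂_mul]
    exact hfW.symm.dvd.mul_right _
  rcases hWp.dvd_or_dvd h4 with h | h
  · left; rw [h₁]; exact dvd_add (dvd_mul_left _ _) (h7 _ h)
  · right; rw [h₂]; exact dvd_add (dvd_mul_left _ _) (h7 _ h)

end PrimeOfDivision

/-! ### Weierstrass polynomials -/

section WeierstrassRings
open MvPowerSeries Finsupp

variable {k : Type*} [Field k] {n : ℕ} {O : Subalgebra k (MvPowerSeries (Fin n) k)}

/-- The elements of `O` that are series in the variables `xᵢ`, `i ∈ T`. -/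
abbrev partialRing (O : Subalgebra k (MvPowerSeries (Fin n) k)) (T : Finset (Fin n)) :
    Subalgebra k (MvPowerSeries (Fin n) k) := O ⊓ seriesIn k T

theorem partialRing_mono {S T : Finset (Fin n)} (h : S ⊆ T) :
    partialRing O S ≤ partialRing O T := inf_le_inf_left O (seriesIn_mono h)

/-- The inclusion of a ring of series in fewer variables. -/
abbrev inclInsert (O : Subalgebra k (MvPowerSeries (Fin n) k)) (T : Finset (Fin n)) (z : Fin n) :
    partialRing O T →+* partialRing O (insert z T) :=
  (Subalgebra.inclusion (partialRing_mono (Finset.subset_insert z T))).toRingHom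

/-- The variable `x_z` as an element of a ring of series. -/
def IsWeierstrass.var (hO : IsWeierstrass O) {T : Finset (Fin n)} {z : Fin n} (hz : z ∈ T) :
    partialRing O T := ⟨X z, hO.X_mem z, X_mem_seriesIn hz⟩

theorem IsWeierstrass.isUnit_iff (hO : IsWeierstrass O) (z : Fin n) {T : Finset (Fin n)}
    (f : partialRing O T) :
    IsUnit f ↔ constantCoeff (f : MvPowerSeries (Fin n) k) ≠ 0 := by
  constructor
  · intro h
    exact (isUnit_constantCoeff _ (h.map (partialRing O T).val)).ne_zero
  · intro h
    refine IsUnit.of_mul_eq_one ⟨_, hO.inv_mem z f.2 h⟩ ?_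
    ext1
    exact MvPowerSeries.mul_inv_cancel _ h

/-- Polynomials in `x_z` over the series in the variables of `T` are determined by their values as
series. -/
theorem eq_zero_of_sum_mul_X_pow {T : Finset (Fin n)} {z : Fin n} (hz : z ∉ T) {D : ℕ}
    {c : ℕ → MvPowerSeries (Fin n) k} (hc : ∀ j, c j ∈ seriesIn k T)
    (h : ∑ j ∈ Finset.range D, c j * X z ^ j = 0) {j : ℕ} (hj : j < D) : c j = 0 := by
  ext m
  by_cases hm : m z = 0
  · have h1 := congrArg (coeff (m + single z j)) h
    rw [map_sum, map_zero, Finset.sum_eq_single j] at h1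
    · rw [coeff_mul_X_pow, if_pos (by simp), add_tsub_cancel_right] at h1
      rw [h1, map_zero]
    · intro i _ hi
      rw [coeff_mul_X_pow]
      split_ifs with h2
      · refine hc i _ ⟨z, hz, ?_⟩
        simp only [Finsupp.coe_tsub, Finsupp.coe_add, Pi.sub_apply, Pi.add_apply,
          Finsupp.single_eq_same] at h2 ⊢
        omega
      · rfl
    · intro h2
      exact absurd (Finset.mem_range.2 hj) h2
  · rw [hc j m ⟨z, hz, hm⟩, map_zero]

section Division

variable {T : Finset (Fin n)} {z : Fin n} {D : ℕ} (hO : IsWeierstrass O)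
include hO

theorem IsWeierstrass.coe_eval₂ (p : Polynomial (partialRing O T)) (hp : p.degree < D) :
    ((Polynomial.eval₂ (inclInsert O T z) (hO.var (Finset.mem_insert_self z T)) p :
      partialRing O (insert z T)) : MvPowerSeries (Fin n) k) =
      ∑ j ∈ Finset.range D, (p.coeff j : MvPowerSeries (Fin n) k) * X z ^ j := by
  by_cases hp0 : p = 0
  · simp [hp0]
  rw [Polynomial.eval₂_eq_sum_range' _ (n := D)
    ((Polynomial.natDegree_lt_iff_degree_lt hp0).2 hp)]
  rw [AddSubmonoidClass.coe_finsetSum]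
  rfl

/-- Weierstrass division with the remainder written as an element of a polynomial ring. -/
theorem IsWeierstrass.exists_division_polynomial {f : partialRing O (insert z T)}
    (hfD : IsRegularIn z D (f : MvPowerSeries (Fin n) k)) (g : partialRing O (insert z T)) :
    ∃ (q : partialRing O (insert z T)) (p : Polynomial (partialRing O T)), p.degree < D ∧
      g = q * f + p.eval₂ (inclInsert O T z) (hO.var (Finset.mem_insert_self z T)) := by
  obtain ⟨q, c, hq, hc, h⟩ := hO.exists_division hfD f.2 g.2
  let p : Polynomial (partialRing O T) :=
    ∑ j : Fin D, Polynomial.C (⟨c j, hc j⟩ : partialRing O T) * Polynomial.X ^ (j : ℕ)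
  have hp : p.degree < D := Polynomial.degree_sum_fin_lt fun j : Fin D =>
    (⟨c j, hc j⟩ : partialRing O T)
  refine ⟨⟨q, hq⟩, p, hp, Subtype.ext ?_⟩
  rw [AddMemClass.coe_add, hO.coe_eval₂ p hp, h]
  congr 1
  refine Finset.sum_congr rfl fun j hj => ?_
  rw [Finset.mem_range] at hj
  congr 1
  have : p.coeff j = ⟨c j, hc j⟩ := by
    simp only [p, Polynomial.finsetSum_coeff, Polynomial.coeff_C_mul, Polynomial.coeff_X_pow]
    rw [Finset.sum_eq_single ⟨j, hj⟩]
    · simp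
    · intro i _ hi
      rw [if_neg, mul_zero]
      rintro rfl
      exact hi rfl
    · simp
  rw [this]

/-- Uniqueness of the remainder in Weierstrass division. -/
theorem IsWeierstrass.eq_zero_of_dvd_eval₂ (hz : z ∉ T) {f : partialRing O (insert z T)}
    (hfD : IsRegularIn z D (f : MvPowerSeries (Fin n) k)) {p : Polynomial (partialRing O T)}
    (hp : p.degree < D)
    (h : f ∣ p.eval₂ (inclInsert O T z) (hO.var (Finset.mem_insert_self z T))) : p = 0 := by
  obtain ⟨q, hq⟩ := h
  have h1 := congrArg (Subtype.val) hq
  rw [hO.coe_eval₂ p hp, mul_comm] at h1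
  have hc : ∀ j, (p.coeff j : MvPowerSeries (Fin n) k) ∈ seriesIn k T := fun j => (p.coeff j).2.2
  have h2 : (q : MvPowerSeries (Fin n) k) = 0 := hfD.eq_zero_of_mul_eq hz hc h1.symm
  rw [MulMemClass.coe_mul, h2, zero_mul] at h1
  ext1 j
  by_cases hj : j < D
  · rw [Polynomial.coeff_zero]
    exact Subtype.ext (eq_zero_of_sum_mul_X_pow hz hc h1 hj)
  · rw [Polynomial.coeff_eq_zero_of_degree_lt (hp.trans_le (by exact_mod_cast not_lt.1 hj)),
      Polynomial.coeff_zero]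

omit hO in
theorem axis_of_mem_seriesIn {g : MvPowerSeries (Fin n) k} (hz : z ∉ T) (hg : g ∈ seriesIn k T) :
    axis z g = PowerSeries.C (constantCoeff g) := by
  ext j
  rw [coeff_axis, PowerSeries.coeff_C]
  split_ifs with h
  · rw [h, Finsupp.single_zero, coeff_zero_eq_constantCoeff_apply]
  · exact hg _ ⟨z, hz, by simpa using h⟩

/-- The Weierstrass preparation theorem. -/
theorem IsWeierstrass.exists_preparation (hz : z ∉ T) {f : partialRing O (insert z T)}
    (hfD : IsRegularIn z D (f : MvPowerSeries (Fin n) k)) :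
    ∃ W : Polynomial (partialRing O T), W.Monic ∧ W.degree = D ∧
      (∀ j < D, constantCoeff (W.coeff j : MvPowerSeries (Fin n) k) = 0) ∧
      Associated (W.eval₂ (inclInsert O T z) (hO.var (Finset.mem_insert_self z T))) f := by
  obtain ⟨q, p, hp, h⟩ := hO.exists_division_polynomial hfD
    (hO.var (Finset.mem_insert_self z T) ^ D)
  have h1 := congrArg (fun g : partialRing O (insert z T) => axis z (g : MvPowerSeries (Fin n) k)) h
  have hX : axis z (X z : MvPowerSeries (Fin n) k) = PowerSeries.X := by
    classical
    ext j
    rw [coeff_axis, coeff_X, PowerSeries.coeff_X]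
    simp [Finsupp.single_eq_single_iff]
  simp only [MulMemClass.coe_mul, AddMemClass.coe_add, SubmonoidClass.coe_pow, map_add, map_mul,
    hO.coe_eval₂ p hp, map_sum, map_pow] at h1
  change axis z (X z : MvPowerSeries (Fin n) k) ^ D = _ at h1
  simp only [hX, axis_of_mem_seriesIn hz (p.coeff _).2.2] at h1
  have hfX : PowerSeries.X ^ D ∣ axis z (f : MvPowerSeries (Fin n) k) := by
    rw [PowerSeries.X_pow_dvd_iff]
    intro m hm
    rw [coeff_axis]
    exact hfD.1 m hm
  have hp0 : ∀ j < D, constantCoeff (p.coeff j : MvPowerSeries (Fin n) k) = 0 := by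
    intro j hj
    have h2 : PowerSeries.X ^ D ∣ ∑ j ∈ Finset.range D,
        PowerSeries.C (constantCoeff (p.coeff j : MvPowerSeries (Fin n) k)) *
          (PowerSeries.X : PowerSeries k) ^ j := by
      rw [← dvd_add_right (hfX.mul_left (axis z (q : MvPowerSeries (Fin n) k))), ← h1]
    have h3 := (PowerSeries.X_pow_dvd_iff.1 h2) j hj
    rw [map_sum, Finset.sum_eq_single j] at h3
    · simpa using h3
    · intro i _ hi
      rw [PowerSeries.coeff_C_mul, PowerSeries.coeff_X_pow, if_neg (Ne.symm hi), mul_zero]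
    · intro h; exact absurd (Finset.mem_range.2 hj) h
  have hq0 : constantCoeff (q : MvPowerSeries (Fin n) k) ≠ 0 := by
    rw [Finset.sum_eq_zero, add_zero] at h1
    · intro hq0
      have h2 : PowerSeries.X ∣ axis z (q : MvPowerSeries (Fin n) k) := by
        rw [PowerSeries.X_dvd_iff, ← PowerSeries.coeff_zero_eq_constantCoeff_apply, coeff_axis,
          Finsupp.single_zero, coeff_zero_eq_constantCoeff_apply, hq0]
      have h3 := mul_dvd_mul h2 hfX
      rw [← h1, ← pow_succ', PowerSeries.X_pow_dvd_iff] at h3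
      have h4 := h3 D (Nat.lt_succ_self D)
      rw [PowerSeries.coeff_X_pow_self] at h4
      exact one_ne_zero h4
    · intro j hj
      rw [hp0 j (Finset.mem_range.1 hj), map_zero, zero_mul]
  refine ⟨Polynomial.X ^ D - p, Polynomial.monic_X_pow_sub hp, ?_, ?_, ?_⟩
  · rw [Polynomial.degree_sub_eq_left_of_degree_lt]
    · exact Polynomial.degree_X_pow D
    · rwa [Polynomial.degree_X_pow]
  · intro j hj
    rw [Polynomial.coeff_sub, Polynomial.coeff_X_pow, if_neg hj.ne, zero_sub,
      NegMemClass.coe_neg, map_neg, hp0 j hj, neg_zero]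
  · rw [Polynomial.eval₂_sub, Polynomial.eval₂_pow, Polynomial.eval₂_X, h, add_sub_cancel_right]
    exact associated_unit_mul_left _ _ ((hO.isUnit_iff z q).2 hq0)

end Division
end WeierstrassRings

/-! ### Noetherian rings from division with remainder -/

section FG
open Polynomial

/-- If every element is congruent to a combination of `1, z, …, z ^ (D - 1)` modulo some element
of the ideal `J`, then `J` is finitely generated. -/
theorem fg_of_division {A R : Type*} [CommRing A] [IsNoetherianRing A] [CommRing R] (ι : A →+* R)
    (z : R) {f : R} {D : ℕ}
    (hdiv : ∀ g, ∃ (q : R) (p : A[X]), p.degree < D ∧ g = q * f + eval₂ ι z p) {J : Ideal R}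
    (hf : f ∈ J) : J.FG := by
  let : Algebra A R := ι.toAlgebra
  let N : Submodule A R := Submodule.span A (Set.range fun j : Fin D => z ^ (j : ℕ))
  have hN : (N ⊓ J.restrictScalars A).FG := by
    have : IsNoetherian A N :=
      isNoetherian_of_fg_of_noetherian N (Submodule.fg_span (Set.finite_range _))
    exact (isNoetherian_submodule.1 this) _ inf_le_left
  obtain ⟨S, hS⟩ := hN
  have hJ : J = Ideal.span (insert f (S : Set R)) := by
    apply le_antisymm
    · intro g hg
      obtain ⟨q, p, hp, h⟩ := hdiv g
      have h1 : p.eval₂ ι z ∈ N ⊓ J.restrictScalars A := by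
        constructor
        · by_cases hp0 : p = 0
          · simp [hp0]
          rw [Polynomial.eval₂_eq_sum_range' _ (n := D)
            ((Polynomial.natDegree_lt_iff_degree_lt hp0).2 hp)]
          refine Submodule.sum_mem _ fun j hj => ?_
          exact Submodule.smul_mem N (p.coeff j)
            (Submodule.subset_span ⟨⟨j, Finset.mem_range.1 hj⟩, rfl⟩)
        · have h2 : p.eval₂ ι z = g - q * f := by rw [h]; ring
          rw [h2]
          exact J.sub_mem hg (J.mul_mem_left _ hf)
      rw [← hS] at h1
      have h3 : Submodule.span A (S : Set R) ≤
          (Ideal.span (insert f (S : Set R))).restrictScalars A := by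
        rw [Submodule.span_le]
        exact fun x hx => Ideal.subset_span (Set.mem_insert_of_mem _ hx)
      rw [h]
      exact Ideal.add_mem _ (Ideal.mul_mem_left _ _ (Ideal.subset_span (Set.mem_insert _ _)))
        (h3 h1)
    · rw [Ideal.span_le, Set.insert_subset_iff]
      refine ⟨hf, fun x hx => ?_⟩
      have : x ∈ N ⊓ J.restrictScalars A := by
        rw [← hS]; exact Submodule.subset_span hx
      exact this.2
  rw [hJ]
  exact Submodule.fg_span (S.finite_toSet.insert _)

theorem _root_.Ideal.fg_of_fg_map_ringEquiv {R S : Type*} [CommRing R] [CommRing S] (σ : R ≃+* S)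
    {J : Ideal R} (h : (J.map (σ : R →+* S)).FG) : J.FG := by
  have := Ideal.FG.map h (σ.symm : S →+* R)
  rwa [Ideal.map_map, RingEquiv.symm_comp, Ideal.map_id] at this

end FG

/-! ### Noetherianity and factoriality of Weierstrass rings -/

section WeierstrassRings
open MvPowerSeries Finsupp

variable {k : Type*} [Field k] {n : ℕ} {O : Subalgebra k (MvPowerSeries (Fin n) k)}

instance (T : Finset (Fin n)) : IsDomain (partialRing O T) :=
  have : IsDomain (MvPowerSeries (Fin n) k) := NoZeroDivisors.to_isDomain _
  Subalgebra.isDomain _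

/-- The shear `xᵢ ↦ xᵢ + cᵢ x_z` as an automorphism of a ring of series. -/
def IsWeierstrass.shearEquiv (hO : IsWeierstrass O) {T : Finset (Fin n)} {z : Fin n} (hz : z ∈ T)
    {c : Fin n → k} (hc : c z = 0) : partialRing O T ≃+* partialRing O T where
  toFun f := ⟨shear z c f, hO.shear_mem z c f.2.1, shear_mem_seriesIn hz c f.2.2⟩
  invFun f := ⟨shear z (-c) f, hO.shear_mem z (-c) f.2.1, shear_mem_seriesIn hz (-c) f.2.2⟩
  left_inv f := Subtype.ext (shear_neg_shear z hc _)
  right_inv f := Subtype.ext (by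
    have := shear_neg_shear z (c := -c) (by simp [hc]) (f : MvPowerSeries (Fin n) k)
    rwa [neg_neg] at this)
  map_mul' f g := Subtype.ext (map_mul (shear z c) _ _)
  map_add' f g := Subtype.ext (map_add (shear z c) _ _)

theorem IsWeierstrass.exists_shearEquiv [Infinite k] (hO : IsWeierstrass O) {T : Finset (Fin n)}
    {z : Fin n} (hz : z ∈ T) {f : partialRing O T} (hf : f ≠ 0) :
    ∃ (c : Fin n → k) (hc : c z = 0) (D : ℕ),
      IsRegularIn z D (hO.shearEquiv hz hc f : MvPowerSeries (Fin n) k) := by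
  obtain ⟨c, hc, D, h⟩ := exists_isRegularIn_shear z (f := (f : MvPowerSeries (Fin n) k))
    (fun h => hf (Subtype.ext h))
  exact ⟨c, hc, D, h⟩

theorem mem_seriesIn_empty_iff {f : MvPowerSeries (Fin n) k} :
    f ∈ seriesIn k (∅ : Finset (Fin n)) ↔ f = C (constantCoeff f) := by
  constructor
  · intro h
    ext m
    rw [coeff_C]
    split_ifs with hm
    · rw [hm, coeff_zero_eq_constantCoeff_apply]
    · obtain ⟨i, hi⟩ := Finsupp.ne_iff.1 hm
      exact h m ⟨i, by simp, hi⟩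
  · intro h
    rw [h]
    exact (seriesIn k _).algebraMap_mem _

theorem IsWeierstrass.isUnit_of_ne_zero_empty (hO : IsWeierstrass O) (z : Fin n)
    {f : partialRing O ∅} (hf : f ≠ 0) : IsUnit f := by
  rw [hO.isUnit_iff z]
  intro h
  apply hf
  have := mem_seriesIn_empty_iff.1 f.2.2
  rw [h, map_zero] at this
  exact Subtype.ext this

/-- A nonzero ideal contains, after a shear, an element by which one can divide. -/
theorem IsWeierstrass.isNoetherianRing_insert [Infinite k] (hO : IsWeierstrass O)
    {T : Finset (Fin n)} {z : Fin n} [IsNoetherianRing (partialRing O T)] :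
    IsNoetherianRing (partialRing O (insert z T)) := by
  rw [isNoetherianRing_iff_ideal_fg]
  intro J
  by_cases hJ : J = ⊥
  · rw [hJ]; exact Submodule.fg_bot
  obtain ⟨f, hfJ, hf0⟩ := Submodule.exists_mem_ne_zero_of_ne_bot hJ
  obtain ⟨c, hc, D, hD⟩ := hO.exists_shearEquiv (Finset.mem_insert_self z T) hf0
  exact Ideal.fg_of_fg_map_ringEquiv (hO.shearEquiv (Finset.mem_insert_self z T) hc)
    (fg_of_division _ _ (hO.exists_division_polynomial hD) (Ideal.mem_map_of_mem _ hfJ))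

/-- An irreducible element is, after a shear, a unit times a Weierstrass polynomial, and this
polynomial is irreducible and hence prime by the lemma of Gauss. -/
theorem IsWeierstrass.prime_of_irreducible_insert [Infinite k] (hO : IsWeierstrass O)
    {T : Finset (Fin n)} {z : Fin n} (hz : z ∉ T)
    [UniqueFactorizationMonoid (partialRing O T)] {f : partialRing O (insert z T)}
    (hf : Irreducible f) : Prime f := by
  obtain ⟨c, hc, D, hD⟩ := hO.exists_shearEquiv (Finset.mem_insert_self z T) hf.ne_zero
  set σ := hO.shearEquiv (Finset.mem_insert_self z T) hc
  suffices h : Prime (σ f) from (MulEquiv.prime_iff σ.toMulEquiv).1 h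
  have hf' : Irreducible (σ f) := (MulEquiv.irreducible_iff σ.toMulEquiv).2 hf
  obtain ⟨W, hW, hWD, hW0, hWf⟩ := hO.exists_preparation hz hD
  refine prime_of_irreducible_of_division _ _ (σ f) W hW hWf ?_ ?_ ?_ hf'
  · rw [hWD]
    exact hO.exists_division_polynomial hD
  · rw [hWD]
    exact fun p hp h => hO.eq_zero_of_dvd_eval₂ hz hD hp h
  · -- modulo the maximal ideal, `W` is a power of `x_z`, and so is its monic factor `U`
    intro U V hU hV hUV hu
    rw [hO.isUnit_iff z] at hu
    let φ : partialRing O T →+* k := constantCoeff.comp (partialRing O T).val.toRingHom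
    have h1 : W.map φ = Polynomial.X ^ D := by
      ext j
      rw [Polynomial.coeff_map, Polynomial.coeff_X_pow]
      rcases lt_trichotomy j D with h | h | h
      · rw [if_neg h.ne]; exact hW0 j h
      · rw [if_pos h]
        have : W.natDegree = D := Polynomial.natDegree_eq_of_degree_eq_some hWD
        rw [h, ← this, hW.coeff_natDegree, map_one]
      · rw [if_neg h.ne', Polynomial.coeff_eq_zero_of_degree_lt (by rw [hWD]; exact_mod_cast h),
          map_zero]
    have h2 : U.map φ ∣ Polynomial.X ^ D := by
      rw [← h1, ← hUV, Polynomial.map_mul]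
      exact dvd_mul_right _ _
    obtain ⟨e, he, hUe⟩ := (dvd_prime_pow Polynomial.prime_X D).1 h2
    have h3 : U.map φ = Polynomial.X ^ e :=
      Polynomial.eq_of_monic_of_associated (hU.map φ) (Polynomial.monic_X_pow e) hUe
    have h4 : U.natDegree = e := by
      rw [← hU.natDegree_map φ, h3, Polynomial.natDegree_X_pow]
    rw [h4]
    by_contra he0
    apply hu
    have h5 : constantCoeff ((U.eval₂ (inclInsert O T z) (hO.var (Finset.mem_insert_self z T)) :
        partialRing O (insert z T)) : MvPowerSeries (Fin n) k) = (U.map φ).eval 0 := by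
      let ψ : partialRing O (insert z T) →+* k :=
        constantCoeff.comp (partialRing O (insert z T)).val.toRingHom
      change ψ _ = _
      rw [Polynomial.hom_eval₂, Polynomial.eval_map]
      congr 1
      exact constantCoeff_X z
    rw [h5, h3, Polynomial.eval_pow, Polynomial.eval_X, zero_pow he0]

/-- Induction on the number of variables; the variable `z` only witnesses `n ≠ 0`. -/
theorem IsWeierstrass.noetherian_and_factorial [Infinite k] (hO : IsWeierstrass O)
    (z : Fin n) (T : Finset (Fin n)) :
    IsNoetherianRing (partialRing O T) ∧ UniqueFactorizationMonoid (partialRing O T) := by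
  induction T using Finset.induction_on with
  | empty =>
    have h : IsField (partialRing O ∅) :=
      ⟨exists_pair_ne _, mul_comm, fun h => (hO.isUnit_of_ne_zero_empty z h).exists_right_inv⟩
    let := h.toField
    exact ⟨inferInstance, inferInstance⟩
  | insert y T hy ih =>
    obtain ⟨h1, h2⟩ := ih
    have h3 := hO.isNoetherianRing_insert (z := y) (T := T)
    refine ⟨h3, ?_⟩
    have : WfDvdMonoid (partialRing O (insert y T)) := inferInstance
    exact ⟨fun {a} => ⟨fun h => hO.prime_of_irreducible_insert hy h, fun h => h.irreducible⟩⟩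

theorem IsWeierstrass.isNoetherianRing [Infinite k] (hO : IsWeierstrass O) (z : Fin n) :
    IsNoetherianRing O := by
  have h := (hO.noetherian_and_factorial z Finset.univ).1
  have e : partialRing O Finset.univ = O := by
    refine le_antisymm inf_le_left fun f hf => ⟨hf, mem_seriesIn_univ f⟩
  rwa [e] at h

theorem IsWeierstrass.uniqueFactorizationMonoid [Infinite k] (hO : IsWeierstrass O) (z : Fin n) :
    UniqueFactorizationMonoid O := by
  have h := (hO.noetherian_and_factorial z Finset.univ).2
  have e : partialRing O Finset.univ = O := by
    refine le_antisymm inf_le_left fun f hf => ⟨hf, mem_seriesIn_univ f⟩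
  rwa [e] at h

end WeierstrassRings

/-- Krull's intersection theorem: ideals of a Noetherian local ring are closed. -/
theorem _root_.Ideal.mem_of_forall_sub_mem_pow {R : Type*} [CommRing R] [IsNoetherianRing R]
    [IsLocalRing R] {J I : Ideal R} (hJ : J ≠ ⊤) {g : R} (h : ∀ N : ℕ, ∃ i ∈ I, g - i ∈ J ^ N) :
    g ∈ I := by
  have h1 := Ideal.iInf_pow_smul_eq_bot_of_isLocalRing (M := R ⧸ I) J hJ
  rw [← Ideal.Quotient.eq_zero_iff_mem, ← Submodule.mem_bot R, ← h1, Submodule.mem_iInf]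
  intro N
  obtain ⟨i, hi, hN⟩ := h N
  have h3 : Ideal.Quotient.mk I g = (g - i) • (1 : R ⧸ I) := by
    rw [Algebra.smul_def, mul_one, Ideal.Quotient.algebraMap_eq, map_sub,
      Ideal.Quotient.eq_zero_iff_mem.2 hi, sub_zero]
  rw [h3]
  exact Submodule.smul_mem_smul hN trivial

/-! ### Rings of germs -/

section GermRings
open MvPowerSeries Finsupp

variable {k : Type*} [Field k] {n : ℕ}

/-- The properties shared by the three rings of germs: a factorial Noetherian local ring of power
series whose maximal ideal is generated by the variables, closed under differentiation. -/
structure IsGermRing (O : Subalgebra k (MvPowerSeries (Fin n) k)) : Prop where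
  X_mem : ∀ i, X i ∈ O
  inv_mem : ∀ {f}, f ∈ O → constantCoeff f ≠ 0 → f⁻¹ ∈ O
  exists_eq_sum : ∀ {f}, f ∈ O → constantCoeff f = 0 →
    ∃ c : Fin n → MvPowerSeries (Fin n) k, (∀ i, c i ∈ O) ∧ f = ∑ i, c i * X i
  pderiv_mem : ∀ {f} i, f ∈ O → pderiv k i f ∈ O
  isNoetherianRing : IsNoetherianRing O
  uniqueFactorizationMonoid : UniqueFactorizationMonoid O

theorem IsWeierstrass.exists_eq_sum {O : Subalgebra k (MvPowerSeries (Fin n) k)}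
    (hO : IsWeierstrass O) {f : MvPowerSeries (Fin n) k} (hf : f ∈ O) (h0 : constantCoeff f = 0) :
    ∃ c : Fin n → MvPowerSeries (Fin n) k, (∀ i, c i ∈ O) ∧ f = ∑ i, c i * X i := by
  have key : ∀ T : Finset (Fin n), ∀ f ∈ O ⊓ seriesIn k T, constantCoeff f = 0 →
      ∃ c : Fin n → MvPowerSeries (Fin n) k, (∀ i, c i ∈ O) ∧ f = ∑ i, c i * X i := by
    intro T
    induction T using Finset.induction_on with
    | empty =>
      intro f hf h0
      refine ⟨0, fun _ => zero_mem O, ?_⟩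
      rw [mem_seriesIn_empty_iff.1 hf.2, h0, map_zero]
      simp
    | insert z T hz ih =>
      intro f hf h0
      obtain ⟨c, hc, h⟩ := ih (sliceCoeff z 0 f)
        ⟨hO.sliceCoeff_mem z 0 hf.1, sliceCoeff_mem_seriesIn 0 hf.2⟩ (by
          rw [← coeff_zero_eq_constantCoeff_apply, coeff_sliceCoeff]
          simpa using h0)
      refine ⟨c + Pi.single z (divXPow z 1 f), fun i => ?_, ?_⟩
      · refine add_mem (hc i) ?_
        by_cases hi : i = z
        · subst hi
          rw [Pi.single_eq_same]
          exact hO.divXPow_mem _ 1 hf.1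
        · rw [Pi.single_eq_of_ne hi]
          exact zero_mem O
      · have h1 := eq_sum_sliceCoeff_add z 1 f
        rw [Finset.sum_range_one, pow_zero, mul_one, pow_one, h] at h1
        simp only [Pi.add_apply, add_mul, Finset.sum_add_distrib]
        rw [Finset.sum_eq_single_of_mem (f := fun x => (Pi.single z (divXPow z 1 f) : Fin n → _) x * X x)
          z (Finset.mem_univ z), Pi.single_eq_same]
        · exact h1
        · intro i _ hi
          rw [Pi.single_eq_of_ne hi, zero_mul]
  exact key Finset.univ f ⟨hf, mem_seriesIn_univ f⟩ h0

/-- A Weierstrass ring closed under differentiation is a ring of germs. -/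
theorem IsWeierstrass.isGermRing [Infinite k] {O : Subalgebra k (MvPowerSeries (Fin n) k)}
    (hO : IsWeierstrass O) (z : Fin n) (hd : ∀ {f} i, f ∈ O → pderiv k i f ∈ O) :
    IsGermRing O where
  X_mem := hO.X_mem
  inv_mem hf h0 := (hO.inv_mem z ⟨hf, mem_seriesIn_univ _⟩ h0).1
  exists_eq_sum := hO.exists_eq_sum
  pderiv_mem := hd
  isNoetherianRing := hO.isNoetherianRing z
  uniqueFactorizationMonoid := hO.uniqueFactorizationMonoid z

namespace IsGermRing

variable {O : Subalgebra k (MvPowerSeries (Fin n) k)}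

theorem isUnit_iff (hO : IsGermRing O) (f : O) :
    IsUnit f ↔ constantCoeff (f : MvPowerSeries (Fin n) k) ≠ 0 := by
  constructor
  · intro h
    exact (isUnit_constantCoeff _ (h.map O.val)).ne_zero
  · intro h
    refine IsUnit.of_mul_eq_one ⟨_, hO.inv_mem f.2 h⟩ ?_
    ext1
    exact MvPowerSeries.mul_inv_cancel _ h

theorem isLocalRing (hO : IsGermRing O) : IsLocalRing O := by
  refine IsLocalRing.of_nonunits_add fun a b ha hb => ?_
  rw [mem_nonunits_iff, hO.isUnit_iff, not_not] at *
  rw [AddMemClass.coe_add, map_add, ha, hb, add_zero]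

theorem _root_.DetRep.isDomain_subalgebra (O : Subalgebra k (MvPowerSeries (Fin n) k)) :
    IsDomain O :=
  have : IsDomain (MvPowerSeries (Fin n) k) := NoZeroDivisors.to_isDomain _
  Subalgebra.isDomain _

/-- The ideal of the series of order at least `N`. -/
def _root_.DetRep.orderIdeal (O : Subalgebra k (MvPowerSeries (Fin n) k)) (N : ℕ) : Ideal O where
  carrier := {f | (N : ℕ∞) ≤ (f : MvPowerSeries (Fin n) k).order}
  add_mem' {f g} hf hg := (le_min hf hg).trans min_order_le_add
  zero_mem' := by simp
  smul_mem' c f hf := le_trans (le_trans (Set.mem_ofPred.1 hf) le_add_self)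
    (le_order_mul (f := (c : MvPowerSeries (Fin n) k)))

theorem _root_.DetRep.mem_orderIdeal {N : ℕ} {f : O} :
    f ∈ orderIdeal O N ↔ (N : ℕ∞) ≤ (f : MvPowerSeries (Fin n) k).order := Iff.rfl

/-- The ideal generated by the variables. -/
def varIdeal (hO : IsGermRing O) : Ideal O :=
  Ideal.span (Set.range fun i => (⟨X i, hO.X_mem i⟩ : O))

theorem mem_varIdeal (hO : IsGermRing O) {f : O}
    (hf : constantCoeff (f : MvPowerSeries (Fin n) k) = 0) : f ∈ hO.varIdeal := by
  obtain ⟨c, hc, h⟩ := hO.exists_eq_sum f.2 hf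
  have : f = ∑ i, (⟨c i, hc i⟩ : O) * ⟨X i, hO.X_mem i⟩ := by
    ext1
    rw [h, AddSubmonoidClass.coe_finsetSum]
    rfl
  rw [this]
  exact Ideal.sum_mem _ fun i _ => Ideal.mul_mem_left _ _ (Ideal.subset_span ⟨i, rfl⟩)

theorem varIdeal_pow_le (hO : IsGermRing O) (N : ℕ) : hO.varIdeal ^ N ≤ orderIdeal O N := by
  induction N with
  | zero => intro f _; rw [mem_orderIdeal]; simp
  | succ N ih =>
    rw [pow_succ', Ideal.mul_le]
    intro f hf g hg
    have h1 : hO.varIdeal ≤ orderIdeal O 1 := by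
      rw [varIdeal, Ideal.span_le]
      rintro _ ⟨i, rfl⟩
      rw [SetLike.mem_coe, mem_orderIdeal, Nat.cast_one, one_le_order_iff_constCoeff_eq_zero]
      exact constantCoeff_X i
    rw [mem_orderIdeal, add_comm, Nat.cast_add]
    exact (add_le_add (mem_orderIdeal.1 (h1 hf)) (mem_orderIdeal.1 (ih hg))).trans le_order_mul

theorem sub_algebraMap_mem_varIdeal (hO : IsGermRing O) (c : O) :
    c - algebraMap k O (constantCoeff (c : MvPowerSeries (Fin n) k)) ∈ hO.varIdeal := by
  apply hO.mem_varIdeal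
  rw [AddSubgroupClass.coe_sub, map_sub, sub_eq_zero]
  exact (constantCoeff_C _).symm

/-- An element of the `N`-th power of the maximal ideal is a form of degree `N` up to elements of
the next power. -/
theorem exists_homogeneous_add (hO : IsGermRing O) (N : ℕ) : ∀ g ∈ hO.varIdeal ^ N,
    ∃ p ∈ hO.varIdeal ^ N, (∀ m, m.degree ≠ N → coeff m (p : MvPowerSeries (Fin n) k) = 0) ∧
      ∃ h ∈ hO.varIdeal ^ (N + 1), g = p + h := by
  classical
  induction N with
  | zero =>
    intro g _
    refine ⟨algebraMap k O (constantCoeff (g : MvPowerSeries (Fin n) k)), by simp, ?_,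
      _, by simpa using hO.sub_algebraMap_mem_varIdeal g, by ring⟩
    intro m hm
    change coeff m (C _) = 0
    rw [coeff_C, if_neg]
    rintro rfl
    exact hm (by simp)
  | succ N ih =>
    have hsum : ∀ a ∈ hO.varIdeal, ∃ l ∈ hO.varIdeal,
        (∃ c : Fin n → k, (l : MvPowerSeries (Fin n) k) = ∑ i, C (c i) * X i) ∧
        ∃ h ∈ hO.varIdeal ^ 2, a = l + h := by
      intro a ha
      induction ha using Submodule.span_induction with
      | zero => exact ⟨0, zero_mem _, ⟨0, by simp⟩, 0, zero_mem _, by simp⟩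
      | add a b _ _ ha hb =>
        obtain ⟨l, hl, ⟨c, e⟩, h, hh, rfl⟩ := ha
        obtain ⟨l', hl', ⟨c', e'⟩, h', hh', rfl⟩ := hb
        refine ⟨l + l', add_mem hl hl', ⟨c + c', ?_⟩, h + h', add_mem hh hh', by ring⟩
        rw [AddMemClass.coe_add, e, e']
        simp [add_mul, Finset.sum_add_distrib]
      | smul b a _ ha =>
        obtain ⟨l, hl, ⟨c, e⟩, h, hh, rfl⟩ := ha
        set b0 := constantCoeff (b : MvPowerSeries (Fin n) k)
        refine ⟨algebraMap k O b0 * l, Ideal.mul_mem_left _ _ hl, ⟨fun i => b0 * c i, ?_⟩,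
          (b - algebraMap k O b0) * l + b * h, add_mem ?_ (Ideal.mul_mem_left _ _ hh), ?_⟩
        · rw [MulMemClass.coe_mul, e, Finset.mul_sum]
          refine Finset.sum_congr rfl fun i _ => ?_
          rw [map_mul, mul_assoc]
          rfl
        · rw [pow_two]
          exact Ideal.mul_mem_mul (hO.sub_algebraMap_mem_varIdeal b) hl
        · rw [smul_eq_mul]; ring
      | mem a ha =>
        obtain ⟨i, rfl⟩ := ha
        refine ⟨_, Ideal.subset_span ⟨i, rfl⟩, ⟨Pi.single i 1, ?_⟩, 0, zero_mem _, by simp⟩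
        rw [Finset.sum_eq_single_of_mem i (Finset.mem_univ i)]
        · simp
        · intro j _ hj
          rw [Pi.single_eq_of_ne hj, map_zero, zero_mul]
    intro g hg
    rw [pow_succ'] at hg
    refine Submodule.mul_induction_on hg ?_ ?_
    · intro a ha b hb
      obtain ⟨l, hl, ⟨c, e⟩, h, hh, rfl⟩ := hsum a ha
      obtain ⟨p, hp, hp', h', hh', rfl⟩ := ih b hb
      refine ⟨l * p, ?_, ?_, h * p + (l + h) * h', add_mem ?_ ?_, by ring⟩
      · rw [pow_succ']; exact Ideal.mul_mem_mul hl hp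
      · intro m hm
        rw [MulMemClass.coe_mul, e, Finset.sum_mul, map_sum]
        refine Finset.sum_eq_zero fun i _ => ?_
        rw [mul_assoc, coeff_C_mul, mul_comm (X i), ← pow_one (X i), coeff_mul_X_pow]
        split_ifs with h1
        · rw [hp', mul_zero]
          intro h2
          apply hm
          have h3 : m = (m - single i 1) + single i 1 := by
            ext j
            by_cases hj : j = i
            · subst hj; simp; omega
            · simp [hj]
          rw [h3, map_add, h2, Finsupp.degree_single]
        · rw [mul_zero]
      · have := Ideal.mul_mem_mul hh hp
        rwa [← pow_add, add_comm 2 N] at this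
      · have := Ideal.mul_mem_mul ha hh'
        rwa [← pow_succ'] at this
    · rintro a b ⟨p, hp, hp', h, hh, rfl⟩ ⟨q, hq, hq', h', hh', rfl⟩
      refine ⟨p + q, add_mem hp hq, fun m hm => ?_, h + h', add_mem hh hh', by ring⟩
      rw [AddMemClass.coe_add, map_add, hp' m hm, hq' m hm, add_zero]

/-- The powers of the maximal ideal are given by orders of vanishing: in a series of order greater
than `N`, the component of degree `N` from `exists_homogeneous_add` vanishes. -/
theorem orderIdeal_eq (hO : IsGermRing O) (N : ℕ) : orderIdeal O N = hO.varIdeal ^ N := by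
  refine le_antisymm ?_ (hO.varIdeal_pow_le N)
  induction N with
  | zero => simp
  | succ N ih =>
    intro f hf
    have h1 : f ∈ hO.varIdeal ^ N :=
      ih (mem_orderIdeal.2 (le_trans (by exact_mod_cast Nat.le_succ N) (mem_orderIdeal.1 hf)))
    -- the component of `f` of degree `N` vanishes
    obtain ⟨p, -, hp, h, hh, e⟩ := hO.exists_homogeneous_add N f h1
    have hp0 : (p : MvPowerSeries (Fin n) k) = 0 := by
      ext m
      by_cases hm : m.degree = N
      · have e1 := congrArg (fun x : O => coeff m (x : MvPowerSeries (Fin n) k)) e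
        simp only [AddMemClass.coe_add, map_add] at e1
        have hN : (m.degree : ℕ∞) < ((N + 1 : ℕ) : ℕ∞) := by
          rw [hm]; exact_mod_cast Nat.lt_succ_self N
        rw [coeff_of_lt_order (f := (h : MvPowerSeries (Fin n) k)),
          coeff_of_lt_order (f := (f : MvPowerSeries (Fin n) k)), add_zero] at e1
        · rw [← e1, map_zero]
        · exact lt_of_lt_of_le hN (mem_orderIdeal.1 hf)
        · exact lt_of_lt_of_le hN (mem_orderIdeal.1 (hO.varIdeal_pow_le _ hh))
      · rw [hp m hm, map_zero]
    have e2 : f = h := by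
      rw [e]; ext1; rw [AddMemClass.coe_add, hp0, zero_add]
    rwa [e2]

/-- Ideals are closed in the topology given by the order of vanishing. -/
theorem mem_of_forall_order (hO : IsGermRing O) {I : Ideal O} {g : O}
    (h : ∀ N : ℕ, ∃ i ∈ I, (N : ℕ∞) ≤ ((g - i : O) : MvPowerSeries (Fin n) k).order) : g ∈ I := by
  have := hO.isNoetherianRing
  have := hO.isLocalRing
  have hne : hO.varIdeal ≠ ⊤ := by
    intro h1
    have h2 : (1 : O) ∈ hO.varIdeal ^ 1 := by rw [h1]; simp
    have h3 := mem_orderIdeal.1 (hO.varIdeal_pow_le 1 h2)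
    rw [Nat.cast_one, one_le_order_iff_constCoeff_eq_zero] at h3
    exact one_ne_zero (h3.symm.trans (map_one _)).symm
  refine _root_.Ideal.mem_of_forall_sub_mem_pow hne fun N => ?_
  obtain ⟨i, hi, hN⟩ := h N
  exact ⟨i, hi, hO.orderIdeal_eq N ▸ mem_orderIdeal.2 hN⟩

end IsGermRing
end GermRings

/-! ### Rational functions -/

section Rational
open MvPowerSeries Finsupp

variable {k : Type*} [NontriviallyNormedField k] {n : ℕ}

theorem coe_mem_rationalSeries (p : MvPolynomial (Fin n) k) :
    (p : MvPowerSeries (Fin n) k) ∈ rationalSeries k n :=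
  ⟨p, 1, by simp, by rw [MvPolynomial.coe_one, one_mul]⟩

/-- Polynomials as rational functions regular at the origin. -/
def polyToRational (k : Type*) [NontriviallyNormedField k] (n : ℕ) :
    MvPolynomial (Fin n) k →+* rationalSeries k n where
  toFun p := ⟨p, coe_mem_rationalSeries p⟩
  map_one' := Subtype.ext MvPolynomial.coe_one
  map_mul' p q := Subtype.ext (MvPolynomial.coe_mul p q)
  map_zero' := Subtype.ext MvPolynomial.coe_zero
  map_add' p q := Subtype.ext (MvPolynomial.coe_add p q)

theorem polyToRational_injective : Function.Injective (polyToRational k n) := fun p q h => by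
  have := congrArg Subtype.val h
  exact MvPolynomial.coe_injective _ _ this

theorem constantCoeff_coe (p : MvPolynomial (Fin n) k) :
    constantCoeff (p : MvPowerSeries (Fin n) k) = MvPolynomial.constantCoeff p := by
  rw [← coeff_zero_eq_constantCoeff_apply, MvPolynomial.coeff_coe]; rfl

theorem rational_inv_mem {f : MvPowerSeries (Fin n) k} (hf : f ∈ rationalSeries k n)
    (h0 : constantCoeff f ≠ 0) : f⁻¹ ∈ rationalSeries k n := by
  obtain ⟨p, q, hq, h⟩ := hf
  refine ⟨q, p, ?_, ?_⟩
  · rw [← constantCoeff_coe, ← h, map_mul, constantCoeff_coe]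
    exact mul_ne_zero hq h0
  · rw [← h, mul_assoc, MvPowerSeries.mul_inv_cancel _ h0, mul_one]

/-- The polynomials that do not vanish at the origin. -/
def nonvanishing (k : Type*) [Field k] (n : ℕ) : Submonoid (MvPolynomial (Fin n) k) where
  carrier := {q | MvPolynomial.constantCoeff q ≠ 0}
  one_mem' := by simp
  mul_mem' {p q} hp hq := by
    rw [Set.mem_ofPred, map_mul]; exact mul_ne_zero hp hq

theorem isUnit_polyToRational {q : MvPolynomial (Fin n) k} (hq : q ∈ nonvanishing k n) :
    IsUnit (polyToRational k n q) := by
  have h0 : constantCoeff (q : MvPowerSeries (Fin n) k) ≠ 0 := by rwa [constantCoeff_coe]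
  exact IsUnit.of_mul_eq_one ⟨_, rational_inv_mem (coe_mem_rationalSeries q) h0⟩
    (Subtype.ext (MvPowerSeries.mul_inv_cancel _ h0))

instance : Algebra (MvPolynomial (Fin n) k) (rationalSeries k n) := (polyToRational k n).toAlgebra

instance : IsLocalization (nonvanishing k n) (rationalSeries k n) where
  map_units := fun q => isUnit_polyToRational q.2
  surj := by
    rintro ⟨f, p, q, hq, h⟩
    refine ⟨⟨p, ⟨q, hq⟩⟩, Subtype.ext ?_⟩
    rw [mul_comm]
    exact h
  exists_of_eq {p q} h := ⟨1, by rw [polyToRational_injective h]⟩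

theorem isGermRing_rationalSeries : IsGermRing (rationalSeries k n) where
  X_mem i := by
    rw [← MvPolynomial.coe_X]
    exact coe_mem_rationalSeries _
  inv_mem := rational_inv_mem
  exists_eq_sum := by
    rintro f ⟨p, q, hq, h⟩ h0
    have hp : MvPolynomial.constantCoeff p = 0 := by
      rw [← constantCoeff_coe, ← h, map_mul, h0, mul_zero]
    have hp' : p ∈ Ideal.span (Set.range (MvPolynomial.X : Fin n → MvPolynomial (Fin n) k)) := by
      rw [← Set.image_univ, MvPolynomial.mem_ideal_span_X_image]
      intro m hm
      by_contra! h1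
      have h2 : m = 0 := Finsupp.ext fun i => h1 i (Set.mem_univ i)
      rw [h2, MvPolynomial.mem_support_iff] at hm
      exact hm hp
    rw [Ideal.mem_span_range_iff_exists_fun] at hp'
    obtain ⟨c, hc⟩ := hp'
    have hq0 : constantCoeff (q : MvPowerSeries (Fin n) k) ≠ 0 := by rwa [constantCoeff_coe]
    refine ⟨fun i => (q : MvPowerSeries (Fin n) k)⁻¹ * c i, fun i => mul_mem
      (rational_inv_mem (coe_mem_rationalSeries q) hq0) (coe_mem_rationalSeries _), ?_⟩
    have h1 : f = (q : MvPowerSeries (Fin n) k)⁻¹ * p := by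
      rw [← h, ← mul_assoc, MvPowerSeries.inv_mul_cancel _ hq0, one_mul]
    have h2 : (p : MvPowerSeries (Fin n) k) = ∑ i, (c i : MvPowerSeries (Fin n) k) * X i := by
      rw [← hc, ← MvPolynomial.coeToMvPowerSeries.ringHom_apply, map_sum]
      simp
    rw [h1, h2, Finset.mul_sum]
    exact Finset.sum_congr rfl fun i _ => by ring
  pderiv_mem := by
    rintro f i ⟨p, q, hq, h⟩
    refine ⟨q * MvPolynomial.pderiv i p - p * MvPolynomial.pderiv i q, q * q, ?_, ?_⟩
    · rw [map_mul]; exact mul_ne_zero hq hq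
    · have h1 := congrArg (pderiv k i) h
      rw [Derivation.leibniz, pderiv_coe, pderiv_coe, smul_eq_mul, smul_eq_mul] at h1
      rw [← MvPolynomial.coeToMvPowerSeries.ringHom_apply,
        ← MvPolynomial.coeToMvPowerSeries.ringHom_apply, map_sub, map_mul, map_mul, map_mul]
      simp only [MvPolynomial.coeToMvPowerSeries.ringHom_apply]
      rw [← h1, ← h]
      ring
  isNoetherianRing := IsLocalization.isNoetherianRing (nonvanishing k n) _ inferInstance
  uniqueFactorizationMonoid :=
    UniqueFactorizationMonoid.of_isLocalization (nonvanishing k n) _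

end Rational

/-! ### Weierstrass division of convergent power series -/

section WeightedNorm
open MvPowerSeries Finsupp
open scoped ENNReal NNReal

variable {k : Type*} [NontriviallyNormedField k] {n : ℕ}

/-- The monomial `∏ ρᵢ ^ mᵢ`. -/
def radiusPow (ρ : Fin n → ℝ≥0∞) (m : Fin n →₀ ℕ) : ℝ≥0∞ := ∏ i, ρ i ^ m i

theorem radiusPow_add (ρ : Fin n → ℝ≥0∞) (m l : Fin n →₀ ℕ) :
    radiusPow ρ (m + l) = radiusPow ρ m * radiusPow ρ l := by
  simp [radiusPow, pow_add, Finset.prod_mul_distrib]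

theorem radiusPow_single (ρ : Fin n → ℝ≥0∞) (z : Fin n) (D : ℕ) :
    radiusPow ρ (single z D) = ρ z ^ D := by
  rw [radiusPow, Finset.prod_eq_single_of_mem z (Finset.mem_univ z)]
  · simp
  · intro i _ hi
    simp [Finsupp.single_eq_of_ne hi]

theorem radiusPow_const (r : ℝ≥0∞) (m : Fin n →₀ ℕ) :
    radiusPow (fun _ => r) m = r ^ m.degree := by
  rw [radiusPow, Finset.prod_pow_eq_pow_sum, Finsupp.degree_eq_sum]

theorem radiusPow_mono {ρ ρ' : Fin n → ℝ≥0∞} (h : ρ ≤ ρ') (m : Fin n →₀ ℕ) :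
    radiusPow ρ m ≤ radiusPow ρ' m :=
  Finset.prod_le_prod' fun i _ => pow_le_pow_left' (h i) _

/-- The weighted `ℓ¹`-norm of a power series on the polydisc of polyradius `ρ`. -/
def weightedNorm (ρ : Fin n → ℝ≥0∞) (f : MvPowerSeries (Fin n) k) : ℝ≥0∞ :=
  ∑' m : Fin n →₀ ℕ, ‖coeff m f‖ₑ * radiusPow ρ m

theorem weightedNorm_mono {ρ ρ' : Fin n → ℝ≥0∞} (h : ρ ≤ ρ') (f : MvPowerSeries (Fin n) k) :
    weightedNorm ρ f ≤ weightedNorm ρ' f :=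
  ENNReal.tsum_le_tsum fun m => by gcongr; exact radiusPow_mono h m

theorem weightedNorm_add_le (ρ : Fin n → ℝ≥0∞) (f g : MvPowerSeries (Fin n) k) :
    weightedNorm ρ (f + g) ≤ weightedNorm ρ f + weightedNorm ρ g := by
  rw [weightedNorm, weightedNorm, weightedNorm, ← ENNReal.tsum_add]
  refine ENNReal.tsum_le_tsum fun m => ?_
  rw [map_add, ← add_mul]
  gcongr
  exact enorm_add_le _ _

theorem weightedNorm_C (ρ : Fin n → ℝ≥0∞) (c : k) :
    weightedNorm ρ (C c : MvPowerSeries (Fin n) k) = ‖c‖ₑ := by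
  classical
  rw [weightedNorm, tsum_eq_single 0]
  · simp [radiusPow]
  · intro m hm
    rw [coeff_C, if_neg hm, enorm_zero, zero_mul]

theorem weightedNorm_X (ρ : Fin n → ℝ≥0∞) (i : Fin n) :
    weightedNorm ρ (X i : MvPowerSeries (Fin n) k) = ρ i := by
  classical
  rw [weightedNorm, tsum_eq_single (single i 1)]
  · rw [coeff_X, if_pos rfl, radiusPow_single]; simp
  · intro m hm
    rw [coeff_X, if_neg hm, enorm_zero, zero_mul]

theorem weightedNorm_mul_le (ρ : Fin n → ℝ≥0∞) (f g : MvPowerSeries (Fin n) k) :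
    weightedNorm ρ (f * g) ≤ weightedNorm ρ f * weightedNorm ρ g := by
  classical
  have h1 : ∀ m, ‖coeff m (f * g)‖ₑ * radiusPow ρ m ≤
      ∑' p : Finset.HasAntidiagonal.antidiagonal m, (‖coeff p.1.1 f‖ₑ * radiusPow ρ p.1.1) *
        (‖coeff p.1.2 g‖ₑ * radiusPow ρ p.1.2) := by
    intro m
    rw [Finset.tsum_subtype (Finset.HasAntidiagonal.antidiagonal m)
      (fun p => (‖coeff p.1 f‖ₑ * radiusPow ρ p.1) * (‖coeff p.2 g‖ₑ * radiusPow ρ p.2)), coeff_mul]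
    calc _ ≤ (∑ p ∈ Finset.HasAntidiagonal.antidiagonal m, ‖coeff p.1 f‖ₑ * ‖coeff p.2 g‖ₑ) *
          radiusPow ρ m := by
          gcongr
          refine (enorm_sum_le _ _).trans (le_of_eq ?_)
          exact Finset.sum_congr rfl fun p _ => enorm_mul _ _
      _ = _ := by
          rw [Finset.sum_mul]
          refine Finset.sum_congr rfl fun p hp => ?_
          rw [← Finset.HasAntidiagonal.mem_antidiagonal.1 hp, radiusPow_add]
          ring
  refine (ENNReal.tsum_le_tsum h1).trans (le_of_eq ?_)
  rw [← ENNReal.tsum_sigma' (β := fun m => Finset.HasAntidiagonal.antidiagonal m)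
    (fun q => (‖coeff q.2.1.1 f‖ₑ * radiusPow ρ q.2.1.1) * (‖coeff q.2.1.2 g‖ₑ * radiusPow ρ q.2.1.2))]
  rw [weightedNorm, weightedNorm, ← ENNReal.tsum_mul_right]
  simp_rw [← ENNReal.tsum_mul_left]
  rw [← ENNReal.tsum_prod (f := fun a b => (‖coeff a f‖ₑ * radiusPow ρ a) *
    (‖coeff b g‖ₑ * radiusPow ρ b))]
  exact Finset.HasAntidiagonal.sigmaAntidiagonalEquivProd.tsum_eq
    (fun q : (Fin n →₀ ℕ) × (Fin n →₀ ℕ) => (‖coeff q.1 f‖ₑ * radiusPow ρ q.1) *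
      (‖coeff q.2 g‖ₑ * radiusPow ρ q.2))

theorem weightedNorm_divXPow_le (ρ : Fin n → ℝ≥0∞) (z : Fin n) (D : ℕ)
    (f : MvPowerSeries (Fin n) k) :
    weightedNorm ρ (divXPow z D f) * ρ z ^ D ≤ weightedNorm ρ f := by
  rw [weightedNorm, ← ENNReal.tsum_mul_right]
  refine le_trans (le_of_eq ?_) (ENNReal.tsum_comp_le_tsum_of_injective
    (add_left_injective (single z D)) (fun m => ‖coeff m f‖ₑ * radiusPow ρ m))
  refine tsum_congr fun m => ?_
  rw [coeff_divXPow, radiusPow_add, radiusPow_single, mul_assoc]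

theorem weightedNorm_sliceCoeff_le (ρ : Fin n → ℝ≥0∞) (z : Fin n) (D : ℕ)
    (f : MvPowerSeries (Fin n) k) :
    weightedNorm ρ (sliceCoeff z D f) ≤ weightedNorm ρ (divXPow z D f) := by
  refine ENNReal.tsum_le_tsum fun m => ?_
  gcongr
  rw [coeff_sliceCoeff, coeff_divXPow]
  split_ifs
  · exact le_rfl
  · simp

/-- Shrinking the radii of the variables in which `p` vanishes makes the norm of `p` small. -/
theorem weightedNorm_shrink_le {ρ : Fin n → ℝ≥0∞} {U : Finset (Fin n)}
    {p : MvPowerSeries (Fin n) k} (hp : VanishesOn U p) {ε : ℝ≥0∞} (hε : ε ≤ 1) :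
    weightedNorm (fun i => if i ∈ U then ε * ρ i else ρ i) p ≤ ε * weightedNorm ρ p := by
  rw [weightedNorm, weightedNorm, ← ENNReal.tsum_mul_left]
  refine ENNReal.tsum_le_tsum fun m => ?_
  by_cases hm : partialDegree U m = 0
  · rw [hp m hm]; simp
  have h1 : radiusPow (fun i => if i ∈ U then ε * ρ i else ρ i) m =
      ε ^ partialDegree U m * radiusPow ρ m := by
    rw [radiusPow, radiusPow, partialDegree, ← Finset.prod_pow_eq_pow_sum]
    rw [← Finset.prod_mul_prod_compl U, ← Finset.prod_mul_prod_compl U (fun i => ρ i ^ m i),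
      ← mul_assoc, ← Finset.prod_mul_distrib]
    congr 1
    · exact Finset.prod_congr rfl fun i hi => by rw [if_pos hi, mul_pow]
    · exact Finset.prod_congr rfl fun i hi => by rw [if_neg (Finset.mem_compl.1 hi)]
  rw [h1]
  calc _ ≤ ‖coeff m p‖ₑ * (ε * radiusPow ρ m) := by
        gcongr
        exact pow_le_of_le_one zero_le hε hm
    _ = _ := by ring

/-- The series `divSol` is majorized by a geometric series. -/
theorem weightedNorm_divSol_le {ρ : Fin n → ℝ≥0∞} {U : Finset (Fin n)} {z : Fin n} {D : ℕ}
    {p : MvPowerSeries (Fin n) k} (g : MvPowerSeries (Fin n) k) (hρ : ρ z ^ D ≠ 0)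
    (hρ' : ρ z ^ D ≠ ∞) :
    weightedNorm ρ (divSol U z D p g) ≤
      ∑' i : ℕ, (weightedNorm ρ p * (ρ z ^ D)⁻¹) ^ i * weightedNorm ρ g := by
  have h1 : ∀ i, weightedNorm ρ ((divOp z D p)^[i] g) ≤
      (weightedNorm ρ p * (ρ z ^ D)⁻¹) ^ i * weightedNorm ρ g := by
    intro i
    induction i with
    | zero => simp
    | succ i ih =>
      rw [Function.iterate_succ_apply']
      have h2 := (weightedNorm_divXPow_le ρ z D (p * (divOp z D p)^[i] g)).trans
        (weightedNorm_mul_le _ _ _)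
      rw [← ENNReal.le_div_iff_mul_le (Or.inl hρ) (Or.inl hρ')] at h2
      refine h2.trans ?_
      rw [div_eq_mul_inv, pow_succ]
      calc _ ≤ weightedNorm ρ p * ((weightedNorm ρ p * (ρ z ^ D)⁻¹) ^ i * weightedNorm ρ g) *
            (ρ z ^ D)⁻¹ := by gcongr
        _ = _ := by ring
  calc weightedNorm ρ (divSol U z D p g)
      ≤ ∑' m, ∑' i, ‖coeff m ((divOp z D p)^[i] g)‖ₑ * radiusPow ρ m := by
        refine ENNReal.tsum_le_tsum fun m => ?_
        rw [coeff_divSol, ENNReal.tsum_mul_right]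
        gcongr
        exact (enorm_sum_le _ _).trans (ENNReal.sum_le_tsum _)
    _ = ∑' i, weightedNorm ρ ((divOp z D p)^[i] g) := ENNReal.tsum_comm
    _ ≤ _ := ENNReal.tsum_le_tsum h1

theorem weightedNorm_prod_le (ρ : Fin n → ℝ≥0∞) (g : Fin n → MvPowerSeries (Fin n) k)
    (l : Fin n →₀ ℕ) : weightedNorm ρ (l.prod fun i e => g i ^ e) ≤
      radiusPow (fun i => weightedNorm ρ (g i)) l := by
  have h1 : weightedNorm ρ (1 : MvPowerSeries (Fin n) k) ≤ 1 := by
    rw [← map_one C, weightedNorm_C]; simp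
  have hpow : ∀ (a : MvPowerSeries (Fin n) k) e, weightedNorm ρ (a ^ e) ≤ weightedNorm ρ a ^ e := by
    intro a e
    induction e with
    | zero => simpa using h1
    | succ e ih =>
      rw [pow_succ, pow_succ]
      exact (weightedNorm_mul_le _ _ _).trans (by gcongr)
  rw [Finsupp.prod_fintype _ _ (by simp), radiusPow]
  refine (Finset.le_prod_of_submultiplicative _ h1 (weightedNorm_mul_le ρ) _ _).trans ?_
  exact Finset.prod_le_prod' fun i _ => hpow _ _

/-- A shear maps a polydisc into a larger one. -/
theorem weightedNorm_shear_le (ρ : Fin n → ℝ≥0∞) (z : Fin n) (c : Fin n → k)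
    (f : MvPowerSeries (Fin n) k) :
    weightedNorm ρ (shear z c f) ≤ weightedNorm (fun i => ρ i + ‖c i‖ₑ * ρ z) f := by
  have h1 : ∀ m, ‖coeff m (shear z c f)‖ₑ ≤
      ∑' l, ‖coeff l f‖ₑ * ‖coeff m (l.prod fun i e =>
        (X i + C (c i) * X z : MvPowerSeries (Fin n) k) ^ e)‖ₑ := by
    intro m
    rw [shear, substAlgHom_apply, coeff_subst (hasSubst_shear z c),
      finsum_eq_sum _ (coeff_subst_finite (hasSubst_shear z c) f m)]
    refine (enorm_sum_le _ _).trans ((ENNReal.sum_le_tsum _).trans (le_of_eq ?_))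
    refine tsum_congr fun l => ?_
    rw [smul_eq_mul, enorm_mul]
  calc weightedNorm ρ (shear z c f)
      ≤ ∑' m, ∑' l, ‖coeff l f‖ₑ * (‖coeff m (l.prod fun i e =>
        (X i + C (c i) * X z : MvPowerSeries (Fin n) k) ^ e)‖ₑ * radiusPow ρ m) := by
        refine ENNReal.tsum_le_tsum fun m => ?_
        simp_rw [← mul_assoc]
        rw [ENNReal.tsum_mul_right]
        gcongr
        exact h1 m
    _ = ∑' l, ‖coeff l f‖ₑ * weightedNorm ρ (l.prod fun i e =>
        (X i + C (c i) * X z : MvPowerSeries (Fin n) k) ^ e) := by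
        rw [ENNReal.tsum_comm]
        exact tsum_congr fun l => ENNReal.tsum_mul_left
    _ ≤ _ := by
        refine ENNReal.tsum_le_tsum fun l => ?_
        gcongr
        refine (weightedNorm_prod_le _ _ _).trans (radiusPow_mono (fun i => ?_) _)
        refine (weightedNorm_add_le _ _ _).trans ?_
        rw [weightedNorm_X]
        gcongr
        refine (weightedNorm_mul_le _ _ _).trans ?_
        rw [weightedNorm_C, weightedNorm_X]

theorem converges_iff_const {f : MvPowerSeries (Fin n) k} :
    Converges f ↔ ∃ r : ℝ≥0, 0 < r ∧ weightedNorm (fun _ => (r : ℝ≥0∞)) f ≠ ∞ := by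
  have h : ∀ r : ℝ≥0, weightedNorm (fun _ => (r : ℝ≥0∞)) f ≠ ∞ ↔
      Summable fun m : Fin n →₀ ℕ => ‖coeff m f‖ * (r : ℝ) ^ m.degree := by
    intro r
    have h1 : weightedNorm (fun _ => (r : ℝ≥0∞)) f =
        ∑' m : Fin n →₀ ℕ, ((‖coeff m f‖₊ * r ^ m.degree : ℝ≥0) : ℝ≥0∞) := by
      refine tsum_congr fun m => ?_
      rw [radiusPow_const, ENNReal.coe_mul, ENNReal.coe_pow]
      rfl
    rw [h1, ENNReal.tsum_coe_ne_top_iff_summable, ← NNReal.summable_coe]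
    simp
  constructor
  · rintro ⟨r, hr, hf⟩
    exact ⟨⟨r, hr.le⟩, hr, (h _).2 hf⟩
  · rintro ⟨r, hr, hf⟩
    exact ⟨r, hr, (h r).1 hf⟩

theorem converges_iff {f : MvPowerSeries (Fin n) k} :
    Converges f ↔
      ∃ ρ : Fin n → ℝ≥0, (∀ i, 0 < ρ i) ∧ weightedNorm (fun i => (ρ i : ℝ≥0∞)) f ≠ ∞ := by
  rw [converges_iff_const]
  constructor
  · rintro ⟨r, hr, hf⟩
    exact ⟨fun _ => r, fun _ => hr, hf⟩
  · rintro ⟨ρ, hρ, hf⟩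
    have h1 : ∀ᶠ r in 𝓝[>] (0 : ℝ≥0), ∀ i, r ≤ ρ i :=
      eventually_all.2 fun i => (eventually_le_nhds (hρ i)).filter_mono nhdsWithin_le_nhds
    obtain ⟨r, hr, hr0⟩ := (h1.and self_mem_nhdsWithin).exists
    exact ⟨r, hr0, ne_top_of_le_ne_top hf (weightedNorm_mono (fun i => by
      exact ENNReal.coe_le_coe.2 (hr i)) f)⟩

/-- Finitely many convergent series converge on a common polydisc of constant polyradius. -/
theorem Converges.exists_radius {ι : Type*} [Finite ι] {f : ι → MvPowerSeries (Fin n) k}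
    (hf : ∀ j, Converges (f j)) :
    ∃ r : ℝ≥0, 0 < r ∧ ∀ j, weightedNorm (fun _ => (r : ℝ≥0∞)) (f j) ≠ ∞ := by
  choose r hr hf using fun j => converges_iff_const.1 (hf j)
  have h1 : ∀ᶠ s in 𝓝[>] (0 : ℝ≥0), ∀ j, s ≤ r j :=
    eventually_all.2 fun j => (eventually_le_nhds (hr j)).filter_mono nhdsWithin_le_nhds
  obtain ⟨s, hs, hs0⟩ := (h1.and self_mem_nhdsWithin).exists
  exact ⟨s, hs0, fun j => ne_top_of_le_ne_top (hf j) (weightedNorm_mono (fun i => by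
    exact ENNReal.coe_le_coe.2 (hs j)) _)⟩

theorem converges_X (i : Fin n) : Converges (X i : MvPowerSeries (Fin n) k) := by
  rw [converges_iff_const]
  refine ⟨1, one_pos, ?_⟩
  rw [weightedNorm_X]
  simp

theorem Converges.divXPow {f : MvPowerSeries (Fin n) k} (hf : Converges f) (z : Fin n) (D : ℕ) :
    Converges (divXPow z D f) := by
  rw [converges_iff_const] at hf ⊢
  obtain ⟨r, hr, hf⟩ := hf
  refine ⟨r, hr, fun h => hf ?_⟩
  have h1 := weightedNorm_divXPow_le (fun _ => (r : ℝ≥0∞)) z D f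
  rw [h, ENNReal.top_mul] at h1
  · exact top_le_iff.1 h1
  · exact_mod_cast (pow_pos hr D).ne'

theorem Converges.sliceCoeff {f : MvPowerSeries (Fin n) k} (hf : Converges f) (z : Fin n) (D : ℕ) :
    Converges (sliceCoeff z D f) := by
  have h := hf.divXPow z D
  rw [converges_iff_const] at h ⊢
  obtain ⟨r, hr, h⟩ := h
  exact ⟨r, hr, ne_top_of_le_ne_top h (weightedNorm_sliceCoeff_le _ z D f)⟩

theorem Converges.shear {f : MvPowerSeries (Fin n) k} (hf : Converges f) (z : Fin n)
    (c : Fin n → k) : Converges (shear z c f) := by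
  rw [converges_iff_const] at hf ⊢
  obtain ⟨r, hr, hf⟩ := hf
  have h1 : ∀ᶠ s in 𝓝[>] (0 : ℝ≥0), ∀ i, s + ‖c i‖₊ * s ≤ r := by
    refine eventually_all.2 fun i => ?_
    have h2 : Tendsto (fun s : ℝ≥0 => s + ‖c i‖₊ * s) (𝓝 0) (𝓝 (0 + ‖c i‖₊ * 0)) :=
      Continuous.tendsto (by fun_prop) 0
    rw [mul_zero, add_zero] at h2
    exact (h2.eventually (eventually_le_nhds hr)).filter_mono nhdsWithin_le_nhds
  obtain ⟨s, hs, hs0⟩ := (h1.and self_mem_nhdsWithin).exists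
  refine ⟨s, hs0, ne_top_of_le_ne_top hf ((weightedNorm_shear_le _ z c f).trans
    (weightedNorm_mono (fun i => ?_) f))⟩
  have := hs i
  change (s : ℝ≥0∞) + (‖c i‖₊ : ℝ≥0∞) * s ≤ r
  exact_mod_cast this

/-- The radii are chosen equal to `ε r` in the variables of `U` and to `r` in the others; as `p`
vanishes without the variables of `U`, the geometric series of `weightedNorm_divSol_le` converges
for small `ε`. -/
theorem Converges.divSol {U : Finset (Fin n)} {z : Fin n} {D : ℕ} {p g : MvPowerSeries (Fin n) k}
    (hp0 : VanishesOn U p) (hz : partialDegree U (single z D) = 0) (hp : Converges p)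
    (hg : Converges g) : Converges (divSol U z D p g) := by
  obtain ⟨r, hr, h⟩ := Converges.exists_radius (f := ![p, g]) (by
    intro j; fin_cases j <;> assumption)
  have hNp : weightedNorm (fun _ => (r : ℝ≥0∞)) p ≠ ∞ := h 0
  have hNg : weightedNorm (fun _ => (r : ℝ≥0∞)) g ≠ ∞ := h 1
  have hrD : (r : ℝ≥0∞) ^ D ≠ 0 := by exact_mod_cast (pow_pos hr D).ne'
  have hrD' : (r : ℝ≥0∞) ^ D ≠ ∞ := by exact_mod_cast ENNReal.coe_ne_top
  -- choose `ε` so small that the division operator becomes a contraction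
  obtain ⟨ε, hε0, hε1, hε⟩ : ∃ ε : ℝ≥0, 0 < ε ∧ ε ≤ 1 ∧
      (ε : ℝ≥0∞) * (weightedNorm (fun _ => (r : ℝ≥0∞)) p * ((r : ℝ≥0∞) ^ D)⁻¹) ≤ 2⁻¹ := by
    have hC : weightedNorm (fun _ => (r : ℝ≥0∞)) p * ((r : ℝ≥0∞) ^ D)⁻¹ ≠ ∞ :=
      ENNReal.mul_ne_top hNp (ENNReal.inv_ne_top.2 hrD)
    lift weightedNorm (fun _ => (r : ℝ≥0∞)) p * ((r : ℝ≥0∞) ^ D)⁻¹ to ℝ≥0 using hC with C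
    have h2 : Tendsto (fun s : ℝ≥0 => s * C) (𝓝 0) (𝓝 (0 * C)) :=
      Continuous.tendsto (by fun_prop) 0
    rw [zero_mul] at h2
    have h3 : ∀ᶠ s in 𝓝[>] (0 : ℝ≥0), s ≤ 1 ∧ s * C ≤ 2⁻¹ :=
      ((eventually_le_nhds one_pos).and (h2.eventually (eventually_le_nhds (by norm_num)))).filter_mono
        nhdsWithin_le_nhds
    obtain ⟨s, ⟨hs, hs'⟩, hs0⟩ := (h3.and self_mem_nhdsWithin).exists
    refine ⟨s, hs0, hs, ?_⟩
    have h4 : ((s * C : ℝ≥0) : ℝ≥0∞) ≤ ((2⁻¹ : ℝ≥0) : ℝ≥0∞) := by exact_mod_cast hs'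
    rwa [ENNReal.coe_mul, ENNReal.coe_inv two_ne_zero, ENNReal.coe_ofNat] at h4
  rw [converges_iff]
  refine ⟨fun i => if i ∈ U then ε * r else r, fun i => ?_, ?_⟩
  · dsimp only
    split_ifs
    · exact mul_pos hε0 hr
    · exact hr
  have hρ : (fun i => ((if i ∈ U then ε * r else r : ℝ≥0) : ℝ≥0∞)) =
      fun i => if i ∈ U then (ε : ℝ≥0∞) * r else r := by
    funext i; split_ifs <;> simp
  rw [hρ]
  have hρz : (if z ∈ U then (ε : ℝ≥0∞) * r else r) ^ D = (r : ℝ≥0∞) ^ D := by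
    split_ifs with hzU
    · have hD : D = 0 := by
        rw [partialDegree, Finset.sum_eq_zero_iff] at hz
        simpa using hz z hzU
      rw [hD, pow_zero, pow_zero]
    · rfl
  have h5 := weightedNorm_shrink_le (ρ := fun _ => (r : ℝ≥0∞)) hp0
    (show (ε : ℝ≥0∞) ≤ 1 by exact_mod_cast hε1)
  have h6 : weightedNorm (fun i => if i ∈ U then (ε : ℝ≥0∞) * r else r) g ≤
      weightedNorm (fun _ => (r : ℝ≥0∞)) g := by
    refine weightedNorm_mono (fun i => ?_) g
    dsimp only
    split_ifs
    · exact mul_le_of_le_one_left zero_le (by exact_mod_cast hε1)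
    · exact le_rfl
  refine ne_top_of_le_ne_top ?_ (weightedNorm_divSol_le g (by rwa [hρz]) (by rwa [hρz]))
  rw [hρz]
  refine ne_top_of_le_ne_top ?_ (ENNReal.tsum_le_tsum fun i => mul_le_mul' (pow_le_pow_left'
    (a := _) (b := 2⁻¹) ?_ i) h6)
  · rw [ENNReal.tsum_mul_right, ENNReal.tsum_geometric, ENNReal.one_sub_inv_two, inv_inv]
    exact ENNReal.mul_ne_top (by simp) hNg
  · refine le_trans ?_ hε
    rw [← mul_assoc]
    gcongr

theorem isWeierstrass_convergentSeries : IsWeierstrass (convergentSeries k n) where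
  X_mem := converges_X
  divXPow_mem z D hf := Converges.divXPow hf z D
  sliceCoeff_mem z j hf := Converges.sliceCoeff hf z j
  divSol_mem hp hz hpm hg := Converges.divSol hp hz hpm hg
  shear_mem z c hf := Converges.shear hf z c

theorem Converges.pderiv {f : MvPowerSeries (Fin n) k} (hf : Converges f) (i : Fin n) :
    Converges (pderiv k i f) := by
  obtain ⟨r, hr, hf⟩ := hf
  have h2 : (0 : ℝ) < r / 2 := by positivity
  refine ⟨r / 2, h2, ?_⟩
  have h3 := (hf.comp_injective (add_left_injective (single i 1))).mul_left r⁻¹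
  refine Summable.of_nonneg_of_le (fun m => by positivity) (fun m => ?_) h3
  have h4 : ‖((m i : k) + 1)‖ ≤ 2 ^ m.degree := by
    have h5 : ‖((m i + 1 : ℕ) : k)‖ ≤ ((m i + 1 : ℕ) : ℝ) := by
      have := Nat.norm_cast_le (α := k) (m i + 1)
      rwa [norm_one, mul_one] at this
    have h6 : m i + 1 ≤ 2 ^ m.degree :=
      (Nat.lt_two_pow_self).trans_le (Nat.pow_le_pow_right two_pos (Finsupp.le_degree i m))
    push_cast at h5
    exact h5.trans (by exact_mod_cast h6)
  simp only [Function.comp_apply]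
  rw [coeff_pderiv, norm_mul, div_pow, map_add, Finsupp.degree_single, pow_succ]
  calc ‖coeff (m + single i 1) f‖ * ‖((m i : k) + 1)‖ * (r ^ m.degree / 2 ^ m.degree)
      ≤ ‖coeff (m + single i 1) f‖ * 2 ^ m.degree * (r ^ m.degree / 2 ^ m.degree) := by gcongr
    _ = r⁻¹ * (‖coeff (m + single i 1) f‖ * (r ^ m.degree * r)) := by
      field_simp

end WeightedNorm

/-! ### Values and derivatives of convergent power series -/

section Evaluation
open MvPowerSeries Finsupp
open scoped ENNReal NNReal

variable {k : Type*} [NontriviallyNormedField k] {n : ℕ}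

/-- The series that converge absolutely on the closed polydisc of radius `r`. -/
def convergentOn (k : Type*) [NontriviallyNormedField k] (n : ℕ) (r : ℝ≥0) :
    Subalgebra k (MvPowerSeries (Fin n) k) where
  carrier := {f | weightedNorm (fun _ => (r : ℝ≥0∞)) f ≠ ∞}
  mul_mem' {f g} hf hg := ne_top_of_le_ne_top (ENNReal.mul_ne_top hf hg) (weightedNorm_mul_le _ f g)
  add_mem' {f g} hf hg := ne_top_of_le_ne_top (ENNReal.add_ne_top.2 ⟨hf, hg⟩)
    (weightedNorm_add_le _ f g)
  algebraMap_mem' c := by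
    change weightedNorm _ (C c) ≠ ∞
    rw [weightedNorm_C]
    exact enorm_ne_top

theorem mem_convergentOn {r : ℝ≥0} {f : MvPowerSeries (Fin n) k} :
    f ∈ convergentOn k n r ↔ weightedNorm (fun _ => (r : ℝ≥0∞)) f ≠ ∞ := Iff.rfl

theorem convergentOn_anti {r s : ℝ≥0} (h : s ≤ r) : convergentOn k n r ≤ convergentOn k n s :=
  fun f hf => ne_top_of_le_ne_top hf (weightedNorm_mono (fun _ => ENNReal.coe_le_coe.2 h) f)

theorem X_mem_convergentOn (r : ℝ≥0) (i : Fin n) :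
    (X i : MvPowerSeries (Fin n) k) ∈ convergentOn k n r := by
  rw [mem_convergentOn, weightedNorm_X]
  exact ENNReal.coe_ne_top

theorem valueAt_eq (f : MvPowerSeries (Fin n) k) (a : Fin n → k) :
    valueAt f a = ∑' m : Fin n →₀ ℕ, coeff m f * ∏ i, a i ^ m i := by
  rw [valueAt, ← coeff_zero_eq_constantCoeff_apply]
  refine tsum_congr fun m => ?_
  simp

/-- The gradient, read off from the expansion at `a`, consists of the values of the formal partial
derivatives. -/
theorem gradientAt_eq (f : MvPowerSeries (Fin n) k) (a : Fin n → k) (i : Fin n) :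
    gradientAt f a i = valueAt (pderiv k i f) a := by
  rw [valueAt_eq]
  refine tsum_congr fun m => ?_
  rw [coeff_pderiv, add_comm (single i 1) m, mul_assoc]
  congr 1
  rw [← Finset.mul_prod_erase _ _ (Finset.mem_univ i),
    ← Finset.mul_prod_erase _ (fun j => a j ^ m j) (Finset.mem_univ i), ← mul_assoc]
  congr 1
  · simp [add_comm]
  · refine Finset.prod_congr rfl fun j hj => ?_
    simp [Finsupp.single_eq_of_ne (Finset.ne_of_mem_erase hj)]

/-- A zero at which the gradient vanishes has multiplicity at least two. -/
theorem two_le_multAt {f : MvPowerSeries (Fin n) k} {a : Fin n → k} (h0 : valueAt f a = 0)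
    (h1 : ∀ i, gradientAt f a i = 0) : 2 ≤ multAt f a := by
  refine nat_le_order fun m hm => ?_
  interval_cases h : m.degree
  · rw [Finsupp.degree_eq_zero_iff] at h
    rw [h, coeff_zero_eq_constantCoeff_apply]
    exact h0
  · obtain ⟨i, rfl⟩ : ∃ i, m = single i 1 := by
      have h2 : m ≠ 0 := by rintro rfl; simp at h
      obtain ⟨i, hi⟩ := Finsupp.ne_iff.1 h2
      have h3 : single i 1 ≤ m := Finsupp.single_le_iff.2 (Nat.one_le_iff_ne_zero.2 hi)
      obtain ⟨l, rfl⟩ := le_iff_exists_add.1 h3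
      rw [map_add, Finsupp.degree_single] at h
      have h4 : l = 0 := (Finsupp.degree_eq_zero_iff l).1 (by omega)
      exact ⟨i, by rw [h4, add_zero]⟩
    exact h1 i

theorem enorm_prod_pow_le {r : ℝ≥0} {a : Fin n → k} (ha : ∀ i, ‖a i‖₊ ≤ r) (m : Fin n →₀ ℕ) :
    ‖∏ i, a i ^ m i‖ₑ ≤ radiusPow (fun _ => (r : ℝ≥0∞)) m := by
  rw [radiusPow]
  have : ‖∏ i, a i ^ m i‖ₑ = ∏ i, ‖a i‖ₑ ^ m i := by
    have : ∏ i, ‖a i‖ₑ ^ m i = ((∏ i, ‖a i‖₊ ^ m i : ℝ≥0) : ℝ≥0∞) := by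
      push_cast; rfl
    rw [this, enorm_eq_nnnorm, nnnorm_prod]
    simp
  rw [this]
  exact Finset.prod_le_prod' fun i _ => pow_le_pow_left' (ENNReal.coe_le_coe.2 (ha i)) _

theorem tsum_enorm_le {r : ℝ≥0} {a : Fin n → k} (ha : ∀ i, ‖a i‖₊ ≤ r)
    (f : MvPowerSeries (Fin n) k) :
    ∑' m : Fin n →₀ ℕ, ‖coeff m f * ∏ i, a i ^ m i‖ₑ ≤ weightedNorm (fun _ => (r : ℝ≥0∞)) f := by
  refine ENNReal.tsum_le_tsum fun m => ?_
  rw [enorm_mul]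
  gcongr
  exact enorm_prod_pow_le ha m

theorem summable_norm_of_tsum_enorm {ι : Type*} {F : ι → k} (h : ∑' i, ‖F i‖ₑ ≠ ∞) :
    Summable fun i => ‖F i‖ := by
  have h1 : ∑' i, ((‖F i‖₊ : ℝ≥0) : ℝ≥0∞) ≠ ∞ := h
  rw [ENNReal.tsum_coe_ne_top_iff_summable, ← NNReal.summable_coe] at h1
  exact h1

theorem summable_norm_eval {r : ℝ≥0} {a : Fin n → k} (ha : ∀ i, ‖a i‖₊ ≤ r)
    {f : MvPowerSeries (Fin n) k} (hf : f ∈ convergentOn k n r) :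
    Summable fun m : Fin n →₀ ℕ => ‖coeff m f * ∏ i, a i ^ m i‖ :=
  summable_norm_of_tsum_enorm (ne_top_of_le_ne_top hf (tsum_enorm_le ha f))

theorem summable_eval [CompleteSpace k] {r : ℝ≥0} {a : Fin n → k} (ha : ∀ i, ‖a i‖₊ ≤ r)
    {f : MvPowerSeries (Fin n) k} (hf : f ∈ convergentOn k n r) :
    Summable fun m : Fin n →₀ ℕ => coeff m f * ∏ i, a i ^ m i :=
  Summable.of_norm (summable_norm_eval ha hf)

theorem valueAt_mul [CompleteSpace k] {r : ℝ≥0} {a : Fin n → k} (ha : ∀ i, ‖a i‖₊ ≤ r)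
    {f g : MvPowerSeries (Fin n) k} (hf : f ∈ convergentOn k n r) (hg : g ∈ convergentOn k n r) :
    valueAt (f * g) a = valueAt f a * valueAt g a := by
  classical
  set F : (Fin n →₀ ℕ) → k := fun m => coeff m f * ∏ i, a i ^ m i
  set G : (Fin n →₀ ℕ) → k := fun m => coeff m g * ∏ i, a i ^ m i
  have hF : Summable fun m => ‖F m‖ := summable_norm_eval ha hf
  have hG : Summable fun m => ‖G m‖ := summable_norm_eval ha hg
  have hFG : Summable fun q : (Fin n →₀ ℕ) × (Fin n →₀ ℕ) => F q.1 * G q.2 :=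
    summable_mul_of_summable_norm hF hG
  have key := Summable.tsum_mul_tsum_eq_tsum_sum_antidiagonal (summable_eval ha hf)
    (summable_eval ha hg) hFG
  rw [valueAt_eq, valueAt_eq, valueAt_eq, key]
  refine tsum_congr fun m => ?_
  rw [coeff_mul, Finset.sum_mul]
  refine Finset.sum_congr rfl fun p hp => ?_
  rw [← Finset.HasAntidiagonal.mem_antidiagonal.1 hp]
  simp only [Finsupp.add_apply, pow_add, Finset.prod_mul_distrib]
  ring

theorem enorm_valueAt_le [CompleteSpace k] {r : ℝ≥0} {a : Fin n → k} (ha : ∀ i, ‖a i‖₊ ≤ r)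
    (f : MvPowerSeries (Fin n) k) :
    ‖valueAt f a‖ₑ ≤ weightedNorm (fun _ => (r : ℝ≥0∞)) f := by
  rw [valueAt_eq]
  exact enorm_tsum_le_tsum_enorm.trans (tsum_enorm_le ha f)

theorem valueAt_C (c : k) (a : Fin n → k) : valueAt (C c) a = c := by
  classical
  rw [valueAt_eq, tsum_eq_single 0]
  · simp
  · intro m hm
    rw [coeff_C, if_neg hm, zero_mul]

theorem valueAt_X (i : Fin n) (a : Fin n → k) : valueAt (X i) a = a i := by
  classical
  rw [valueAt_eq, tsum_eq_single (single i 1)]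
  · rw [coeff_X, if_pos rfl, one_mul, Finset.prod_eq_single_of_mem i (Finset.mem_univ i)]
    · simp
    · intro j _ hj
      simp [Finsupp.single_eq_of_ne hj]
  · intro m hm
    rw [coeff_X, if_neg hm, zero_mul]

variable [CompleteSpace k]

/-- Evaluation at a point of the polydisc of radius `r`. -/
def evalHom {r : ℝ≥0} {a : Fin n → k} (ha : ∀ i, ‖a i‖₊ ≤ r) : convergentOn k n r →ₐ[k] k where
  toFun f := valueAt f a
  map_one' := by
    rw [OneMemClass.coe_one, ← map_one C, valueAt_C]
  map_zero' := by
    rw [ZeroMemClass.coe_zero, ← map_zero C, valueAt_C]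
  map_add' f g := by
    rw [valueAt_eq, valueAt_eq, valueAt_eq, ← Summable.tsum_add]
    · refine tsum_congr fun m => ?_
      rw [AddMemClass.coe_add, map_add, add_mul]
    · exact summable_eval ha f.2
    · exact summable_eval ha g.2
  map_mul' f g := valueAt_mul ha f.2 g.2
  commutes' c := valueAt_C c a

theorem evalHom_apply {r : ℝ≥0} {a : Fin n → k} (ha : ∀ i, ‖a i‖₊ ≤ r) (f : convergentOn k n r) :
    evalHom ha f = valueAt f a := rfl

omit [CompleteSpace k] in
/-- A convergent series depends only on the variables that occur in it. -/
theorem valueAt_congr {T : Finset (Fin n)} {f : MvPowerSeries (Fin n) k} (hf : f ∈ seriesIn k T)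
    {a b : Fin n → k} (hab : ∀ i ∈ T, a i = b i) : valueAt f a = valueAt f b := by
  rw [valueAt_eq, valueAt_eq]
  refine tsum_congr fun m => ?_
  by_cases hm : ∃ i ∉ T, m i ≠ 0
  · rw [hf m hm, zero_mul, zero_mul]
  · push Not at hm
    congr 1
    refine Finset.prod_congr rfl fun i _ => ?_
    by_cases hi : i ∈ T
    · rw [hab i hi]
    · rw [hm i hi, pow_zero, pow_zero]

/-- A convergent series without constant term is small near the origin. -/
theorem exists_radius_norm_valueAt_le {r : ℝ≥0} (hr : 0 < r) {f : MvPowerSeries (Fin n) k}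
    (hf : f ∈ convergentOn k n r) (h0 : constantCoeff f = 0) {ε : ℝ≥0} (hε : 0 < ε) :
    ∃ s : ℝ≥0, 0 < s ∧ s ≤ r ∧ ∀ a : Fin n → k, (∀ i, ‖a i‖₊ ≤ s) → ‖valueAt f a‖₊ ≤ ε := by
  have hf' := mem_convergentOn.1 hf
  obtain ⟨C, hC⟩ : ∃ C : ℝ≥0, weightedNorm (fun _ => (r : ℝ≥0∞)) f = C := ⟨_, (ENNReal.coe_toNNReal hf').symm⟩
  have h2 : Tendsto (fun s : ℝ≥0 => s * C) (𝓝 0) (𝓝 (0 * C)) := Continuous.tendsto (by fun_prop) 0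
  rw [zero_mul] at h2
  have h3 : ∀ᶠ s in 𝓝[>] (0 : ℝ≥0), s ≤ 1 ∧ s * C ≤ ε :=
    ((eventually_le_nhds one_pos).and (h2.eventually (eventually_le_nhds hε))).filter_mono
      nhdsWithin_le_nhds
  obtain ⟨t, ⟨ht1, ht⟩, ht0⟩ := (h3.and self_mem_nhdsWithin).exists
  refine ⟨t * r, mul_pos ht0 hr, mul_le_of_le_one_left zero_le ht1, fun a ha => ?_⟩
  have hv : VanishesOn Finset.univ f := by
    intro m hm
    have hm0 : m = 0 := by
      rw [partialDegree, Finset.sum_eq_zero_iff] at hm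
      ext i
      exact hm i (Finset.mem_univ i)
    rw [hm0, coeff_zero_eq_constantCoeff_apply, h0]
  have h4 := weightedNorm_shrink_le (ρ := fun _ => (r : ℝ≥0∞)) hv (ε := t)
    (by exact_mod_cast ht1)
  simp only [Finset.mem_univ, if_true] at h4
  have h5 := (enorm_valueAt_le ha f).trans ((le_of_eq (by push_cast; rfl)).trans h4)
  rw [hC] at h5
  have h6 : (‖valueAt f a‖₊ : ℝ≥0∞) ≤ ((t * C : ℝ≥0) : ℝ≥0∞) := by rw [ENNReal.coe_mul]; exact h5
  exact (ENNReal.coe_le_coe.1 h6).trans ht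

/-- Evaluation is compatible with shears. -/
theorem valueAt_shear {r s : ℝ≥0} {z : Fin n} {c : Fin n → k} {f : MvPowerSeries (Fin n) k}
    (hf : f ∈ convergentOn k n r) (hs : ∀ i, s + ‖c i‖₊ * s ≤ r) {a : Fin n → k}
    (ha : ∀ i, ‖a i‖₊ ≤ s) : valueAt (shear z c f) a = valueAt f (fun i => a i + c i * a z) := by
  set g : Fin n → MvPowerSeries (Fin n) k := fun i => X i + C (c i) * X z
  let F : (Fin n →₀ ℕ) → (Fin n →₀ ℕ) → k := fun l m =>
    coeff l f * coeff m (l.prod fun i e => g i ^ e) * ∏ i, a i ^ m i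
  have hF : Summable (Function.uncurry F) := by
    suffices h : ∑' l, ∑' m, ‖F l m‖ₑ ≤ weightedNorm (fun _ => (r : ℝ≥0∞)) f by
      refine Summable.of_norm (summable_norm_of_tsum_enorm (F := Function.uncurry F) ?_)
      have h' : ∑' q, ‖Function.uncurry F q‖ₑ = ∑' l, ∑' m, ‖F l m‖ₑ := ENNReal.tsum_prod'
      rw [h']
      exact ne_top_of_le_ne_top (mem_convergentOn.1 hf) h
    refine ENNReal.tsum_le_tsum fun l => ?_
    calc _ ≤ ∑' m, ‖coeff l f‖ₑ * (‖coeff m (l.prod fun i e => g i ^ e)‖ₑ *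
          radiusPow (fun _ => (s : ℝ≥0∞)) m) := by
          refine ENNReal.tsum_le_tsum fun m => ?_
          simp only [F]
          rw [enorm_mul, enorm_mul, mul_assoc]
          gcongr
          exact enorm_prod_pow_le ha m
      _ = ‖coeff l f‖ₑ * weightedNorm (fun _ => (s : ℝ≥0∞)) (l.prod fun i e => g i ^ e) :=
          ENNReal.tsum_mul_left
      _ ≤ _ := by
          gcongr
          refine (weightedNorm_prod_le _ _ _).trans (radiusPow_mono (fun i => ?_) _)
          refine (weightedNorm_add_le _ _ _).trans ?_
          rw [weightedNorm_X]
          refine (add_le_add_right (weightedNorm_mul_le _ _ _) _).trans ?_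
          rw [weightedNorm_C, weightedNorm_X]
          have := hs i
          change (s : ℝ≥0∞) + (‖c i‖₊ : ℝ≥0∞) * s ≤ r
          exact_mod_cast this
  have hg : ∀ i, g i ∈ convergentOn k n s := fun i => add_mem (X_mem_convergentOn s i)
    (mul_mem ((convergentOn k n s).algebraMap_mem (c i)) (X_mem_convergentOn s z))
  have h1 : ∀ l : Fin n →₀ ℕ, valueAt (l.prod fun i e => g i ^ e) a =
      ∏ i, (a i + c i * a z) ^ l i := by
    intro l
    rw [Finsupp.prod_fintype _ _ (by simp)]
    have h2 : ∏ i, g i ^ l i = ((∏ i, (⟨g i, hg i⟩ : convergentOn k n s) ^ l i :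
        convergentOn k n s) : MvPowerSeries (Fin n) k) := by
      rw [SubmonoidClass.coe_finsetProd]; rfl
    rw [h2, ← evalHom_apply ha, map_prod]
    refine Finset.prod_congr rfl fun i _ => ?_
    rw [map_pow]
    congr 1
    have h3 : (⟨g i, hg i⟩ : convergentOn k n s) = ⟨X i, X_mem_convergentOn s i⟩ +
        algebraMap k _ (c i) * ⟨X z, X_mem_convergentOn s z⟩ := rfl
    have h4 : ∀ j, evalHom ha ⟨X j, X_mem_convergentOn s j⟩ = a j := fun j => valueAt_X j a
    rw [h3, map_add, map_mul, h4, h4, AlgHom.commutes]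
    rfl
  rw [valueAt_eq, valueAt_eq f]
  calc ∑' m, coeff m (shear z c f) * ∏ i, a i ^ m i = ∑' m, ∑' l, F l m := by
        refine tsum_congr fun m => ?_
        rw [shear, substAlgHom_apply, coeff_subst (hasSubst_shear z c),
          ← tsum_eq_finsum (L := .unconditional _)
            (coeff_subst_finite (hasSubst_shear z c) f m), ← tsum_mul_right]
        rfl
    _ = ∑' l, ∑' m, F l m := hF.tsum_comm
    _ = _ := by
        refine tsum_congr fun l => ?_
        rw [← h1, valueAt_eq, ← tsum_mul_left]
        refine tsum_congr fun m => ?_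
        simp only [F]
        ring

end Evaluation

/-! ### Norms of elements of monogenic extensions -/

section Norms
open Polynomial

/-- Over a ring with division by `f`, a non-zero-divisor modulo `f` has a nonzero multiple in the
coefficient ring modulo `f`: the constant term of its minimal equation. -/
theorem exists_multiple_of_division {A R : Type*} [CommRing A] [Nontrivial A] [CommRing R]
    (ι : A →+* R) (z f g : R) {D : ℕ}
    (hdiv : ∀ g, ∃ (q : R) (p : A[X]), p.degree < D ∧ g = q * f + eval₂ ι z p)
    (hg : ∀ u, f ∣ g * u → f ∣ u) : ∃ r : A, r ≠ 0 ∧ ∃ v : R, f ∣ ι r - g * v := by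
  classical
  have hint : ∃ q : A[X], q ≠ 0 ∧ f ∣ eval₂ ι g q := by
    let π := (Ideal.Quotient.mk (Ideal.span {f})).comp ι
    let : Algebra A (R ⧸ Ideal.span {f}) := π.toAlgebra
    have hfin : Module.Finite A (R ⧸ Ideal.span {f}) := by
      refine ⟨⟨(Finset.range D).image fun j => Ideal.Quotient.mk (Ideal.span {f}) (z ^ j), ?_⟩⟩
      rw [eq_top_iff]
      rintro x -
      obtain ⟨x, rfl⟩ := Ideal.Quotient.mk_surjective x
      obtain ⟨q, p, hp, h⟩ := hdiv x
      have h1 : Ideal.Quotient.mk (Ideal.span {f}) x =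
          Ideal.Quotient.mk (Ideal.span {f}) (eval₂ ι z p) := by
        rw [Ideal.Quotient.eq, Ideal.mem_span_singleton, h]
        exact ⟨q, by ring⟩
      rw [h1]
      by_cases hp0 : p = 0
      · simp [hp0]
      rw [Polynomial.eval₂_eq_sum_range' _ (n := D)
        ((Polynomial.natDegree_lt_iff_degree_lt hp0).2 hp), map_sum]
      refine Submodule.sum_mem _ fun j hj => ?_
      rw [map_mul]
      exact Submodule.smul_mem _ (p.coeff j) (Submodule.subset_span
        (Finset.mem_coe.2 (Finset.mem_image_of_mem _ hj)))
    obtain ⟨q, hq, h⟩ := Algebra.IsIntegral.isIntegral (R := A) (Ideal.Quotient.mk (Ideal.span {f}) g)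
    refine ⟨q, hq.ne_zero, ?_⟩
    rw [← Ideal.mem_span_singleton, ← Ideal.Quotient.eq_zero_iff_mem, hom_eval₂]
    exact h
  have hd : ∃ d, ∃ q : A[X], q ≠ 0 ∧ f ∣ eval₂ ι g q ∧ q.natDegree = d := by
    obtain ⟨q, h1, h2⟩ := hint
    exact ⟨_, q, h1, h2, rfl⟩
  obtain ⟨q, hq0, hq, hqd⟩ := Nat.find_spec hd
  have h1 : eval₂ ι g q = g * eval₂ ι g q.divX + ι (q.coeff 0) := by
    conv_lhs => rw [← divX_mul_X_add q]
    rw [eval₂_add, eval₂_mul, eval₂_X, eval₂_C]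
    ring
  refine ⟨q.coeff 0, fun h0 => ?_, -eval₂ ι g q.divX, ?_⟩
  · rw [h0, map_zero, add_zero] at h1
    rw [h1] at hq
    have h2 : q.divX ≠ 0 := by
      intro h
      apply hq0
      rw [← divX_mul_X_add q, h, h0]; simp
    refine Nat.find_min hd (m := q.divX.natDegree) ?_ ⟨_, h2, hg _ hq, rfl⟩
    rw [← hqd, natDegree_divX_eq_natDegree_tsub_one]
    have : q.natDegree ≠ 0 := by
      intro h
      rw [natDegree_eq_zero] at h
      obtain ⟨c, rfl⟩ := h
      simp at h0
      rw [h0, C_0] at hq0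
      exact hq0 rfl
    omega
  · rw [h1] at hq
    convert hq using 1
    ring

end Norms

/-! ### Coordinates adapted to a pair of germs -/

section Coordinates
open MvPowerSeries Finsupp

variable {k : Type*} [Field k] {n : ℕ} {O : Subalgebra k (MvPowerSeries (Fin n) k)}

/-- Coordinates adapted to the ideal `(f₁, f₂)`: the series `f₁` is regular in `x_z`, and the
ideal contains, modulo `f₁`, a series `r` in the variables other than `x_z` that is regular
in `x_y`. -/
structure AdaptedPair (O : Subalgebra k (MvPowerSeries (Fin n) k)) (T : Finset (Fin n))
    (y z : Fin n) (D E : ℕ) (f₁ f₂ r v : MvPowerSeries (Fin n) k) : Prop where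
  notMem_y : y ∉ T
  notMem_z : z ∉ insert y T
  cover : insert z (insert y T) = Finset.univ
  mem₁ : f₁ ∈ O
  mem₂ : f₂ ∈ O
  regular₁ : IsRegularIn z D f₁
  mem_r : r ∈ O ⊓ seriesIn k (insert y T)
  regular_r : IsRegularIn y E r
  mem_v : v ∈ O
  dvd : ∃ e ∈ O, r - f₂ * v = f₁ * e

namespace AdaptedPair

variable {T : Finset (Fin n)} {y z : Fin n} {D E : ℕ} {f₁ f₂ r v : MvPowerSeries (Fin n) k}
  (h : AdaptedPair O T y z D E f₁ f₂ r v) (hO : IsWeierstrass O)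
include h hO

/-- Division by `f₁`. -/
theorem division₁ {g : MvPowerSeries (Fin n) k} (hg : g ∈ O) :
    ∃ q ∈ O, ∃ p : ℕ → MvPowerSeries (Fin n) k, (∀ j, p j ∈ O ⊓ seriesIn k (insert y T)) ∧
      g = q * f₁ + ∑ j ∈ Finset.range D, p j * X z ^ j := by
  obtain ⟨q, p, hq, hp, e⟩ := hO.exists_division (T := insert y T) h.regular₁
    ⟨h.mem₁, by rw [h.cover]; exact mem_seriesIn_univ _⟩
    ⟨hg, by rw [h.cover]; exact mem_seriesIn_univ _⟩
  exact ⟨q, hq.1, p, hp, e⟩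

/-- Division by `r`, in the series without `x_z`. -/
theorem division_r {g : MvPowerSeries (Fin n) k} (hg : g ∈ O ⊓ seriesIn k (insert y T)) :
    ∃ q ∈ O ⊓ seriesIn k (insert y T), ∃ c : ℕ → MvPowerSeries (Fin n) k,
      (∀ j, c j ∈ O ⊓ seriesIn k T) ∧ g = q * r + ∑ j ∈ Finset.range E, c j * X y ^ j := by
  obtain ⟨q, p, hq, hp, e⟩ := hO.exists_division (T := T) h.regular_r h.mem_r hg
  exact ⟨q, hq, p, hp, e⟩

omit hO in
theorem unique₁ {q : MvPowerSeries (Fin n) k} {p : ℕ → MvPowerSeries (Fin n) k}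
    (hp : ∀ j, p j ∈ seriesIn k (insert y T))
    (e : q * f₁ = ∑ j ∈ Finset.range D, p j * X z ^ j) {j : ℕ} (hj : j < D) : p j = 0 := by
  have hq := h.regular₁.eq_zero_of_mul_eq h.notMem_z hp e
  rw [hq, zero_mul] at e
  exact eq_zero_of_sum_mul_X_pow h.notMem_z hp e.symm hj

omit hO in
theorem unique_r {q : MvPowerSeries (Fin n) k} {p : ℕ → MvPowerSeries (Fin n) k}
    (hp : ∀ j, p j ∈ seriesIn k T)
    (e : q * r = ∑ j ∈ Finset.range E, p j * X y ^ j) {j : ℕ} (hj : j < E) : p j = 0 := by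
  have hq := h.regular_r.eq_zero_of_mul_eq h.notMem_y hp e
  rw [hq, zero_mul] at e
  exact eq_zero_of_sum_mul_X_pow h.notMem_y hp e.symm hj

/-- `O / (f₁, r)` is torsion free over the series in the variables of `T`. -/
theorem torsionFree_r {a u : MvPowerSeries (Fin n) k} (ha : a ∈ O ⊓ seriesIn k T) (ha0 : a ≠ 0)
    (hu : u ∈ O) {α β : MvPowerSeries (Fin n) k} (hβ : β ∈ O)
    (e : a * u = α * f₁ + β * r) : ∃ α' ∈ O, ∃ β' ∈ O, u = α' * f₁ + β' * r := by
  have hr0 : r ≠ 0 := by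
    intro h0
    apply h.regular_r.2
    rw [h0, map_zero]
  obtain ⟨q, hq, p, hp, eu⟩ := h.division₁ hO hu
  obtain ⟨q', hq', p', hp', eβ⟩ := h.division₁ hO hβ
  have hTT := inf_le_inf_left O (seriesIn_mono (k := k) (Finset.subset_insert y T))
  have hcoef : ∀ j < D, a * p j = r * p' j := by
    intro j hj
    rw [← sub_eq_zero]
    refine h.unique₁ (q := α + r * q' - a * q) (p := fun j => a * p j - r * p' j)
      (fun j => sub_mem (mul_mem (hTT ha).2 (hp j).2) (mul_mem h.mem_r.2 (hp' j).2)) ?_ hj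
    simp only [sub_mul, Finset.sum_sub_distrib, mul_assoc, ← Finset.mul_sum]
    rw [eu, eβ] at e
    linear_combination -e
  have hdvd : ∀ j, ∃ w, w ∈ O ∧ (j < D → p j = w * r) := by
    intro j
    by_cases hj : j < D
    · obtain ⟨w, hw, c, hc, ew⟩ := h.division_r hO (hp j)
      have hc0 : ∀ i < E, c i = 0 := by
        intro i hi
        have h1 : a * c i = 0 := by
          refine h.unique_r (q := p' j - a * w) (p := fun i => a * c i)
            (fun i => mul_mem ha.2 (hc i).2) ?_ hi
          simp only [mul_assoc, ← Finset.mul_sum]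
          have := hcoef j hj
          rw [ew] at this
          linear_combination -this
        exact (mul_eq_zero.1 h1).resolve_left ha0
      refine ⟨w, hw.1, fun _ => ?_⟩
      rw [ew, Finset.sum_eq_zero, add_zero]
      intro i hi
      rw [hc0 i (Finset.mem_range.1 hi), zero_mul]
    · exact ⟨0, zero_mem O, fun hj' => absurd hj' hj⟩
  choose w hw hpw using hdvd
  refine ⟨q, hq, ∑ j ∈ Finset.range D, w j * X z ^ j,
    sum_mem fun j _ => mul_mem (hw j) (pow_mem (hO.X_mem z) j), ?_⟩
  rw [eu, Finset.sum_mul]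
  congr 1
  refine Finset.sum_congr rfl fun j hj => ?_
  rw [hpw j (Finset.mem_range.1 hj)]
  ring

/-- `O / (f₁, f₂)` is torsion free over the series in the variables of `T`. -/
theorem torsionFree {a u : MvPowerSeries (Fin n) k} (ha : a ∈ O ⊓ seriesIn k T) (ha0 : a ≠ 0)
    (hu : u ∈ O) {α β : MvPowerSeries (Fin n) k} (hβ : β ∈ O)
    (e : a * u = α * f₁ + β * f₂) : ∃ α' ∈ O, ∃ β' ∈ O, u = α' * f₁ + β' * f₂ := by
  obtain ⟨d, hd, ed⟩ := h.dvd
  have hr0 : r ≠ 0 := by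
    intro h0
    apply h.regular_r.2
    rw [h0, map_zero]
  obtain ⟨α₁, hα₁, β₁, hβ₁, e₁⟩ := h.torsionFree_r hO ha ha0 (mul_mem hu h.mem_v)
    (α := α * v - β * d) hβ
    (by linear_combination v * e - β * ed)
  -- `v` divides `r` modulo `f₁`, hence is not a zero divisor modulo `f₁`
  set w := u - β₁ * f₂
  have hw : w ∈ O := sub_mem hu (mul_mem hβ₁ h.mem₂)
  have e₂ : v * w = f₁ * (α₁ + β₁ * d) := by
    simp only [w]; linear_combination e₁ + β₁ * ed
  obtain ⟨q, hq, p, hp, ew⟩ := h.division₁ hO hw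
  have hp0 : ∀ j < D, p j = 0 := by
    intro j hj
    have h1 : r * p j = 0 := by
      refine h.unique₁ (q := f₂ * (α₁ + β₁ * d) + d * w - r * q) (p := fun j => r * p j)
        (fun j => mul_mem h.mem_r.2 (hp j).2) ?_ hj
      simp only [mul_assoc, ← Finset.mul_sum]
      linear_combination r * ew - f₂ * e₂ - w * ed
    exact (mul_eq_zero.1 h1).resolve_left hr0
  rw [Finset.sum_eq_zero (fun j hj => by rw [hp0 j (Finset.mem_range.1 hj), zero_mul]),
    add_zero] at ew
  exact ⟨q, hq, β₁, hβ₁, by simp only [w] at ew; linear_combination ew⟩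

end AdaptedPair
end Coordinates

/-! ### Extension of ring homomorphisms and bounds for roots -/

section Extension

/-- A homomorphism to an algebraically closed field extends along an integral extension of domains,
and the extension can be chosen nonzero at a given element, outside a proper closed set. -/
theorem exists_ringHom_extension {K Λ B : Type*} [Field K] [IsAlgClosed K] [CommRing Λ] [Nontrivial Λ]
    [Algebra K Λ] [CommRing B] [IsDomain B] [Algebra Λ B] [Algebra.IsIntegral Λ B]
    (hinj : Function.Injective (algebraMap Λ B)) {b : B} (hb : b ≠ 0) :
    ∃ s : Λ, s ≠ 0 ∧ ∀ e : Λ →ₐ[K] K, e s ≠ 0 →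
      ∃ χ : B →+* K, (∀ l, χ (algebraMap Λ B l) = e l) ∧ χ b ≠ 0 := by
  have h1 : (Ideal.span {b}).comap (algebraMap Λ B) ≠ ⊥ :=
    Ideal.comap_ne_bot_of_integral_mem hb (Ideal.mem_span_singleton_self b)
      (Algebra.IsIntegral.isIntegral b)
  obtain ⟨s, hs, hs0⟩ := Submodule.exists_mem_ne_zero_of_ne_bot h1
  refine ⟨s, hs0, fun e he => ?_⟩
  have hker : RingHom.ker (algebraMap Λ B) ≤ RingHom.ker e := by
    rw [(RingHom.injective_iff_ker_eq_bot _).1 hinj]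
    exact bot_le
  have : (RingHom.ker e).IsPrime := RingHom.ker_isPrime _
  obtain ⟨Q, hQ, hQe⟩ := Ideal.exists_ideal_over_prime_of_isIntegral_of_isDomain
    (S := B) (RingHom.ker e) hker
  let π : B →+* B ⧸ Q := Ideal.Quotient.mk Q
  let : Algebra K (B ⧸ Q) := (π.comp ((algebraMap Λ B).comp (algebraMap K Λ))).toAlgebra
  have hπ : ∀ l : Λ, π (algebraMap Λ B l) = algebraMap K (B ⧸ Q) (e l) := by
    intro l
    change _ = π (algebraMap Λ B (algebraMap K Λ (e l)))
    rw [Ideal.Quotient.eq, ← map_sub, ← Ideal.mem_comap]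
    rw [hQe, RingHom.mem_ker, map_sub, AlgHom.commutes, sub_eq_zero]
    rfl
  have hint : Algebra.IsIntegral K (B ⧸ Q) := by
    refine ⟨fun x => ?_⟩
    obtain ⟨x, rfl⟩ := Ideal.Quotient.mk_surjective x
    obtain ⟨p, hp, hx⟩ := Algebra.IsIntegral.isIntegral (R := Λ) x
    refine ⟨p.map (e : Λ →+* K), hp.map _, ?_⟩
    have h2 : (algebraMap K (B ⧸ Q)).comp (e : Λ →+* K) = π.comp (algebraMap Λ B) :=
      RingHom.ext fun l => (hπ l).symm
    rw [Polynomial.eval₂_map, h2, ← Polynomial.hom_eval₂, hx, map_zero]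
  let ε := RingEquiv.ofBijective _
    (IsAlgClosed.algebraMap_bijective_of_isIntegral (k := K) (K := B ⧸ Q))
  refine ⟨(ε.symm : B ⧸ Q →+* K).comp π, fun l => ?_, fun h => he ?_⟩
  · change ε.symm (π _) = _
    rw [hπ, RingEquiv.symm_apply_eq]
    rfl
  · have h2 : π b = 0 := (map_eq_zero_iff ε.symm ε.symm.injective).1 h
    have h3 : b ∈ Q := Ideal.Quotient.eq_zero_iff_mem.1 h2
    have h4 : s ∈ Q.comap (algebraMap Λ B) := (Ideal.span_singleton_le_iff_mem Q).2 h3 hs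
    rw [hQe] at h4
    exact h4

/-- A root of a Weierstrass polynomial with small coefficients is small. -/
theorem norm_le_of_pow_eq_sum {k : Type*} [NormedField k] {E : ℕ} {c : ℕ → k} {x : k} {η : ℝ}
    (hη : 0 < η) (hη1 : η ≤ 1) (hc : ∀ j < E, ‖c j‖ ≤ η ^ E / (E + 1))
    (hx : x ^ E = ∑ j ∈ Finset.range E, c j * x ^ j) : ‖x‖ ≤ η := by
  by_contra! h
  have h1 : ∀ j ∈ Finset.range E, ‖c j * x ^ j‖ ≤ ‖x‖ ^ E / (E + 1) := by
    intro j hj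
    rw [Finset.mem_range] at hj
    have h2 : η ^ E * ‖x‖ ^ j ≤ ‖x‖ ^ E := by
      calc η ^ E * ‖x‖ ^ j ≤ η ^ (E - j) * ‖x‖ ^ j := by
            gcongr ?_ * _
            exact pow_le_pow_of_le_one hη.le hη1 (Nat.sub_le E j)
        _ ≤ ‖x‖ ^ (E - j) * ‖x‖ ^ j := by gcongr
        _ = ‖x‖ ^ E := by rw [← pow_add, Nat.sub_add_cancel hj.le]
    rw [norm_mul, norm_pow]
    calc ‖c j‖ * ‖x‖ ^ j ≤ η ^ E / (E + 1) * ‖x‖ ^ j := by gcongr; exact hc j hj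
      _ = (η ^ E * ‖x‖ ^ j) / (E + 1) := by ring
      _ ≤ _ := by gcongr
  have h3 : ‖x‖ ^ E ≤ E * (‖x‖ ^ E / (E + 1)) := by
    calc ‖x‖ ^ E = ‖∑ j ∈ Finset.range E, c j * x ^ j‖ := by rw [← norm_pow, hx]
      _ ≤ ∑ j ∈ Finset.range E, ‖c j * x ^ j‖ := norm_sum_le _ _
      _ ≤ ∑ j ∈ Finset.range E, ‖x‖ ^ E / (E + 1) := Finset.sum_le_sum h1
      _ = _ := by simp
  have h4 : 0 < ‖x‖ ^ E := pow_pos (hη.trans h) E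
  rw [mul_div_assoc', le_div_iff₀ (by positivity)] at h3
  nlinarith

end Extension

/-! ### Existence of adapted coordinates -/

section Weierstrass
open MvPowerSeries Finsupp

variable {k : Type*} [Field k] {n : ℕ} {O : Subalgebra k (MvPowerSeries (Fin n) k)}

/-- The Weierstrass preparation theorem, in terms of power series. -/
theorem IsWeierstrass.exists_eq_mul_weierstrass (hO : IsWeierstrass O) {T : Finset (Fin n)}
    {z : Fin n} (hz : z ∉ T) {D : ℕ} {f : MvPowerSeries (Fin n) k} (hfD : IsRegularIn z D f)
    (hf : f ∈ O ⊓ seriesIn k (insert z T)) :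
    ∃ c : ℕ → MvPowerSeries (Fin n) k, (∀ j, c j ∈ O ⊓ seriesIn k T) ∧
      (∀ j, constantCoeff (c j) = 0) ∧ ∃ w ∈ O ⊓ seriesIn k (insert z T), constantCoeff w ≠ 0 ∧
        f = w * (X z ^ D - ∑ j ∈ Finset.range D, c j * X z ^ j) := by
  obtain ⟨W, hW, hWD, hW0, u, hu⟩ := hO.exists_preparation hz (f := ⟨f, hf⟩) hfD
  refine ⟨fun j => if j < D then -(W.coeff j : MvPowerSeries (Fin n) k) else 0, fun j => ?_,
    fun j => ?_, (u : partialRing O (insert z T)).1, (u : partialRing O (insert z T)).2,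
    (hO.isUnit_iff z _).1 u.isUnit, ?_⟩
  · dsimp only
    split_ifs
    · exact neg_mem (W.coeff j).2
    · exact zero_mem _
  · dsimp only
    split_ifs with h
    · rw [map_neg, hW0 j h, neg_zero]
    · exact map_zero _
  · have h1 : (W - Polynomial.X ^ D).degree < (D : WithBot ℕ) := by
      have h2 : W.degree = (Polynomial.X ^ D : Polynomial (partialRing O T)).degree := by
        rw [hWD, Polynomial.degree_X_pow]
      have := Polynomial.degree_sub_lt_left h2 hW.ne_zero (by rw [hW, Polynomial.leadingCoeff_X_pow])
      rwa [hWD] at this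
    have h3 := hO.coe_eval₂ (z := z) _ h1
    rw [Polynomial.eval₂_sub, Polynomial.eval₂_pow, Polynomial.eval₂_X,
      AddSubgroupClass.coe_sub] at h3
    have h4 : f = ((W.eval₂ (inclInsert O T z) (hO.var (Finset.mem_insert_self z T)) :
        partialRing O (insert z T)) : MvPowerSeries (Fin n) k) *
          (u : partialRing O (insert z T)).1 := (congrArg Subtype.val hu).symm
    rw [h4, mul_comm]
    congr 1
    have h5 : ∀ j ∈ Finset.range D, ((W - Polynomial.X ^ D).coeff j : MvPowerSeries (Fin n) k) *
        X z ^ j = -((if j < D then -(W.coeff j : MvPowerSeries (Fin n) k) else 0) * X z ^ j) := by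
      intro j hj
      rw [Finset.mem_range] at hj
      rw [if_pos hj, Polynomial.coeff_sub, Polynomial.coeff_X_pow, if_neg hj.ne, sub_zero]
      ring
    rw [Finset.sum_congr rfl h5, Finset.sum_neg_distrib] at h3
    rw [eq_add_of_sub_eq h3, neg_add_eq_sub]
    rfl

theorem coeff_single_shear_of_ne {y z : Fin n} (hyz : z ≠ y) (c : Fin n → k)
    (f : MvPowerSeries (Fin n) k) (j : ℕ) :
    coeff (single z j) (shear y c f) = coeff (single z j) f := by
  classical
  have hX : ∀ i, axis z (X i + C (c i) * X y : MvPowerSeries (Fin n) k) =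
      PowerSeries.C (if i = z then 1 else 0) * PowerSeries.X := by
    intro i
    ext j
    rw [coeff_axis, map_add, coeff_C_mul, PowerSeries.coeff_C_mul, coeff_X, coeff_X,
      PowerSeries.coeff_X]
    simp only [Finsupp.single_eq_single_iff]
    by_cases hj : j = 1
    · subst hj
      by_cases hi : i = z
      · subst hi; simp [hyz]
      · simp [hi, Ne.symm hi, hyz]
    · simp [hj]
  have hprod : ∀ l : Fin n →₀ ℕ, coeff (single z j)
      (l.prod fun s e => (X s + C (c s) * X y : MvPowerSeries (Fin n) k) ^ e) =
        if l = single z j then 1 else 0 := by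
    intro l
    rw [← coeff_axis, Finsupp.prod_fintype _ _ (by simp), map_prod]
    simp_rw [map_pow, hX, mul_pow, Finset.prod_mul_distrib, ← map_pow]
    rw [← map_prod, Finset.prod_pow_eq_pow_sum, PowerSeries.coeff_C_mul, PowerSeries.coeff_X_pow]
    by_cases hl : ∃ i, i ≠ z ∧ l i ≠ 0
    · obtain ⟨i, hi, hli⟩ := hl
      rw [Finset.prod_eq_zero (Finset.mem_univ i), zero_mul, if_neg]
      · rintro rfl
        exact hli (Finsupp.single_eq_of_ne hi)
      · rw [if_neg hi, zero_pow hli]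
    · push Not at hl
      have h1 : l = single z (l z) := by
        ext i
        by_cases hi : i = z
        · subst hi; simp
        · rw [hl i hi, Finsupp.single_eq_of_ne hi]
      rw [Finset.prod_eq_one, one_mul, Finset.sum_eq_single_of_mem z (Finset.mem_univ z)
        (fun i _ hi => hl i hi)]
      · by_cases hj : j = l z
        · rw [if_pos hj, if_pos (by rw [hj]; exact h1)]
        · rw [if_neg hj, if_neg]
          intro h2
          apply hj
          rw [h2]; simp
      · intro i _
        by_cases hi : i = z
        · rw [if_pos hi, one_pow]
        · rw [hl i hi, pow_zero]
  rw [shear, substAlgHom_apply, coeff_subst (hasSubst_shear y c)]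
  simp_rw [hprod]
  rw [finsum_eq_single _ (single z j)]
  · simp
  · intro l hl
    rw [if_neg hl, smul_zero]

theorem IsRegularIn.shear {y z : Fin n} (hyz : z ≠ y) (c : Fin n → k) {D : ℕ}
    {f : MvPowerSeries (Fin n) k} (hf : IsRegularIn z D f) : IsRegularIn z D (shear y c f) := by
  refine ⟨fun j hj => ?_, ?_⟩
  · rw [coeff_single_shear_of_ne hyz, hf.1 j hj]
  · rw [coeff_single_shear_of_ne hyz]
    exact hf.2

theorem IsWeierstrass.regular_shear (hO : IsWeierstrass O) (z : Fin n) {c : Fin n → k}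
    (hc : c z = 0) {f₁ f₂ : MvPowerSeries (Fin n) k}
    (h : ∀ u ∈ O, (∃ e ∈ O, f₂ * u = f₁ * e) → ∃ e ∈ O, u = f₁ * e) :
    ∀ u ∈ O, (∃ e ∈ O, shear z c f₂ * u = shear z c f₁ * e) → ∃ e ∈ O, u = shear z c f₁ * e := by
  rintro u hu ⟨e, he, heq⟩
  have hcc : ∀ g, shear z (-c) (shear z c g) = g := shear_neg_shear z hc
  have hcc' : ∀ g, shear z c (shear z (-c) g) = g := fun g => by
    have := shear_neg_shear z (c := -c) (by simp [hc]) g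
    rwa [neg_neg] at this
  obtain ⟨e', he', heq'⟩ := h (shear z (-c) u) (hO.shear_mem _ _ hu)
    ⟨shear z (-c) e, hO.shear_mem _ _ he, by
      have := congrArg (shear z (-c)) heq
      rwa [map_mul, map_mul, hcc, hcc] at this⟩
  refine ⟨shear z c e', hO.shear_mem _ _ he', ?_⟩
  rw [← map_mul, ← heq', hcc']

/-- Two shears bring a pair `f₁`, `f₂`, with `f₂` regular modulo `f₁`, into adapted coordinates. -/
theorem IsWeierstrass.exists_adaptedPair [Infinite k] (hO : IsWeierstrass O) {T : Finset (Fin n)}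
    {y z : Fin n} (hy : y ∉ T) (hz : z ∉ insert y T) (hT : insert z (insert y T) = Finset.univ)
    {f₁ f₂ : MvPowerSeries (Fin n) k} (h₁ : f₁ ∈ O) (h₂ : f₂ ∈ O) (h0 : f₁ ≠ 0)
    (hreg : ∀ u ∈ O, (∃ e ∈ O, f₂ * u = f₁ * e) → ∃ e ∈ O, u = f₁ * e) :
    ∃ c₁ c₂ : Fin n → k, c₁ z = 0 ∧ c₂ y = 0 ∧ ∃ D E r v, AdaptedPair O T y z D E
      (shear y c₂ (shear z c₁ f₁)) (shear y c₂ (shear z c₁ f₂)) r v := by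
  obtain ⟨c₁, hc₁, D, hD⟩ := exists_isRegularIn_shear z h0
  have hreg₁ := hO.regular_shear z hc₁ hreg
  have hfull : ∀ g : MvPowerSeries (Fin n) k, g ∈ seriesIn k (insert z (insert y T)) := by
    intro g; rw [hT]; exact mem_seriesIn_univ g
  let g₁ : partialRing O (insert z (insert y T)) := ⟨shear z c₁ f₁, hO.shear_mem _ _ h₁, hfull _⟩
  let g₂ : partialRing O (insert z (insert y T)) := ⟨shear z c₁ f₂, hO.shear_mem _ _ h₂, hfull _⟩
  obtain ⟨r, hr0, v, e, hv⟩ := exists_multiple_of_division _ _ g₁ g₂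
    (hO.exists_division_polynomial (T := insert y T) hD) (by
      rintro u ⟨e, he⟩
      obtain ⟨e', he', h⟩ := hreg₁ u u.2.1 ⟨e, e.2.1, congrArg Subtype.val he⟩
      exact ⟨⟨e', he', hfull _⟩, Subtype.ext h⟩)
  obtain ⟨c₂, hc₂, E, hE⟩ := exists_isRegularIn_shear y
    (f := (r : MvPowerSeries (Fin n) k)) (fun h => hr0 (Subtype.ext h))
  have hyz : z ≠ y := fun h => hz (h ▸ Finset.mem_insert_self z T)
  refine ⟨c₁, c₂, hc₁, hc₂, D, E, shear y c₂ r, shear y c₂ v, hy, hz, hT,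
    hO.shear_mem _ _ g₁.2.1, hO.shear_mem _ _ g₂.2.1, hD.shear hyz c₂,
    ⟨hO.shear_mem _ _ r.2.1, shear_mem_seriesIn (Finset.mem_insert_self y T) c₂ r.2.2⟩, hE,
    hO.shear_mem _ _ v.2.1, ⟨shear y c₂ e, hO.shear_mem _ _ e.2.1, ?_⟩⟩
  have h3 : (r : MvPowerSeries (Fin n) k) - shear z c₁ f₂ * v = shear z c₁ f₁ * e :=
    congrArg Subtype.val hv
  rw [← map_mul, ← map_sub, h3, map_mul]

end Weierstrass

/-! ### Points near the origin at which a germ outside a minimal prime does not vanish -/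

section Points
open MvPowerSeries Finsupp
open scoped NNReal ENNReal

variable {k : Type*} [NontriviallyNormedField k] {n : ℕ}

theorem isIntegral_of_pow_eq_sum {Λ C : Type*} [CommRing Λ] [CommRing C] [Algebra Λ C] {E : ℕ}
    {c : ℕ → C} {x : C} (hc : ∀ j, IsIntegral Λ (c j))
    (hx : x ^ E = ∑ j ∈ Finset.range E, c j * x ^ j) : IsIntegral Λ x := by
  nontriviality C
  let p : Polynomial (integralClosure Λ C) :=
    ∑ j : Fin E, Polynomial.C (⟨c j, hc j⟩ : integralClosure Λ C) * Polynomial.X ^ (j : ℕ)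
  have hp : p.degree < E := Polynomial.degree_sum_fin_lt fun j : Fin E =>
    (⟨c j, hc j⟩ : integralClosure Λ C)
  have h1 : IsIntegral (integralClosure Λ C) x := by
    refine ⟨Polynomial.X ^ E - p, Polynomial.monic_X_pow_sub hp, ?_⟩
    rw [Polynomial.eval₂_sub, Polynomial.eval₂_pow, Polynomial.eval₂_X, hx, sub_eq_zero,
      Polynomial.eval₂_finsetSum, ← Fin.sum_univ_eq_sum_range (fun j => c j * x ^ j)]
    refine Finset.sum_congr rfl fun j _ => ?_
    rw [Polynomial.eval₂_mul, Polynomial.eval₂_C, Polynomial.eval₂_pow, Polynomial.eval₂_X]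
    rfl
  exact isIntegral_trans x h1

/-- Specialization of the solutions `Y`, `Z` of two successive monic equations over `Λ`: the
inequality `H(Y, Z) ≠ 0` survives, for a suitable choice of the solutions, at almost all points
of `Λ`. -/
theorem exists_specialization {K Λ C : Type*} [Field K] [IsAlgClosed K] [CommRing Λ] [Nontrivial Λ]
    [Algebra K Λ] [CommRing C] [IsDomain C] (φ : Λ →+* C) (hφ : Function.Injective φ) {D E : ℕ}
    {Y Z : C} {c : ℕ → Λ} {s t : ℕ → ℕ → Λ} (hY : Y ^ E = ∑ j ∈ Finset.range E, φ (c j) * Y ^ j)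
    (hZ : Z ^ D = ∑ j ∈ Finset.range D, (∑ i ∈ Finset.range E, φ (s i j) * Y ^ i) * Z ^ j)
    (ht : ∑ j ∈ Finset.range D, (∑ i ∈ Finset.range E, φ (t i j) * Y ^ i) * Z ^ j ≠ 0) :
    ∃ l : Λ, l ≠ 0 ∧ ∀ e : Λ →ₐ[K] K, e l ≠ 0 → ∃ y z : K,
      y ^ E = ∑ j ∈ Finset.range E, e (c j) * y ^ j ∧
      z ^ D = ∑ j ∈ Finset.range D, (∑ i ∈ Finset.range E, e (s i j) * y ^ i) * z ^ j ∧
      ∑ j ∈ Finset.range D, (∑ i ∈ Finset.range E, e (t i j) * y ^ i) * z ^ j ≠ 0 ∧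
      ∀ t' : ℕ → ℕ → Λ,
        ∑ j ∈ Finset.range D, (∑ i ∈ Finset.range E, φ (t' i j) * Y ^ i) * Z ^ j = 0 →
        ∑ j ∈ Finset.range D, (∑ i ∈ Finset.range E, e (t' i j) * y ^ i) * z ^ j = 0 := by
  let : Algebra Λ C := φ.toAlgebra
  have hYi : IsIntegral Λ Y := isIntegral_of_pow_eq_sum (fun j => isIntegral_algebraMap) hY
  have hZi : IsIntegral Λ Z := isIntegral_of_pow_eq_sum
    (fun j => IsIntegral.sum _ fun i _ => (isIntegral_algebraMap (x := s i j)).mul (hYi.pow i)) hZ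
  let B := integralClosure Λ C
  let Y' : B := ⟨Y, hYi⟩
  let Z' : B := ⟨Z, hZi⟩
  have hval : ∀ u : ℕ → ℕ → Λ,
      ((∑ j ∈ Finset.range D, (∑ i ∈ Finset.range E, algebraMap Λ B (u i j) * Y' ^ i) * Z' ^ j : B) :
        C) = ∑ j ∈ Finset.range D, (∑ i ∈ Finset.range E, φ (u i j) * Y ^ i) * Z ^ j := by
    intro u
    simp only [AddSubmonoidClass.coe_finsetSum, MulMemClass.coe_mul, SubmonoidClass.coe_pow]
    rfl
  have hne : (∑ j ∈ Finset.range D,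
      (∑ i ∈ Finset.range E, algebraMap Λ B (t i j) * Y' ^ i) * Z' ^ j : B) ≠ 0 := by
    intro h
    apply ht
    rw [← hval, h]
    rfl
  have hinj : Function.Injective (algebraMap Λ B) := fun a b hab =>
    hφ (congrArg (Subtype.val : B → C) hab)
  have : Algebra.IsIntegral Λ B := integralClosure.AlgebraIsIntegral
  obtain ⟨l, hl, H⟩ := exists_ringHom_extension (K := K) hinj hne
  refine ⟨l, hl, fun e he => ?_⟩
  obtain ⟨χ, hχ, hχ0⟩ := H e he
  have hχs : ∀ u : ℕ → ℕ → Λ,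
      χ (∑ j ∈ Finset.range D, (∑ i ∈ Finset.range E, algebraMap Λ B (u i j) * Y' ^ i) * Z' ^ j) =
      ∑ j ∈ Finset.range D, (∑ i ∈ Finset.range E, e (u i j) * χ Y' ^ i) * χ Z' ^ j := by
    intro u
    simp only [map_sum, map_mul, map_pow, hχ]
  refine ⟨χ Y', χ Z', ?_, ?_, ?_, fun t' ht' => ?_⟩
  · have h1 : Y' ^ E = ∑ j ∈ Finset.range E, algebraMap Λ B (c j) * Y' ^ j := by
      apply Subtype.ext
      simp only [AddSubmonoidClass.coe_finsetSum, MulMemClass.coe_mul, SubmonoidClass.coe_pow]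
      exact hY
    rw [← map_pow, h1]
    simp only [map_sum, map_mul, map_pow, hχ]
  · rw [← hχs, ← map_pow]
    congr 1
    apply Subtype.ext
    rw [hval]
    exact hZ
  · rw [← hχs]
    exact hχ0
  · rw [← hχs]
    have h1 : (∑ j ∈ Finset.range D,
        (∑ i ∈ Finset.range E, algebraMap Λ B (t' i j) * Y' ^ i) * Z' ^ j : B) = 0 :=
      Subtype.ext ((hval t').trans ht')
    rw [h1, map_zero]

/-- The relations expressing that `K` is generated by `x_y`, `x_z` over `Λ` modulo `F₁` and `R`:
`R` and `F₁` are multiples of monic polynomials, and `F₂`, `G` have remainders over `Λ`. -/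
structure ReductionData {Λ K : Type*} [CommRing Λ] [CommRing K] (ι : Λ →+* K) (xy xz : K) (D E : ℕ)
    (R F₁ F₂ G wr w₁ : K) (c : ℕ → Λ) (b : ℕ → K) (s t₂ t₃ : ℕ → ℕ → Λ) : Prop where
  rel_r : R = wr * (xy ^ E - ∑ j ∈ Finset.range E, ι (c j) * xy ^ j)
  rel₁ : F₁ = w₁ * (xz ^ D - ∑ j ∈ Finset.range D, b j * xz ^ j)
  rel_b : ∀ j < D, ∃ q, b j = q * R + ∑ i ∈ Finset.range E, ι (s i j) * xy ^ i
  rel₂ : ∃ α β, F₂ = α * F₁ + β * R +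
    ∑ j ∈ Finset.range D, (∑ i ∈ Finset.range E, ι (t₂ i j) * xy ^ i) * xz ^ j
  rel₃ : ∃ α β, G = α * F₁ + β * R +
    ∑ j ∈ Finset.range D, (∑ i ∈ Finset.range E, ι (t₃ i j) * xy ^ i) * xz ^ j

namespace ReductionData

variable {Λ K : Type*} [CommRing Λ] [CommRing K] {ι : Λ →+* K} {xy xz : K} {D E : ℕ}
  {R F₁ F₂ G wr w₁ : K} {c : ℕ → Λ} {b : ℕ → K} {s t₂ t₃ : ℕ → ℕ → Λ}
  (h : ReductionData ι xy xz D E R F₁ F₂ G wr w₁ c b s t₂ t₃)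
  {C : Type*} [CommRing C] (θ : K →+* C)
include h

theorem map_r (hy : θ xy ^ E = ∑ j ∈ Finset.range E, θ (ι (c j)) * θ xy ^ j) : θ R = 0 := by
  rw [h.rel_r, map_mul, map_sub, map_pow, map_sum]
  simp only [map_mul, map_pow]
  rw [hy, sub_self, mul_zero]

theorem map_b (hR : θ R = 0) {j : ℕ} (hj : j < D) :
    θ (b j) = ∑ i ∈ Finset.range E, θ (ι (s i j)) * θ xy ^ i := by
  obtain ⟨q, e⟩ := h.rel_b j hj
  rw [e, map_add, map_mul, hR, mul_zero, zero_add]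
  simp only [map_sum, map_mul, map_pow]

theorem map_sum_b (hR : θ R = 0) : θ (∑ j ∈ Finset.range D, b j * xz ^ j) =
    ∑ j ∈ Finset.range D, (∑ i ∈ Finset.range E, θ (ι (s i j)) * θ xy ^ i) * θ xz ^ j := by
  rw [map_sum]
  refine Finset.sum_congr rfl fun j hj => ?_
  rw [map_mul, map_pow, h.map_b θ hR (Finset.mem_range.1 hj)]

theorem map₁ (hR : θ R = 0) (hz : θ xz ^ D = ∑ j ∈ Finset.range D,
    (∑ i ∈ Finset.range E, θ (ι (s i j)) * θ xy ^ i) * θ xz ^ j) : θ F₁ = 0 := by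
  rw [h.rel₁, map_mul, map_sub, map_pow, h.map_sum_b θ hR, hz, sub_self, mul_zero]

theorem map₂ (hR : θ R = 0) (h₁ : θ F₁ = 0) : θ F₂ =
    ∑ j ∈ Finset.range D, (∑ i ∈ Finset.range E, θ (ι (t₂ i j)) * θ xy ^ i) * θ xz ^ j := by
  obtain ⟨α, β, e⟩ := h.rel₂
  rw [e, map_add, map_add, map_mul, map_mul, hR, h₁, mul_zero, mul_zero, add_zero, zero_add]
  simp only [map_sum, map_mul, map_pow]

theorem map₃ (hR : θ R = 0) (h₁ : θ F₁ = 0) : θ G =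
    ∑ j ∈ Finset.range D, (∑ i ∈ Finset.range E, θ (ι (t₃ i j)) * θ xy ^ i) * θ xz ^ j := by
  obtain ⟨α, β, e⟩ := h.rel₃
  rw [e, map_add, map_add, map_mul, map_mul, hR, h₁, mul_zero, mul_zero, add_zero, zero_add]
  simp only [map_sum, map_mul, map_pow]

theorem pow_y [IsDomain C] (hR : θ R = 0) (hw : θ wr ≠ 0) :
    θ xy ^ E = ∑ j ∈ Finset.range E, θ (ι (c j)) * θ xy ^ j := by
  rw [h.rel_r, map_mul, mul_eq_zero] at hR
  have h1 := hR.resolve_left hw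
  rw [map_sub, sub_eq_zero, map_pow, map_sum] at h1
  simpa only [map_mul, map_pow] using h1

theorem pow_z [IsDomain C] (hR : θ R = 0) (h₁ : θ F₁ = 0) (hw : θ w₁ ≠ 0) :
    θ xz ^ D = ∑ j ∈ Finset.range D,
      (∑ i ∈ Finset.range E, θ (ι (s i j)) * θ xy ^ i) * θ xz ^ j := by
  rw [h.rel₁, map_mul, mul_eq_zero] at h₁
  have h1 := h₁.resolve_left hw
  rwa [map_sub, sub_eq_zero, map_pow, h.map_sum_b θ hR] at h1

end ReductionData

theorem exists_lift_family {R : Type*} [CommRing R] {A : Type*} [CommRing A] [Algebra A R]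
    (S : Subalgebra A R) (N : ℕ) {f : ℕ → R} (h : ∀ j < N, f j ∈ S) :
    ∃ g : ℕ → S, ∀ j < N, (g j : R) = f j := by
  have h1 : ∀ j, ∃ x : S, j < N → (x : R) = f j := by
    intro j
    by_cases hj : j < N
    · exact ⟨⟨f j, h j hj⟩, fun _ => rfl⟩
    · exact ⟨0, fun h => absurd h hj⟩
  choose g hg using h1
  exact ⟨g, hg⟩

theorem eventually_mem_convergentOn {f : MvPowerSeries (Fin n) k}
    (hf : f ∈ convergentSeries k n) : ∀ᶠ r in 𝓝[>] (0 : ℝ≥0), f ∈ convergentOn k n r := by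
  obtain ⟨r, hr, h⟩ := converges_iff_const.1 hf
  filter_upwards [(eventually_le_nhds hr).filter_mono nhdsWithin_le_nhds] with s hs
  exact convergentOn_anti hs h

theorem convergentOn_le {r : ℝ≥0} (hr : 0 < r) : convergentOn k n r ≤ convergentSeries k n :=
  fun _ hf => converges_iff_const.2 ⟨r, hr, hf⟩

/-- The series in the variables of `T` that converge on the polydisc of radius `ρ`. -/
abbrev convergentIn (k : Type*) [NontriviallyNormedField k] {n : ℕ} (ρ : ℝ≥0)
    (T : Finset (Fin n)) : Subalgebra k (MvPowerSeries (Fin n) k) :=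
  convergentOn k n ρ ⊓ seriesIn k T

/-- The inclusion into the ring of all series that converge on the polydisc. -/
abbrev inclConvergent (k : Type*) [NontriviallyNormedField k] {n : ℕ} (ρ : ℝ≥0)
    (T : Finset (Fin n)) : convergentIn k ρ T →ₐ[k] convergentOn k n ρ :=
  Subalgebra.inclusion inf_le_left

/-- The variable `xᵢ` as a series that converges on the polydisc of radius `ρ`. -/
abbrev varOn (k : Type*) [NontriviallyNormedField k] {n : ℕ} (ρ : ℝ≥0) (i : Fin n) :
    convergentOn k n ρ := ⟨X i, X_mem_convergentOn ρ i⟩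

variable [CompleteSpace k]

theorem eventually_norm_valueAt_le {f : MvPowerSeries (Fin n) k}
    (hf : f ∈ convergentSeries k n) (h0 : constantCoeff f = 0) {ε : ℝ≥0} (hε : 0 < ε) :
    ∀ᶠ s in 𝓝[>] (0 : ℝ≥0), ∀ a : Fin n → k, (∀ i, ‖a i‖₊ ≤ s) → ‖valueAt f a‖₊ ≤ ε := by
  obtain ⟨r, hr, h⟩ := converges_iff_const.1 hf
  obtain ⟨s, hs, -, hs'⟩ := exists_radius_norm_valueAt_le hr h h0 hε
  filter_upwards [(eventually_le_nhds hs).filter_mono nhdsWithin_le_nhds] with t ht a ha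
  exact hs' a fun i => (ha i).trans ht

omit [CompleteSpace k] in
theorem coe_mem_convergentOn (p : MvPolynomial (Fin n) k) (r : ℝ≥0) :
    (p : MvPowerSeries (Fin n) k) ∈ convergentOn k n r := by
  induction p using MvPolynomial.induction_on with
  | C a => rw [MvPolynomial.coe_C]; exact (convergentOn k n r).algebraMap_mem a
  | add p q hp hq => rw [MvPolynomial.coe_add]; exact add_mem hp hq
  | mul_X p i hp =>
    rw [MvPolynomial.coe_mul, MvPolynomial.coe_X]
    exact mul_mem hp (X_mem_convergentOn r i)

omit [CompleteSpace k] in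
theorem valueAt_coe (p : MvPolynomial (Fin n) k) (a : Fin n → k) :
    valueAt (p : MvPowerSeries (Fin n) k) a = MvPolynomial.eval a p := by
  rw [valueAt_eq, MvPolynomial.eval_eq', tsum_eq_sum (s := p.support)]
  · simp
  · intro m hm
    rw [MvPolynomial.coeff_coe, MvPolynomial.notMem_support_iff.1 hm, zero_mul]

omit [CompleteSpace k] in
theorem weightedNorm_scale_le {N : ℕ} {g : MvPowerSeries (Fin n) k}
    (hg : ∀ m, m.degree < N → coeff m g = 0) {τ : ℝ≥0∞} (hτ : τ ≤ 1) (r : ℝ≥0∞) :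
    weightedNorm (fun _ => τ * r) g ≤ τ ^ N * weightedNorm (fun _ => r) g := by
  rw [weightedNorm, weightedNorm, ← ENNReal.tsum_mul_left]
  refine ENNReal.tsum_le_tsum fun m => ?_
  by_cases hm : m.degree < N
  · rw [hg m hm]; simp
  rw [radiusPow_const, radiusPow_const, mul_pow]
  calc _ ≤ ‖coeff m g‖ₑ * (τ ^ N * r ^ m.degree) := by
        refine mul_le_mul' le_rfl (mul_le_mul' ?_ le_rfl)
        exact pow_le_pow_of_le_one zero_le hτ (not_lt.1 hm)
    _ = _ := by ring

/-- A nonzero convergent series does not vanish identically near the origin: on a line along which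
its leading form does not vanish, the leading form dominates. -/
theorem exists_valueAt_ne_zero {f : MvPowerSeries (Fin n) k} (hf : f ∈ convergentSeries k n)
    (hf0 : f ≠ 0) {δ : ℝ≥0} (hδ : 0 < δ) :
    ∃ a : Fin n → k, (∀ i, ‖a i‖₊ ≤ δ) ∧ valueAt f a ≠ 0 := by
  obtain ⟨r, hr, hfr⟩ := converges_iff_const.1 hf
  set F := leadingForm f
  set N := f.order.toNat
  have hN : (N : ℕ∞) = f.order := ne_zero_iff_order_finite.1 hf0
  obtain ⟨v, hv⟩ : ∃ v, MvPolynomial.eval v F ≠ 0 := by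
    by_contra! h
    exact leadingForm_ne_zero hf0 (MvPolynomial.funext fun v => by rw [h v, map_zero])
  set g : MvPowerSeries (Fin n) k := f - F
  have hg : ∀ m, m.degree < N + 1 → coeff m g = 0 := by
    intro m hm
    rw [map_sub, MvPolynomial.coeff_coe, coeff_leadingForm]
    split_ifs with h
    · exact sub_self _
    · rw [sub_zero]
      apply coeff_of_lt_order
      rw [← hN]
      have : m.degree < N := lt_of_le_of_ne (Nat.lt_succ_iff.1 hm) h
      exact_mod_cast this
  have hgr : g ∈ convergentOn k n r := sub_mem hfr (coe_mem_convergentOn F r)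
  obtain ⟨C, hC⟩ : ∃ C : ℝ≥0, weightedNorm (fun _ => (r : ℝ≥0∞)) g = C :=
    ⟨_, (ENNReal.coe_toNNReal (mem_convergentOn.1 hgr)).symm⟩
  obtain ⟨M, hM0, hM⟩ : ∃ M : ℝ≥0, 0 < M ∧ ∀ i, ‖v i‖₊ ≤ M :=
    ⟨∑ i, ‖v i‖₊ + 1, by positivity, fun i =>
      (Finset.single_le_sum (f := fun i => ‖v i‖₊) (fun _ _ => zero_le) (Finset.mem_univ i)).trans
        le_self_add⟩
  have hv' : 0 < ‖MvPolynomial.eval v F‖₊ := nnnorm_pos.2 hv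
  have h1 : ∀ᶠ t in 𝓝[>] (0 : ℝ≥0), t * M ≤ δ ∧ t * (M / r) ≤ 1 ∧
      t * ((M / r) ^ (N + 1) * C) < ‖MvPolynomial.eval v F‖₊ := by
    have hl : ∀ b : ℝ≥0, Tendsto (fun t : ℝ≥0 => t * b) (𝓝[>] 0) (𝓝 0) := by
      intro b
      have h2 : Tendsto (fun t : ℝ≥0 => t * b) (𝓝 0) (𝓝 (0 * b)) :=
        Continuous.tendsto (by fun_prop) 0
      rw [zero_mul] at h2
      exact h2.mono_left nhdsWithin_le_nhds
    exact ((hl _).eventually (eventually_le_nhds hδ)).and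
      (((hl _).eventually (eventually_le_nhds one_pos)).and
        ((hl _).eventually (eventually_lt_nhds hv')))
  obtain ⟨τ, ⟨hτ1, hτ2, hτ3⟩, hτ0⟩ := (h1.and self_mem_nhdsWithin).exists
  obtain ⟨t, ht0, htτ⟩ := NormedField.exists_norm_lt k (r := (τ : ℝ)) hτ0
  have htτ' : ‖t‖₊ ≤ τ := by exact_mod_cast htτ.le
  have ht0' : 0 < ‖t‖₊ := by exact_mod_cast ht0
  have hs : ‖t‖₊ * (M / r) * r = ‖t‖₊ * M := by field_simp
  have hale : ∀ i, ‖t * v i‖₊ ≤ ‖t‖₊ * (M / r) * r := fun i => by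
    rw [hs, nnnorm_mul]; gcongr; exact hM i
  have hσ1 : ‖t‖₊ * (M / r) ≤ 1 := (mul_le_mul_left htτ' _).trans hτ2
  have hσr : ‖t‖₊ * (M / r) * r ≤ r := mul_le_of_le_one_left zero_le hσ1
  refine ⟨fun i => t * v i, fun i => ?_, fun h0 => ?_⟩
  · refine (hale i).trans ?_
    rw [hs]
    exact (mul_le_mul_left htτ' _).trans hτ1
  · have hsum : valueAt f (fun i => t * v i) = t ^ N * MvPolynomial.eval v F +
        valueAt g (fun i => t * v i) := by
      have h2 : MvPolynomial.eval (fun i => t * v i) F = t ^ N * MvPolynomial.eval v F :=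
        eval_smul_of_isHomogeneous (isHomogeneous_leadingForm f) t v
      have hale' : ∀ i, ‖t * v i‖₊ ≤ r := fun i => (hale i).trans hσr
      rw [← h2, ← valueAt_coe]
      have := map_add (evalHom hale') ⟨F, coe_mem_convergentOn F r⟩ ⟨g, hgr⟩
      refine Eq.trans ?_ this
      rw [evalHom_apply]
      congr 1
      rw [AddMemClass.coe_add]
      simp only [g]
      ring
    have h2 : ‖valueAt g (fun i => t * v i)‖ₑ ≤
        ((‖t‖₊ * (M / r)) ^ (N + 1) * C : ℝ≥0) := by
      refine (enorm_valueAt_le hale g).trans ?_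
      have h3 := weightedNorm_scale_le hg (τ := (‖t‖₊ * (M / r) : ℝ≥0))
        (by exact_mod_cast hσ1) r
      rw [hC] at h3
      push_cast at h3 ⊢
      exact h3
    have h3 : ‖valueAt g (fun i => t * v i)‖₊ ≤ (‖t‖₊ * (M / r)) ^ (N + 1) * C :=
      ENNReal.coe_le_coe.1 h2
    rw [hsum, add_comm, add_eq_zero_iff_eq_neg] at h0
    rw [h0, nnnorm_neg, nnnorm_mul, nnnorm_pow] at h3
    have h4 : ‖t‖₊ ^ N * ‖MvPolynomial.eval v F‖₊ ≤
        ‖t‖₊ ^ N * (‖t‖₊ * ((M / r) ^ (N + 1) * C)) := by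
      refine h3.trans (le_of_eq ?_)
      rw [mul_pow, pow_succ]
      ring
    have h5 := le_of_mul_le_mul_left h4 (pow_pos ht0' N)
    exact absurd (h5.trans (mul_le_mul_left htτ' _)) (not_le.2 hτ3)

omit [CompleteSpace k] in
/-- Modulo `f₁` and `r`, the ring `O` is generated over the series in the variables of `T` by the
monomials `x_y ^ i x_z ^ j` with `i < E`, `j < D`. -/
theorem AdaptedPair.exists_eq_add {T : Finset (Fin n)} {y z : Fin n} {D E : ℕ}
    {O : Subalgebra k (MvPowerSeries (Fin n) k)} (hO : IsWeierstrass O)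
    {f₁ f₂ r v : MvPowerSeries (Fin n) k} (h : AdaptedPair O T y z D E f₁ f₂ r v)
    {g : MvPowerSeries (Fin n) k} (hg : g ∈ O) :
    ∃ α ∈ O, ∃ β ∈ O, ∃ t : ℕ → ℕ → MvPowerSeries (Fin n) k, (∀ i j, t i j ∈ O ⊓ seriesIn k T) ∧
      g = α * f₁ + β * r +
        ∑ j ∈ Finset.range D, (∑ i ∈ Finset.range E, t i j * X y ^ i) * X z ^ j := by
  obtain ⟨α, hα, p, hp, e⟩ := h.division₁ hO hg
  choose q hq t ht ep using fun j => h.division_r hO (hp j)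
  refine ⟨α, hα, ∑ j ∈ Finset.range D, q j * X z ^ j,
    sum_mem fun j _ => mul_mem (hq j).1 (pow_mem (hO.X_mem z) j), fun i j => t j i,
    fun i j => ht j i, ?_⟩
  rw [e, add_assoc, Finset.sum_mul, ← Finset.sum_add_distrib]
  congr 1
  refine Finset.sum_congr rfl fun j _ => ?_
  rw [ep j]
  ring

theorem exists_radius_forall_norm_valueAt_le {f : ℕ → MvPowerSeries (Fin n) k} (N : ℕ) {σ ε : ℝ≥0}
    (hσ : 0 < σ) (hε : 0 < ε) (hf : ∀ j < N, f j ∈ convergentSeries k n)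
    (hf0 : ∀ j < N, constantCoeff (f j) = 0) : ∃ s : ℝ≥0, 0 < s ∧ s ≤ σ ∧ ∀ j < N,
      ∀ a : Fin n → k, (∀ i, ‖a i‖₊ ≤ s) → ‖valueAt (f j) a‖₊ ≤ ε := by
  have h3 := (Finset.range N).eventually_all.2 fun j hj => eventually_norm_valueAt_le
    (hf j (Finset.mem_range.1 hj)) (hf0 j (Finset.mem_range.1 hj)) hε
  have h4 : ∀ᶠ s in 𝓝[>] (0 : ℝ≥0), 0 < s ∧ s ≤ σ := by
    filter_upwards [self_mem_nhdsWithin, (eventually_le_nhds hσ).filter_mono nhdsWithin_le_nhds]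
      with s h1 h2
    exact ⟨h1, h2⟩
  obtain ⟨s, ⟨h5, h6⟩, h7⟩ := (h4.and h3).exists
  exact ⟨s, h5, h6, fun j hj => h7 j (Finset.mem_range.2 hj)⟩

/-- A homomorphism `θ` from the series converging on a polydisc to a domain, injective on the
series in the variables of `T` and killing `F₁`, `F₂`, `R`, can be specialized to a point of the
polydisc, at which a given series `G` with `θ G ≠ 0` does not vanish. -/
theorem ReductionData.exists_point [IsAlgClosed k] {ρ : ℝ≥0} (hρ0 : 0 < ρ) (hρ1 : ρ ≤ 1)
    {T : Finset (Fin n)} {y z : Fin n} (hyT : y ∉ T) (hzT : z ∉ insert y T) {D E : ℕ}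
    {R F₁ F₂ G wr w₁ : convergentOn k n ρ} {c : ℕ → convergentIn k ρ T}
    {b : ℕ → convergentOn k n ρ} {s t₂ t₃ : ℕ → ℕ → convergentIn k ρ T}
    (h : ReductionData (inclConvergent k ρ T : convergentIn k ρ T →+* convergentOn k n ρ)
      (varOn k ρ y) (varOn k ρ z) D E R F₁ F₂ G wr w₁ c b s t₂ t₃)
    (hc : ∀ j < E, constantCoeff (c j : MvPowerSeries (Fin n) k) = 0)
    (hb : ∀ j < D, constantCoeff (b j : MvPowerSeries (Fin n) k) = 0)
    {C : Type*} [CommRing C] [IsDomain C] (θ : convergentOn k n ρ →+* C)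
    (hθ : Function.Injective
      (θ.comp (inclConvergent k ρ T : convergentIn k ρ T →+* convergentOn k n ρ)))
    (hR : θ R = 0) (h₁ : θ F₁ = 0) (h₂ : θ F₂ = 0) (hG : θ G ≠ 0) (hwr : θ wr ≠ 0)
    (hw₁ : θ w₁ ≠ 0) : ∃ p : Fin n → k, (∀ i, ‖p i‖₊ ≤ ρ) ∧
      valueAt (F₁ : MvPowerSeries (Fin n) k) p = 0 ∧ valueAt (F₂ : MvPowerSeries (Fin n) k) p = 0 ∧
      valueAt (G : MvPowerSeries (Fin n) k) p ≠ 0 := by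
  classical
  have hyz : z ≠ y := fun e => hzT (e ▸ Finset.mem_insert_self z T)
  have hG' := hG
  rw [h.map₃ θ hR h₁] at hG'
  have h₂' := h₂
  rw [h.map₂ θ hR h₁] at h₂'
  obtain ⟨l, hl, hspec⟩ := exists_specialization (K := k) _ hθ (h.pow_y θ hR hwr)
    (h.pow_z θ hR h₁ hw₁) hG'
  -- choose the point so close to the origin that `x_y`, hence `x_z`, is small
  obtain ⟨s₁, hs₁0, hs₁ρ, hs₁⟩ := exists_radius_forall_norm_valueAt_le D (ε := ρ ^ D / (D + 1)) hρ0
    (div_pos (pow_pos hρ0 D) (by positivity)) (fun j _ => convergentOn_le hρ0 (b j).2) hb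
  obtain ⟨s₂, hs₂0, hs₂s, hs₂⟩ := exists_radius_forall_norm_valueAt_le E (ε := s₁ ^ E / (E + 1))
    hs₁0 (div_pos (pow_pos hs₁0 E) (by positivity)) (fun j _ => convergentOn_le hρ0 (c j).2.1) hc
  obtain ⟨a, ha, hal⟩ := exists_valueAt_ne_zero (convergentOn_le hρ0 l.2.1)
    (fun h0 => hl (Subtype.ext h0)) hs₂0
  have haρ : ∀ i, ‖a i‖₊ ≤ ρ := fun i => (ha i).trans (hs₂s.trans hs₁ρ)
  set e := (evalHom haρ).comp (inclConvergent k ρ T)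
  obtain ⟨y₀, z₀, hy₀, hz₀, hg₀, hall⟩ := hspec e hal
  have hy₀s : ‖y₀‖ ≤ s₁ := by
    refine norm_le_of_pow_eq_sum hs₁0 (hs₁ρ.trans hρ1) (fun j hj => ?_) hy₀
    exact_mod_cast hs₂ j hj a ha
  -- evaluation at the points `(a, y₀, w)`
  let pt : k → Fin n → k := fun w i => if i = z then w else if i = y then y₀ else a i
  have hpty : ∀ w, pt w y = y₀ := fun w => by simp [pt, hyz.symm]
  have hptz : ∀ w, pt w z = w := fun w => by simp [pt]
  have hptT : ∀ w, ∀ i ∈ T, pt w i = a i := by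
    intro w i hi
    have h3 : i ≠ z := fun e => hzT (e ▸ Finset.mem_insert_of_mem hi)
    have h4 : i ≠ y := fun e => hyT (e ▸ hi)
    simp [pt, h3, h4]
  have hptle : ∀ w (σ : ℝ≥0), s₁ ≤ σ → ‖w‖₊ ≤ σ → ∀ i, ‖pt w i‖₊ ≤ σ := by
    intro w σ hσ hw i
    simp only [pt]
    split_ifs
    · exact hw
    · exact le_trans (by exact_mod_cast hy₀s) hσ
    · exact (ha i).trans (hs₂s.trans hσ)
  have key : ∀ w (hw : ∀ i, ‖pt w i‖₊ ≤ ρ), ∃ ε : convergentOn k n ρ →+* k,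
      (∀ f, ε f = valueAt (f : MvPowerSeries (Fin n) k) (pt w)) ∧
      (∀ x, ε (inclConvergent k ρ T x) = e x) ∧ ε (varOn k ρ y) = y₀ ∧ ε (varOn k ρ z) = w ∧
      ε R = 0 := by
    intro w hw
    have hε : ∀ x, evalHom hw (inclConvergent k ρ T x) = e x := fun x =>
      valueAt_congr x.2.2 (hptT w)
    have hεy : evalHom hw (varOn k ρ y) = y₀ := (valueAt_X y _).trans (hpty w)
    refine ⟨evalHom hw, fun f => rfl, hε, hεy, (valueAt_X z _).trans (hptz w),
      h.map_r (evalHom hw : convergentOn k n ρ →+* k) ?_⟩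
    simp only [RingHom.coe_coe, hε, hεy]
    exact hy₀
  have hz₀ρ : ‖z₀‖ ≤ ρ := by
    refine norm_le_of_pow_eq_sum hρ0 hρ1 (fun j hj => ?_) hz₀
    have h0 : ∀ i, ‖pt 0 i‖₊ ≤ s₁ := hptle 0 s₁ le_rfl (by simp)
    obtain ⟨ε, hε, hεl, hεy, -, hεR⟩ := key 0 fun i => (h0 i).trans hs₁ρ
    have h3 := hs₁ j hj (pt 0) h0
    rw [← hε, h.map_b ε hεR hj] at h3
    simp only [RingHom.coe_coe, hεl, hεy] at h3
    exact_mod_cast h3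
  have hp : ∀ i, ‖pt z₀ i‖₊ ≤ ρ := hptle z₀ ρ hs₁ρ (by exact_mod_cast hz₀ρ)
  obtain ⟨ε, hε, hεl, hεy, hεz, hεR⟩ := key z₀ hp
  have hε1 : ε F₁ = 0 := by
    refine h.map₁ ε hεR ?_
    simp only [RingHom.coe_coe, hεl, hεy, hεz]
    exact hz₀
  refine ⟨pt z₀, hp, (hε F₁).symm.trans hε1, ?_, ?_⟩
  · rw [← hε, h.map₂ ε hεR hε1]
    simp only [RingHom.coe_coe, hεl, hεy, hεz]
    exact hall _ h₂'
  · rw [← hε, h.map₃ ε hεR hε1]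
    simp only [RingHom.coe_coe, hεl, hεy, hεz]
    exact hg₀

omit [CompleteSpace k] in
/-- Adapted coordinates give the relations of a `ReductionData` on a small polydisc. -/
theorem AdaptedPair.exists_reductionData {T : Finset (Fin n)} {y z : Fin n} {D E : ℕ}
    {f₁ f₂ r v g : MvPowerSeries (Fin n) k}
    (h : AdaptedPair (convergentSeries k n) T y z D E f₁ f₂ r v)
    (hg : g ∈ convergentSeries k n) {δ : ℝ≥0} (hδ : 0 < δ) :
    ∃ ρ : ℝ≥0, 0 < ρ ∧ ρ ≤ 1 ∧ ρ ≤ δ ∧ ∃ (R F₁ F₂ G wr w₁ : convergentOn k n ρ)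
      (c : ℕ → convergentIn k ρ T) (b : ℕ → convergentOn k n ρ)
      (s t₂ t₃ : ℕ → ℕ → convergentIn k ρ T),
      ReductionData (inclConvergent k ρ T : convergentIn k ρ T →+* convergentOn k n ρ)
        (varOn k ρ y) (varOn k ρ z) D E R F₁ F₂ G wr w₁ c b s t₂ t₃ ∧
      (∀ j < E, constantCoeff (c j : MvPowerSeries (Fin n) k) = 0) ∧
      (∀ j < D, constantCoeff (b j : MvPowerSeries (Fin n) k) = 0) ∧
      (R : MvPowerSeries (Fin n) k) = r ∧ (F₁ : MvPowerSeries (Fin n) k) = f₁ ∧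
      (F₂ : MvPowerSeries (Fin n) k) = f₂ ∧ (G : MvPowerSeries (Fin n) k) = g ∧
      constantCoeff (wr : MvPowerSeries (Fin n) k) ≠ 0 ∧
      constantCoeff (w₁ : MvPowerSeries (Fin n) k) ≠ 0 := by
  have hO : IsWeierstrass (convergentSeries k n) := isWeierstrass_convergentSeries
  -- the Weierstrass polynomials of `r` and `f₁`, and the remainders of the series in question
  obtain ⟨c, hc, hc0, wr, hwr, hwr0, er⟩ := hO.exists_eq_mul_weierstrass h.notMem_y h.regular_r h.mem_r
  obtain ⟨b, hb, hb0, w₁, hw₁, hw₁0, e₁⟩ := hO.exists_eq_mul_weierstrass h.notMem_z h.regular₁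
    ⟨h.mem₁, by rw [h.cover]; exact mem_seriesIn_univ _⟩
  choose q hq c' hc' eb using fun j => h.division_r hO (hb j)
  obtain ⟨α₂, hα₂, β₂, hβ₂, t₂, ht₂, e₂⟩ := h.exists_eq_add hO h.mem₂
  obtain ⟨α₃, hα₃, β₃, hβ₃, t₃, ht₃, e₃⟩ := h.exists_eq_add hO hg
  -- a polydisc on which everything converges
  have hev : ∀ {f : MvPowerSeries (Fin n) k}, f ∈ convergentSeries k n →
      ∀ᶠ r in 𝓝[>] (0 : ℝ≥0), f ∈ convergentOn k n r := eventually_mem_convergentOn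
  have hev1 : ∀ {f : ℕ → MvPowerSeries (Fin n) k} (N : ℕ), (∀ j, f j ∈ convergentSeries k n) →
      ∀ᶠ r in 𝓝[>] (0 : ℝ≥0), ∀ j < N, f j ∈ convergentOn k n r := by
    intro f N hf
    have := (Finset.range N).eventually_all.2 fun j _ => hev (hf j)
    simpa using this
  have hev2 : ∀ {f : ℕ → ℕ → MvPowerSeries (Fin n) k} (N N' : ℕ),
      (∀ i j, f i j ∈ convergentSeries k n) →
      ∀ᶠ r in 𝓝[>] (0 : ℝ≥0), ∀ i < N, ∀ j < N', f i j ∈ convergentOn k n r := by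
    intro f N N' hf
    have := (Finset.range N).eventually_all.2 fun i _ => hev1 N' (hf i)
    simpa using this
  have hδ' : ∀ᶠ s in 𝓝[>] (0 : ℝ≥0), 0 < s ∧ s ≤ δ ∧ s ≤ 1 := by
    filter_upwards [self_mem_nhdsWithin, (eventually_le_nhds hδ).filter_mono nhdsWithin_le_nhds,
      (eventually_le_nhds one_pos).filter_mono nhdsWithin_le_nhds] with s h1 h2 h3
    exact ⟨h1, h2, h3⟩
  obtain ⟨ρ, ⟨hρ0, hρδ, hρ1⟩, k1, k2, k3, k4, k5, k6, k7, k8, k9, k10, k11, k12, k13, k14, k15, k16⟩ :=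
    (hδ'.and <| (hev hwr.1).and <| (hev1 E fun j => (hc j).1).and <| (hev hw₁.1).and <|
      (hev1 D fun j => (hb j).1).and <| (hev1 D fun j => (hq j).1).and <|
      (hev2 D E fun j i => (hc' j i).1).and <| (hev hα₂).and <| (hev hβ₂).and <|
      (hev2 D E fun j i => (ht₂ i j).1).and <| (hev hα₃).and <| (hev hβ₃).and <|
      (hev2 D E fun j i => (ht₃ i j).1).and <| (hev h.mem₁).and <| (hev h.mem_r.1).and <|
      (hev h.mem₂).and <| (hev hg)).exists
  -- the relations between these series, in the ring `K` of series converging on the polydisc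
  let Λ := convergentIn k ρ T
  let ι := inclConvergent k ρ T
  let xy := varOn k ρ y
  let xz := varOn k ρ z
  let F₁ : (convergentOn k n ρ) := ⟨f₁, k13⟩
  let F₂ : (convergentOn k n ρ) := ⟨f₂, k15⟩
  let R : (convergentOn k n ρ) := ⟨r, k14⟩
  obtain ⟨cΛ, hcΛ⟩ := exists_lift_family (convergentIn k ρ T) E (f := c) fun j hj => ⟨k2 j hj, (hc j).2⟩
  obtain ⟨bK, hbK⟩ := exists_lift_family (convergentOn k n ρ) D (f := b) k4
  obtain ⟨qK, hqK⟩ := exists_lift_family (convergentOn k n ρ) D (f := q) k5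
  have hlift : ∀ t : ℕ → ℕ → MvPowerSeries (Fin n) k, (∀ j < D, ∀ i < E, t i j ∈ (convergentOn k n ρ)) →
      (∀ i j, t i j ∈ seriesIn k T) →
      ∃ tΛ : ℕ → ℕ → Λ, ∀ j < D, ∀ i < E, (tΛ i j : MvPowerSeries (Fin n) k) = t i j := by
    intro t h1 h2
    have h3 : ∀ j, ∃ g : ℕ → Λ, j < D → ∀ i < E, (g i : MvPowerSeries (Fin n) k) = t i j := by
      intro j
      by_cases hj : j < D
      · obtain ⟨g, hg⟩ := exists_lift_family Λ E (f := fun i => t i j)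
          fun i hi => ⟨h1 j hj i hi, h2 i j⟩
        exact ⟨g, fun _ => hg⟩
      · exact ⟨0, fun h => absurd h hj⟩
    choose g hg using h3
    exact ⟨fun i j => g j i, hg⟩
  obtain ⟨sΛ, hsΛ⟩ := hlift (fun i j => c' j i) k6 (fun i j => (hc' j i).2)
  obtain ⟨t₂Λ, ht₂Λ⟩ := hlift t₂ k9 (fun i j => (ht₂ i j).2)
  obtain ⟨t₃Λ, ht₃Λ⟩ := hlift t₃ k12 (fun i j => (ht₃ i j).2)
  have hrow : ∀ (t : ℕ → ℕ → MvPowerSeries (Fin n) k) (tΛ : ℕ → ℕ → Λ),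
      (∀ j < D, ∀ i < E, (tΛ i j : MvPowerSeries (Fin n) k) = t i j) → ∀ j < D,
      ((∑ i ∈ Finset.range E, ι (tΛ i j) * xy ^ i : (convergentOn k n ρ)) : MvPowerSeries (Fin n) k) =
        ∑ i ∈ Finset.range E, t i j * X y ^ i := by
    intro t tΛ htΛ j hj
    rw [AddSubmonoidClass.coe_finsetSum]
    refine Finset.sum_congr rfl fun i hi => ?_
    rw [← htΛ j hj i (Finset.mem_range.1 hi)]
    rfl
  have hbiv : ∀ (t : ℕ → ℕ → MvPowerSeries (Fin n) k) (tΛ : ℕ → ℕ → Λ),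
      (∀ j < D, ∀ i < E, (tΛ i j : MvPowerSeries (Fin n) k) = t i j) →
      ((∑ j ∈ Finset.range D, (∑ i ∈ Finset.range E, ι (tΛ i j) * xy ^ i) * xz ^ j : (convergentOn k n ρ)) :
        MvPowerSeries (Fin n) k) =
        ∑ j ∈ Finset.range D, (∑ i ∈ Finset.range E, t i j * X y ^ i) * X z ^ j := by
    intro t tΛ htΛ
    rw [AddSubmonoidClass.coe_finsetSum]
    refine Finset.sum_congr rfl fun j hj => ?_
    rw [MulMemClass.coe_mul, hrow t tΛ htΛ j (Finset.mem_range.1 hj)]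
    rfl
  have Er : R = ⟨wr, k1⟩ * (xy ^ E - ∑ j ∈ Finset.range E, ι (cΛ j) * xy ^ j) := by
    apply Subtype.ext
    rw [MulMemClass.coe_mul, AddSubgroupClass.coe_sub, AddSubmonoidClass.coe_finsetSum]
    refine er.trans ?_
    congr 2
    exact Finset.sum_congr rfl fun j hj => by rw [← hcΛ j (Finset.mem_range.1 hj)]; rfl
  have E1 : F₁ = ⟨w₁, k3⟩ * (xz ^ D - ∑ j ∈ Finset.range D, bK j * xz ^ j) := by
    apply Subtype.ext
    rw [MulMemClass.coe_mul, AddSubgroupClass.coe_sub, AddSubmonoidClass.coe_finsetSum]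
    refine e₁.trans ?_
    congr 2
    exact Finset.sum_congr rfl fun j hj => by rw [← hbK j (Finset.mem_range.1 hj)]; rfl
  have Eb : ∀ j < D, bK j = qK j * R + ∑ i ∈ Finset.range E, ι (sΛ i j) * xy ^ i := by
    intro j hj
    apply Subtype.ext
    rw [AddMemClass.coe_add, hrow _ sΛ hsΛ j hj, hbK j hj, MulMemClass.coe_mul, hqK j hj]
    exact eb j
  have E2 : F₂ = ⟨α₂, k7⟩ * F₁ + ⟨β₂, k8⟩ * R +
      ∑ j ∈ Finset.range D, (∑ i ∈ Finset.range E, ι (t₂Λ i j) * xy ^ i) * xz ^ j := by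
    apply Subtype.ext
    rw [AddMemClass.coe_add, hbiv _ t₂Λ ht₂Λ]
    exact e₂
  have E3 : (⟨g, k16⟩ : (convergentOn k n ρ)) = ⟨α₃, k10⟩ * F₁ + ⟨β₃, k11⟩ * R +
      ∑ j ∈ Finset.range D, (∑ i ∈ Finset.range E, ι (t₃Λ i j) * xy ^ i) * xz ^ j := by
    apply Subtype.ext
    rw [AddMemClass.coe_add, hbiv _ t₃Λ ht₃Λ]
    exact e₃
  refine ⟨ρ, hρ0, hρ1, hρδ, R, F₁, F₂, ⟨g, k16⟩, ⟨wr, k1⟩, ⟨w₁, k3⟩, cΛ, bK, sΛ, t₂Λ, t₃Λ,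
    ⟨Er, E1, fun j hj => ⟨_, Eb j hj⟩, ⟨_, _, E2⟩, ⟨_, _, E3⟩⟩, fun j hj => ?_, fun j hj => ?_,
    rfl, rfl, rfl, rfl, hwr0, hw₁0⟩
  · rw [hcΛ j hj, hc0 j]
  · rw [hbK j hj, hb0 j]

/-- The points of `AdaptedPair.exists_point`, for the kernel of a homomorphism to a domain in place
of a prime ideal. -/
theorem AdaptedPair.exists_point_of_ringHom [IsAlgClosed k] {T : Finset (Fin n)} {y z : Fin n}
    {D E : ℕ} {f₁ f₂ r v g : MvPowerSeries (Fin n) k}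
    (h : AdaptedPair (convergentSeries k n) T y z D E f₁ f₂ r v) {C : Type*} [CommRing C]
    [IsDomain C] (π : convergentSeries k n →+* C)
    (h₁ : ∀ hm, π ⟨f₁, hm⟩ = 0) (h₂ : ∀ hm, π ⟨f₂, hm⟩ = 0)
    (hπT : ∀ a, π a = 0 → (a : MvPowerSeries (Fin n) k) ∈ seriesIn k T → a = 0)
    (hg : g ∈ convergentSeries k n) (hgπ : ∀ hm, π ⟨g, hm⟩ ≠ 0) {δ : ℝ≥0} (hδ : 0 < δ) :
    ∃ p : Fin n → k, (∀ i, ‖p i‖₊ ≤ δ) ∧ valueAt f₁ p = 0 ∧ valueAt f₂ p = 0 ∧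
      valueAt g p ≠ 0 := by
  have hO : IsWeierstrass (convergentSeries k n) := isWeierstrass_convergentSeries
  obtain ⟨ρ, hρ0, hρ1, hρδ, R, F₁, F₂, G, wr, w₁, c, b, s, t₂, t₃, hrel, hc, hb, eR, e₁, e₂,
    eG, hwr, hw₁⟩ := h.exists_reductionData hg hδ
  let inc : convergentOn k n ρ →+* convergentSeries k n :=
    (Subalgebra.inclusion (convergentOn_le hρ0)).toRingHom
  have hinc : ∀ x : convergentOn k n ρ, inc x = ⟨x, convergentOn_le hρ0 x.2⟩ := fun _ => rfl
  let θ : convergentOn k n ρ →+* C := π.comp inc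
  have hθ : ∀ x : convergentOn k n ρ, θ x = π ⟨x, convergentOn_le hρ0 x.2⟩ := fun _ => rfl
  have hunit : ∀ w : convergentOn k n ρ, constantCoeff (w : MvPowerSeries (Fin n) k) ≠ 0 →
      θ w ≠ 0 := by
    intro w hw
    have h4 : IsUnit (⟨w, convergentOn_le hρ0 w.2⟩ : convergentSeries k n) :=
      IsUnit.of_mul_eq_one
        ⟨_, (hO.inv_mem z ⟨convergentOn_le hρ0 w.2, mem_seriesIn_univ _⟩ hw).1⟩
        (Subtype.ext (MvPowerSeries.mul_inv_cancel _ hw))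
    rw [hθ]
    exact (h4.map π).ne_zero
  have hθr : θ R = 0 := by
    obtain ⟨d, hd, ed⟩ := h.dvd
    have h3 : (⟨R, convergentOn_le hρ0 R.2⟩ : convergentSeries k n) =
        ⟨f₁, h.mem₁⟩ * ⟨d, hd⟩ + ⟨f₂, h.mem₂⟩ * ⟨v, h.mem_v⟩ :=
      Subtype.ext (by
        rw [sub_eq_iff_eq_add] at ed
        exact eR.trans ed)
    rw [hθ, h3, map_add, map_mul, map_mul, h₁, h₂, zero_mul, zero_mul, add_zero]
  have hval : ∀ (x : convergentOn k n ρ) (f : MvPowerSeries (Fin n) k) (hm : f ∈ convergentSeries k n),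
      (x : MvPowerSeries (Fin n) k) = f → θ x = π ⟨f, hm⟩ := by
    intro x f hm e
    rw [hθ]
    congr 1
    exact Subtype.ext e
  have hinj : Function.Injective
      (θ.comp (inclConvergent k ρ T : convergentIn k ρ T →+* convergentOn k n ρ)) := by
    rw [injective_iff_map_eq_zero]
    intro a ha
    have h3 := hπT _ ha a.2.2
    exact Subtype.ext (congrArg (fun x : convergentSeries k n => (x : MvPowerSeries (Fin n) k)) h3)
  have hθ₁ : θ F₁ = 0 := (hval F₁ f₁ h.mem₁ e₁).trans (h₁ _)
  have hθ₂ : θ F₂ = 0 := (hval F₂ f₂ h.mem₂ e₂).trans (h₂ _)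
  have hθG : θ G ≠ 0 := by
    rw [hval G g hg eG]
    exact hgπ _
  obtain ⟨p, hp, hp'⟩ := hrel.exists_point hρ0 hρ1 h.notMem_y h.notMem_z hc hb θ hinj hθr
    hθ₁ hθ₂ hθG (hunit _ hwr) (hunit _ hw₁)
  rw [e₁, e₂, eG] at hp'
  exact ⟨p, fun i => (hp i).trans hρδ, hp'⟩

/-- A prime ideal is the kernel of a homomorphism to a domain. The domain is left abstract because
this keeps the search for instances on the quotient short. -/
theorem exists_ringHom_ker_eq.{u} {S : Type u} [CommRing S] (P : Ideal S) [P.IsPrime] :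
    ∃ (C : Type u) (_ : CommRing C) (_ : IsDomain C) (π : S →+* C), ∀ a, π a = 0 ↔ a ∈ P :=
  ⟨S ⧸ P, inferInstance, inferInstance, Ideal.Quotient.mk P, fun _ => Ideal.Quotient.eq_zero_iff_mem⟩

/-- The points of a germ of codimension two in adapted coordinates: a series outside a prime ideal
`P` that contains `f₁`, `f₂` and meets the series in the variables of `T` in zero only, does not
vanish at some common zero of `f₁` and `f₂` arbitrarily close to the origin. -/
theorem AdaptedPair.exists_point [IsAlgClosed k] {T : Finset (Fin n)} {y z : Fin n} {D E : ℕ}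
    {f₁ f₂ r v g : MvPowerSeries (Fin n) k}
    (h : AdaptedPair (convergentSeries k n) T y z D E f₁ f₂ r v)
    (P : Ideal (convergentSeries k n)) [P.IsPrime] (h₁ : ⟨f₁, h.mem₁⟩ ∈ P) (h₂ : ⟨f₂, h.mem₂⟩ ∈ P)
    (hPT : ∀ a ∈ P, (a : MvPowerSeries (Fin n) k) ∈ seriesIn k T → a = 0)
    (hg : g ∈ convergentSeries k n) (hgP : ⟨g, hg⟩ ∉ P) {δ : ℝ≥0} (hδ : 0 < δ) :
    ∃ p : Fin n → k, (∀ i, ‖p i‖₊ ≤ δ) ∧ valueAt f₁ p = 0 ∧ valueAt f₂ p = 0 ∧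
      valueAt g p ≠ 0 := by
  obtain ⟨C, _, _, π, hπ⟩ := exists_ringHom_ker_eq P
  exact h.exists_point_of_ringHom π (fun _ => (hπ _).2 h₁) (fun _ => (hπ _).2 h₂)
    (fun a ha => hPT a ((hπ a).1 ha)) hg (fun _ h0 => hgP ((hπ _).1 h0)) hδ

/-- Points arbitrarily close to the origin can be found in sheared coordinates. -/
theorem exists_point_of_shear {f₁ f₂ g : MvPowerSeries (Fin n) k} (z : Fin n) (c : Fin n → k)
    (h₁ : f₁ ∈ convergentSeries k n) (h₂ : f₂ ∈ convergentSeries k n)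
    (hg : g ∈ convergentSeries k n)
    (H : ∀ δ : ℝ≥0, 0 < δ → ∃ p : Fin n → k, (∀ i, ‖p i‖₊ ≤ δ) ∧ valueAt (shear z c f₁) p = 0 ∧
      valueAt (shear z c f₂) p = 0 ∧ valueAt (shear z c g) p ≠ 0) (δ : ℝ≥0) (hδ : 0 < δ) :
    ∃ p : Fin n → k, (∀ i, ‖p i‖₊ ≤ δ) ∧ valueAt f₁ p = 0 ∧ valueAt f₂ p = 0 ∧
      valueAt g p ≠ 0 := by
  have hδ' : ∀ᶠ s in 𝓝[>] (0 : ℝ≥0), 0 < s ∧ s ≤ δ := by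
    filter_upwards [self_mem_nhdsWithin, (eventually_le_nhds hδ).filter_mono nhdsWithin_le_nhds]
      with s h1 h2
    exact ⟨h1, h2⟩
  obtain ⟨r, ⟨hr0, hrδ⟩, k1, k2, k3⟩ := (hδ'.and <| (eventually_mem_convergentOn h₁).and <|
    (eventually_mem_convergentOn h₂).and <| (eventually_mem_convergentOn hg)).exists
  have h1 : ∀ᶠ s in 𝓝[>] (0 : ℝ≥0), ∀ i, s + ‖c i‖₊ * s ≤ r := by
    refine eventually_all.2 fun i => ?_
    have h2 : Tendsto (fun s : ℝ≥0 => s + ‖c i‖₊ * s) (𝓝 0) (𝓝 (0 + ‖c i‖₊ * 0)) :=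
      Continuous.tendsto (by fun_prop) 0
    rw [mul_zero, add_zero] at h2
    exact (h2.eventually (eventually_le_nhds hr0)).filter_mono nhdsWithin_le_nhds
  obtain ⟨s, hs, hs0⟩ := (h1.and self_mem_nhdsWithin).exists
  obtain ⟨p, hp, e₁, e₂, eg⟩ := H s hs0
  rw [valueAt_shear k1 hs hp] at e₁
  rw [valueAt_shear k2 hs hp] at e₂
  rw [valueAt_shear k3 hs hp] at eg
  refine ⟨_, fun i => ?_, e₁, e₂, eg⟩
  refine (nnnorm_add_le _ _).trans (le_trans ?_ ((hs i).trans hrδ))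
  rw [nnnorm_mul]
  exact add_le_add (hp i) (mul_le_mul_right (hp z) _)

omit [CompleteSpace k] in
/-- A shear as an automorphism of a ring of series in all variables. -/
def IsWeierstrass.shearAut {O : Subalgebra k (MvPowerSeries (Fin n) k)} (hO : IsWeierstrass O)
    (z : Fin n) {c : Fin n → k} (hc : c z = 0) : O ≃ₐ[k] O where
  toFun f := ⟨shear z c f, hO.shear_mem z c f.2⟩
  invFun f := ⟨shear z (-c) f, hO.shear_mem z (-c) f.2⟩
  left_inv f := Subtype.ext (shear_neg_shear z hc _)
  right_inv f := Subtype.ext (by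
    have := shear_neg_shear z (c := -c) (by simp [hc]) (f : MvPowerSeries (Fin n) k)
    rwa [neg_neg] at this)
  map_mul' f g := Subtype.ext (map_mul (shear z c) _ _)
  map_add' f g := Subtype.ext (map_add (shear z c) _ _)
  commutes' a := Subtype.ext ((shear z c).commutes a)

omit [CompleteSpace k] in
/-- Coordinates adapted to a pair `f₁`, `f₂`, where `f₂` is regular modulo `f₁`. In these
coordinates the minimal primes of `(f₁, f₂)` contain no series in the variables other than `y` and
`z`, because such primes consist of zero divisors modulo `(f₁, f₂)`. -/
theorem IsWeierstrass.exists_adaptedPair_minimalPrimes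
    {O : Subalgebra k (MvPowerSeries (Fin n) k)} (hO : IsWeierstrass O) {y z : Fin n} (hyz : y ≠ z)
    {f₁ f₂ : O} (h0 : f₁ ≠ 0) (hreg : ∀ u, f₁ ∣ f₂ * u → f₁ ∣ u) :
    ∃ (T : Finset (Fin n)) (c₁ c₂ : Fin n → k) (hc₁ : c₁ z = 0) (hc₂ : c₂ y = 0) (D E : ℕ)
      (r v : MvPowerSeries (Fin n) k), AdaptedPair O T y z D E
        ((hO.shearAut z hc₁).trans (hO.shearAut y hc₂) f₁ : O)
        ((hO.shearAut z hc₁).trans (hO.shearAut y hc₂) f₂ : O) r v ∧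
      ∀ P ∈ (Ideal.span {f₁, f₂}).minimalPrimes, ∀ a : O,
        ((hO.shearAut z hc₁).trans (hO.shearAut y hc₂)).symm a ∈ P →
        (a : MvPowerSeries (Fin n) k) ∈ seriesIn k T → a = 0 := by
  classical
  have : Infinite k := NontriviallyNormedField.infinite k
  set T : Finset (Fin n) := (Finset.univ.erase z).erase y
  have hyT : y ∉ T := Finset.notMem_erase _ _
  have hyTi : insert y T = Finset.univ.erase z :=
    Finset.insert_erase (Finset.mem_erase.2 ⟨hyz, Finset.mem_univ y⟩)
  obtain ⟨c₁, c₂, hc₁, hc₂, D, E, r, v, h⟩ := hO.exists_adaptedPair hyT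
    (z := z) (by rw [hyTi]; exact Finset.notMem_erase _ _)
    (by rw [hyTi]; exact Finset.insert_erase (Finset.mem_univ z)) f₁.2 f₂.2
    (fun e => h0 (Subtype.ext e)) (by
      rintro u hu ⟨e, he, eq⟩
      obtain ⟨e', he'⟩ := hreg ⟨u, hu⟩ ⟨⟨e, he⟩, Subtype.ext eq⟩
      exact ⟨e', e'.2, congrArg Subtype.val he'⟩)
  refine ⟨T, c₁, c₂, hc₁, hc₂, D, E, r, v, h, fun P hP a ha haT => ?_⟩
  set σ := (hO.shearAut z hc₁).trans (hO.shearAut y hc₂)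
  by_contra ha0
  obtain ⟨u, hu, hau⟩ := Ideal.exists_mul_mem_of_mem_minimalPrimes hP ha
  apply hu
  obtain ⟨α, β, e⟩ := Ideal.mem_span_pair.1 hau
  have e1 : a * σ u = σ α * σ f₁ + σ β * σ f₂ := by
    rw [← map_mul, ← map_mul, ← map_add, e, map_mul]
    congr 1
    exact (σ.apply_symm_apply a).symm
  obtain ⟨α', hα', β', hβ', e2⟩ := h.torsionFree hO ⟨a.2, haT⟩ (fun e => ha0 (Subtype.ext e))
    (σ u).2 (σ β).2 (congrArg Subtype.val e1)
  have e3 : σ u = ⟨α', hα'⟩ * σ f₁ + ⟨β', hβ'⟩ * σ f₂ := Subtype.ext e2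
  rw [Ideal.mem_span_pair]
  refine ⟨σ.symm ⟨α', hα'⟩, σ.symm ⟨β', hβ'⟩, σ.injective ?_⟩
  rw [e3, map_add, map_mul, map_mul, σ.apply_symm_apply, σ.apply_symm_apply]

/-- A convergent series outside some minimal prime of `(f₁, f₂)`, where `f₂` is regular modulo
`f₁`, does not vanish at some common zero of `f₁` and `f₂` arbitrarily close to the origin. -/
theorem exists_point_of_minimalPrime [IsAlgClosed k] {y z : Fin n} (hyz : y ≠ z)
    {f₁ f₂ g : convergentSeries k n} (h0 : f₁ ≠ 0) (hreg : ∀ u, f₁ ∣ f₂ * u → f₁ ∣ u)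
    {P : Ideal (convergentSeries k n)} (hP : P ∈ (Ideal.span {f₁, f₂}).minimalPrimes)
    (hg : g ∉ P) (δ : ℝ≥0) (hδ : 0 < δ) : ∃ p : Fin n → k, (∀ i, ‖p i‖₊ ≤ δ) ∧
      valueAt (f₁ : MvPowerSeries (Fin n) k) p = 0 ∧
      valueAt (f₂ : MvPowerSeries (Fin n) k) p = 0 ∧ valueAt (g : MvPowerSeries (Fin n) k) p ≠ 0 := by
  have hO : IsWeierstrass (convergentSeries k n) := isWeierstrass_convergentSeries
  have hPp : P.IsPrime := hP.1.1
  obtain ⟨T, c₁, c₂, hc₁, hc₂, D, E, r, v, h, hT⟩ :=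
    hO.exists_adaptedPair_minimalPrimes hyz h0 hreg
  set σ := (hO.shearAut z hc₁).trans (hO.shearAut y hc₂)
  have hmem : ∀ x, σ x ∈ P.comap (σ.symm : convergentSeries k n →+* convergentSeries k n) ↔
      x ∈ P := by
    intro x
    rw [Ideal.mem_comap]
    change σ.symm (σ x) ∈ P ↔ _
    rw [σ.symm_apply_apply]
  have hf₁ : f₁ ∈ P := hP.1.2 (Ideal.subset_span (by simp))
  have hf₂ : f₂ ∈ P := hP.1.2 (Ideal.subset_span (by simp))
  exact exists_point_of_shear z c₁ f₁.2 f₂.2 g.2 (exists_point_of_shear y c₂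
    (hO.shear_mem _ _ f₁.2) (hO.shear_mem _ _ f₂.2) (hO.shear_mem _ _ g.2) fun δ hδ =>
    h.exists_point (P.comap (σ.symm : convergentSeries k n →+* convergentSeries k n))
      ((hmem f₁).2 hf₁) ((hmem f₂).2 hf₂) (fun a ha => hT P hP a ha)
      (hO.shear_mem _ _ (hO.shear_mem _ _ g.2)) (fun hgP => hg ((hmem g).1 hgP)) hδ) δ hδ

end Points

/-! ### Jacobian minors at minimal primes -/

section Jacobian

/-- Over a radical ideal, each element of a minimal prime is killed by an element outside of this
prime. -/
theorem exists_notMem_mul_mem_of_mem_minimalPrimes {R : Type*} [CommRing R] {I P : Ideal R}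
    (hI : I.IsRadical) (hP : P ∈ I.minimalPrimes) {x : R} (hx : x ∈ P) :
    ∃ s ∉ P, s * x ∈ I := by
  have hPp : P.IsPrime := hP.1.1
  by_contra! hcon
  -- a prime over `I` that avoids the products `x ^ i * s` with `s ∉ P` is a smaller one than `P`
  let S : Submonoid R := Submonoid.powers x ⊔ P.primeCompl
  have hdisj : Disjoint (I : Set R) S := by
    rw [Set.disjoint_left]
    intro a haI haS
    obtain ⟨b, hb, s, hs, rfl⟩ := Submonoid.mem_sup.1 haS
    obtain ⟨i, rfl⟩ := hb
    refine hcon s hs (hI ⟨i + 1, ?_⟩)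
    have : (s * x) ^ (i + 1) = s ^ i * x * (x ^ i * s) := by ring
    rw [this]
    exact I.mul_mem_left _ haI
  obtain ⟨Q, hQ, hIQ, hQS⟩ := Ideal.exists_le_prime_disjoint I S hdisj
  have hQP : Q ≤ P := by
    intro a ha
    by_contra haP
    exact Set.disjoint_left.1 hQS ha (Submonoid.mem_sup_right (show a ∈ P.primeCompl from haP))
  exact Set.disjoint_left.1 hQS (hP.2 ⟨hQ, hIQ⟩ hQP hx)
    (Submonoid.mem_sup_left (Submonoid.mem_powers x))

/-- An element that is algebraic modulo a prime, over a ring of characteristic zero that meets the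
prime in zero, is a simple root modulo that prime of some polynomial. -/
theorem exists_derivative_notMem {A R : Type*} [CommRing A] [IsDomain A] [CharZero A] [CommRing R]
    (ι : A →+* R) {P : Ideal R} [P.IsPrime] (hι : ∀ a, ι a ∈ P → a = 0) {y : R}
    (hy : ∃ w : Polynomial A, w ≠ 0 ∧ w.eval₂ ι y ∈ P) :
    ∃ w : Polynomial A, w.eval₂ ι y ∈ P ∧ w.derivative.eval₂ ι y ∉ P := by
  classical
  have hex : ∃ N, ∃ w : Polynomial A, w ≠ 0 ∧ w.eval₂ ι y ∈ P ∧ w.natDegree = N := by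
    obtain ⟨w, hw, hwP⟩ := hy
    exact ⟨_, w, hw, hwP, rfl⟩
  obtain ⟨w, hw, hwP, hdeg⟩ := Nat.find_spec hex
  refine ⟨w, hwP, fun hd => ?_⟩
  have hpos : w.natDegree ≠ 0 := by
    intro h0
    rw [Polynomial.eq_C_of_natDegree_eq_zero h0, Polynomial.eval₂_C] at hwP
    rw [Polynomial.eq_C_of_natDegree_eq_zero h0, hι _ hwP, map_zero] at hw
    exact hw rfl
  refine Nat.find_min hex (m := w.derivative.natDegree) ?_ ⟨w.derivative, ?_, hd, rfl⟩
  · rw [← hdeg]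
    exact Polynomial.natDegree_derivative_lt hpos
  · intro h0
    exact hpos (Polynomial.derivative_eq_zero.1 h0)

theorem derivation_eval₂ {k A R : Type*} [CommRing k] [CommRing A] [CommRing R] [Algebra k R]
    (ι : A →+* R) (D : Derivation k R R) (hD : ∀ a, D (ι a) = 0) (y : R) (w : Polynomial A) :
    D (w.eval₂ ι y) = w.derivative.eval₂ ι y * D y := by
  induction w using Polynomial.induction_on' with
  | add p q hp hq => simp only [Polynomial.eval₂_add, map_add, hp, hq, add_mul]
  | monomial m a =>
    rw [Polynomial.eval₂_monomial, Polynomial.derivative_monomial, Polynomial.eval₂_monomial,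
      Derivation.leibniz, Derivation.leibniz_pow, hD, smul_zero, add_zero, map_mul, map_natCast]
    simp only [smul_eq_mul, nsmul_eq_mul]
    ring

/-- The Jacobian criterion, in the direction that needs characteristic zero: at a minimal prime of
a radical ideal `(f₁, f₂)` the Jacobian minor of `f₁`, `f₂` with respect to two variables `y`, `z`
does not vanish, if `y` and `z` are algebraic there over a subring of constants. -/
theorem jacobian_notMem {k A R : Type*} [CommRing k] [CommRing A] [IsDomain A] [CharZero A]
    [CommRing R] [Algebra k R] (ι : A →+* R) {f₁ f₂ : R} (hI : (Ideal.span {f₁, f₂}).IsRadical) {P : Ideal R}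
    (hP : P ∈ (Ideal.span {f₁, f₂}).minimalPrimes) (hι : ∀ a, ι a ∈ P → a = 0) {y z : R}
    (hy : ∃ w : Polynomial A, w ≠ 0 ∧ w.eval₂ ι y ∈ P)
    (hz : ∃ w : Polynomial A, w ≠ 0 ∧ w.eval₂ ι z ∈ P) {D₁ D₂ : Derivation k R R}
    (h₁ : ∀ a, D₁ (ι a) = 0) (h₂ : ∀ a, D₂ (ι a) = 0) (h₁y : D₁ y = 1) (h₁z : D₁ z = 0)
    (h₂z : D₂ z = 1) : D₁ f₁ * D₂ f₂ - D₁ f₂ * D₂ f₁ ∉ P := by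
  have hPp : P.IsPrime := hP.1.1
  obtain ⟨w, hw, hw'⟩ := exists_derivative_notMem ι hι hy
  obtain ⟨v, hv, hv'⟩ := exists_derivative_notMem ι hι hz
  have hf₁ : f₁ ∈ P := hP.1.2 (Ideal.subset_span (by simp))
  have hf₂ : f₂ ∈ P := hP.1.2 (Ideal.subset_span (by simp))
  obtain ⟨s, hs, hsw⟩ := exists_notMem_mul_mem_of_mem_minimalPrimes hI hP hw
  obtain ⟨t, ht, htv⟩ := exists_notMem_mul_mem_of_mem_minimalPrimes hI hP hv
  obtain ⟨a₁, a₂, ea⟩ := Ideal.mem_span_pair.1 hsw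
  obtain ⟨b₁, b₂, eb⟩ := Ideal.mem_span_pair.1 htv
  -- derivatives of the two relations, modulo `P`
  have key : ∀ (D : Derivation k R R) (c₁ c₂ q x : R), c₁ * f₁ + c₂ * f₂ = q * x → x ∈ P →
      c₁ * D f₁ + c₂ * D f₂ - q * D x ∈ P := by
    intro D c₁ c₂ q x e hx
    have e' := congrArg D e
    simp only [map_add, Derivation.leibniz, smul_eq_mul] at e'
    have : c₁ * D f₁ + c₂ * D f₂ - q * D x = x * D q - f₁ * D c₁ - f₂ * D c₂ := by
      linear_combination e'
    rw [this]
    exact P.sub_mem (P.sub_mem (P.mul_mem_right _ hx) (P.mul_mem_right _ hf₁))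
      (P.mul_mem_right _ hf₂)
  have k11 := key D₁ _ _ _ _ ea hw
  have k12 := key D₁ _ _ _ _ eb hv
  have k22 := key D₂ _ _ _ _ eb hv
  rw [derivation_eval₂ ι D₁ h₁, h₁y, mul_one] at k11
  rw [derivation_eval₂ ι D₁ h₁, h₁z, mul_zero, mul_zero, sub_zero] at k12
  rw [derivation_eval₂ ι D₂ h₂, h₂z, mul_one] at k22
  intro hJ
  have hprod : s * w.derivative.eval₂ ι y * (t * v.derivative.eval₂ ι z) ∈ P := by
    rw [← Ideal.Quotient.eq_zero_iff_mem] at k11 k12 k22 hJ ⊢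
    simp only [map_sub, map_add, map_mul] at k11 k12 k22 hJ ⊢
    set μ := Ideal.Quotient.mk P
    linear_combination (μ a₁ * μ (D₂ f₁) + μ a₂ * μ (D₂ f₂)) * k12 +
      (-(μ t * μ (v.derivative.eval₂ ι z))) * k11 + (-(μ a₁ * μ (D₁ f₁) + μ a₂ * μ (D₁ f₂))) * k22 + 
       (μ a₁ * μ b₂ - μ a₂ * μ b₁) * hJ
  rcases hPp.mem_or_mem hprod with h | h
  · exact (hPp.mem_or_mem h).elim hs hw'
  · exact (hPp.mem_or_mem h).elim ht hv'

end Jacobian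

/-! ### Derivations of rings of germs -/

section Derivations
open MvPowerSeries

variable {k : Type*} [Field k] {n : ℕ} {O : Subalgebra k (MvPowerSeries (Fin n) k)}

/-- The partial derivatives of a ring of germs. -/
def IsGermRing.partial (hO : IsGermRing O) (i : Fin n) : Derivation k O O :=
  Derivation.mk' (((pderiv k i : Derivation k _ _).toLinearMap.domRestrict
      (Subalgebra.toSubmodule O)).codRestrict (Subalgebra.toSubmodule O)
      fun f => hO.pderiv_mem i f.2) fun _ _ => Subtype.ext (Derivation.leibniz (pderiv k i) _ _)

/-- The coordinates of a ring of germs. -/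
def IsGermRing.coord (hO : IsGermRing O) (i : Fin n) : O := ⟨X i, hO.X_mem i⟩

/-- A derivation that kills the coordinates is zero, because its values lie in all powers of the
maximal ideal. -/
theorem IsGermRing.derivation_eq_zero (hO : IsGermRing O) {D : Derivation k O O}
    (h : ∀ i, D (hO.coord i) = 0) (f : O) : D f = 0 := by
  have key : ∀ (N : ℕ) (f : O), D f ∈ hO.varIdeal ^ N := by
    intro N
    induction N with
    | zero => simp
    | succ N ih =>
      intro f
      set a := constantCoeff (f : MvPowerSeries (Fin n) k)
      have h1 : constantCoeff ((f - algebraMap k O a : O) : MvPowerSeries (Fin n) k) = 0 := by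
        rw [AddSubgroupClass.coe_sub, map_sub, sub_eq_zero]
        exact (constantCoeff_C a).symm
      obtain ⟨c, hc, e⟩ := hO.exists_eq_sum (f - algebraMap k O a).2 h1
      have e1 : f = algebraMap k O a + ∑ i, (⟨c i, hc i⟩ : O) * hO.coord i := by
        rw [← sub_eq_iff_eq_add']
        apply Subtype.ext
        rw [e, AddSubmonoidClass.coe_finsetSum]
        rfl
      rw [e1, map_add, Derivation.map_algebraMap, zero_add, map_sum, pow_succ']
      refine sum_mem fun i _ => ?_
      rw [Derivation.leibniz, h, smul_zero, zero_add, smul_eq_mul]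
      exact Ideal.mul_mem_mul (Ideal.subset_span (Set.mem_range_self i)) (ih _)
  have := hO.mem_of_forall_order (I := ⊥) (g := D f) fun N =>
    ⟨0, zero_mem _, by
      rw [sub_zero]
      exact mem_orderIdeal.1 (hO.varIdeal_pow_le N (key N f))⟩
  simpa using this

theorem sum_derivation_apply {R S ι : Type*} [CommRing R] [CommRing S] [Algebra R S] (s : Finset ι)
    (D : ι → Derivation R S S) (a : S) : (∑ i ∈ s, D i) a = ∑ i ∈ s, D i a := by
  classical
  induction s using Finset.induction_on with
  | empty => simp
  | insert i s hi ih => rw [Finset.sum_insert hi, Finset.sum_insert hi, Derivation.add_apply, ih]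

theorem IsGermRing.derivation_eq_sum (hO : IsGermRing O) (D : Derivation k O O) (f : O) :
    D f = ∑ i, D (hO.coord i) * hO.partial i f := by
  classical
  have h := hO.derivation_eq_zero (D := D - ∑ i, D (hO.coord i) • hO.partial i) (fun j => ?_) f
  · rw [Derivation.sub_apply, sub_eq_zero] at h
    rw [h, sum_derivation_apply]
    rfl
  · rw [Derivation.sub_apply, sum_derivation_apply, sub_eq_zero,
      Finset.sum_eq_single_of_mem j (Finset.mem_univ j)]
    · have : hO.partial j (hO.coord j) = 1 := Subtype.ext pderiv_X_self
      rw [Derivation.smul_apply, this, smul_eq_mul, mul_one]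
    · intro i _ hij
      have : hO.partial i (hO.coord j) = 0 := Subtype.ext (pderiv_X_of_ne hij.symm)
      rw [Derivation.smul_apply, this, smul_zero]

/-- The Jacobian minors of a pair of germs. -/
def IsGermRing.minor (hO : IsGermRing O) (f₁ f₂ : O) (i j : Fin n) : O :=
  hO.partial i f₁ * hO.partial j f₂ - hO.partial i f₂ * hO.partial j f₁

/-- Every derivation is a combination of the partial ones, so the Jacobian determinant for two
derivations is a combination of the minors. -/
theorem IsGermRing.exists_minor_notMem (hO : IsGermRing O) {P : Ideal O} {f₁ f₂ : O}
    {D₁ D₂ : Derivation k O O} (h : D₁ f₁ * D₂ f₂ - D₁ f₂ * D₂ f₁ ∉ P) :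
    ∃ i j, hO.minor f₁ f₂ i j ∉ P := by
  by_contra! hcon
  apply h
  have : D₁ f₁ * D₂ f₂ - D₁ f₂ * D₂ f₁ =
      ∑ i, ∑ j, D₁ (hO.coord i) * D₂ (hO.coord j) * hO.minor f₁ f₂ i j := by
    rw [hO.derivation_eq_sum D₁ f₁, hO.derivation_eq_sum D₁ f₂, hO.derivation_eq_sum D₂ f₁,
      hO.derivation_eq_sum D₂ f₂, Finset.sum_mul_sum, Finset.sum_mul_sum, ← Finset.sum_sub_distrib]
    refine Finset.sum_congr rfl fun i _ => ?_
    rw [← Finset.sum_sub_distrib]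
    refine Finset.sum_congr rfl fun j _ => ?_
    rw [minor]
    ring
  rw [this]
  exact sum_mem fun i _ => sum_mem fun j _ => P.mul_mem_left _ (hcon i j)

/-- A derivation carried over by an automorphism. -/
def conjDerivation {R S : Type*} [CommRing R] [CommRing S] [Algebra R S] (σ : S ≃ₐ[R] S)
    (D : Derivation R S S) : Derivation R S S :=
  Derivation.mk' (σ.symm.toLinearMap ∘ₗ D.toLinearMap ∘ₗ σ.toLinearMap) fun a b => by
    simp [Derivation.leibniz]

theorem conjDerivation_apply {R S : Type*} [CommRing R] [CommRing S] [Algebra R S] (σ : S ≃ₐ[R] S)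
    (D : Derivation R S S) (a : S) : conjDerivation σ D a = σ.symm (D (σ a)) := rfl

end Derivations

/-! ### The Jacobian criterion for formal and convergent power series -/

section ConvergentMinors
open MvPowerSeries

variable {k : Type*} [NontriviallyNormedField k] [CharZero k] {n : ℕ}
  {O : Subalgebra k (MvPowerSeries (Fin n) k)}

omit [CharZero k] in
/-- Modulo `(f₁, f₂)`, the coordinates `y` and `z` of an adapted pair are integral over the series
in the remaining variables. -/
theorem AdaptedPair.isIntegralElem {T : Finset (Fin n)} {y z : Fin n} {D E : ℕ}
    {f₁ f₂ r v : MvPowerSeries (Fin n) k} (hO : IsWeierstrass O)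
    (h : AdaptedPair O T y z D E f₁ f₂ r v) {C : Type*} [CommRing C] (π : O →+* C)
    (h₁ : ∀ hm, π ⟨f₁, hm⟩ = 0) (h₂ : ∀ hm, π ⟨f₂, hm⟩ = 0) :
    ((π.comp (Subalgebra.inclusion (inf_le_left : O ⊓ seriesIn k T ≤ O)).toRingHom)).IsIntegralElem
      (π ⟨X y, hO.X_mem y⟩) ∧
    ((π.comp (Subalgebra.inclusion (inf_le_left : O ⊓ seriesIn k T ≤ O)).toRingHom)).IsIntegralElem
      (π ⟨X z, hO.X_mem z⟩) := by
  set ι : partialRing O T →+* O :=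
    (Subalgebra.inclusion (inf_le_left : O ⊓ seriesIn k T ≤ O)).toRingHom
  set φ := π.comp ι
  let := φ.toAlgebra
  have hφ : ∀ a : partialRing O T, IsIntegral (partialRing O T) (π ⟨a, a.2.1⟩) := fun a =>
    isIntegral_algebraMap (x := a)
  have hr : π ⟨r, h.mem_r.1⟩ = 0 := by
    obtain ⟨d, hd, ed⟩ := h.dvd
    have h3 : (⟨r, h.mem_r.1⟩ : O) =
        ⟨f₁, h.mem₁⟩ * ⟨d, hd⟩ + ⟨f₂, h.mem₂⟩ * ⟨v, h.mem_v⟩ :=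
      Subtype.ext (by rw [sub_eq_iff_eq_add] at ed; exact ed)
    rw [h3, map_add, map_mul, map_mul, h₁, h₂, zero_mul, zero_mul, add_zero]
  -- a unit multiple of a monic polynomial
  have key : ∀ (x : Fin n) (N : ℕ) (c : ℕ → O) (w g : O),
      constantCoeff (w : MvPowerSeries (Fin n) k) ≠ 0 → π g = 0 →
      (∀ j, IsIntegral (partialRing O T) (π (c j))) →
      (g : MvPowerSeries (Fin n) k) = (w : MvPowerSeries (Fin n) k) *
        (X x ^ N - ∑ j ∈ Finset.range N, (c j : MvPowerSeries (Fin n) k) * X x ^ j) →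
      IsIntegral (partialRing O T) (π ⟨X x, hO.X_mem x⟩) := by
    intro x N c w g hw hg hc e
    refine isIntegral_of_pow_eq_sum (E := N) hc ?_
    have hu : IsUnit w := IsUnit.of_mul_eq_one
      ⟨_, (hO.inv_mem z ⟨w.2, mem_seriesIn_univ _⟩ hw).1⟩
      (Subtype.ext (MvPowerSeries.mul_inv_cancel _ hw))
    have e' : g = w * ((⟨X x, hO.X_mem x⟩ : O) ^ N -
        ∑ j ∈ Finset.range N, c j * (⟨X x, hO.X_mem x⟩ : O) ^ j) := by
      apply Subtype.ext
      rw [e, MulMemClass.coe_mul, AddSubgroupClass.coe_sub, AddSubmonoidClass.coe_finsetSum]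
      rfl
    rw [e', map_mul, (hu.map π).mul_right_eq_zero, map_sub, sub_eq_zero] at hg
    simpa only [map_sum, map_mul, map_pow] using hg
  have hy : IsIntegral (partialRing O T) (π ⟨X y, hO.X_mem y⟩) := by
    obtain ⟨c, hc, -, w, hw, hw0, e⟩ :=
      hO.exists_eq_mul_weierstrass h.notMem_y h.regular_r h.mem_r
    exact key y E (fun j => ⟨c j, (hc j).1⟩) ⟨w, hw.1⟩ ⟨r, h.mem_r.1⟩ hw0 hr
      (fun j => hφ ⟨c j, hc j⟩) e
  refine ⟨hy, ?_⟩
  obtain ⟨b, hb, -, w, hw, hw0, e⟩ := hO.exists_eq_mul_weierstrass h.notMem_z h.regular₁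
    ⟨h.mem₁, by rw [h.cover]; exact mem_seriesIn_univ _⟩
  refine key z D (fun j => ⟨b j, (hb j).1⟩) ⟨w, hw.1⟩ ⟨f₁, h.mem₁⟩ hw0 (h₁ _) (fun j => ?_) e
  obtain ⟨q, hq, c, hc, eb⟩ := h.division_r hO (hb j)
  have e' : (⟨b j, (hb j).1⟩ : O) = ⟨q, hq.1⟩ * ⟨r, h.mem_r.1⟩ +
      ∑ i ∈ Finset.range E, (⟨c i, (hc i).1⟩ : O) * (⟨X y, hO.X_mem y⟩ : O) ^ i := by
    apply Subtype.ext
    rw [AddMemClass.coe_add, AddSubmonoidClass.coe_finsetSum]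
    exact eb
  rw [e', map_add, map_mul, hr, mul_zero, zero_add, map_sum]
  refine IsIntegral.sum _ fun i _ => ?_
  rw [map_mul, map_pow]
  exact (hφ ⟨c i, hc i⟩).mul (hy.pow i)

theorem pderiv_eq_zero_of_mem_seriesIn {k : Type*} [Field k] {T : Finset (Fin n)} {i : Fin n}
    (hi : i ∉ T) {f : MvPowerSeries (Fin n) k} (hf : f ∈ seriesIn k T) : pderiv k i f = 0 := by
  ext m
  rw [coeff_pderiv, hf _ ⟨i, hi, by simp⟩, zero_mul, map_zero]

/-- The Jacobian criterion at the minimal primes of a radical ideal `(f₁, f₂)` in a Weierstrass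
ring. -/
theorem IsWeierstrass.exists_minor_notMem (hW : IsWeierstrass O) (hO : IsGermRing O) {y z : Fin n}
    (hyz : y ≠ z) {f₁ f₂ : O} (h0 : f₁ ≠ 0) (hreg : ∀ u, f₁ ∣ f₂ * u → f₁ ∣ u)
    (hI : (Ideal.span {f₁, f₂}).IsRadical) {P : Ideal O}
    (hP : P ∈ (Ideal.span {f₁, f₂}).minimalPrimes) : ∃ i j, hO.minor f₁ f₂ i j ∉ P := by
  obtain ⟨T, c₁, c₂, hc₁, hc₂, D, E, r, v, h, hT⟩ :=
    hW.exists_adaptedPair_minimalPrimes hyz h0 hreg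
  set σ := (hW.shearAut z hc₁).trans (hW.shearAut y hc₂)
  have hPp : P.IsPrime := hP.1.1
  have hf₁ : f₁ ∈ P := hP.1.2 (Ideal.subset_span (by simp))
  have hf₂ : f₂ ∈ P := hP.1.2 (Ideal.subset_span (by simp))
  obtain ⟨C, _, _, π, hπ⟩ := exists_ringHom_ker_eq P
  have : CharZero (partialRing O T) :=
    charZero_of_injective_algebraMap (algebraMap k (partialRing O T)).injective
  let incl : partialRing O T →+* O :=
    (Subalgebra.inclusion (inf_le_left : O ⊓ seriesIn k T ≤ O)).toRingHom
  let τ : O →+* O := (σ.symm : O →+* O)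
  have hτ : ∀ a, τ (σ a) = a := σ.symm_apply_apply
  obtain ⟨hy, hz⟩ := h.isIntegralElem hW (π.comp τ)
    (fun _ => (hπ _).2 (by rw [← hτ f₁] at hf₁; exact hf₁))
    (fun _ => (hπ _).2 (by rw [← hτ f₂] at hf₂; exact hf₂))
  have halg : ∀ x : O, ((π.comp τ).comp incl).IsIntegralElem ((π.comp τ) x) →
      ∃ w : Polynomial (partialRing O T), w ≠ 0 ∧ w.eval₂ (τ.comp incl) (τ x) ∈ P := by
    rintro x ⟨w, hw, e⟩
    refine ⟨w, hw.ne_zero, (hπ _).1 ?_⟩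
    rw [Polynomial.hom_eval₂]
    exact e
  have hconst : ∀ i, i ∉ T → ∀ a, conjDerivation σ (hO.partial i) ((τ.comp incl) a) = 0 := by
    intro i hi a
    rw [conjDerivation_apply]
    change σ.symm (hO.partial i (σ (σ.symm (incl a)))) = 0
    rw [σ.apply_symm_apply, show hO.partial i (incl a) = 0 from
      Subtype.ext (pderiv_eq_zero_of_mem_seriesIn hi a.2.2), map_zero]
  have hcoord : ∀ i (x : O), conjDerivation σ (hO.partial i) (τ x) = τ (hO.partial i x) := by
    intro i x
    rw [conjDerivation_apply]
    change σ.symm (hO.partial i (σ (σ.symm x))) = _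
    rw [σ.apply_symm_apply]
    rfl
  have hyT := h.notMem_y
  have hzT : z ∉ T := fun hz => h.notMem_z (Finset.mem_insert_of_mem hz)
  refine hO.exists_minor_notMem (jacobian_notMem (τ.comp incl) hI hP (fun a ha => ?_)
    (halg _ hy) (halg _ hz) (D₁ := conjDerivation σ (hO.partial y))
    (D₂ := conjDerivation σ (hO.partial z)) (hconst y hyT) (hconst z hzT) ?_ ?_ ?_)
  · have := hT P hP (incl a) ha a.2.2
    exact Subtype.ext (congrArg (fun x : O => (x : MvPowerSeries (Fin n) k)) this)
  · rw [hcoord, show hO.partial y ⟨X y, hW.X_mem y⟩ = 1 from Subtype.ext pderiv_X_self, map_one]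
  · rw [hcoord, show hO.partial y ⟨X z, hW.X_mem z⟩ = 0 from
      Subtype.ext (pderiv_X_of_ne hyz.symm), map_zero]
  · rw [hcoord, show hO.partial z ⟨X z, hW.X_mem z⟩ = 1 from Subtype.ext pderiv_X_self, map_one]

end ConvergentMinors

/-! ### Extension of rings of germs -/

section Completion
open MvPowerSeries

variable {k : Type*} [Field k] {n : ℕ} {O : Subalgebra k (MvPowerSeries (Fin n) k)}

theorem IsGermRing.coe_mem (hO : IsGermRing O) (p : MvPolynomial (Fin n) k) :
    (p : MvPowerSeries (Fin n) k) ∈ O := by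
  induction p using MvPolynomial.induction_on with
  | C a => rw [MvPolynomial.coe_C]; exact O.algebraMap_mem a
  | add p q hp hq => rw [MvPolynomial.coe_add]; exact add_mem hp hq
  | mul_X p i hp =>
    rw [MvPolynomial.coe_mul, MvPolynomial.coe_X]
    exact mul_mem hp (hO.X_mem i)

theorem le_order_sub_truncTotal (N : ℕ) (f : MvPowerSeries (Fin n) k) :
    (N : ℕ∞) ≤ (f - (truncTotal N f : MvPolynomial (Fin n) k)).order := by
  refine nat_le_order fun m hm => ?_
  rw [map_sub, MvPolynomial.coeff_coe, coeff_truncTotal _ hm, sub_self]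

theorem IsGermRing.mem_orderIdeal_iff (hO : IsGermRing O) {N : ℕ} {f : O} :
    f ∈ hO.varIdeal ^ N ↔ (N : ℕ∞) ≤ (f : MvPowerSeries (Fin n) k).order := by
  rw [← hO.orderIdeal_eq, mem_orderIdeal]

/-- Polynomials approximate each series to any order. -/
theorem IsGermRing.exists_approx (hO : IsGermRing O) (N : ℕ) (f : MvPowerSeries (Fin n) k) :
    ∃ p : O, (N : ℕ∞) ≤ (f - p).order :=
  ⟨⟨_, hO.coe_mem (truncTotal N f)⟩, le_order_sub_truncTotal N f⟩

theorem le_order_add_of_le {N : ℕ∞} {f g : MvPowerSeries (Fin n) k} (hf : N ≤ f.order)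
    (hg : N ≤ g.order) : N ≤ (f + g).order :=
  (le_min hf hg).trans min_order_le_add

theorem le_order_mul_of_le {N : ℕ∞} {f : MvPowerSeries (Fin n) k} (g : MvPowerSeries (Fin n) k)
    (hf : N ≤ f.order) : N ≤ (f * g).order :=
  (hf.trans le_self_add).trans le_order_mul

/-- Ideals of a ring of germs are contracted from larger rings of series. -/
theorem IsGermRing.mem_span_pair_of_eq (hO : IsGermRing O) {f₁ f₂ u : O}
    {α β : MvPowerSeries (Fin n) k} (e : (u : MvPowerSeries (Fin n) k) = α * f₁ + β * f₂) :
    u ∈ Ideal.span {f₁, f₂} := by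
  refine hO.mem_of_forall_order fun N => ?_
  obtain ⟨a, ha⟩ := hO.exists_approx N α
  obtain ⟨b, hb⟩ := hO.exists_approx N β
  refine ⟨a * f₁ + b * f₂, Ideal.mem_span_pair.2 ⟨a, b, rfl⟩, ?_⟩
  have : ((u - (a * f₁ + b * f₂) : O) : MvPowerSeries (Fin n) k) =
      (α - a) * f₁ + (β - b) * f₂ := by
    rw [AddSubgroupClass.coe_sub, e, AddMemClass.coe_add, MulMemClass.coe_mul, MulMemClass.coe_mul]
    ring
  rw [this]
  exact le_order_add_of_le (le_order_mul_of_le _ ha) (le_order_mul_of_le _ hb)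

/-- The extension to a larger ring of germs preserves the regularity of `f₂` modulo `f₁`. -/
theorem IsGermRing.dvd_of_dvd_mul (hO : IsGermRing O) {O' : Subalgebra k (MvPowerSeries (Fin n) k)}
    (hO' : IsGermRing O') (hle : O ≤ O') {f₁ f₂ : O} (hreg : ∀ u, f₁ ∣ f₂ * u → f₁ ∣ u)
    (u : O') (hu : Subalgebra.inclusion hle f₁ ∣ Subalgebra.inclusion hle f₂ * u) :
    Subalgebra.inclusion hle f₁ ∣ u := by
  have := hO.isNoetherianRing
  obtain ⟨c, hc⟩ := hu
  have e : (f₂ : MvPowerSeries (Fin n) k) * u = f₁ * c := congrArg Subtype.val hc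
  -- by the Artin–Rees lemma, the relations between `f₁` and `f₂` over the larger ring can be
  -- approximated by relations over the smaller one
  obtain ⟨t, ht⟩ := Ideal.exists_pow_inf_eq_pow_smul hO.varIdeal (Ideal.span {f₁, f₂})
  rw [← Ideal.mem_span_singleton]
  refine hO'.mem_of_forall_order fun N => ?_
  obtain ⟨u₀, hu₀⟩ := hO.exists_approx (N + t) (u : MvPowerSeries (Fin n) k)
  obtain ⟨c₀, hc₀⟩ := hO.exists_approx (N + t) (c : MvPowerSeries (Fin n) k)
  have h1 : f₂ * u₀ - f₁ * c₀ ∈ hO.varIdeal ^ (N + t) := by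
    rw [hO.mem_orderIdeal_iff]
    have : ((f₂ * u₀ - f₁ * c₀ : O) : MvPowerSeries (Fin n) k) =
        (c - c₀) * f₁ + (u - u₀) * (-f₂) := by
      rw [AddSubgroupClass.coe_sub, MulMemClass.coe_mul, MulMemClass.coe_mul]
      linear_combination e
    rw [this]
    exact le_order_add_of_le (le_order_mul_of_le _ hc₀) (le_order_mul_of_le _ hu₀)
  have h2 : f₂ * u₀ - f₁ * c₀ ∈ Ideal.span {f₁, f₂} :=
    Ideal.mem_span_pair.2 ⟨-c₀, u₀, by ring⟩
  have h3 : f₂ * u₀ - f₁ * c₀ ∈ hO.varIdeal ^ N * Ideal.span {f₁, f₂} := by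
    have h4 : f₂ * u₀ - f₁ * c₀ ∈ hO.varIdeal ^ (N + t) • (⊤ : Submodule O O) ⊓
        Ideal.span {f₁, f₂} := ⟨by simpa using h1, h2⟩
    rw [ht _ (Nat.le_add_left t N), Nat.add_sub_cancel] at h4
    exact Ideal.mul_mono_right inf_le_right h4
  rw [Ideal.span_insert, Ideal.mul_sup, Submodule.mem_sup] at h3
  obtain ⟨x, hx, y, hy, exy⟩ := h3
  obtain ⟨a, ha, rfl⟩ := Ideal.mem_mul_span_singleton.1 hx
  obtain ⟨b, hb, rfl⟩ := Ideal.mem_mul_span_singleton.1 hy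
  obtain ⟨q, hq⟩ := hreg (u₀ - b) ⟨c₀ + a, by linear_combination -exy⟩
  refine ⟨Subalgebra.inclusion hle f₁ * Subalgebra.inclusion hle q,
    Ideal.mul_mem_right _ _ (Ideal.mem_span_singleton_self _), ?_⟩
  have h5 : ((u - Subalgebra.inclusion hle f₁ * Subalgebra.inclusion hle q : O') :
      MvPowerSeries (Fin n) k) = (u - u₀) * 1 + b := by
    have := congrArg (Subtype.val : O → MvPowerSeries (Fin n) k) hq
    rw [AddSubgroupClass.coe_sub, MulMemClass.coe_mul] at this
    rw [AddSubgroupClass.coe_sub, MulMemClass.coe_mul, Subalgebra.coe_inclusion,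
      Subalgebra.coe_inclusion]
    linear_combination this
  rw [h5]
  refine le_order_add_of_le (le_order_mul_of_le _ (le_trans ?_ hu₀)) (hO.mem_orderIdeal_iff.1 hb)
  exact_mod_cast Nat.le_add_right N t

end Completion

theorem mem_of_forall_minimalPrimes {R : Type*} [CommRing R] {I : Ideal R} (hI : I.IsRadical)
    {a : R} (h : ∀ P ∈ I.minimalPrimes, a ∈ P) : a ∈ I := by
  rw [← hI.radical, ← Ideal.sInf_minimalPrimes, Ideal.mem_sInf]
  exact fun {P} hP => h P hP

/-! ### Vanishing of the adjugate at smooth points -/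

section PointwiseVanishing
open MvPowerSeries
open scoped NNReal

variable {k : Type*} [NontriviallyNormedField k] [CompleteSpace k] {n : ℕ}
  {O : Subalgebra k (MvPowerSeries (Fin n) k)}

/-- Values of matrices and of their adjugates at points near the origin. -/
theorem eventually_map_adjugate (hle : O ≤ convergentSeries k n) {d : ℕ}
    (M : Matrix (Fin d) (Fin d) O) : ∀ᶠ r in 𝓝[>] (0 : ℝ≥0), ∀ p : Fin n → k, (∀ i, ‖p i‖₊ ≤ r) →
      M.adjugate.map (fun g => valueAt (g : MvPowerSeries (Fin n) k) p) =
        (M.map fun g => valueAt (g : MvPowerSeries (Fin n) k) p).adjugate := by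
  have h1 : ∀ᶠ r in 𝓝[>] (0 : ℝ≥0), ∀ i j, (M i j : MvPowerSeries (Fin n) k) ∈ convergentOn k n r :=
    eventually_all.2 fun i => eventually_all.2 fun j => eventually_mem_convergentOn (hle (M i j).2)
  filter_upwards [h1] with r hr p hp
  let L : Matrix (Fin d) (Fin d) (convergentOn k n r) := Matrix.of fun i j => ⟨M i j, hr i j⟩
  have e1 : ∀ i j, (L.adjugate i j : MvPowerSeries (Fin n) k) = M.adjugate i j := by
    intro i j
    have h2 := RingHom.map_adjugate (convergentOn k n r).val.toRingHom L
    have h3 := RingHom.map_adjugate O.val.toRingHom M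
    have h4 : (convergentOn k n r).val.toRingHom.mapMatrix L = O.val.toRingHom.mapMatrix M := rfl
    rw [h4, ← h3] at h2
    exact congrFun (congrFun h2 i) j
  have e2 := RingHom.map_adjugate (evalHom hp).toRingHom L
  ext i j
  rw [Matrix.map_apply, ← e1]
  exact congrFun (congrFun e2 i) j

/-- Near the origin, the adjugate of a maximally generated representation vanishes at the common
points of the two hypersurfaces, because the determinant vanishes there to order two. -/
theorem eventually_adjugate_eq_zero (hle : O ≤ convergentSeries k n) {d : ℕ}
    (M : Matrix (Fin d) (Fin d) O) {f₁ f₂ : O} (hM : f₁ * f₂ ∣ M.det) :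
    ∀ᶠ r in 𝓝[>] (0 : ℝ≥0), ∀ p : Fin n → k, (∀ i, ‖p i‖₊ ≤ r) →
      valueAt (f₁ : MvPowerSeries (Fin n) k) p = 0 → valueAt (f₂ : MvPowerSeries (Fin n) k) p = 0 →
      MaxGenAt M p → ∀ i j, valueAt (M.adjugate i j : MvPowerSeries (Fin n) k) p = 0 := by
  obtain ⟨w, hw⟩ := hM
  have hw' : (M.det : MvPowerSeries (Fin n) k) = f₁ * f₂ * w := congrArg Subtype.val hw
  have hd : ∀ f : O, ∀ᶠ r in 𝓝[>] (0 : ℝ≥0),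
      ∀ i, pderiv k i (f : MvPowerSeries (Fin n) k) ∈ convergentOn k n r := fun f =>
    eventually_all.2 fun i => eventually_mem_convergentOn (Converges.pderiv (hle f.2) i)
  filter_upwards [eventually_map_adjugate hle M, eventually_mem_convergentOn (hle f₁.2),
    eventually_mem_convergentOn (hle f₂.2), eventually_mem_convergentOn (hle w.2), hd f₁, hd f₂,
    hd w] with r hadj h₁ h₂ h₃ d₁ d₂ d₃ p hp e₁ e₂ hmax i j
  have hval : valueAt (M.det : MvPowerSeries (Fin n) k) p = 0 := by
    rw [hw', valueAt_mul hp (mul_mem h₁ h₂) h₃, valueAt_mul hp h₁ h₂, e₁, zero_mul, zero_mul]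
  have hgrad : ∀ i, gradientAt (M.det : MvPowerSeries (Fin n) k) p i = 0 := by
    intro i
    have e3 : pderiv k i (M.det : MvPowerSeries (Fin n) k) =
        f₁ * (f₂ * pderiv k i (w : MvPowerSeries (Fin n) k) +
          w * pderiv k i (f₂ : MvPowerSeries (Fin n) k)) +
        f₂ * (w * pderiv k i (f₁ : MvPowerSeries (Fin n) k)) := by
      rw [hw', Derivation.leibniz, Derivation.leibniz]
      simp only [smul_eq_mul]
      ring
    rw [gradientAt_eq, e3]
    have h4 := add_mem (mul_mem h₂ (d₃ i)) (mul_mem h₃ (d₂ i))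
    have h5 := mul_mem h₃ (d₁ i)
    have e4 := map_add (evalHom hp) ⟨_, mul_mem h₁ h4⟩ ⟨_, mul_mem h₂ h5⟩
    rw [evalHom_apply, evalHom_apply, evalHom_apply] at e4
    refine e4.trans ?_
    dsimp only
    rw [valueAt_mul hp h₁ h4, valueAt_mul hp h₂ h5, e₁, e₂, zero_mul, zero_mul, add_zero]
  have hmult := two_le_multAt hval hgrad
  rw [MaxGenAt] at hmax
  rw [← hmax, corankAt] at hmult
  have hrank : 2 ≤ d - (M.map fun g => valueAt (g : MvPowerSeries (Fin n) k) p).rank := by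
    exact_mod_cast hmult
  have h6 := adjugate_eq_zero_of_rank_add_two_le
    (M.map fun g => valueAt (g : MvPowerSeries (Fin n) k) p) (by omega)
  rw [← hadj p hp] at h6
  exact congrFun (congrFun h6 i) j

/-- Near the origin, a common point at which a Jacobian minor does not vanish is smooth. -/
theorem eventually_isSmoothPoint (hle : O ≤ convergentSeries k n) (hO : IsGermRing O) (f₁ f₂ : O)
    (i j : Fin n) : ∀ᶠ r in 𝓝[>] (0 : ℝ≥0), ∀ p : Fin n → k, (∀ i, ‖p i‖₊ ≤ r) →
      valueAt (f₁ : MvPowerSeries (Fin n) k) p = 0 → valueAt (f₂ : MvPowerSeries (Fin n) k) p = 0 →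
      valueAt (hO.minor f₁ f₂ i j : MvPowerSeries (Fin n) k) p ≠ 0 →
      IsSmoothPoint (f₁ : MvPowerSeries (Fin n) k) f₂ p := by
  have hd : ∀ (f : O) i, ∀ᶠ r in 𝓝[>] (0 : ℝ≥0),
      pderiv k i (f : MvPowerSeries (Fin n) k) ∈ convergentOn k n r := fun f i =>
    eventually_mem_convergentOn (Converges.pderiv (hle f.2) i)
  filter_upwards [hd f₁ i, hd f₁ j, hd f₂ i, hd f₂ j] with r h1 h2 h3 h4 p hp e₁ e₂ hne
  refine ⟨e₁, e₂, ?_⟩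
  rw [LinearIndependent.pair_iff]
  intro a b hab
  have e3 := map_sub (evalHom hp) ⟨_, mul_mem h1 h4⟩ ⟨_, mul_mem h3 h2⟩
  rw [evalHom_apply, evalHom_apply, evalHom_apply] at e3
  have e4 : valueAt (hO.minor f₁ f₂ i j : MvPowerSeries (Fin n) k) p =
      gradientAt (f₁ : MvPowerSeries (Fin n) k) p i * gradientAt (f₂ : MvPowerSeries (Fin n) k) p j -
      gradientAt (f₂ : MvPowerSeries (Fin n) k) p i *
        gradientAt (f₁ : MvPowerSeries (Fin n) k) p j := by
    refine e3.trans ?_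
    dsimp only
    rw [valueAt_mul hp h1 h4, valueAt_mul hp h3 h2, gradientAt_eq, gradientAt_eq, gradientAt_eq,
      gradientAt_eq]
  rw [e4] at hne
  have hi := congrFun hab i
  have hj := congrFun hab j
  simp only [Pi.add_apply, Pi.smul_apply, smul_eq_mul, Pi.zero_apply] at hi hj
  constructor
  · refine (mul_eq_zero.1 ?_).resolve_right hne
    linear_combination gradientAt (f₂ : MvPowerSeries (Fin n) k) p j * hi -
      gradientAt (f₂ : MvPowerSeries (Fin n) k) p i * hj
  · refine (mul_eq_zero.1 ?_).resolve_right hne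
    linear_combination gradientAt (f₁ : MvPowerSeries (Fin n) k) p i * hj -
      gradientAt (f₁ : MvPowerSeries (Fin n) k) p j * hi

variable [IsAlgClosed k]

/-- The adjugate of a representation that is maximally generated at the smooth points lies in
`(f₁, f₂)`, if this ideal is radical and satisfies the Jacobian criterion at its minimal primes:
otherwise there were a smooth point near the origin at which the adjugate does not vanish. -/
theorem adjugate_mem_of_maxGenAt (hle : O ≤ convergentSeries k n) (hO : IsGermRing O)
    {y z : Fin n} (hyz : y ≠ z) {f₁ f₂ : O} (h0 : f₁ ≠ 0) (hreg : ∀ u, f₁ ∣ f₂ * u → f₁ ∣ u)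
    (hI : (Ideal.span {f₁, f₂}).IsRadical)
    (hJ : ∀ P ∈ (Ideal.span {f₁, f₂}).minimalPrimes, ∃ i j, hO.minor f₁ f₂ i j ∉ P) {d : ℕ}
    (M : Matrix (Fin d) (Fin d) O) (hM : f₁ * f₂ ∣ M.det)
    (hmax : ∀ᶠ a in 𝓝 (0 : Fin n → k), IsSmoothPoint (f₁ : MvPowerSeries (Fin n) k) f₂ a →
      MaxGenAt M a) (i j : Fin d) : M.adjugate i j ∈ Ideal.span {f₁, f₂} := by
  have hC : IsGermRing (convergentSeries k n) :=
    isWeierstrass_convergentSeries.isGermRing y fun i hf => Converges.pderiv hf i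
  have : Infinite k := NontriviallyNormedField.infinite k
  refine mem_of_forall_minimalPrimes hI fun P hP => ?_
  by_contra hgP
  obtain ⟨i', j', hδP⟩ := hJ P hP
  set g := M.adjugate i j * hO.minor f₁ f₂ i' j'
  have hgδ : g ∉ P := fun h => (hP.1.1.mem_or_mem h).elim hgP hδP
  let ι := Subalgebra.inclusion hle
  -- no power of `g` lies in the extension of `(f₁, f₂)` to the convergent series
  have hrad : ι g ∉ (Ideal.span {ι f₁, ι f₂}).radical := by
    rintro ⟨m, hm⟩
    obtain ⟨α, β, e⟩ := Ideal.mem_span_pair.1 hm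
    refine hgδ (hP.1.1.mem_of_pow_mem m (hP.1.2 (hO.mem_span_pair_of_eq (u := g ^ m) (α := α)
      (β := β) ?_)))
    have := congrArg (Subtype.val : convergentSeries k n → MvPowerSeries (Fin n) k) e
    exact this.symm
  rw [← Ideal.sInf_minimalPrimes, Ideal.mem_sInf] at hrad
  push Not at hrad
  obtain ⟨P', hP', hgP'⟩ := hrad
  obtain ⟨ε, hε, hball⟩ := Metric.nhds_basis_closedBall.eventually_iff.1 hmax
  have hsmall : ∀ᶠ r in 𝓝[>] (0 : ℝ≥0), 0 < r ∧ r ≤ ⟨ε, hε.le⟩ := by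
    filter_upwards [self_mem_nhdsWithin, (eventually_le_nhds (show (0 : ℝ≥0) < ⟨ε, hε.le⟩ from
      hε)).filter_mono nhdsWithin_le_nhds] with r h1 h2
    exact ⟨h1, h2⟩
  obtain ⟨r, ⟨hr0, hrε⟩, hadj, hsm, hg₁, hg₂⟩ := (hsmall.and <|
    (eventually_adjugate_eq_zero hle M hM).and <|
    (eventually_isSmoothPoint hle hO f₁ f₂ i' j').and <|
    (eventually_mem_convergentOn (hle (M.adjugate i j).2)).and
    (eventually_mem_convergentOn (hle (hO.minor f₁ f₂ i' j').2))).exists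
  obtain ⟨p, hp, e₁, e₂, hne⟩ := exists_point_of_minimalPrime hyz (f₁ := ι f₁) (f₂ := ι f₂)
    (fun h => h0 (Subalgebra.inclusion_injective hle (h.trans (map_zero ι).symm)))
    (hO.dvd_of_dvd_mul hC hle hreg) hP' hgP' r hr0
  have hval : valueAt (ι g : MvPowerSeries (Fin n) k) p =
      valueAt (M.adjugate i j : MvPowerSeries (Fin n) k) p *
        valueAt (hO.minor f₁ f₂ i' j' : MvPowerSeries (Fin n) k) p := valueAt_mul hp hg₁ hg₂
  rw [hval] at hne
  have hball' : p ∈ Metric.closedBall (0 : Fin n → k) ε := by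
    rw [mem_closedBall_zero_iff, pi_norm_le_iff_of_nonneg hε.le]
    exact fun i => NNReal.coe_le_coe.2 ((hp i).trans hrε)
  exact hne (by rw [hadj p hp e₁ e₂ (hball hball' (hsm p hp e₁ e₂ (right_ne_zero_of_mul hne))) i j,
    zero_mul])

end PointwiseVanishing

/-! ### Primes and transcendence bases in polynomial rings -/

section AlgebraicIndependence

/-- A maximal set of coordinates that are algebraically independent modulo a prime. -/
theorem exists_maximal_algebraicIndependent_coordinates {k R ι : Type*} [Field k] [CommRing R]
    [Algebra k R] [Finite ι] (P : Ideal R) [P.IsPrime] (x : ι → R) : ∃ T : Set ι,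
      (∀ a : MvPolynomial T k, MvPolynomial.aeval (fun i : T => x i) a ∈ P → a = 0) ∧
      ∀ y ∉ T, ∃ w : Polynomial (MvPolynomial T k), w ≠ 0 ∧
        w.eval₂ (MvPolynomial.aeval (fun i : T => x i) : MvPolynomial T k →ₐ[k] R).toRingHom (x y)
          ∈ P := by
  let xb : ι → R ⧸ P := fun i => Ideal.Quotient.mkₐ k P (x i)
  have hne : (Set.univ.powerset ∩ {T : Set ι | AlgebraicIndepOn k xb T}).Nonempty := by
    refine ⟨∅, Set.empty_subset _, ?_⟩
    exact algebraicIndependent_empty_type_iff.2 (algebraMap k (R ⧸ P)).injective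
  obtain ⟨T, ⟨-, hT⟩, hmax⟩ := (Set.toFinite _).exists_maximal hne
  have hval : ∀ a : MvPolynomial T k, MvPolynomial.aeval (fun i : T => xb i) a =
      Ideal.Quotient.mk P (MvPolynomial.aeval (fun i : T => x i) a) := by
    intro a
    have := MvPolynomial.comp_aeval_apply (fun i : T => x i) (Ideal.Quotient.mkₐ k P) a
    exact this.symm
  refine ⟨T, fun a ha => ?_, fun y hy => ?_⟩
  · have hinj : Function.Injective (MvPolynomial.aeval (R := k) fun i : T => xb i) := hT
    refine (injective_iff_map_eq_zero _).1 hinj a ?_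
    rw [hval]
    exact Ideal.Quotient.eq_zero_iff_mem.2 ha
  · have halg : ¬ Transcendental (Algebra.adjoin k (Set.range fun i : T => xb i)) (xb y) := by
      intro htr
      have h1 : AlgebraicIndepOn k xb (insert y T) :=
        hT.insert (by rw [Set.image_eq_range]; exact htr)
      exact hy (hmax ⟨Set.subset_univ _, h1⟩ (Set.subset_insert y T) (Set.mem_insert y T))
    rw [Transcendental, not_not] at halg
    obtain ⟨p, hp, hp0⟩ := halg
    have hT' : AlgebraicIndependent k fun i : T => xb i := hT
    let e := hT'.aevalEquiv
    refine ⟨p.map (e.symm : _ →+* MvPolynomial T k), ?_, ?_⟩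
    · rwa [Ne, Polynomial.map_eq_zero_iff e.symm.injective]
    · rw [← Ideal.Quotient.eq_zero_iff_mem, Polynomial.hom_eval₂, Polynomial.eval₂_map, ← hp0,
        Polynomial.aeval_def]
      congr 1
      ext a
      have h2 := hval (e.symm a)
      have h3 : MvPolynomial.aeval (fun i : T => xb i) (e.symm a) = (e (e.symm a) : R ⧸ P) :=
        (hT'.algebraMap_aevalEquiv _).symm
      rw [e.apply_symm_apply] at h3
      exact h2.symm.trans h3

/-- A prime of `U[X]` over a factorial ring `U` that meets `U` in zero is principal. -/
theorem exists_eq_span_of_comap_C_eq_bot {U : Type*} [CommRing U] [IsDomain U]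
    [UniqueFactorizationMonoid U] (Q : Ideal (Polynomial U)) [Q.IsPrime]
    (hQ : ∀ a, Polynomial.C a ∈ Q → a = 0) : ∃ q, Q = Ideal.span {q} := by
  classical
  by_cases hbot : Q = ⊥
  · exact ⟨0, by rw [hbot]; simp⟩
  -- a prime element of least degree
  have hex : ∃ N, ∃ q ∈ Q, Prime q ∧ q.natDegree = N := by
    obtain ⟨q, hq, hqp⟩ := Ideal.IsPrime.exists_mem_prime_of_ne_bot ‹_› hbot
    exact ⟨_, q, hq, hqp, rfl⟩
  obtain ⟨q, hqQ, hq, hdeg⟩ := Nat.find_spec hex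
  have hmin : ∀ f ∈ Q, f ≠ 0 → q.natDegree ≤ f.natDegree := by
    intro f hf hf0
    obtain ⟨l, hl, hu⟩ := WfDvdMonoid.exists_factors f hf0
    obtain ⟨p, hpl, hpQ⟩ : ∃ p ∈ l, p ∈ Q := by
      have h1 : l.prod ∈ Q := by
        obtain ⟨u, hu⟩ := hu.symm
        rw [← hu]
        exact Q.mul_mem_right _ hf
      exact (Ideal.IsPrime.multiset_prod_mem_iff_exists_mem ‹_› l).1 h1
    have hpf : p ∣ f := (Multiset.dvd_prod hpl).trans hu.dvd
    refine le_trans ?_ (Polynomial.natDegree_le_of_dvd hpf hf0)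
    rw [hdeg]
    exact Nat.find_min' hex ⟨p, hpQ, (hl p hpl).prime, rfl⟩
  have hq0 : q.natDegree ≠ 0 := by
    intro h0
    rw [Polynomial.eq_C_of_natDegree_eq_zero h0] at hqQ
    apply hq.ne_zero
    rw [Polynomial.eq_C_of_natDegree_eq_zero h0, hQ _ hqQ, map_zero]
  refine ⟨q, le_antisymm ?_ ((Ideal.span_singleton_le_iff_mem _).2 hqQ)⟩
  have key : ∀ (N : ℕ) (f : Polynomial U), f.natDegree < N → f ∈ Q → q ∣ f := by
    intro N
    induction N with
    | zero => intro f hf; omega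
    | succ N ih =>
      intro f hfN hfQ
      by_cases hf0 : f = 0
      · rw [hf0]; exact dvd_zero q
      have hle := hmin f hfQ hf0
      set g := Polynomial.C q.leadingCoeff * f -
        Polynomial.C f.leadingCoeff * Polynomial.X ^ (f.natDegree - q.natDegree) * q with hg
      have hgQ : g ∈ Q := sub_mem (Q.mul_mem_left _ hfQ) (Q.mul_mem_left _ hqQ)
      have hgq : q ∣ g := by
        by_cases hg0 : g = 0
        · rw [hg0]; exact dvd_zero q
        refine ih g ?_ hgQ
        have h1 : g.degree < f.degree := by
          have hlc : q.leadingCoeff ≠ 0 := Polynomial.leadingCoeff_ne_zero.2 hq.ne_zero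
          have hlf : f.leadingCoeff ≠ 0 := Polynomial.leadingCoeff_ne_zero.2 hf0
          have h2 : (Polynomial.C q.leadingCoeff * f).degree = f.degree :=
            Polynomial.degree_C_mul hlc
          rw [← h2]
          refine Polynomial.degree_sub_lt_left ?_ (mul_ne_zero (Polynomial.C_ne_zero.2 hlc) hf0) ?_
          · rw [h2, mul_assoc, Polynomial.degree_C_mul hlf, Polynomial.degree_mul,
              Polynomial.degree_X_pow, Polynomial.degree_eq_natDegree hq.ne_zero,
              Polynomial.degree_eq_natDegree hf0, ← Nat.cast_add, Nat.sub_add_cancel hle]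
          · rw [Polynomial.leadingCoeff_mul, Polynomial.leadingCoeff_mul, Polynomial.leadingCoeff_mul,
              Polynomial.leadingCoeff_X_pow, Polynomial.leadingCoeff_C, Polynomial.leadingCoeff_C,
              mul_one, mul_comm]
        have := Polynomial.natDegree_lt_natDegree hg0 h1
        omega
      have h3 : q ∣ Polynomial.C q.leadingCoeff * f := by
        have h4 := dvd_add hgq (Dvd.intro_left (Polynomial.C f.leadingCoeff *
          Polynomial.X ^ (f.natDegree - q.natDegree)) (rfl : _ * q = _))
        rwa [hg, sub_add_cancel] at h4
      refine (hq.dvd_or_dvd h3).resolve_left fun h4 => hq0 ?_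
      have h5 := Polynomial.natDegree_le_of_dvd h4
        (Polynomial.C_ne_zero.2 (Polynomial.leadingCoeff_ne_zero.2 hq.ne_zero))
      rw [Polynomial.natDegree_C] at h5
      omega
  exact fun f hf => Ideal.mem_span_singleton.2 (key _ f (Nat.lt_succ_self _) hf)

/-- The polynomial ring in `n` variables as a ring of polynomials in `xᵢ`. -/
def splitVariable (k : Type*) [Field k] {n : ℕ} (i : Fin n) :
    MvPolynomial (Fin n) k ≃ₐ[k] Polynomial (MvPolynomial {j // j ≠ i} k) := by
  classical
  exact (MvPolynomial.renameEquiv k (Equiv.optionSubtypeNe i).symm).trans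
    (MvPolynomial.optionEquivLeft k {j // j ≠ i})

theorem splitVariable_symm_C {k : Type*} [Field k] {n : ℕ} (i : Fin n)
    (a : MvPolynomial {j // j ≠ i} k) :
    (splitVariable k i).symm (Polynomial.C a) = MvPolynomial.rename Subtype.val a := by
  classical
  rw [AlgEquiv.symm_apply_eq]
  induction a using MvPolynomial.induction_on with
  | C c => simp [splitVariable]
  | add p q hp hq => rw [map_add, hp, hq, map_add, map_add]
  | mul_X p j hp =>
    rw [map_mul, hp, map_mul, map_mul]
    congr 1
    simp [splitVariable, Equiv.optionSubtypeNe_symm_of_ne j.2]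

end AlgebraicIndependence

/-! ### The Jacobian criterion for rational functions -/

section RationalMinors
open MvPowerSeries

variable {k : Type*} [NontriviallyNormedField k] [CharZero k] {n : ℕ}

omit [CharZero k] in
theorem polyToRational_eq_aeval (hO : IsGermRing (rationalSeries k n)) (p : MvPolynomial (Fin n) k) :
    polyToRational k n p = MvPolynomial.aeval hO.coord p := by
  induction p using MvPolynomial.induction_on with
  | C c =>
    rw [MvPolynomial.aeval_C]
    exact Subtype.ext (MvPolynomial.coe_C c)
  | add p q hp hq => rw [map_add, map_add, hp, hq]
  | mul_X p i hp =>
    rw [map_mul, map_mul, hp, MvPolynomial.aeval_X]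
    congr 1
    exact Subtype.ext (MvPolynomial.coe_X i)

omit [CharZero k] in
/-- Two relatively prime germs have at least two independent relations among the coordinates. -/
theorem not_forall_ne_algebraicIndependent {f₁ f₂ : rationalSeries k n} (hf : IsRelPrime f₁ f₂)
    {P : Ideal (rationalSeries k n)} [P.IsPrime] (h₁ : f₁ ∈ P) (h₂ : f₂ ∈ P) (i : Fin n) :
    ∃ a : MvPolynomial {j // j ≠ i} k, a ≠ 0 ∧
      polyToRational k n (MvPolynomial.rename Subtype.val a) ∈ P := by
  by_contra! hcon
  let φ : Polynomial (MvPolynomial {j // j ≠ i} k) →+* rationalSeries k n :=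
    (polyToRational k n : MvPolynomial (Fin n) k →+* rationalSeries k n).comp
      (splitVariable k i).symm.toRingHom
  obtain ⟨q, hq⟩ := exists_eq_span_of_comap_C_eq_bot (P.comap φ) fun a ha => by
    by_contra ha0
    refine hcon a ha0 ?_
    rw [← splitVariable_symm_C]
    exact ha
  have hqP : φ q ∈ P := by
    have : q ∈ P.comap φ := by rw [hq]; exact Ideal.mem_span_singleton_self q
    exact this
  have hdvd : ∀ f ∈ P, φ q ∣ f := by
    rintro ⟨f, p, b, hb, e⟩ hfP
    have e' : polyToRational k n b * ⟨f, p, b, hb, e⟩ = polyToRational k n p := Subtype.ext e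
    have hp : splitVariable k i p ∈ P.comap φ := by
      change polyToRational k n ((splitVariable k i).symm (splitVariable k i p)) ∈ P
      rw [(splitVariable k i).symm_apply_apply, ← e']
      exact P.mul_mem_left _ hfP
    rw [hq, Ideal.mem_span_singleton] at hp
    have h3 := map_dvd φ hp
    change φ q ∣ polyToRational k n ((splitVariable k i).symm (splitVariable k i p)) at h3
    rw [(splitVariable k i).symm_apply_apply, ← e'] at h3
    exact (isUnit_polyToRational hb).dvd_mul_left.1 h3
  exact Ideal.IsPrime.ne_top' (Ideal.eq_top_of_isUnit_mem P hqP (hf (hdvd f₁ h₁) (hdvd f₂ h₂)))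

/-- The Jacobian criterion at the minimal primes of a radical ideal `(f₁, f₂)` of rational
functions. -/
theorem exists_minor_notMem_rational (hn : 0 < n) (hO : IsGermRing (rationalSeries k n))
    {f₁ f₂ : rationalSeries k n} (hf : IsRelPrime f₁ f₂) (hI : (Ideal.span {f₁, f₂}).IsRadical)
    {P : Ideal (rationalSeries k n)} (hP : P ∈ (Ideal.span {f₁, f₂}).minimalPrimes) :
    ∃ i j, hO.minor f₁ f₂ i j ∉ P := by
  have hPp : P.IsPrime := hP.1.1
  have hf₁ : f₁ ∈ P := hP.1.2 (Ideal.subset_span (by simp))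
  have hf₂ : f₂ ∈ P := hP.1.2 (Ideal.subset_span (by simp))
  obtain ⟨T, hT, halg⟩ := exists_maximal_algebraicIndependent_coordinates (k := k) P hO.coord
  set ι : MvPolynomial T k →ₐ[k] rationalSeries k n := MvPolynomial.aeval fun i : T => hO.coord i
  obtain ⟨y, z, hyz, hy, hz⟩ : ∃ y z, y ≠ z ∧ y ∉ T ∧ z ∉ T := by
    by_contra! hcon
    obtain ⟨i, hi⟩ : ∃ i, ∀ j, j ≠ i → j ∈ T := by
      by_cases h : ∃ i, i ∉ T
      · obtain ⟨i, hi⟩ := h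
        exact ⟨i, fun j hj => hcon i j hj.symm hi⟩
      · push Not at h
        exact ⟨⟨0, hn⟩, fun j _ => h j⟩
    obtain ⟨a, ha0, haP⟩ := not_forall_ne_algebraicIndependent hf hf₁ hf₂ i
    let em : {j // j ≠ i} → T := fun j => ⟨j, hi j j.2⟩
    have hem : Function.Injective em := fun a b h => Subtype.ext (congrArg (fun t : T => (t : Fin n)) h)
    refine ha0 (MvPolynomial.rename_injective em hem ((hT (MvPolynomial.rename em a) ?_).trans
      (map_zero _).symm))
    have : MvPolynomial.aeval (fun i : T => hO.coord i) (MvPolynomial.rename em a) =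
        polyToRational k n (MvPolynomial.rename Subtype.val a) := by
      rw [polyToRational_eq_aeval hO, MvPolynomial.aeval_rename, MvPolynomial.aeval_rename]
      rfl
    rw [this]
    exact haP
  have hconst : ∀ i ∉ T, ∀ a, hO.partial i (ι a) = 0 := by
    intro i hi a
    induction a using MvPolynomial.induction_on with
    | C c => rw [MvPolynomial.algHom_C, Derivation.map_algebraMap]
    | add p q hp hq => rw [map_add, map_add, hp, hq, add_zero]
    | mul_X p j hp =>
      have h1 : hO.partial i (hO.coord j) = 0 :=
        Subtype.ext (pderiv_X_of_ne fun h => hi (h ▸ j.2))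
      rw [map_mul, Derivation.leibniz, hp, MvPolynomial.aeval_X, h1, smul_zero, smul_zero, add_zero]
  refine hO.exists_minor_notMem (jacobian_notMem ι.toRingHom hI hP hT (halg y hy) (halg z hz)
    (D₁ := hO.partial y) (D₂ := hO.partial z) (hconst y hy) (hconst z hz) ?_ ?_ ?_)
  · exact Subtype.ext pderiv_X_self
  · exact Subtype.ext (pderiv_X_of_ne hyz.symm)
  · exact Subtype.ext pderiv_X_self

end RationalMinors

/-! ### Maximal generation at regular primes -/

section RegularPrimes

/-- A local ring whose maximal ideal vanishes is regular. -/
theorem isRegularLocalRing_of_maximalIdeal_eq_bot {R : Type*} [CommRing R] [IsLocalRing R]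
    [IsNoetherianRing R] (h : IsLocalRing.maximalIdeal R = ⊥) : IsRegularLocalRing R := by
  apply IsRegularLocalRing.of_spanFinrank_maximalIdeal_le
  rw [h, Submodule.spanFinrank_bot]
  exact_mod_cast ringKrullDim_nonneg_of_nontrivial

/-- The quotient by a radical ideal is regular at its minimal primes: the local ring there is a
field. -/
theorem isRegularLocalRing_of_mem_minimalPrimes {S : Type*} [CommRing S] [IsNoetherianRing S]
    {I : Ideal S} (hI : I.IsRadical) {P : Ideal S} (hP : P ∈ I.minimalPrimes)
    (q : PrimeSpectrum (S ⧸ I)) (hq : q.asIdeal.comap (Ideal.Quotient.mk I) = P) :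
    IsRegularLocalRing (Localization.AtPrime q.asIdeal) := by
  have : IsNoetherianRing (Localization.AtPrime q.asIdeal) :=
    IsLocalization.isNoetherianRing q.asIdeal.primeCompl _ inferInstance
  apply isRegularLocalRing_of_maximalIdeal_eq_bot
  rw [← Localization.AtPrime.map_eq_maximalIdeal, Ideal.map_eq_bot_iff_le_ker]
  intro x hx
  obtain ⟨a, rfl⟩ := Ideal.Quotient.mk_surjective x
  have ha : a ∈ P := by rw [← hq]; exact hx
  obtain ⟨s, hs, hsa⟩ := exists_notMem_mul_mem_of_mem_minimalPrimes hI hP ha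
  have hs' : Ideal.Quotient.mk I s ∈ q.asIdeal.primeCompl := by
    intro h
    apply hs
    rw [← hq]
    exact h
  rw [RingHom.mem_ker, IsLocalization.map_eq_zero_iff q.asIdeal.primeCompl]
  exact ⟨⟨_, hs'⟩, by rw [← map_mul]; exact Ideal.Quotient.eq_zero_iff_mem.2 hsa⟩

theorem le_multAtPrime {S : Type*} [CommRing S] {f : S} (p : PrimeSpectrum S) {e : ℕ}
    (hf : f ∈ p.asIdeal ^ e) : (e : ℕ∞) ≤ multAtPrime f p := by
  refine le_iSup₂_of_le e ?_ le_rfl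
  rw [← Localization.AtPrime.map_eq_maximalIdeal, ← Ideal.map_pow]
  exact Ideal.mem_map_of_mem _ hf

/-- The adjugate of a matrix that is maximally generated at a prime of multiplicity at least two
lies in this prime. -/
theorem adjugate_mem_of_maxGenAtPrime {S : Type*} [CommRing S] {d : ℕ} {M : Matrix (Fin d) (Fin d) S}
    {p : PrimeSpectrum S} (h : MaxGenAtPrime M p) (h2 : M.det ∈ p.asIdeal ^ 2) (i j : Fin d) :
    M.adjugate i j ∈ p.asIdeal := by
  have h3 := le_multAtPrime p h2
  rw [← h, corankAtPrime] at h3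
  have h4 : 2 ≤ d - (M.map (algebraMap S p.asIdeal.ResidueField)).rank := by exact_mod_cast h3
  have h5 := adjugate_eq_zero_of_rank_add_two_le (M.map (algebraMap S p.asIdeal.ResidueField))
    (by omega)
  have h6 := RingHom.map_adjugate (algebraMap S p.asIdeal.ResidueField) M
  have h7 : (algebraMap S p.asIdeal.ResidueField).mapMatrix M =
    M.map (algebraMap S p.asIdeal.ResidueField) := rfl
  rw [h7, h5] at h6
  rw [← Ideal.algebraMap_residueField_eq_zero]
  exact congrFun (congrFun h6 i) j

/-- At a minimal prime of a radical ideal the local ring of the quotient is a field, hence regular,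
and `det M` has multiplicity at least two there; so the adjugate lies in all minimal primes. -/
theorem adjugate_mem_of_maxGenAtRegularPrimes {S : Type*} [CommRing S] [IsNoetherianRing S]
    {f₁ f₂ : S} (hI : (Ideal.span {f₁, f₂}).IsRadical) {d : ℕ} {M : Matrix (Fin d) (Fin d) S}
    (hM : f₁ * f₂ ∣ M.det) (hmax : MaxGenAtRegularPrimes M (Ideal.span {f₁, f₂})) (i j : Fin d) :
    M.adjugate i j ∈ Ideal.span {f₁, f₂} := by
  refine mem_of_forall_minimalPrimes hI fun P hP => ?_
  have hPp : P.IsPrime := hP.1.1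
  have hker : RingHom.ker (Ideal.Quotient.mk (Ideal.span {f₁, f₂})) ≤ P := by
    rw [Ideal.mk_ker]
    exact hP.1.2
  let q : PrimeSpectrum (S ⧸ Ideal.span {f₁, f₂}) :=
    ⟨P.map (Ideal.Quotient.mk _), Ideal.map_isPrime_of_surjective Ideal.Quotient.mk_surjective hker⟩
  have hq : q.asIdeal.comap (Ideal.Quotient.mk (Ideal.span {f₁, f₂})) = P := by
    change (P.map (Ideal.Quotient.mk _)).comap _ = P
    rw [Ideal.comap_map_of_surjective' _ Ideal.Quotient.mk_surjective, sup_eq_left]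
    exact hker
  have hgen := hmax q (isRegularLocalRing_of_mem_minimalPrimes hI hP q hq)
  have hp : (PrimeSpectrum.comap (Ideal.Quotient.mk (Ideal.span {f₁, f₂})) q).asIdeal = P := hq
  have h := adjugate_mem_of_maxGenAtPrime hgen (by
    rw [hp]
    refine Ideal.mem_of_dvd _ hM ?_
    rw [pow_two]
    exact Ideal.mul_mem_mul (hP.1.2 (Ideal.subset_span (by simp)))
      (hP.1.2 (Ideal.subset_span (by simp)))) i j
  rwa [hp] at h

end RegularPrimes

/-! ### Radicality from the lowest order forms -/

section InitialForms
open MvPowerSeries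

variable {k : Type*} [Field k] {n : ℕ}

/-- The homogeneous component of degree `N - a` of a power series, as a polynomial. It is zero
if `N < a`. -/
def formPart (a N : ℕ) (f : MvPowerSeries (Fin n) k) : MvPolynomial (Fin n) k :=
  if a ≤ N then truncTotal (N - a + 1) (homogeneousComponent (N - a) f) else 0

theorem coeff_formPart (a N : ℕ) (f : MvPowerSeries (Fin n) k) (m : Fin n →₀ ℕ) :
    (formPart a N f).coeff m = if m.degree + a = N then coeff m f else 0 := by
  rw [formPart]
  split_ifs with h1 h2 h2
  · rw [coeff_truncTotal_eq_ite, coeff_homogeneousComponent, if_pos (by omega), if_pos (by omega)]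
  · rw [coeff_truncTotal_eq_ite, coeff_homogeneousComponent]
    split_ifs <;> first | rfl | omega
  · omega
  · rw [MvPolynomial.coeff_zero]

theorem isHomogeneous_mul_of_coeff {A F : MvPolynomial (Fin n) k} {a N : ℕ}
    (hA : ∀ m, A.coeff m ≠ 0 → m.degree + a = N) (hF : F.IsHomogeneous a) :
    (A * F).IsHomogeneous N := by
  by_cases h : a ≤ N
  · have h1 : A.IsHomogeneous (N - a) := by
      intro m hm
      change Finsupp.weight (fun _ => 1) m = _
      rw [← Finsupp.degree_eq_weight_one]
      have := hA m hm
      omega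
    have := h1.mul hF
    rwa [Nat.sub_add_cancel h] at this
  · have h1 : A = 0 := by
      ext m
      rw [MvPolynomial.coeff_zero]
      by_contra hm
      have := hA m hm
      omega
    rw [h1, zero_mul]
    exact MvPolynomial.isHomogeneous_zero _ _ _

theorem degree_add_of_coeff_formPart_ne_zero {a N : ℕ} {f : MvPowerSeries (Fin n) k}
    {m : Fin n →₀ ℕ} (hm : (formPart a N f).coeff m ≠ 0) : m.degree + a = N := by
  rw [coeff_formPart] at hm
  by_contra h
  exact hm (if_neg h)

theorem isHomogeneous_formPart_mul (a N : ℕ) (f : MvPowerSeries (Fin n) k)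
    {F : MvPolynomial (Fin n) k} (hF : F.IsHomogeneous a) : (formPart a N f * F).IsHomogeneous N :=
  isHomogeneous_mul_of_coeff (fun _ => degree_add_of_coeff_formPart_ne_zero) hF

theorem le_order_add_iff {N a : ℕ} {f : MvPowerSeries (Fin n) k} :
    (N : ℕ∞) ≤ f.order + a ↔ ∀ m : Fin n →₀ ℕ, m.degree + a < N → coeff m f = 0 := by
  constructor
  · intro h m hm
    apply coeff_of_lt_order
    by_contra! hle
    have h1 : (N : ℕ∞) ≤ m.degree + a := h.trans (by gcongr)
    have h2 : N ≤ m.degree + a := by exact_mod_cast h1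
    omega
  · intro h
    have h1 : ((N - a : ℕ) : ℕ∞) ≤ f.order := nat_le_order fun m hm => h m (by omega)
    calc (N : ℕ∞) ≤ ((N - a : ℕ) : ℕ∞) + a := by exact_mod_cast (by omega : N ≤ N - a + a)
      _ ≤ f.order + a := by gcongr

theorem le_order_add_add {N a : ℕ} {f g : MvPowerSeries (Fin n) k} (hf : (N : ℕ∞) ≤ f.order + a)
    (hg : (N : ℕ∞) ≤ g.order + a) : (N : ℕ∞) ≤ (f + g).order + a := by
  rw [le_order_add_iff] at hf hg ⊢
  intro m hm
  rw [map_add, hf m hm, hg m hm, add_zero]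

theorem le_order_formPart (a N : ℕ) (f : MvPowerSeries (Fin n) k) :
    (N : ℕ∞) ≤ (formPart a N f : MvPowerSeries (Fin n) k).order + a := by
  rw [le_order_add_iff]
  intro m hm
  rw [MvPolynomial.coeff_coe, coeff_formPart, if_neg hm.ne]

theorem le_order_sub_formPart {a N : ℕ} {f : MvPowerSeries (Fin n) k}
    (h : (N : ℕ∞) ≤ f.order + a) :
    ((N + 1 : ℕ) : ℕ∞) ≤ (f - formPart a N f).order + a := by
  rw [le_order_add_iff] at h ⊢
  intro m hm
  rw [map_sub, MvPolynomial.coeff_coe, coeff_formPart]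
  split_ifs with h1
  · rw [sub_self]
  · rw [sub_zero]
    exact h m (by omega)

theorem le_order_of_isHomogeneous {F : MvPolynomial (Fin n) k} {a : ℕ} (hF : F.IsHomogeneous a) :
    (a : ℕ∞) ≤ (F : MvPowerSeries (Fin n) k).order := by
  refine nat_le_order fun m hm => ?_
  rw [MvPolynomial.coeff_coe]
  by_contra h
  have h1 : Finsupp.weight (fun _ => 1) m = a := hF h
  rw [← Finsupp.degree_eq_weight_one] at h1
  change (m.degree : ℕ) = a at h1
  omega

theorem eq_zero_of_isHomogeneous_of_lt_order {F : MvPolynomial (Fin n) k} {a : ℕ}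
    (hF : F.IsHomogeneous a) (h : (a : ℕ∞) < (F : MvPowerSeries (Fin n) k).order) : F = 0 := by
  ext m
  rw [MvPolynomial.coeff_zero]
  by_contra hm
  have h1 : Finsupp.weight (fun _ => 1) m = a := hF hm
  rw [← Finsupp.degree_eq_weight_one] at h1
  change (m.degree : ℕ) = a at h1
  refine hm ?_
  rw [← MvPolynomial.coeff_coe]
  apply coeff_of_lt_order
  rwa [h1]

theorem order_eq_of_isHomogeneous {F : MvPolynomial (Fin n) k} {a : ℕ} (hF : F.IsHomogeneous a)
    (h0 : F ≠ 0) : (F : MvPowerSeries (Fin n) k).order = a := by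
  refine le_antisymm ?_ (le_order_of_isHomogeneous hF)
  by_contra! h
  exact h0 (eq_zero_of_isHomogeneous_of_lt_order hF h)

theorem le_order_mul_of_le_add {N a : ℕ} {f g : MvPowerSeries (Fin n) k}
    (hf : (N : ℕ∞) ≤ f.order + a) (hg : (a : ℕ∞) ≤ g.order) : (N : ℕ∞) ≤ (f * g).order :=
  (hf.trans (by gcongr)).trans le_order_mul

theorem le_order_leadingForm_sub {f : MvPowerSeries (Fin n) k} (h0 : f ≠ 0) :
    ((f.order.toNat + 1 : ℕ) : ℕ∞) ≤ (f - leadingForm f).order := by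
  refine nat_le_order fun m hm => ?_
  rw [map_sub, MvPolynomial.coeff_coe, coeff_leadingForm]
  split_ifs with h1
  · rw [sub_self]
  · rw [sub_zero]
    apply coeff_of_lt_order
    rw [← ne_zero_iff_order_finite.1 h0]
    exact_mod_cast (by omega : m.degree < f.order.toNat)

/-- A form in the ideal that two forms generate in the power series ring lies in the ideal that
they generate in the polynomial ring. -/
theorem exists_eq_formPart {F G U : MvPolynomial (Fin n) k} {a b N : ℕ} (hF : F.IsHomogeneous a)
    (hG : G.IsHomogeneous b) {α β f : MvPowerSeries (Fin n) k} (e : f = α * (F : MvPowerSeries (Fin n) k) + β * G)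
    (hU : U.IsHomogeneous N) (hfU : ∀ m : Fin n →₀ ℕ, m.degree = N → coeff m f = U.coeff m) :
    U = formPart a N α * F + formPart b N β * G := by
  classical
  have hcoef : ∀ (c : ℕ) (γ : MvPowerSeries (Fin n) k) (H : MvPolynomial (Fin n) k),
      H.IsHomogeneous c → ∀ m : Fin n →₀ ℕ, m.degree = N →
      coeff m (γ * (H : MvPowerSeries (Fin n) k)) = (formPart c N γ * H).coeff m := by
    intro c γ H hH m hm
    rw [coeff_mul, MvPolynomial.coeff_mul]
    refine Finset.sum_congr rfl fun p hp => ?_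
    rw [MvPolynomial.coeff_coe, coeff_formPart]
    by_cases h : H.coeff p.2 = 0
    · rw [h, mul_zero, mul_zero]
    · have h1 : Finsupp.weight (fun _ => 1) p.2 = c := hH h
      rw [← Finsupp.degree_eq_weight_one] at h1
      change (p.2.degree : ℕ) = c at h1
      rw [if_pos]
      rw [← h1, ← map_add, Finset.HasAntidiagonal.mem_antidiagonal.1 hp, hm]
  have h2 := (isHomogeneous_formPart_mul a N α hF).add (isHomogeneous_formPart_mul b N β hG)
  ext m
  by_cases hm : m.degree = N
  · rw [← hfU m hm, e, map_add, hcoef a α F hF m hm, hcoef b β G hG m hm, MvPolynomial.coeff_add]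
  · rw [hU.coeff_eq_zero hm, h2.coeff_eq_zero hm]

variable {O : Subalgebra k (MvPowerSeries (Fin n) k)}

/-- If the initial forms `F`, `G` of `f₁`, `f₂` are relatively prime, then they generate the
initial forms of the ideal `(f₁, f₂)`: cancellations between the initial forms can be removed with
the syzygy `G · F = F · G`. -/
theorem formPart_mem_span_pair {f₁ f₂ w : O} {F G : MvPolynomial (Fin n) k}
    {a b : ℕ} (hF : F.IsHomogeneous a) (hG : G.IsHomogeneous b) (hF0 : F ≠ 0)
    (hf₁ : ((a + 1 : ℕ) : ℕ∞) ≤ ((f₁ : MvPowerSeries (Fin n) k) - F).order)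
    (hf₂ : ((b + 1 : ℕ) : ℕ∞) ≤ ((f₂ : MvPowerSeries (Fin n) k) - G).order)
    (hFG : IsRelPrime F G) {N : ℕ} (hw : w ∈ Ideal.span {f₁, f₂})
    (hN : (N : ℕ∞) ≤ (w : MvPowerSeries (Fin n) k).order) :
    formPart 0 N (w : MvPowerSeries (Fin n) k) ∈ Ideal.span {F, G} := by
  have hFo := order_eq_of_isHomogeneous hF hF0
  have hGo := le_order_of_isHomogeneous hG
  -- the product of the lowest terms, and the rest
  have hsplit : ∀ (M : ℕ) (α β : MvPowerSeries (Fin n) k), (M : ℕ∞) ≤ α.order + a →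
      (M : ℕ∞) ≤ β.order + b → ((M + 1 : ℕ) : ℕ∞) ≤ (α * f₁ + β * f₂ -
        ((formPart a M α * F + formPart b M β * G : MvPolynomial (Fin n) k) :
          MvPowerSeries (Fin n) k)).order := by
    intro M α β hα hβ
    have e : α * f₁ + β * f₂ - ((formPart a M α * F + formPart b M β * G :
        MvPolynomial (Fin n) k) : MvPowerSeries (Fin n) k) =
        ((α - formPart a M α) * F + α * (f₁ - F)) +
        ((β - formPart b M β) * G + β * (f₂ - G)) := by
      rw [MvPolynomial.coe_add, MvPolynomial.coe_mul, MvPolynomial.coe_mul]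
      ring
    rw [e]
    have h1 : ∀ (c : ℕ) (γ : MvPowerSeries (Fin n) k), (M : ℕ∞) ≤ γ.order + c →
        ((M + 1 : ℕ) : ℕ∞) ≤ γ.order + ((c + 1 : ℕ) : ℕ∞) := by
      intro c γ h
      push_cast
      rw [← add_assoc]
      gcongr
    exact le_order_add_of_le
      (le_order_add_of_le (le_order_mul_of_le_add (le_order_sub_formPart hα) hFo.ge)
        (le_order_mul_of_le_add (h1 a α hα) hf₁))
      (le_order_add_of_le (le_order_mul_of_le_add (le_order_sub_formPart hβ) hGo)
        (le_order_mul_of_le_add (h1 b β hβ) hf₂))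
  have key : ∀ M ≤ N, ∃ α β : MvPowerSeries (Fin n) k, (w : MvPowerSeries (Fin n) k) =
      α * f₁ + β * f₂ ∧ (M : ℕ∞) ≤ α.order + a ∧ (M : ℕ∞) ≤ β.order + b := by
    intro M
    induction M with
    | zero =>
      intro _
      obtain ⟨α, β, e⟩ := Ideal.mem_span_pair.1 hw
      exact ⟨α, β, (congrArg (Subtype.val : O → MvPowerSeries (Fin n) k) e).symm, by simp, by simp⟩
    | succ M ih =>
      intro hM
      obtain ⟨α, β, e, hα, hβ⟩ := ih (by omega)
      set A := formPart a M α
      set B := formPart b M β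
      have h0 : A * F + B * G = 0 := by
        refine eq_zero_of_isHomogeneous_of_lt_order
          ((isHomogeneous_formPart_mul a M α hF).add (isHomogeneous_formPart_mul b M β hG)) ?_
        have h1 := hsplit M α β hα hβ
        rw [← e] at h1
        have h2 : ((M + 1 : ℕ) : ℕ∞) ≤ (w : MvPowerSeries (Fin n) k).order :=
          le_trans (by exact_mod_cast hM) hN
        have h3 : ((A * F + B * G : MvPolynomial (Fin n) k) : MvPowerSeries (Fin n) k) =
            w + -1 * (w - ((A * F + B * G : MvPolynomial (Fin n) k) : MvPowerSeries (Fin n) k)) := by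
          ring
        have h4 : ((M + 1 : ℕ) : ℕ∞) ≤
            ((A * F + B * G : MvPolynomial (Fin n) k) : MvPowerSeries (Fin n) k).order := by
          rw [h3]
          refine le_order_add_of_le h2 ?_
          rw [mul_comm]
          exact le_order_mul_of_le _ h1
        exact lt_of_lt_of_le (by exact_mod_cast Nat.lt_succ_self M) h4
      obtain ⟨γ, hγ⟩ : F ∣ B := hFG.dvd_of_dvd_mul_right ⟨-A, by linear_combination h0⟩
      have hA : A = -(γ * G) := by
        apply mul_right_cancel₀ hF0
        linear_combination h0 - G * hγ
      have hγo : (M : ℕ∞) ≤ (γ : MvPowerSeries (Fin n) k).order + a + b := by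
        have h1 := le_order_formPart b M β
        change (M : ℕ∞) ≤ (B : MvPowerSeries (Fin n) k).order + b at h1
        rw [hγ, MvPolynomial.coe_mul, order_mul, hFo, add_comm (a : ℕ∞)] at h1
        exact h1
      refine ⟨α + γ * f₂, β - γ * f₁, by rw [e]; ring, ?_, ?_⟩
      · have e1 : α + γ * f₂ = (α - A) + γ * (f₂ - G) := by
          have h1 : (A : MvPowerSeries (Fin n) k) = -(γ * G) := by
            rw [eq_neg_iff_add_eq_zero, ← MvPolynomial.coe_mul, ← MvPolynomial.coe_add, hA,
              neg_add_cancel, MvPolynomial.coe_zero]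
          rw [h1]
          ring
        rw [e1]
        have h1 : ((M + 1 : ℕ) : ℕ∞) ≤
            ((γ : MvPowerSeries (Fin n) k) * (f₂ - G)).order + a := by
          refine le_trans ?_ (add_le_add_left (le_trans (add_le_add_right hf₂ _) le_order_mul) _)
          push_cast
          rw [← add_assoc, add_right_comm]
          rw [add_right_comm] at hγo
          gcongr
        exact le_order_add_add (le_order_sub_formPart hα) h1
      · have e1 : β - γ * f₁ = (β - B) + (-γ) * (f₁ - F) := by
          rw [hγ, MvPolynomial.coe_mul]
          ring
        rw [e1]
        have h1 : ((M + 1 : ℕ) : ℕ∞) ≤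
            ((-γ : MvPowerSeries (Fin n) k) * (f₁ - F)).order + b := by
          have h2 : (γ : MvPowerSeries (Fin n) k).order ≤ (-γ : MvPowerSeries (Fin n) k).order :=
            le_of_eq (order_neg _).symm
          refine le_trans ?_ (add_le_add_left (le_trans (add_le_add h2 hf₁) le_order_mul) _)
          push_cast
          rw [← add_assoc, add_right_comm]
          gcongr
        exact le_order_add_add (le_order_sub_formPart hβ) h1
  obtain ⟨α, β, e, hα, hβ⟩ := key N le_rfl
  have h1 := hsplit N α β hα hβ
  rw [← e] at h1
  have h2 : formPart 0 N (w : MvPowerSeries (Fin n) k) = formPart a N α * F + formPart b N β * G := by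
    have h3 := (isHomogeneous_formPart_mul a N α hF).add (isHomogeneous_formPart_mul b N β hG)
    ext m
    rw [coeff_formPart, add_zero]
    split_ifs with hm
    · have h4 := coeff_of_lt_order (f := (w : MvPowerSeries (Fin n) k) - _) (d := m)
        (lt_of_lt_of_le (by rw [hm]; exact_mod_cast Nat.lt_succ_self N) h1)
      rw [map_sub, sub_eq_zero, MvPolynomial.coeff_coe] at h4
      exact h4
    · exact (h3.coeff_eq_zero hm).symm
  rw [h2]
  exact Ideal.mem_span_pair.2 ⟨_, _, rfl⟩

/-- An ideal `(f₁, f₂)` is radical if the initial forms of `f₁`, `f₂` are relatively prime and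
generate a radical ideal. -/
theorem IsGermRing.isRadical_of_initialForms (hO : IsGermRing O) {f₁ f₂ : O}
    {F G : MvPolynomial (Fin n) k} {a b : ℕ} (hF : F.IsHomogeneous a) (hG : G.IsHomogeneous b)
    (hF0 : F ≠ 0) (hf₁ : ((a + 1 : ℕ) : ℕ∞) ≤ ((f₁ : MvPowerSeries (Fin n) k) - F).order)
    (hf₂ : ((b + 1 : ℕ) : ℕ∞) ≤ ((f₂ : MvPowerSeries (Fin n) k) - G).order)
    (hFG : IsRelPrime F G) (hrad : (Ideal.span {F, G}).IsRadical) :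
    (Ideal.span {f₁, f₂}).IsRadical := by
  -- the terms of degree `N` of an element of the radical
  have step : ∀ (N : ℕ) (u : O), u ∈ (Ideal.span {f₁, f₂}).radical →
      (N : ℕ∞) ≤ (u : MvPowerSeries (Fin n) k).order → ∃ i ∈ Ideal.span {f₁, f₂},
      ((N + 1 : ℕ) : ℕ∞) ≤ ((u - i : O) : MvPowerSeries (Fin n) k).order := by
    intro N u hu hN
    obtain ⟨m, hm⟩ := hu
    set U := formPart 0 N (u : MvPowerSeries (Fin n) k)
    have hN' : (N : ℕ∞) ≤ (u : MvPowerSeries (Fin n) k).order + (0 : ℕ) := by simpa using hN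
    have hU : U.IsHomogeneous N := by
      have := isHomogeneous_formPart_mul 0 N (u : MvPowerSeries (Fin n) k)
        (MvPolynomial.isHomogeneous_one (Fin n) k)
      rwa [mul_one] at this
    have huU : ((N + 1 : ℕ) : ℕ∞) ≤ ((u : MvPowerSeries (Fin n) k) - U).order := by
      simpa using le_order_sub_formPart hN'
    have hpow : ∀ j : ℕ, ((N * j + 1 : ℕ) : ℕ∞) ≤
        ((u : MvPowerSeries (Fin n) k) ^ j - (U : MvPowerSeries (Fin n) k) ^ j).order := by
      intro j
      induction j with
      | zero => simp
      | succ j ih =>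
        have e : (u : MvPowerSeries (Fin n) k) ^ (j + 1) - (U : MvPowerSeries (Fin n) k) ^ (j + 1) =
            (u ^ j - U ^ j) * u + U ^ j * (u - U) := by ring
        have hUj : ((N * j : ℕ) : ℕ∞) ≤ ((U : MvPowerSeries (Fin n) k) ^ j).order := by
          rw [← MvPolynomial.coe_pow]
          exact le_order_of_isHomogeneous (hU.pow j)
        rw [e]
        refine le_order_add_of_le (le_trans ?_ ((add_le_add ih hN).trans le_order_mul))
          (le_trans ?_ ((add_le_add hUj huU).trans le_order_mul))
        · exact_mod_cast (by ring_nf; omega : N * (j + 1) + 1 ≤ N * j + 1 + N)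
        · exact_mod_cast (by ring_nf; omega : N * (j + 1) + 1 ≤ N * j + (N + 1))
    have hUm : U ∈ Ideal.span {F, G} := by
      refine hrad ⟨m, ?_⟩
      have hle : ((N * m : ℕ) : ℕ∞) ≤ ((u ^ m : O) : MvPowerSeries (Fin n) k).order := by
        rw [SubmonoidClass.coe_pow]
        have h1 : (u : MvPowerSeries (Fin n) k) ^ m = (u ^ m - (U : MvPowerSeries (Fin n) k) ^ m) +
            U ^ m := by ring
        rw [h1]
        refine le_order_add_of_le (le_trans (by exact_mod_cast Nat.le_succ _) (hpow m)) ?_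
        rw [← MvPolynomial.coe_pow]
        exact le_order_of_isHomogeneous (hU.pow m)
      have h2 := formPart_mem_span_pair hF hG hF0 hf₁ hf₂ hFG hm hle
      have h3 : formPart 0 (N * m) ((u ^ m : O) : MvPowerSeries (Fin n) k) = U ^ m := by
        ext l
        rw [coeff_formPart, add_zero]
        split_ifs with hl
        · have h4 := coeff_of_lt_order (d := l) (lt_of_lt_of_le
            (by rw [hl]; exact_mod_cast Nat.lt_succ_self (N * m)) (hpow m))
          rw [map_sub, sub_eq_zero, ← MvPolynomial.coe_pow, MvPolynomial.coeff_coe] at h4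
          exact h4
        · exact ((hU.pow m).coeff_eq_zero hl).symm
      rwa [h3] at h2
    obtain ⟨α, β, e⟩ := Ideal.mem_span_pair.1 hUm
    have e1 : U = formPart a N (α : MvPowerSeries (Fin n) k) * F +
        formPart b N (β : MvPowerSeries (Fin n) k) * G :=
      exists_eq_formPart hF hG (f := (U : MvPowerSeries (Fin n) k))
        (by rw [← e, MvPolynomial.coe_add, MvPolynomial.coe_mul, MvPolynomial.coe_mul]) hU
        fun m _ => MvPolynomial.coeff_coe _ _
    refine ⟨⟨_, hO.coe_mem (formPart a N (α : MvPowerSeries (Fin n) k))⟩ * f₁ +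
      ⟨_, hO.coe_mem (formPart b N (β : MvPowerSeries (Fin n) k))⟩ * f₂,
      Ideal.mem_span_pair.2 ⟨_, _, rfl⟩, ?_⟩
    rw [AddSubgroupClass.coe_sub, AddMemClass.coe_add, MulMemClass.coe_mul, MulMemClass.coe_mul]
    dsimp only
    set A := formPart a N (α : MvPowerSeries (Fin n) k)
    set B := formPart b N (β : MvPowerSeries (Fin n) k)
    have e2 : (u : MvPowerSeries (Fin n) k) - (A * f₁ + B * f₂) =
        (u - U) + ((-A) * (f₁ - F) + (-B) * (f₂ - G)) := by
      have e3 := congrArg (fun p : MvPolynomial (Fin n) k => (p : MvPowerSeries (Fin n) k)) e1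
      simp only [MvPolynomial.coe_add, MvPolynomial.coe_mul] at e3
      linear_combination e3
    rw [e2]
    have h1 : ∀ (c : ℕ) (γ : MvPowerSeries (Fin n) k),
        ((N + 1 : ℕ) : ℕ∞) ≤ (-(formPart c N γ : MvPowerSeries (Fin n) k)).order +
          ((c + 1 : ℕ) : ℕ∞) := by
      intro c γ
      rw [order_neg]
      push_cast
      rw [← add_assoc]
      gcongr
      exact le_order_formPart c N γ
    exact le_order_add_of_le huU (le_order_add_of_le (le_order_mul_of_le_add (h1 a α) hf₁)
      (le_order_mul_of_le_add (h1 b β) hf₂))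
  intro u hu
  refine hO.mem_of_forall_order fun N => ?_
  induction N with
  | zero => exact ⟨0, zero_mem _, by simp⟩
  | succ N ih =>
    obtain ⟨i, hi, hN⟩ := ih
    obtain ⟨j, hj, hj'⟩ := step N (u - i)
      (sub_mem hu (Ideal.le_radical hi)) hN
    exact ⟨i + j, add_mem hi hj, by rwa [← sub_sub]⟩

end InitialForms

/-! ### Transverse intersections of projective hypersurfaces -/

section TransverseForms

variable {k : Type*} [Field k] {n : ℕ}

/-- The Nullstellensatz for the ideal of two polynomials. -/
theorem mem_radical_of_forall_eval [IsAlgClosed k] {I : Ideal (MvPolynomial (Fin n) k)}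
    {h : MvPolynomial (Fin n) k}
    (H : ∀ v : Fin n → k, (∀ f ∈ I, MvPolynomial.eval v f = 0) → MvPolynomial.eval v h = 0) :
    h ∈ I.radical := by
  rw [← MvPolynomial.vanishingIdeal_zeroLocus_eq_radical (K := k)]
  intro v hv
  have := H v fun f hf => by simpa [MvPolynomial.aeval_eq_eval] using hv f hf
  simpa [MvPolynomial.aeval_eq_eval] using this

/-- A polynomial that is not a unit cannot divide two different variables. -/
theorem exists_not_dvd_X {H : MvPolynomial (Fin n) k} (hn : 2 ≤ n) (hH : ¬ IsUnit H) :
    ∃ i, ¬ H ∣ MvPolynomial.X i := by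
  by_contra! hcon
  have h0 := hcon ⟨0, by omega⟩
  have h1 := hcon ⟨1, by omega⟩
  obtain ⟨e, he⟩ := h0
  obtain ⟨e', he'⟩ := h1
  have hp : Prime (MvPolynomial.X ⟨0, by omega⟩ : MvPolynomial (Fin n) k) := MvPolynomial.X_prime
  -- otherwise `H` were associated to two different variables
  have hd : (MvPolynomial.X ⟨0, by omega⟩ : MvPolynomial (Fin n) k) ∣ H := by
    refine (hp.dvd_or_dvd (he ▸ dvd_rfl : _ ∣ H * e)).resolve_right fun ⟨q, hq⟩ => hH ?_
    rw [hq] at he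
    have : (MvPolynomial.X ⟨0, by omega⟩ : MvPolynomial (Fin n) k) * 1 =
      MvPolynomial.X ⟨0, by omega⟩ * (H * q) := by rw [mul_one]; linear_combination he
    exact IsUnit.of_mul_eq_one _ (mul_left_cancel₀ hp.ne_zero this).symm
  have h2 : (MvPolynomial.X ⟨0, by omega⟩ : MvPolynomial (Fin n) k) ∣ MvPolynomial.X ⟨1, by omega⟩ :=
    hd.trans ⟨e', he'⟩
  have h3 := MvPolynomial.X_dvd_X.1 h2
  simp at h3

/-- Forms whose hypersurfaces meet transversally are relatively prime: no transverse point lies on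
a common component `{H = 0}`, so that the cofactor of `H` in `F` vanishes at all common points, in
particular on the whole of this component. -/
theorem isRelPrime_of_meetTransversally [IsAlgClosed k] (hn : 2 ≤ n) {F G : MvPolynomial (Fin n) k}
    (hF0 : F ≠ 0) (hT : MeetTransversally F G) : IsRelPrime F G := by
  by_contra hcon
  obtain ⟨H, hH, hHF, hHG⟩ : ∃ H, Irreducible H ∧ H ∣ F ∧ H ∣ G := by
    rw [IsRelPrime] at hcon
    push Not at hcon
    obtain ⟨D, h1, h2, h3⟩ := hcon
    have hD0 : D ≠ 0 := fun h => hF0 (zero_dvd_iff.1 (h ▸ h1))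
    obtain ⟨H, hH, hHD⟩ := WfDvdMonoid.exists_irreducible_factor h3 hD0
    exact ⟨H, hH, hHD.trans h1, hHD.trans h2⟩
  obtain ⟨i, hi⟩ := exists_not_dvd_X hn hH.not_isUnit
  obtain ⟨e, F', hF', hFF'⟩ := WfDvdMonoid.max_power_factor hF0 hH
  obtain ⟨G', rfl⟩ := hHG
  have he : e ≠ 0 := by
    rintro rfl
    rw [pow_zero, one_mul] at hFF'
    exact hF' (hFF' ▸ hHF)
  obtain ⟨e, rfl⟩ := Nat.exists_eq_succ_of_ne_zero he
  have hvan : ∀ v, TransverseAt F (H * G') v → MvPolynomial.eval v F' = 0 := by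
    rintro v ⟨⟨-, hv1, hv2⟩, hli⟩
    have hHv : MvPolynomial.eval v H ≠ 0 := by
      intro h0
      rw [LinearIndependent.pair_iff] at hli
      have h1 : ∀ j, MvPolynomial.eval v (MvPolynomial.pderiv j F) =
          MvPolynomial.eval v (H ^ e * F') * MvPolynomial.eval v (MvPolynomial.pderiv j H) := by
        intro j
        rw [hFF', pow_succ', mul_assoc, Derivation.leibniz]
        simp [h0]
      have h2 : ∀ j, MvPolynomial.eval v (MvPolynomial.pderiv j (H * G')) =
          MvPolynomial.eval v G' * MvPolynomial.eval v (MvPolynomial.pderiv j H) := by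
        intro j
        rw [Derivation.leibniz]
        simp [h0]
      by_cases hG' : MvPolynomial.eval v G' = 0
      · have := hli 0 1 (by
          funext j
          simp only [Pi.add_apply, Pi.smul_apply, smul_eq_mul, Pi.zero_apply]
          rw [h2, hG']
          ring)
        exact one_ne_zero this.2
      · have := hli (MvPolynomial.eval v G') (-MvPolynomial.eval v (H ^ e * F')) (by
          funext j
          simp only [Pi.add_apply, Pi.smul_apply, smul_eq_mul, Pi.zero_apply]
          rw [h1, h2]
          ring)
        exact hG' this.1
    rw [hFF', map_mul, map_pow] at hv1
    exact (mul_eq_zero.1 hv1).resolve_left (pow_ne_zero _ hHv)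
  have hcom := hT F' hvan
  have hrad : MvPolynomial.X i * F' ∈ (Ideal.span {H}).radical := by
    refine mem_radical_of_forall_eval fun v hv => ?_
    have hHv := hv H (Ideal.mem_span_singleton_self H)
    rw [map_mul, MvPolynomial.eval_X]
    by_cases h0 : v = 0
    · rw [h0, Pi.zero_apply, zero_mul]
    · rw [hcom v ⟨h0, by rw [hFF', map_mul, map_pow, hHv, zero_pow (Nat.succ_ne_zero e), zero_mul],
        by rw [map_mul, hHv, zero_mul]⟩, mul_zero]
  obtain ⟨m, hm⟩ := hrad
  have hp := hH.prime
  have := hp.dvd_of_dvd_pow (Ideal.mem_span_singleton.1 hm)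
  exact (hp.dvd_or_dvd this).elim hi hF'

/-- The Jacobian minors of a pair of polynomials. -/
def polyMinor (F G : MvPolynomial (Fin n) k) (i j : Fin n) : MvPolynomial (Fin n) k :=
  MvPolynomial.pderiv i F * MvPolynomial.pderiv j G - MvPolynomial.pderiv j F * MvPolynomial.pderiv i G

/-- Linear independence of the gradients gives a minor that does not vanish. -/
theorem exists_polyMinor_ne_zero {F G : MvPolynomial (Fin n) k} {v : Fin n → k}
    (h : TransverseAt F G v) : ∃ i j, MvPolynomial.eval v (polyMinor F G i j) ≠ 0 := by
  by_contra! hcon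
  have hli := h.2
  rw [LinearIndependent.pair_iff] at hli
  have hrel : ∀ i j, MvPolynomial.eval v (MvPolynomial.pderiv i F) *
      MvPolynomial.eval v (MvPolynomial.pderiv j G) = MvPolynomial.eval v (MvPolynomial.pderiv j F) *
      MvPolynomial.eval v (MvPolynomial.pderiv i G) := by
    intro i j
    have := hcon i j
    rw [polyMinor, map_sub, map_mul, map_mul, sub_eq_zero] at this
    exact this
  by_cases hF : ∀ i, MvPolynomial.eval v (MvPolynomial.pderiv i F) = 0
  · have := hli 1 0 (by
      funext j
      simp only [Pi.add_apply, Pi.smul_apply, smul_eq_mul, Pi.zero_apply]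
      rw [hF j]
      ring)
    exact one_ne_zero this.1
  · push Not at hF
    obtain ⟨i, hi⟩ := hF
    have := hli (MvPolynomial.eval v (MvPolynomial.pderiv i G))
      (-MvPolynomial.eval v (MvPolynomial.pderiv i F)) (by
      funext j
      simp only [Pi.add_apply, Pi.smul_apply, smul_eq_mul, Pi.zero_apply]
      linear_combination -hrel i j)
    exact hi (neg_eq_zero.1 this.2)

/-- The Jacobian criterion at a minimal prime of the intersection of two transverse hypersurfaces,
if this prime is not the ideal of the origin. -/
theorem exists_polyMinor_notMem [IsAlgClosed k] {F G : MvPolynomial (Fin n) k}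
    (hT : MeetTransversally F G) {Q : Ideal (MvPolynomial (Fin n) k)}
    (hQ : Q ∈ (Ideal.span {F, G}).minimalPrimes) {i : Fin n} (hi : MvPolynomial.X i ∉ Q) :
    ∃ i j, polyMinor F G i j ∉ Q := by
  have hQp : Q.IsPrime := hQ.1.1
  by_contra! hcon
  have hQ' : Q ∈ (Ideal.span {F, G}).radical.minimalPrimes := by
    rwa [Ideal.radical_minimalPrimes]
  choose s hs hs' using fun i j => exists_notMem_mul_mem_of_mem_minimalPrimes
    (Ideal.radical_isRadical _) hQ' (hcon i j)
  -- the product of all `s i j` vanishes at the transverse points, hence at all common points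
  set t := ∏ i, ∏ j, s i j
  have ht : t ∉ Q := by
    intro h
    obtain ⟨i, -, hi⟩ := (hQp.prod_mem_iff).1 h
    obtain ⟨j, -, hj⟩ := (hQp.prod_mem_iff).1 hi
    exact hs i j hj
  have hzero : ∀ v, CommonPoint F G v → ∀ f ∈ (Ideal.span {F, G}).radical,
      MvPolynomial.eval v f = 0 := by
    rintro v ⟨-, h1, h2⟩ f ⟨m, hm⟩
    obtain ⟨α, β, e⟩ := Ideal.mem_span_pair.1 hm
    have := congrArg (MvPolynomial.eval v) e
    rw [map_add, map_mul, map_mul, h1, h2, mul_zero, mul_zero, add_zero, map_pow] at this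
    exact eq_zero_of_pow_eq_zero this.symm
  have htv := hT t fun v hv => by
    obtain ⟨i, j, hij⟩ := exists_polyMinor_ne_zero hv
    have h1 := hzero v hv.1 _ (hs' i j)
    rw [map_mul] at h1
    rw [map_prod]
    refine Finset.prod_eq_zero (Finset.mem_univ i) ?_
    rw [map_prod]
    exact Finset.prod_eq_zero (Finset.mem_univ j) ((mul_eq_zero.1 h1).resolve_right hij)
  have hrad : MvPolynomial.X i * t ∈ (Ideal.span {F, G}).radical := by
    refine mem_radical_of_forall_eval fun v hv => ?_
    rw [map_mul, MvPolynomial.eval_X]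
    by_cases h0 : v = 0
    · rw [h0, Pi.zero_apply, zero_mul]
    · rw [htv v ⟨h0, hv F (Ideal.subset_span (by simp)), hv G (Ideal.subset_span (by simp))⟩,
        mul_zero]
  exact ((hQp.mem_or_mem (hQ'.1.2 hrad)).elim hi ht)

/-- The converse direction of the Jacobian criterion: two polynomials with a Jacobian minor outside
a minimal prime `Q` of the ideal that they generate, generate `Q` locally. Indeed their classes in
the cotangent space of the regular local ring at `Q` are linearly independent, and its dimension is
at most two. -/
theorem exists_notMem_mul_mem_of_polyMinor {F G : MvPolynomial (Fin n) k}
    {Q : Ideal (MvPolynomial (Fin n) k)} (hQ : Q ∈ (Ideal.span {F, G}).minimalPrimes) {i j : Fin n}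
    (hij : polyMinor F G i j ∉ Q) {x : MvPolynomial (Fin n) k} (hx : x ∈ Q) :
    ∃ s ∉ Q, s * x ∈ Ideal.span {F, G} := by
  classical
  have hQp : Q.IsPrime := hQ.1.1
  have hF : F ∈ Q := hQ.1.2 (Ideal.subset_span (by simp))
  have hG : G ∈ Q := hQ.1.2 (Ideal.subset_span (by simp))
  have hreg : IsRegularRing (MvPolynomial (Fin n) k) := inferInstance
  set L := Localization.AtPrime Q
  have hL : IsRegularLocalRing L := (isRegularRing_iff.1 hreg) Q
  have hdim : Module.finrank (IsLocalRing.ResidueField L) (IsLocalRing.CotangentSpace L) ≤ 2 := by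
    have h1 := (IsRegularLocalRing.iff_finrank_cotangentSpace L).1 hL
    rw [IsLocalization.AtPrime.ringKrullDim_eq_height Q L] at h1
    have h2 := Ideal.height_le_card_of_mem_minimalPrimes_span_finset (s := {F, G}) (by simpa using hQ)
    have h3 : ((({F, G} : Finset (MvPolynomial (Fin n) k)).card : ℕ) : ℕ∞) ≤ 2 := by
      exact_mod_cast Finset.card_le_two
    have h4 : (Module.finrank (IsLocalRing.ResidueField L) (IsLocalRing.CotangentSpace L) : ℕ∞) ≤ 2 := by
      have : (Module.finrank (IsLocalRing.ResidueField L) (IsLocalRing.CotangentSpace L) : ℕ∞) =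
        Q.height := by exact_mod_cast h1
      rw [this]
      exact h2.trans h3
    exact_mod_cast h4
  -- the derivatives of `a * F + b * G ∈ Q ^ 2`
  have key : ∀ a b : MvPolynomial (Fin n) k, a * F + b * G ∈ Q ^ 2 → a ∈ Q ∧ b ∈ Q := by
    intro a b h
    have hd : ∀ l, a * MvPolynomial.pderiv l F + b * MvPolynomial.pderiv l G ∈ Q := by
      intro l
      have h1 : MvPolynomial.pderiv l (a * F + b * G) ∈ Q := by
        rw [pow_two] at h
        refine Submodule.mul_induction_on h (fun x hx y hy => ?_) fun x y hx hy => ?_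
        · rw [Derivation.leibniz]
          exact Q.add_mem (Q.mul_mem_right _ hx) (Q.mul_mem_right _ hy)
        · rw [map_add]
          exact Q.add_mem hx hy
      rw [map_add, Derivation.leibniz, Derivation.leibniz] at h1
      have h2 := Q.sub_mem h1 (Q.add_mem (Q.mul_mem_right (MvPolynomial.pderiv l a) hF)
        (Q.mul_mem_right (MvPolynomial.pderiv l b) hG))
      convert h2 using 1
      simp only [smul_eq_mul]
      ring
    have ha : a * polyMinor F G i j ∈ Q := by
      have := Q.sub_mem (Q.mul_mem_right (MvPolynomial.pderiv j G) (hd i))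
        (Q.mul_mem_right (MvPolynomial.pderiv i G) (hd j))
      convert this using 1
      rw [polyMinor]
      ring
    have hb : b * polyMinor F G i j ∈ Q := by
      have := Q.sub_mem (Q.mul_mem_right (MvPolynomial.pderiv i F) (hd j))
        (Q.mul_mem_right (MvPolynomial.pderiv j F) (hd i))
      convert this using 1
      rw [polyMinor]
      ring
    exact ⟨(hQp.mem_or_mem ha).resolve_right hij, (hQp.mem_or_mem hb).resolve_right hij⟩
  have hmax : IsLocalRing.maximalIdeal L = Q.map (algebraMap _ L) :=
    (Localization.AtPrime.map_eq_maximalIdeal).symm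
  have hmem : ∀ u ∈ Q, algebraMap _ L u ∈ IsLocalRing.maximalIdeal L := fun u hu =>
    hmax ▸ Ideal.mem_map_of_mem _ hu
  have keyL : ∀ a b : L, a * algebraMap _ L F + b * algebraMap _ L G ∈
      IsLocalRing.maximalIdeal L ^ 2 →
      a ∈ IsLocalRing.maximalIdeal L ∧ b ∈ IsLocalRing.maximalIdeal L := by
    intro a b h
    obtain ⟨a', b', ⟨w, hw⟩, e1, e2⟩ : ∃ (a' b' : MvPolynomial (Fin n) k) (w : Q.primeCompl),
        a * algebraMap _ L (w : MvPolynomial (Fin n) k) = algebraMap _ L a' ∧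
        b * algebraMap _ L (w : MvPolynomial (Fin n) k) = algebraMap _ L b' := by
      obtain ⟨w, hw⟩ := IsLocalization.exist_integer_multiples_of_finset Q.primeCompl {a, b}
      obtain ⟨a', ha'⟩ := hw a (by simp)
      obtain ⟨b', hb'⟩ := hw b (by simp)
      refine ⟨a', b', w, ?_, ?_⟩
      · rw [ha', Algebra.smul_def, mul_comm]
      · rw [hb', Algebra.smul_def, mul_comm]
    dsimp only at e1 e2
    have hwu : IsUnit (algebraMap _ L w) := IsLocalization.map_units L (⟨w, hw⟩ : Q.primeCompl)
    have h1 : algebraMap _ L (a' * F + b' * G) ∈ (Q ^ 2).map (algebraMap _ L) := by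
      rw [Ideal.map_pow, ← hmax, map_add, map_mul, map_mul, ← e1, ← e2]
      convert Ideal.mul_mem_left _ (algebraMap _ L w) h using 1
      ring
    obtain ⟨t, ht, h2⟩ := (IsLocalization.algebraMap_mem_map_algebraMap_iff Q.primeCompl L _ _).1 h1
    obtain ⟨h3, h4⟩ := key (t * a') (t * b') (by convert h2 using 1; ring)
    have h3' := (hQp.mem_or_mem h3).resolve_left ht
    have h4' := (hQp.mem_or_mem h4).resolve_left ht
    refine ⟨?_, ?_⟩
    · exact ((Ideal.IsMaximal.isPrime' _).mem_or_mem (e1 ▸ hmem _ h3')).resolve_right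
        fun h => (IsLocalRing.mem_maximalIdeal _).1 h hwu
    · exact ((Ideal.IsMaximal.isPrime' _).mem_or_mem (e2 ▸ hmem _ h4')).resolve_right
        fun h => (IsLocalRing.mem_maximalIdeal _).1 h hwu
  set F' : IsLocalRing.maximalIdeal L := ⟨algebraMap _ L F, hmem F hF⟩
  set G' : IsLocalRing.maximalIdeal L := ⟨algebraMap _ L G, hmem G hG⟩
  set c := (IsLocalRing.maximalIdeal L).toCotangent
  have hli : LinearIndependent (IsLocalRing.ResidueField L) ![c F', c G'] := by
    rw [LinearIndependent.pair_iff]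
    intro a b h
    obtain ⟨a, rfl⟩ := IsLocalRing.residue_surjective a
    obtain ⟨b, rfl⟩ := IsLocalRing.residue_surjective b
    have h1 : c (a • F' + b • G') = 0 := by
      rw [map_add, map_smul, map_smul]
      exact h
    have h2 := (IsLocalRing.maximalIdeal L).toCotangent_eq_zero _ |>.1 h1
    obtain ⟨h3, h4⟩ := keyL a b h2
    exact ⟨(IsLocalRing.residue_eq_zero_iff _).2 h3, (IsLocalRing.residue_eq_zero_iff _).2 h4⟩
  have htop : Submodule.span (IsLocalRing.ResidueField L) (c '' {F', G'}) = ⊤ := by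
    have hc : Fintype.card (Fin 2) = Module.finrank (IsLocalRing.ResidueField L)
        (IsLocalRing.CotangentSpace L) :=
      le_antisymm hli.fintype_card_le_finrank (by simpa using hdim)
    have := hli.span_eq_top_of_card_eq_finrank hc
    rwa [Matrix.range_cons, Matrix.range_cons, Matrix.range_empty, Set.union_empty,
      Set.singleton_union, ← Set.image_pair] at this
  have hspan := IsLocalRing.CotangentSpace.span_image_eq_top_iff.1 htop
  have hxL : (⟨algebraMap _ L x, hmem x hx⟩ : IsLocalRing.maximalIdeal L) ∈
      Submodule.span L {F', G'} := hspan ▸ Submodule.mem_top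
  obtain ⟨a, b, e⟩ := Submodule.mem_span_pair.1 hxL
  have hxI : algebraMap _ L x ∈ (Ideal.span {F, G}).map (algebraMap _ L) := by
    rw [Ideal.map_span, Set.image_pair, Ideal.mem_span_pair]
    exact ⟨a, b, congrArg Subtype.val e⟩
  exact (IsLocalization.algebraMap_mem_map_algebraMap_iff Q.primeCompl L _ _).1 hxI

end TransverseForms

/-! ### Torsion over polynomials in fewer variables -/

section PolynomialCoordinates

variable {k : Type*} [Field k] {n : ℕ}

/-- The linear coordinate change `shear z c`, on polynomials. -/
def polyShear (z : Fin n) (c : Fin n → k) : MvPolynomial (Fin n) k →ₐ[k] MvPolynomial (Fin n) k :=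
  MvPolynomial.aeval fun i => MvPolynomial.X i + MvPolynomial.C (c i) * MvPolynomial.X z

theorem polyShear_X (z : Fin n) (c : Fin n → k) (i : Fin n) : polyShear z c (MvPolynomial.X i) =
    MvPolynomial.X i + MvPolynomial.C (c i) * MvPolynomial.X z :=
  MvPolynomial.aeval_X _ i

theorem polyShear_polyShear (z : Fin n) {c c' : Fin n → k} (hc : c z = 0) (h : ∀ i, c i + c' i = 0)
    (p : MvPolynomial (Fin n) k) : polyShear z c' (polyShear z c p) = p := by
  rw [← AlgHom.comp_apply, ← AlgHom.id_apply (R := k) p]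
  congr 1
  refine MvPolynomial.algHom_ext fun i => ?_
  have hc' : c' z = 0 := by simpa [hc] using h z
  rw [AlgHom.comp_apply, polyShear_X, map_add, map_mul, MvPolynomial.algHom_C, polyShear_X,
    polyShear_X, hc', map_zero, zero_mul, add_zero, AlgHom.id_apply, add_assoc,
    MvPolynomial.algebraMap_eq, ← add_mul, ← map_add, add_comm (c' i), h, map_zero, zero_mul,
    add_zero]

theorem coe_polyShear (z : Fin n) (c : Fin n → k) (p : MvPolynomial (Fin n) k) :
    (polyShear z c p : MvPowerSeries (Fin n) k) = shear z c (p : MvPowerSeries (Fin n) k) := by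
  induction p using MvPolynomial.induction_on with
  | C a =>
    rw [MvPolynomial.algHom_C, MvPolynomial.algebraMap_eq, MvPolynomial.coe_C]
    exact ((shear z c).commutes a).symm
  | add p q hp hq =>
    rw [map_add, MvPolynomial.coe_add, hp, hq, MvPolynomial.coe_add, map_add]
  | mul_X p i hp =>
    rw [map_mul, MvPolynomial.coe_mul, hp, polyShear_X, MvPolynomial.coe_mul, map_mul,
      MvPolynomial.coe_X, shear_X, MvPolynomial.coe_add, MvPolynomial.coe_mul, MvPolynomial.coe_X,
      MvPolynomial.coe_X, MvPolynomial.coe_C]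

/-- The linear coordinate change `shear z c`, as an automorphism of the polynomial ring. -/
def polyShearEquiv (z : Fin n) {c : Fin n → k} (hc : c z = 0) :
    MvPolynomial (Fin n) k ≃ₐ[k] MvPolynomial (Fin n) k :=
  AlgEquiv.ofAlgHom (polyShear z c) (polyShear z (-c))
    (AlgHom.ext fun p => by
      rw [AlgHom.comp_apply, AlgHom.id_apply]
      exact polyShear_polyShear z (c := -c) (c' := c) (by simp [hc]) (fun i => by simp) p)
    (AlgHom.ext fun p => by
      rw [AlgHom.comp_apply, AlgHom.id_apply]
      exact polyShear_polyShear z (c := c) (c' := -c) hc (fun i => by simp) p)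

/-- The ideal of two forms in the polynomial ring is the contraction of the ideal that they
generate in the ring of formal power series. -/
theorem mem_span_pair_of_coe_eq {F G : MvPolynomial (Fin n) k} {a b : ℕ} (hF : F.IsHomogeneous a)
    (hG : G.IsHomogeneous b) {u : MvPolynomial (Fin n) k} {α β : MvPowerSeries (Fin n) k}
    (e : (u : MvPowerSeries (Fin n) k) = α * (F : MvPowerSeries (Fin n) k) + β * G) :
    u ∈ Ideal.span {F, G} := by
  rw [← MvPolynomial.sum_homogeneousComponent u]
  refine Ideal.sum_mem _ fun N _ => ?_
  have := exists_eq_formPart hF hG e (MvPolynomial.homogeneousComponent_isHomogeneous N u)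
    fun m hm => by rw [MvPolynomial.coeff_coe, MvPolynomial.coeff_homogeneousComponent, if_pos hm]
  exact Ideal.mem_span_pair.2 ⟨_, _, this.symm⟩

theorem coe_rename_mem_seriesIn (T : Finset (Fin n)) (p : MvPolynomial {i // i ∈ T} k) :
    (MvPolynomial.rename Subtype.val p : MvPowerSeries (Fin n) k) ∈ seriesIn k T := by
  induction p using MvPolynomial.induction_on with
  | C a =>
    rw [MvPolynomial.rename_C, MvPolynomial.coe_C]
    exact (seriesIn k T).algebraMap_mem a
  | add p q hp hq =>
    rw [map_add, MvPolynomial.coe_add]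
    exact add_mem hp hq
  | mul_X p i hp =>
    rw [map_mul, MvPolynomial.rename_X, MvPolynomial.coe_mul, MvPolynomial.coe_X]
    exact mul_mem hp (X_mem_seriesIn i.2)

/-- Let `F`, `G` be forms, `F` regular and `G` regular modulo `F` in the ring of formal power
series. After a linear change of coordinates, `(F, G)` has no torsion over the polynomials in all
variables but two. -/
theorem exists_coordinates_torsionFree [Infinite k] {F G : MvPolynomial (Fin n) k} {a b : ℕ}
    (hF : F.IsHomogeneous a) (hG : G.IsHomogeneous b) (hF0 : F ≠ 0)
    (hreg : ∀ u : MvPowerSeries (Fin n) k, (F : MvPowerSeries (Fin n) k) ∣ G * u →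
      (F : MvPowerSeries (Fin n) k) ∣ u) {y z : Fin n} (hyz : y ≠ z) :
    ∃ ι : MvPolynomial (Fin n) k ≃ₐ[k] MvPolynomial (Fin n) k,
      (∀ i, ι (MvPolynomial.X i) ∈ Ideal.span (Set.range MvPolynomial.X)) ∧
      ∀ c : MvPolynomial {i // i ∈ (Finset.univ.erase z).erase y} k, c ≠ 0 →
        ∀ u, ι (MvPolynomial.rename Subtype.val c) * u ∈ Ideal.span {F, G} →
          u ∈ Ideal.span {F, G} := by
  classical
  set T : Finset (Fin n) := (Finset.univ.erase z).erase y with hT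
  have hyT : y ∉ T := Finset.notMem_erase _ _
  have hyTi : insert y T = Finset.univ.erase z :=
    Finset.insert_erase (Finset.mem_erase.2 ⟨hyz, Finset.mem_univ y⟩)
  obtain ⟨c₁, c₂, hc₁, hc₂, D, E, r, v, h⟩ := (isWeierstrass_top (k := k)).exists_adaptedPair hyT
    (z := z) (by rw [hyTi]; exact Finset.notMem_erase _ _)
    (by rw [hyTi]; exact Finset.insert_erase (Finset.mem_univ z))
    (f₁ := (F : MvPowerSeries (Fin n) k)) (f₂ := G) trivial trivial
    (fun e => hF0 (MvPolynomial.coe_injective _ _ (by simpa using e)))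
    (fun u _ ⟨e, _, he⟩ => by
      obtain ⟨e', he'⟩ := hreg u ⟨e, he⟩
      exact ⟨e', trivial, he'⟩)
  have hc₁' : (-c₁) z = 0 := by simp [hc₁]
  have hc₂' : (-c₂) y = 0 := by simp [hc₂]
  refine ⟨(polyShearEquiv y hc₂').trans (polyShearEquiv z hc₁'), fun i => ?_, fun c hc0 u hu => ?_⟩
  · have hX : ∀ j, (MvPolynomial.X j : MvPolynomial (Fin n) k) ∈
        Ideal.span (Set.range MvPolynomial.X) := fun j => Ideal.subset_span ⟨j, rfl⟩
    change polyShear z (-c₁) (polyShear y (-c₂) (MvPolynomial.X i)) ∈ _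
    rw [polyShear_X, map_add, map_mul, polyShear_X, polyShear_X]
    exact add_mem (add_mem (hX _) (Ideal.mul_mem_left _ _ (hX _)))
      (Ideal.mul_mem_left _ _ (add_mem (hX _) (Ideal.mul_mem_left _ _ (hX _))))
  · obtain ⟨α, β, e⟩ := Ideal.mem_span_pair.1 hu
    set σ := (shear y c₂).comp (shear z c₁) with hσ
    have hσc : σ (((polyShearEquiv y hc₂').trans (polyShearEquiv z hc₁'))
        (MvPolynomial.rename Subtype.val c) : MvPolynomial (Fin n) k) =
        (MvPolynomial.rename Subtype.val c : MvPolynomial (Fin n) k) := by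
      change shear y c₂ (shear z c₁
        (polyShear z (-c₁) (polyShear y (-c₂) (MvPolynomial.rename Subtype.val c)) :
          MvPolynomial (Fin n) k)) = _
      rw [← coe_polyShear, polyShear_polyShear z hc₁' (fun i => by simp), ← coe_polyShear,
        polyShear_polyShear y hc₂' (fun i => by simp)]
    have e' := congrArg (fun p : MvPolynomial (Fin n) k => σ (p : MvPowerSeries (Fin n) k)) e
    simp only [MvPolynomial.coe_add, MvPolynomial.coe_mul, map_add, map_mul] at e'
    rw [hσc] at e'
    obtain ⟨α', -, β', -, e''⟩ := h.torsionFree isWeierstrass_top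
      ⟨trivial, coe_rename_mem_seriesIn T c⟩ (fun h0 => hc0 (MvPolynomial.rename_injective _
        Subtype.val_injective (MvPolynomial.coe_injective _ _ (by simpa using h0))))
      (u := σ u) trivial (α := σ α) (β := σ β) trivial e'.symm
    have hback : ∀ g, shear z (-c₁) (shear y (-c₂) (σ g)) = g := fun g => by
      rw [hσ, AlgHom.comp_apply, shear_neg_shear y hc₂, shear_neg_shear z hc₁]
    replace e'' : σ u = α' * σ F + β' * σ G := e''
    have e3 := congrArg (fun g => shear z (-c₁) (shear y (-c₂) g)) e''
    simp only [map_add, map_mul, hback] at e3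
    exact mem_span_pair_of_coe_eq hF hG e3

end PolynomialCoordinates

/-! ### Heights of primes of polynomial rings -/

section Height

variable {k : Type*} [Field k]

/-- A prime ideal of a polynomial ring which contains no nonzero polynomial in a subset of the
variables has height at most the number of the other variables. -/
theorem height_le_of_forall_rename {σ : Type*} [Finite σ] (p : σ → Prop)
    (P : Ideal (MvPolynomial σ k)) [P.IsPrime]
    (h : ∀ c : MvPolynomial {i // ¬ p i} k, MvPolynomial.rename Subtype.val c ∈ P → c = 0) :
    P.height ≤ Nat.card {i // p i} := by
  classical
  let A := MvPolynomial {i // ¬ p i} k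
  let e : MvPolynomial σ k ≃ₐ[k] MvPolynomial {i // p i} A :=
    (MvPolynomial.renameEquiv k (Equiv.sumCompl p).symm).trans
      (MvPolynomial.sumAlgEquiv k {i // p i} {i // ¬ p i})
  have he : ∀ c : A, e.symm (MvPolynomial.C c) = MvPolynomial.rename Subtype.val c := by
    intro c
    rw [AlgEquiv.symm_apply_eq]
    induction c using MvPolynomial.induction_on with
    | C c =>
      simp [e]
      exact (MvPolynomial.sumAlgEquiv_C_inl k _ _ c).symm
    | add p q hp hq => rw [map_add, hp, hq, map_add, map_add]
    | mul_X q j hq =>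
      rw [map_mul, hq, map_mul, map_mul]
      congr 1
      simp [e, Equiv.sumCompl_symm_apply_of_neg j.2]
      exact (MvPolynomial.sumAlgEquiv_X_inr k _ _ j).symm
  set P' := P.comap (e.symm.toRingEquiv : MvPolynomial {i // p i} A →+* MvPolynomial σ k)
  have hP' : P'.height = P.height := RingEquiv.height_comap e.symm.toRingEquiv P
  let K := FractionRing A
  let : Algebra (MvPolynomial {i // p i} A) (MvPolynomial {i // p i} K) :=
    MvPolynomial.algebraMvPolynomial
  have hdisj : Disjoint (((nonZeroDivisors A).map
      (MvPolynomial.C : A →+* MvPolynomial {i // p i} A) : Submonoid _) :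
        Set (MvPolynomial {i // p i} A)) (P' : Set (MvPolynomial {i // p i} A)) := by
    rw [Set.disjoint_left]
    rintro _ ⟨c, hc, rfl⟩ hcP
    exact nonZeroDivisors.ne_zero hc (h c (by rw [← he]; exact hcP))
  have hloc : IsLocalization ((nonZeroDivisors A).map
      (MvPolynomial.C : A →+* MvPolynomial {i // p i} A)) (MvPolynomial {i // p i} K) :=
    MvPolynomial.isLocalization _ K
  have h1 := IsLocalization.height_map_of_disjoint (S := MvPolynomial {i // p i} K) _ P' hdisj
  have h2 := IsLocalization.isPrime_of_isPrime_disjoint _ (MvPolynomial {i // p i} K) P'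
    inferInstance hdisj
  have h3 := Ideal.height_le_ringKrullDim_of_ne_top h2.ne_top
  rw [h1, hP', MvPolynomial.ringKrullDim_of_isNoetherianRing, ringKrullDim_eq_zero_of_field,
    zero_add] at h3
  exact_mod_cast h3

end Height

/-! ### Transverse forms generate a radical ideal -/

section RadicalForms

/-- Two relatively prime elements of a unique factorization domain generate an ideal of height two:
the prime ideals of height at most two which contain them are minimal over them. -/
theorem mem_minimalPrimes_of_height_le_two {S : Type*} [CommRing S] [IsDomain S]
    [UniqueFactorizationMonoid S] {F G : S} (hF0 : F ≠ 0) (hFG : IsRelPrime F G) {Q : Ideal S}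
    [Q.IsPrime] (hF : F ∈ Q) (hG : G ∈ Q) (hQ : Q.height ≤ 2) :
    Q ∈ (Ideal.span {F, G}).minimalPrimes := by
  obtain ⟨Q₁, hQ₁, hle⟩ := Ideal.exists_minimalPrimes_le (I := Ideal.span {F, G}) (J := Q)
    (by rw [Ideal.span_le]; rintro x (rfl | rfl) <;> assumption)
  obtain rfl | hlt := hle.eq_or_lt
  · exact hQ₁
  exfalso
  have hp₁ : Q₁.IsPrime := hQ₁.1.1
  have hF₁ : F ∈ Q₁ := hQ₁.1.2 (Ideal.subset_span (by simp))
  have hG₁ : G ∈ Q₁ := hQ₁.1.2 (Ideal.subset_span (by simp))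
  have hne : Q₁ ≠ ⊥ := fun h => hF0 (by rw [h] at hF₁; simpa using hF₁)
  obtain ⟨x, hx, hxp⟩ := Ideal.IsPrime.exists_mem_prime_of_ne_bot hp₁ hne
  have hxs : (Ideal.span {x}).IsPrime := (Ideal.span_singleton_prime hxp.ne_zero).2 hxp
  have h1 : (⊥ : Ideal S) < Ideal.span {x} := by
    rw [bot_lt_iff_ne_bot, Ne, Ideal.span_singleton_eq_bot]
    exact hxp.ne_zero
  have h2 : Ideal.span {x} < Q₁ := by
    refine lt_of_le_of_ne ((Ideal.span_singleton_le_iff_mem _).2 hx) fun h => hxp.not_isUnit ?_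
    rw [← h, Ideal.mem_span_singleton] at hF₁ hG₁
    exact hFG hF₁ hG₁
  have hb : (⊥ : Ideal S).IsPrime := Ideal.isPrime_bot
  have e1 := Ideal.height_add_one_le_of_lt_of_isPrime h1
  have e2 := Ideal.height_add_one_le_of_lt_of_isPrime h2
  have e3 := Ideal.height_add_one_le_of_lt_of_isPrime hlt
  have : (3 : ℕ∞) ≤ 2 := by
    calc (3 : ℕ∞) = 0 + 1 + 1 + 1 := by norm_num
      _ ≤ (⊥ : Ideal S).height + 1 + 1 + 1 := by gcongr; exact zero_le
      _ ≤ Q.height := (add_le_add_left ((add_le_add_left e1 1).trans e2) 1).trans e3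
      _ ≤ 2 := hQ
  exact absurd this (by decide)

/-- An ideal of a Noetherian ring which does not contain `u` has an associated prime containing the
ideal quotient by `u`. -/
theorem exists_prime_of_notMem {S : Type*} [CommRing S] [IsNoetherianRing S] {I : Ideal S} {u : S}
    (hu : u ∉ I) : ∃ Q : Ideal S, Q.IsPrime ∧ (∃ w ∉ I, ∀ x, x ∈ Q ↔ x * w ∈ I) ∧
      ∀ x, x * u ∈ I → x ∈ Q := by
  have hcolon : ∀ v x : S, x ∈ (⊥ : Submodule S (S ⧸ I)).colon {Ideal.Quotient.mk I v} ↔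
      x * v ∈ I := by
    intro v x
    rw [Submodule.mem_colon_singleton, Submodule.mem_bot, Algebra.smul_def,
      Ideal.Quotient.algebraMap_eq, ← map_mul, Ideal.Quotient.eq_zero_iff_mem]
  obtain ⟨Q, hQ, hle⟩ := exists_le_isAssociatedPrime_of_isNoetherianRing S
    (Ideal.Quotient.mk I u) (by rwa [Ne, Ideal.Quotient.eq_zero_iff_mem])
  obtain ⟨hQp, w, hw⟩ := isAssociatedPrime_iff.1 hQ
  obtain ⟨w, rfl⟩ := Ideal.Quotient.mk_surjective w
  refine ⟨Q, hQp, ⟨w, fun hwI => hQp.ne_top ?_, fun x => by rw [hw, hcolon]⟩,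
    fun x hx => hle ((hcolon u x).2 hx)⟩
  rw [Ideal.eq_top_iff_one, hw, hcolon, one_mul]
  exact hwI

variable {k : Type*} [NontriviallyNormedField k] {n : ℕ}

/-- Relatively prime polynomials form a regular sequence at the origin. -/
theorem dvd_of_dvd_mul_rational {F G : MvPolynomial (Fin n) k} (hFG : IsRelPrime F G)
    (u : rationalSeries k n) (h : polyToRational k n F ∣ polyToRational k n G * u) :
    polyToRational k n F ∣ u := by
  obtain ⟨⟨w, p', q', hq', ew⟩, e⟩ := h
  obtain ⟨u, p, q, hq, eu⟩ := u
  have eu' : polyToRational k n q * ⟨u, p, q, hq, eu⟩ = polyToRational k n p := Subtype.ext eu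
  have ew' : polyToRational k n q' * ⟨w, p', q', hq', ew⟩ = polyToRational k n p' := Subtype.ext ew
  set u' : rationalSeries k n := ⟨u, p, q, hq, eu⟩
  set w' : rationalSeries k n := ⟨w, p', q', hq', ew⟩
  have e1 : G * (p * q') = F * (p' * q) := by
    apply polyToRational_injective
    rw [map_mul, map_mul, map_mul, map_mul, ← eu', ← ew']
    linear_combination (polyToRational k n q * polyToRational k n q') * e
  have e2 : F ∣ p * q' := hFG.dvd_of_dvd_mul_left ⟨_, e1⟩
  have e3 := map_dvd (polyToRational k n) e2
  rw [map_mul, ← eu'] at e3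
  exact (isUnit_polyToRational hq).dvd_mul_left.1 ((isUnit_polyToRational hq').dvd_mul_right.1 e3)

/-- The lowest order forms of transverse tangent cones generate a radical ideal: the ideal has no
embedded primes, and the Jacobian criterion holds at its minimal primes. -/
theorem isRadical_span_pair_of_meetTransversally [IsAlgClosed k] (hn : 3 ≤ n)
    {F G : MvPolynomial (Fin n) k} {a b : ℕ} (hF : F.IsHomogeneous a) (hG : G.IsHomogeneous b)
    (hF0 : F ≠ 0) (hT : MeetTransversally F G) : (Ideal.span {F, G}).IsRadical := by
  classical
  have hFG := isRelPrime_of_meetTransversally (by omega) hF0 hT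
  let y : Fin n := ⟨0, by omega⟩
  let z : Fin n := ⟨1, by omega⟩
  have hyz : y ≠ z := by simp [y, z]
  have hreg : ∀ u : MvPowerSeries (Fin n) k, (F : MvPowerSeries (Fin n) k) ∣ G * u →
      (F : MvPowerSeries (Fin n) k) ∣ u := by
    intro u hu
    obtain ⟨w, hw⟩ := hu
    obtain ⟨e, he⟩ := isGermRing_rationalSeries.dvd_of_dvd_mul
      (isWeierstrass_top.isGermRing y fun _ _ => trivial) le_top (dvd_of_dvd_mul_rational hFG)
      ⟨u, trivial⟩ ⟨⟨w, trivial⟩, Subtype.ext hw⟩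
    exact ⟨e, congrArg Subtype.val he⟩
  obtain ⟨ι, hι, htors⟩ := exists_coordinates_torsionFree hF hG hF0 hreg hyz
  intro u hu
  by_contra hu0
  set I := Ideal.span {F, G}
  obtain ⟨Q, hQp, ⟨w, hw, hQw⟩, hQu⟩ := exists_prime_of_notMem hu0
  have hIQ : I ≤ Q := fun x hx => (hQw x).2 (I.mul_mem_right _ hx)
  have hFQ : F ∈ Q := hIQ (Ideal.subset_span (by simp))
  have hGQ : G ∈ Q := hIQ (Ideal.subset_span (by simp))
  have hzero : ∀ c : MvPolynomial {i // i ∈ (Finset.univ.erase z).erase y} k,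
      ι (MvPolynomial.rename Subtype.val c) ∈ Q → c = 0 := by
    intro c hc
    by_contra hc0
    exact hw (htors c hc0 w ((hQw _).1 hc))
  -- there is a third variable
  obtain ⟨i, hi⟩ : ∃ i, MvPolynomial.X i ∉ Q := by
    by_contra! hX
    have hle : Ideal.span (Set.range MvPolynomial.X) ≤ Q := by
      rw [Ideal.span_le]
      rintro _ ⟨i, rfl⟩
      exact hX i
    let t : {i // i ∈ (Finset.univ.erase z).erase y} := ⟨⟨2, by omega⟩, by simp [y, z]⟩
    exact MvPolynomial.X_ne_zero t (hzero (MvPolynomial.X t)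
      (by rw [MvPolynomial.rename_X]; exact hle (hι _)))
  have hht : Q.height ≤ 2 := by
    let e : MvPolynomial (Fin n) k ≃+* MvPolynomial (Fin n) k := ι.toRingEquiv
    let Q' := Q.comap (e : MvPolynomial (Fin n) k →+* MvPolynomial (Fin n) k)
    have h1 : Q'.height = Q.height := RingEquiv.height_comap e Q
    have h2 := height_le_of_forall_rename (fun i : Fin n => i = y ∨ i = z) Q' fun c hc => by
      let g : {i : Fin n // ¬ (i = y ∨ i = z)} → {i // i ∈ (Finset.univ.erase z).erase y} :=
        fun i => ⟨i.1, by simpa [not_or] using i.2⟩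
      have hg : Function.Injective g := fun i j hij => Subtype.ext (congrArg (fun t => t.1) hij)
      refine MvPolynomial.rename_injective g hg ?_
      rw [map_zero]
      refine hzero _ ?_
      rw [MvPolynomial.rename_rename]
      exact hc
    have h3 : Nat.card {i : Fin n // i = y ∨ i = z} ≤ 2 := by
      rw [Nat.card_eq_fintype_card, Fintype.card_subtype]
      refine (Finset.card_le_card (t := {y, z}) fun i hi => ?_).trans Finset.card_le_two
      simpa using hi
    rw [← h1]
    exact h2.trans (by exact_mod_cast h3)
  have hmin := mem_minimalPrimes_of_height_le_two hF0 hFG hFQ hGQ hht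
  obtain ⟨i', j', hij⟩ := exists_polyMinor_notMem hT hmin hi
  obtain ⟨m, hm⟩ := hu
  obtain ⟨s, hs, hsu⟩ := exists_notMem_mul_mem_of_polyMinor hmin hij
    (hQp.mem_of_pow_mem m (hIQ hm))
  exact hs (hQu s hsu)

end RadicalForms

/-! ### The adjugate matrix in the three settings -/

section Assembly
open scoped NNReal

variable {k : Type*} [NontriviallyNormedField k] {n : ℕ}

theorem rationalSeries_le_convergentSeries [CompleteSpace k] (hn : 0 < n) :
    rationalSeries k n ≤ convergentSeries k n := by
  have : Infinite k := NontriviallyNormedField.infinite k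
  have hC : IsGermRing (convergentSeries k n) :=
    isWeierstrass_convergentSeries.isGermRing ⟨0, hn⟩ fun i hf => Converges.pderiv hf i
  rintro f ⟨p, q, hq, e⟩
  have hq' : MvPowerSeries.constantCoeff (q : MvPowerSeries (Fin n) k) ≠ 0 := by
    rwa [← MvPowerSeries.coeff_zero_eq_constantCoeff_apply, MvPolynomial.coeff_coe]
  have hcoe : ∀ p : MvPolynomial (Fin n) k, (p : MvPowerSeries (Fin n) k) ∈ convergentSeries k n :=
    fun p => convergentOn_le one_pos (coe_mem_convergentOn p 1)
  have : f = (q : MvPowerSeries (Fin n) k)⁻¹ * p := by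
    rw [← e, ← mul_assoc, MvPowerSeries.inv_mul_cancel _ hq', one_mul]
  rw [this]
  exact mul_mem (hC.inv_mem (hcoe q) hq') (hcoe p)

theorem isGermRing_regularFunctions [CompleteSpace k] (hn : 0 < n) (s : Setting) :
    IsGermRing (regularFunctions k n s) := by
  have : Infinite k := NontriviallyNormedField.infinite k
  cases s with
  | rational => exact isGermRing_rationalSeries
  | convergent =>
    exact isWeierstrass_convergentSeries.isGermRing ⟨0, hn⟩ fun i hf => Converges.pderiv hf i
  | formal => exact isWeierstrass_top.isGermRing ⟨0, hn⟩ fun _ _ => trivial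

/-- The zeros of `f` near the origin are zeros of its multiples. -/
theorem eventually_valueAt_mul_eq_zero [CompleteSpace k] {f g : MvPowerSeries (Fin n) k}
    (hf : f ∈ convergentSeries k n) (hg : g ∈ convergentSeries k n) :
    ∀ᶠ a in 𝓝 (0 : Fin n → k), valueAt f a = 0 → valueAt (f * g) a = 0 := by
  obtain ⟨r, ⟨hf', hg'⟩, hr⟩ := (((eventually_mem_convergentOn hf).and
    (eventually_mem_convergentOn hg)).and self_mem_nhdsWithin).exists
  have hr : 0 < r := hr
  filter_upwards [Metric.closedBall_mem_nhds (0 : Fin n → k) (NNReal.coe_pos.2 hr)] with a ha h0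
  rw [mem_closedBall_zero_iff] at ha
  rw [valueAt_mul (fun i => (norm_le_pi_norm a i).trans ha) hf' hg', h0, zero_mul]

/-- Smooth points of the intersection lie on `X`, so the condition near the origin is the stronger
one. -/
theorem maxGenAtSmooth_of_maxGenNear [CompleteSpace k] (hn : 0 < n) {s : Setting}
    {f₁ f₂ : regularFunctions k n s} {d : ℕ} {M : Matrix (Fin d) (Fin d) (regularFunctions k n s)}
    (hM : f₁ ∣ M.det) (h : MaxGenNear s M) : MaxGenAtSmooth s f₁ f₂ M := by
  obtain ⟨g, hg⟩ := hM
  cases s with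
  | rational =>
    filter_upwards [h, eventually_valueAt_mul_eq_zero
      (rationalSeries_le_convergentSeries hn f₁.2) (rationalSeries_le_convergentSeries hn g.2)]
      with a ha hag hs
    refine ha ?_
    rw [hg]
    exact hag hs.1
  | convergent =>
    filter_upwards [h, eventually_valueAt_mul_eq_zero f₁.2 g.2] with a ha hag hs
    refine ha ?_
    rw [hg]
    exact hag hs.1
  | formal =>
    intro q _
    refine h _ ?_
    rw [hg]
    refine Ideal.mul_mem_right _ _ ?_
    rw [PrimeSpectrum.comap_asIdeal, Ideal.mem_comap, Ideal.Quotient.eq_zero_iff_mem.2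
      (Ideal.subset_span (by simp))]
    exact q.asIdeal.zero_mem

/-- If the ideal `(f₁, f₂)` is radical, and `M` is maximally generated at the smooth points of the
intersection, then the adjugate matrix vanishes on the intersection. -/
theorem adjugate_mem_of_maxGenAtSmooth [CompleteSpace k] [IsAlgClosed k] [CharZero k] (hn : 2 ≤ n)
    {s : Setting} {f₁ f₂ : regularFunctions k n s} (h0 : f₁ ≠ 0) (hf : IsRelPrime f₁ f₂)
    (hI : (Ideal.span {f₁, f₂}).IsRadical) {d : ℕ}
    {M : Matrix (Fin d) (Fin d) (regularFunctions k n s)} (hM : f₁ * f₂ ∣ M.det)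
    (hmax : MaxGenAtSmooth s f₁ f₂ M) (i j : Fin d) :
    M.adjugate i j ∈ Ideal.span {f₁, f₂} := by
  have hO := isGermRing_regularFunctions (k := k) (n := n) (by omega) s
  have := isDomain_subalgebra (regularFunctions k n s)
  have := hO.uniqueFactorizationMonoid
  have hreg : ∀ u, f₁ ∣ f₂ * u → f₁ ∣ u := fun u hu => hf.dvd_of_dvd_mul_left hu
  have hyz : (⟨0, by omega⟩ : Fin n) ≠ ⟨1, by omega⟩ := by simp
  cases s with
  | rational =>
    exact adjugate_mem_of_maxGenAt (rationalSeries_le_convergentSeries (by omega)) hO hyz h0 hreg hI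
      (fun P hP => exists_minor_notMem_rational (by omega) hO hf hI hP) M hM hmax i j
  | convergent =>
    exact adjugate_mem_of_maxGenAt le_rfl hO hyz h0 hreg hI (fun P hP =>
      isWeierstrass_convergentSeries.exists_minor_notMem hO hyz h0 hreg hI hP) M hM hmax i j
  | formal =>
    have := hO.isNoetherianRing
    exact adjugate_mem_of_maxGenAtRegularPrimes hI hM hmax i j

end Assembly

end DetRep

end

theorem mainTheorem4 {k : Type*} [NontriviallyNormedField k] [CompleteSpace k] [IsAlgClosed k]
    [CharZero k] {n : ℕ} (hn : 3 ≤ n) (s : DetRep.Setting)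
    -- the equations of `(X₁, 0)` and `(X₂, 0)`, without common components
    (f₁ f₂ : DetRep.regularFunctions k n s) (hf₁ : ¬ IsUnit f₁) (hf₂ : ¬ IsUnit f₂)
    (hf : IsRelPrime f₁ f₂)
    -- a determinantal representation of `(X, 0) = (X₁, 0) ∪ (X₂, 0)`
    {d : ℕ} (M : Matrix (Fin d) (Fin d) (DetRep.regularFunctions k n s))
    (hM : Associated M.det (f₁ * f₂))
    (hM0 : ∀ i j, MvPowerSeries.constantCoeff (M i j : MvPowerSeries (Fin n) k) = 0) :
    ((Ideal.span {f₁, f₂}).IsRadical → DetRep.MaxGenAtSmooth s f₁ f₂ M →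
      DetRep.Decomposable M f₁ f₂) ∧
    (DetRep.MeetTransversally (DetRep.leadingForm (f₁ : MvPowerSeries (Fin n) k))
        (DetRep.leadingForm (f₂ : MvPowerSeries (Fin n) k)) →
      DetRep.MaxGenNear s M →
      DetRep.Decomposable M f₁ f₂ ∧ ∀ i j, M.adjugate i j ∈ Ideal.span {f₁, f₂}) := by
  have hO := DetRep.isGermRing_regularFunctions (k := k) (n := n) (by omega) s
  have := DetRep.isDomain_subalgebra (DetRep.regularFunctions k n s)
  have := hO.uniqueFactorizationMonoid
  have := hO.isLocalRing
  have : CharZero (DetRep.regularFunctions k n s) := algebraRat.charZero _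
  have h₁ : f₁ ≠ 0 := by
    rintro rfl
    exact hf₂ (hf (dvd_zero _) dvd_rfl)
  have h₂ : f₂ ≠ 0 := by
    rintro rfl
    exact hf₁ (hf dvd_rfl (dvd_zero _))
  have hadj := fun hI hmax => DetRep.adjugate_mem_of_maxGenAtSmooth (by omega) h₁ hf hI
    hM.symm.dvd hmax
  have hdec := DetRep.decomposable_of_adjugate_mem hf₁ hf₂ hf hM fun i j => by
    rw [IsLocalRing.mem_maximalIdeal, mem_nonunits_iff, hO.isUnit_iff, not_not]
    exact hM0 i j
  refine ⟨fun hI hmax => hdec (hadj hI hmax), fun hT hmax => ?_⟩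
  have h₁' : (f₁ : MvPowerSeries (Fin n) k) ≠ 0 := fun h => h₁ (Subtype.ext h)
  have h₂' : (f₂ : MvPowerSeries (Fin n) k) ≠ 0 := fun h => h₂ (Subtype.ext h)
  have hF0 := DetRep.leadingForm_ne_zero h₁'
  have hI : (Ideal.span {f₁, f₂}).IsRadical := hO.isRadical_of_initialForms
    (DetRep.isHomogeneous_leadingForm _) (DetRep.isHomogeneous_leadingForm _) hF0
    (DetRep.le_order_leadingForm_sub h₁') (DetRep.le_order_leadingForm_sub h₂')
    (DetRep.isRelPrime_of_meetTransversally (by omega) hF0 hT)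
    (DetRep.isRadical_span_pair_of_meetTransversally hn (DetRep.isHomogeneous_leadingForm _)
      (DetRep.isHomogeneous_leadingForm _) hF0 hT)
  have hmem := hadj hI
    (DetRep.maxGenAtSmooth_of_maxGenNear (by omega) ((dvd_mul_right f₁ f₂).trans hM.symm.dvd) hmax)
  exact ⟨hdec hmem, hmem⟩
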